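/- **Setting.** Let $\mathcal L$ be a relational language whose symbols $R_i$ are indexed by a finite or infinite initial segment of $\omega$, with arbitrary arities. All $\mathcal L$-structures are assumed to be symmetric (each $R_i$ is invariant under permutations of its arguments), and may be empty. *Predimension.* For finite $A$ and a sublanguage $\mathcal L_0$, $\delta(A|\mathcal L_0)=|A|-\sum_{R\in\mathcal L_0}\#R(A)\in\mathbb Z\cup\{-\infty\}$, where $\#R(A)$ is the number of tuples of $A$ in $R$, counted up to permutation; $\delta(A)=\delta(A|\mathcal L)$ and $\delta(B/A)=\delta(A\cup B)-\delta(A)$. For finite $A\subseteq C$, $A\le C$ ($A$ is strong in $C$) means $\delta(A)\le\delta(D)$ for every finite $D$ with $A\subseteq D\subseteq C$. A finite non-empty $B$ disjoint from $A$ is *simply algebraic* over $A$ if $A\le A\cup B$, $\delta(B/A)=0$ and $\delta(B'/A)\ne0$ for every proper non-empty $B'\subset B$; it is *minimally simply algebraic* (m.s.a.) over $A$ if moreover it is not simply algebraic over any proper subset of $A$. $A\cup B$ is the *free join* $A\oplus_{A\cap B}B$ if all relations on it lie inside $A$ or inside $B$. *Relative types.* The relative quantifier-free type of a tuple $\bar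 b$ over $\bar a$ consists of all positive relations holding on tuples from $\bar a\bar b$ that are not contained in $\bar a$; $\mathcal L_{B/A}$ is the set of symbols occurring in it. Given an m.s.a. extension $Y/X$ with $X,Y$ enumerated, $\bar b$ over $\bar a$ is *of the form of $Y/X$* if $\bar a\bar b$ has no repetitions, $\bar a$ has the same quantifier-free type as $X$, and the relative type of $\bar b/\bar a$ contains that of $Y/X$. *The function $g$.* For finite $A\subseteq C$, $g_C(A)\in\omega\cup\{\infty\}$ is the least $m$ for which there is a finite $X$ with $A\subseteq X\subseteq C$, $|X|\le|A|+m$ and $\delta(X|\mathcal L_m)<\delta(A|\mathcal L_m)$, where $\mathcal L_m$ is the set of the first $m$ symbols; $g_C(A)=\infty$ if there is none. *The function $\mu$.* Let $\mu(X,Y,m)\in\omega$, for $Y/X$ an m.s.a. extension and $m\in\omega\cup\{\infty\}$, be isomorphism invariant and satisfy: $\mu(X,Y,m)\ge\delta(X)$; $\lim_{m\to\infty}\mu(X,Y,m)=\mu(X,Y,\infty)$; and for each relative quantifier-free type $\Psi$ of an m.s.a. extension there is a finite $\mathcal L'\subseteq\mathcal L$ such that $\mu(X,Y,m)=\mu(X',Y',m)$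 for all $m$ whenever $Y/X$ and $Y'/X'$ both have relative type $\Psi$ and $X,X'$ have the same quantifier-free $\mathcal L'$-type. *The property $\zeta$.* Let $\zeta$ be a set of universal $\mathcal L$-sentences that is preserved by free joins of finite structures and holds in the one-point structure without relations. Assume also that for each relative quantifier-free type $\Psi$ of an m.s.a. extension there is a finite $\mathcal L'\subseteq\mathcal L$ such that, for m.s.a. extensions $Y/X$, $Y'/X'$ of relative type $\Psi$ with $X\models\zeta$, $X'\models\zeta$ and $X,X'$ of the same quantifier-free $\mathcal L'$-type, $X\cup Y\models\zeta$ iff $X'\cup Y'\models\zeta$. (This is automatic if $\zeta$ is a single sentence or $\mathcal L$ is finite.) *The class and its generic.* A structure $D$ satisfies the *$\mu$-bound* if, whenever $\bar b^1,\dots,\bar b^r$ are pairwise disjoint tuples of $D$ all of the form of the same m.s.a. extension $Y/X$ over the same tuple $\bar a$ of $D$, then $r\le\mu(X,Y,g_D(\bar a))$. Let $\mathcal C^\zeta_\mu$ be the class of finite structures $C\models\zeta$ that satisfy the $\mu$-bound and in which $\delta(A)\ge0$ for all $A\subseteq C$. A *generic* $M$ of $\mathcal C^\zeta_\mu$ is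 a countable structure with $\delta(A)\ge0$ for all finite $A\subseteq M$ such that every finite $A\le M$ is in $\mathcal C^\zeta_\mu$, and, whenever $B\le M$ is finite and $B\le C\in\mathcal C^\zeta_\mu$, there is an embedding $f:C\to M$ that is the identity on $B$ and has $f(C)\le M$. *The schemata.* For a structure $M$, consider: (2') $M\models\zeta$; $\delta(A)\ge0$ for all finite $A\subseteq M$; and $M$ satisfies the $\mu$-bound. (3'') Suppose $B\subseteq M$ is finite, $B\le C\in\mathcal C^\zeta_\mu$, and $C\smallsetminus B$ is simply algebraic over $B$ and m.s.a. over $F\subseteq B$. Suppose there is no finite $Y\subseteq M$ with $|Y|\le|C\smallsetminus B|$ and $\delta(B\cup Y|\mathcal L_{C/B})<\delta(B|\mathcal L_{C/B})$. Suppose that for every m.s.a. extension $H/G$ and all $G',H'\subseteq C$ with $H'/G'$ of the form of $H/G$, $\mu(G,H,g_C(G'))=\mu(G,H,g_{M\oplus_BC}(G'))$. Then $M$ contains $\mu(F,C\smallsetminus B,g_M(F))$ pairwise disjoint extensions of $F$ of the form of $C\smallsetminus B$ over $F$. **Theorem.** A generic $M^\zeta_\mu$ exists, and for every generic $M=M^\zeta_\mu$: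 1. $\mathrm{Th}(M)$ is strongly minimal: all its models are infinite, and in each of them every subset of the universe definable with parameters is finite or cofinite. 2. $\mathrm{Th}(M)$ is axiomatized by the axioms stating that the model is infinite (and the relations symmetric) together with (2') and (3''): a structure is a model of $\mathrm{Th}(M)$ if and only if it is infinite and symmetric and satisfies (2') and (3''). 3. (2') and (3'') are $\forall\exists$-schemata: there is a set $\Psi$ of $\forall\exists$-sentences such that a structure is a model of $\Psi$ if and only if it is symmetric and satisfies (2') and (3''). 4. $\mathrm{Th}(M)$ is model complete: every embedding between models of it is elementary. -/

import Mathlib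

open FirstOrder

universe u

namespace HG

/-! ## Languages, sublanguages, symmetric structures -/

/-- Indices of the relation symbols: the initial segment of `ω` of length `N` (finite or not). -/
abbrev Symb (N : ℕ∞) : Type := {i : ℕ // (i : ℕ∞) < N}

/-- The relational language with one relation symbol of arity `ar s` for each `s : Symb N`. -/
def lang {N : ℕ∞} (ar : Symb N → ℕ) : FirstOrder.Language.{0, 0} where
  Functions _ := Empty
  Relations n := {s : Symb N // ar s = n}

noncomputable section

open scoped Classical

variable {N : ℕ∞} (ar : Symb N → ℕ)

/-- The relation with index `s` holds on the tuple `v`. -/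
def Holds {E : Type*} [(lang ar).Structure E] (s : Symb N) (v : Fin (ar s) → E) : Prop :=
  FirstOrder.Language.Structure.RelMap (L := lang ar) (n := ar s) ⟨s, rfl⟩ v

/-- Every relation is symmetric. -/
def IsSymm (E : Type*) [(lang ar).Structure E] : Prop :=
  ∀ (s : Symb N) (v : Fin (ar s) → E) (σ : Equiv.Perm (Fin (ar s))),
    Holds ar s (v ∘ σ) ↔ Holds ar s v

/-- The structure on `X` induced by a map `f : X → E`. -/
@[reducible] def pull {X E : Type*} [(lang ar).Structure E] (f : X → E) : (lang ar).Structure X where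
  funMap g := Empty.elim g
  RelMap r v := FirstOrder.Language.Structure.RelMap r (f ∘ v)

/-- The structure on `X` in which no relation holds. -/
@[reducible] def discrete (X : Type*) : (lang ar).Structure X where
  funMap g := Empty.elim g
  RelMap _ _ := False

/-- The substructure with domain `D`. -/
def subOf {E : Type*} [(lang ar).Structure E] (D : Set E) : (lang ar).Substructure E where
  carrier := D
  fun_mem g := Empty.elim g

/-- `S ⊨ ζ`, with the structure as an explicit argument. -/
def Sat {X : Type*} (S : (lang ar).Structure X) (ζ : (lang ar).Theory) : Prop :=
  letI := S
  X ⊨ ζ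

/-- The first `m` relation symbols. -/
def firstSymb (N : ℕ∞) (m : ℕ) : Set (Symb N) := {s | s.1 < m}

/-! ## The predimension and self-sufficiency

Everything is relative to an ambient structure `E`; substructures are subsets of `E`. -/

section Ambient

variable {E : Type*} [(lang ar).Structure E]

/-- The occurrences in `A` of relations with symbol in `K`; a tuple and its permutations are the
same occurrence, so an occurrence is a symbol together with a multiset. -/
def occ (K : Set (Symb N)) (A : Set E) : Set (Symb N × Multiset E) :=
  {p | p.1 ∈ K ∧ ∃ v : Fin (ar p.1) → E, Holds ar p.1 v ∧ (∀ j, v j ∈ A) ∧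
    p.2 = (Finset.univ : Finset (Fin (ar p.1))).val.map v}

/-- The predimension of the reduct of `A` to the sublanguage `K`, where `⊥` is `-∞`. -/
def deltaIn (K : Set (Symb N)) (A : Finset E) : WithBot ℤ :=
  if (occ ar K (A : Set E)).Finite then
    (((A.card : ℤ) - ((occ ar K (A : Set E)).ncard : ℤ) : ℤ) : WithBot ℤ)
  else ⊥

/-- The predimension. -/
def delta (A : Finset E) : WithBot ℤ := deltaIn ar Set.univ A

/-- `A ≤ D`: the finite set `A` is strong (self-sufficient) in `D`. -/
def Strong (A : Finset E) (D : Set E) : Prop :=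
  (A : Set E) ⊆ D ∧ ∀ X : Finset E, A ⊆ X → (X : Set E) ⊆ D → delta ar A ≤ delta ar X

/-- `B` is simply algebraic over `A`. -/
def SimplyAlg (A B : Finset E) : Prop :=
  B.Nonempty ∧ Disjoint A B ∧ Strong ar A ((A ∪ B : Finset E) : Set E) ∧
    delta ar A ≠ ⊥ ∧ delta ar (A ∪ B) = delta ar A ∧
    ∀ B' : Finset E, B' ⊂ B → B'.Nonempty → delta ar (A ∪ B') ≠ delta ar A

/-- `B` is minimally simply algebraic over `A`. -/
def MinSimplyAlg (A B : Finset E) : Prop :=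
  SimplyAlg ar A B ∧ ∀ A' : Finset E, A' ⊂ A → ¬ SimplyAlg ar A' B

/-- `g_D(A)`: the least `m` such that `A` fails to be strong in some `X ⊆ D` with
`|X| ≤ |A| + m`, as witnessed by the first `m` relations only; `⊤` if there is no such `m`. -/
def gval (D : Set E) (A : Finset E) : ℕ∞ :=
  ⨅ (m : ℕ) (_ : ∃ X : Finset E, A ⊆ X ∧ (X : Set E) ⊆ D ∧ X.card ≤ A.card + m ∧
    deltaIn ar (firstSymb N m) X < deltaIn ar (firstSymb N m) A), (m : ℕ∞)

/-- The only relations on `D₁ ∪ D₂` are those inside `D₁` and those inside `D₂`, i.e. `D₁ ∪ D₂` is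
the free join of `D₁` and `D₂` over `D₁ ∩ D₂`. -/
def FreelyJoined (D₁ D₂ : Set E) : Prop :=
  ∀ (s : Symb N) (v : Fin (ar s) → E), Holds ar s v → (∀ j, v j ∈ D₁ ∪ D₂) →
    (∀ j, v j ∈ D₁) ∨ (∀ j, v j ∈ D₂)

/-- The symbols occurring in the relative quantifier-free type of `C \ B` over `B`. -/
def symbOver (B C : Finset E) : Set (Symb N) :=
  {s | ∃ v : Fin (ar s) → E, Holds ar s v ∧ (∀ j, v j ∈ C) ∧ ∃ j, v j ∉ B}

end Ambient

/-! ## Enumerated extensions and the function `μ` -/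

/-- An enumerated extension `Y/X`: a structure with `X` enumerated by `Fin k` and `Y`, disjoint
from `X`, enumerated by `Fin l`. -/
abbrev Ext (k l : ℕ) : Type := (lang ar).Structure (Fin k ⊕ Fin l)

/-- The base `X` of an enumerated extension `Y/X`. -/
def baseSet (k l : ℕ) : Finset (Fin k ⊕ Fin l) := Finset.univ.image Sum.inl

/-- The part `Y` of an enumerated extension `Y/X`. -/
def topSet (k l : ℕ) : Finset (Fin k ⊕ Fin l) := Finset.univ.image Sum.inr

variable {ar}

/-- The enumerated extension is a (symmetric) minimally simply algebraic extension. -/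
def IsMSAExt {k l : ℕ} (S : Ext ar k l) : Prop :=
  letI := S
  IsSymm ar (Fin k ⊕ Fin l) ∧ MinSimplyAlg ar (baseSet k l) (topSet k l)

/-- The structure on the base of an enumerated extension. -/
@[reducible] def baseStr {k l : ℕ} (S : Ext ar k l) : (lang ar).Structure (Fin k) :=
  letI := S
  pull ar (Sum.inl : Fin k → Fin k ⊕ Fin l)

/-- Two enumerated extensions have the same relative quantifier-free type: they agree on all
relations that are not within the base. -/
def SameRelType {k l : ℕ} (S S' : Ext ar k l) : Prop :=
  ∀ (s : Symb N) (v : Fin (ar s) → Fin k ⊕ Fin l), (∃ j y, v j = Sum.inr y) →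
    (@Holds N ar _ S s v ↔ @Holds N ar _ S' s v)

/-- The bases of two enumerated extensions have the same quantifier-free type in the
sublanguage `K`. -/
def SameBaseType {k l : ℕ} (K : Set (Symb N)) (S S' : Ext ar k l) : Prop :=
  ∀ s ∈ K, ∀ v : Fin (ar s) → Fin k,
    (@Holds N ar _ (baseStr S) s v ↔ @Holds N ar _ (baseStr S') s v)

variable (ar) in
/-- Functions `μ(X, Y, m)` of an extension `Y/X` and a number `m ∈ ω ∪ {∞}`. Only the values on
minimally simply algebraic extensions matter. -/
abbrev MuFun : Type := ∀ k l : ℕ, Ext ar k l → ℕ∞ → ℕ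

/-- The requirements on `μ`. -/
structure IsMu (μ : MuFun ar) : Prop where
  /-- `μ` is a function of the extension, not of its enumeration. -/
  iso : ∀ (k l : ℕ) (S : Ext ar k l), IsMSAExt S →
    ∀ (σ : Equiv.Perm (Fin k)) (τ : Equiv.Perm (Fin l)) (m : ℕ∞),
      μ k l (@pull N ar _ _ S (Sum.map σ τ)) m = μ k l S m
  /-- `μ(X, Y, m) ≥ δ(X)`. -/
  lower : ∀ (k l : ℕ) (S : Ext ar k l), IsMSAExt S → ∀ m : ℕ∞,
    @delta N ar _ S (baseSet k l) ≤ (((μ k l S m : ℕ) : ℤ) : WithBot ℤ)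
  /-- For each relative quantifier-free type, `μ` depends only on the quantifier-free type of the
  base in some finite sublanguage. -/
  determined : ∀ (k l : ℕ) (S₀ : Ext ar k l), IsMSAExt S₀ → ∃ K : Set (Symb N), K.Finite ∧
    ∀ S S' : Ext ar k l, IsMSAExt S → IsMSAExt S' → SameRelType S S₀ → SameRelType S' S₀ →
      SameBaseType K S S' → ∀ m : ℕ∞, μ k l S m = μ k l S' m
  /-- `μ(X, Y, m)` converges to `μ(X, Y, ∞)`. -/
  lim : ∀ (k l : ℕ) (S : Ext ar k l), IsMSAExt S →
    Filter.Tendsto (fun m : ℕ => μ k l S (m : ℕ∞)) Filter.atTop (nhds (μ k l S ⊤))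

section Ambient

variable {E : Type*} [(lang ar).Structure E]

/-- The tuple `b` over the tuple `a` is of the form of `Y/X`: `a` has the quantifier-free type
of `X`, and all relations of the relative quantifier-free type of `Y/X` hold on `b` over `a`. -/
def OfForm {k l : ℕ} (S : Ext ar k l) (a : Fin k → E) (b : Fin l → E) : Prop :=
  Function.Injective (Sum.elim a b) ∧
  (∀ (s : Symb N) (v : Fin (ar s) → Fin k),
    @Holds N ar _ S s (Sum.inl ∘ v) ↔ Holds ar s (a ∘ v)) ∧
  ∀ (s : Symb N) (v : Fin (ar s) → Fin k ⊕ Fin l), (∃ j y, v j = Sum.inr y) →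
    @Holds N ar _ S s v → Holds ar s (Sum.elim a b ∘ v)

/-- The `μ`-bound in `D`: if `B¹, …, Bʳ ⊆ D` are disjoint and each `Bⁱ/A` is of the form of the
minimally simply algebraic extension `Y/X`, then `r ≤ μ(X, Y, g_D(A))`. -/
def MuBound (μ : MuFun ar) (D : Set E) : Prop :=
  ∀ (k l : ℕ) (S : Ext ar k l), IsMSAExt S →
    ∀ (a : Fin k → E) (r : ℕ) (b : Fin r → Fin l → E),
      (∀ x, a x ∈ D) → (∀ i y, b i y ∈ D) → (∀ i, OfForm S a (b i)) →
      (∀ i j, i ≠ j → Disjoint (Set.range (b i)) (Set.range (b j))) →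
      r ≤ μ k l S (gval ar D (Finset.univ.image a))

/-- The substructure with domain `D` belongs to the class `C^ζ_μ`. -/
def InClass (ζ : (lang ar).Theory) (μ : MuFun ar) (D : Set E) : Prop :=
  D.Finite ∧ (∀ A : Finset E, (A : Set E) ⊆ D → 0 ≤ delta ar A) ∧ MuBound μ D ∧
    (subOf ar D) ⊨ ζ

end Ambient

/-! ## Requirements on `ζ` -/

/-- `ζ` is preserved by free joins (of finite symmetric structures). -/
def PreservedByFreeJoins (ζ : (lang ar).Theory) : Prop :=
  ∀ (E : Type) [(lang ar).Structure E] [Finite E], IsSymm ar E →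
    ∀ D₁ D₂ : Set E, D₁ ∪ D₂ = Set.univ → FreelyJoined ar D₁ D₂ →
      (subOf ar D₁) ⊨ ζ → (subOf ar D₂) ⊨ ζ → E ⊨ ζ

/-- For each relative quantifier-free type of a minimally simply algebraic extension, whether `ζ`
passes from the base to the extension depends only on the quantifier-free type of the base in
some finite sublanguage. (This is automatic if `ζ` is finite or the language is finite.) -/
def FinitelyDetermined (ζ : (lang ar).Theory) : Prop :=
  ∀ (k l : ℕ) (S₀ : Ext ar k l), IsMSAExt S₀ → ∃ K : Set (Symb N), K.Finite ∧
    ∀ S S' : Ext ar k l, IsMSAExt S → IsMSAExt S' → SameRelType S S₀ → SameRelType S' S₀ →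
      SameBaseType K S S' → Sat ar (baseStr S) ζ → Sat ar (baseStr S') ζ →
      (Sat ar S ζ ↔ Sat ar S' ζ)

/-! ## The generic and the axioms -/

/-- `M` is the generic of the class `C^ζ_μ`. -/
structure IsGeneric (ζ : (lang ar).Theory) (μ : MuFun ar) (M : Type u)
    [(lang ar).Structure M] : Prop where
  symm : IsSymm ar M
  delta_nonneg : ∀ A : Finset M, 0 ≤ delta ar A
  countable : Countable M
  /-- Finite strong subsets belong to the class. -/
  strong_mem : ∀ A : Finset M, Strong ar A Set.univ → InClass ζ μ (A : Set M)
  /-- If `B ≤ M` and `B ≤ C` with `C` in the class, then `C` embeds strongly in `M`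
  over `B`. -/
  extend : ∀ (C : Type u) [(lang ar).Structure C], IsSymm ar C → InClass ζ μ (Set.univ : Set C) →
    ∀ B : Finset C, Strong ar B Set.univ →
    ∀ j : (subOf ar (B : Set C)) ↪[lang ar] M,
      (∃ A : Finset M, (A : Set M) = Set.range j ∧ Strong ar A Set.univ) →
      ∃ f : C ↪[lang ar] M, (∀ x : subOf ar (B : Set C), f x = j x) ∧
        ∃ A : Finset M, (A : Set M) = Set.range f ∧ Strong ar A Set.univ

/-- The universal part of the axioms: `ζ`, nonnegative predimension, and the `μ`-bound. -/
def AxiomTwo (ζ : (lang ar).Theory) (μ : MuFun ar) (M : Type u) [(lang ar).Structure M] : Prop :=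
  M ⊨ ζ ∧ (∀ A : Finset M, 0 ≤ delta ar A) ∧ MuBound μ (Set.univ : Set M)

/-- The existence part of the axioms: over a base `B` that is strong enough in `M`, the maximal
number of disjoint copies of a simply algebraic extension is realized. Here `E = M ⊕_B C` is the free join, `i` the inclusion of `M` in `E`,
`B = M ∩ C`, the tuple `a` enumerates `F ⊆ B`, and `c` enumerates `C \ B`. -/
def AxiomThree (ζ : (lang ar).Theory) (μ : MuFun ar) (M : Type u)
    [(lang ar).Structure M] : Prop :=
  ∀ (E : Type u) [(lang ar).Structure E] (i : M ↪[lang ar] E) (B C : Finset E)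
    (k l : ℕ) (a : Fin k → E) (c : Fin l → E),
    IsSymm ar E → (B : Set E) = Set.range i ∩ (C : Set E) →
    Set.range i ∪ (C : Set E) = Set.univ → FreelyJoined ar (Set.range i) (C : Set E) →
    Strong ar B (C : Set E) → InClass ζ μ (C : Set E) → SimplyAlg ar B (C \ B) →
    Function.Injective a → Function.Injective c → (∀ x, a x ∈ B) →
    Finset.univ.image c = C \ B → MinSimplyAlg ar (Finset.univ.image a) (C \ B) →
    -- `B` is strong enough in `M`
    (¬ ∃ Y : Finset E, (Y : Set E) ⊆ Set.range i ∧ Y.card ≤ (C \ B).card ∧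
      deltaIn ar (symbOver ar B C) (B ∪ Y) < deltaIn ar (symbOver ar B C) B) →
    -- no `μ`-value relevant to `C` changes in the free join
    (∀ (p q : ℕ) (S : Ext ar p q), IsMSAExt S → ∀ (x : Fin p → E) (y : Fin q → E),
      (∀ t, x t ∈ C) → (∀ t, y t ∈ C) → OfForm S x y →
      μ p q S (gval ar (C : Set E) (Finset.univ.image x)) =
        μ p q S (gval ar (Set.univ : Set E) (Finset.univ.image x))) →
    ∃ b : Fin (μ k l (pull ar (Sum.elim a c))
        (gval ar (Set.range i) (Finset.univ.image a))) → Fin l → E,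
      (∀ r t, b r t ∈ Set.range i) ∧
      (∀ r, OfForm (pull ar (Sum.elim a c)) a (b r)) ∧
      ∀ r r', r ≠ r' → Disjoint (Set.range (b r)) (Set.range (b r'))

end

/-! ## Model theory -/

/-- Prenex formulas of the form `∀…∀ ∃…∃ (quantifier-free)`. -/
inductive IsForallExists {L : FirstOrder.Language.{0, 0}} {α : Type} :
    ∀ {n : ℕ}, L.BoundedFormula α n → Prop
  | of_isExistential {n : ℕ} {φ : L.BoundedFormula α n} (h : φ.IsExistential) : IsForallExists φ
  | all {n : ℕ} {φ : L.BoundedFormula α (n + 1)} (h : IsForallExists φ) : IsForallExists φ.all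

/-- In every model (all of which are infinite), every subset definable with parameters is finite
or cofinite. -/
def StronglyMinimal {L : FirstOrder.Language.{0, 0}} (T : L.Theory) : Prop :=
  ∀ (M : Type u) [L.Structure M], M ⊨ T → Infinite M ∧
    ∀ D : Set M, (Set.univ : Set M).Definable₁ L D → D.Finite ∨ Dᶜ.Finite

/-- Every embedding between models is elementary. -/
def ModelComplete {L : FirstOrder.Language.{0, 0}} (T : L.Theory) : Prop :=
  ∀ (M M' : Type u) [L.Structure M] [L.Structure M'], M ⊨ T → M' ⊨ T →
    ∀ f : M ↪[L] M', ∀ (n : ℕ) (φ : L.Formula (Fin n)) (v : Fin n → M),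
      φ.Realize (f ∘ v) ↔ φ.Realize v

end HG

namespace HG

noncomputable section

open scoped Classical

variable {N : ℕ∞} {ar : Symb N → ℕ}

/-! ## The integer-valued predimension -/

section Predimension

variable {E : Type*} [(lang ar).Structure E]

/-! The axioms are reduced to a closure property. Call a structure a `ClosedModel` if it satisfies
(2') and realizes strongly every simply algebraic extension in the class of each of its finite
strong subsets. The combinatorial core is `muBound_or_copies`: the free join of `D` with a simply
algebraic `C` over `B` satisfies the `μ`-bound unless `D` already contains the maximal number of
copies of `C`. Copies over a base in `D` lie inside `D` or coincide with `C \ B`. If the base is not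
in `D` and every copy meets `D`, a predimension count gives at most `δ(base) ≤ μ` copies. If some
copy avoids `D`, everything lies in `C`, where a bound is assumed.

This dichotomy makes (3'') equivalent to closedness under (2') (`closedModel_iff`). In a closed
model, a free join with the `μ`-bound can be realized again and again, and otherwise the copies are
there already. Conversely, over a strong base the provisos of (3'') hold automatically. The copies
it provides cannot all lie in the base, since the extension would then contain one copy too many; a
copy outside is an exact strong realization. The generic is obtained from the same dichotomy, as a
limit of finite approximations meeting countably many tasks.

Closedness is a `∀∃` property because it is local. If a structure satisfies every `∀∃` sentence true
in all closed models, each of its tuples is matched, for every finite sublanguage and every bound,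
by a tuple of a closed model (`LocallyModel`). The function `g` is made for this: a finite value has
a finite witness in finitely many symbols, while at infinite value the matched value is large, where
`μ(X, Y, ·)` has become constant. Hence `μ`-values, the `μ`-bound and the existence axioms pass from
the matching closed models to the structure, and finite determinacy does the same for `ζ` on
one-step extensions.

For completeness and strong minimality, the points that are algebraic over a finite strong set with
bounded size and bounded symbols form a finite set (`finite_badSet`), by the `μ`-bound. So every
infinite subset of a closed model acquires, in an ultrapower, a point free over a given finite
strong set. Ultrapowers of infinite closed models are therefore `Rich`, and in rich models a
back-and-forth between finite strong sets shows that the quantifier-free type of a strong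
enumeration decides all formulas. All infinite closed models are then elementarily equivalent. Free
points over a strong set have a single type, so a definable set and its complement cannot both be
infinite.

For model completeness, let `f` embed one infinite closed model in another, with `B` and `f(B)`
strong. The finite set of bounded-algebraic points over `f(B)` can be copied injectively into that
over `B`, so `f` maps the latter onto the former. Thus points free over `B` stay free, strong sets
go to strong sets (`IsEmb.strong_image_of_closedModel`), and the back-and-forth applies. -/

theorem mem_occ {K : Set (Symb N)} {A : Set E} {p : Symb N × Multiset E} :
    p ∈ occ ar K A ↔ p.1 ∈ K ∧ p ∈ occ ar Set.univ (Set.univ : Set E) ∧ ∀ x ∈ p.2, x ∈ A := by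
  constructor
  · rintro ⟨h1, v, hv, hA, hp⟩
    refine ⟨h1, ⟨trivial, v, hv, fun _ => trivial, hp⟩, ?_⟩
    rw [hp]; simpa using hA
  · rintro ⟨h1, ⟨_, v, hv, _, hp⟩, hA⟩
    refine ⟨h1, v, hv, ?_, hp⟩
    rw [hp] at hA; simpa using hA

theorem occ_mono {K K' : Set (Symb N)} {A A' : Set E} (hK : K ⊆ K') (hA : A ⊆ A') :
    occ ar K A ⊆ occ ar K' A' := fun p hp => by
  rw [mem_occ] at hp ⊢
  exact ⟨hK hp.1, hp.2.1, fun x hx => hA (hp.2.2 x hx)⟩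

theorem occ_inter (K : Set (Symb N)) (A A' : Set E) :
    occ ar K (A ∩ A') = occ ar K A ∩ occ ar K A' := by
  ext p
  rw [Set.mem_inter_iff, mem_occ, mem_occ (A := A), mem_occ (A := A')]
  constructor
  · rintro ⟨h, h', h3⟩
    exact ⟨⟨h, h', fun x hx => (h3 x hx).1⟩, h, h', fun x hx => (h3 x hx).2⟩
  · rintro ⟨⟨h, h', h3⟩, _, _, h4⟩
    exact ⟨h, h', fun x hx => ⟨h3 x hx, h4 x hx⟩⟩

/-- Equal multisets of entries mean fibres of equal size over each point; matching the fibres gives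
a permutation that carries one tuple to the other. -/
theorem holds_of_map_eq (hE : IsSymm ar E) {s : Symb N} {v w : Fin (ar s) → E}
    (h : (Finset.univ : Finset (Fin (ar s))).val.map v =
      (Finset.univ : Finset (Fin (ar s))).val.map w) (hv : Holds ar s v) : Holds ar s w := by
  have h2 : ∃ σ : Equiv.Perm (Fin (ar s)), v ∘ σ = w := by
    have h3 : ∀ x, Nonempty ({i // w i = x} ≃ {i // v i = x}) := fun x => by
      refine ⟨Fintype.equivOfCardEq ?_⟩
      have h4 := congrArg (Multiset.count x) h
      rw [Multiset.count_map, Multiset.count_map] at h4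
      rw [Fintype.card_subtype, Fintype.card_subtype, Finset.card_def, Finset.card_def,
        Finset.filter_val, Finset.filter_val]
      simpa only [eq_comm] using h4.symm
    let e := fun x => (h3 x).some
    refine ⟨((Equiv.sigmaFiberEquiv w).symm.trans
      (Equiv.sigmaCongrRight e)).trans (Equiv.sigmaFiberEquiv v), ?_⟩
    ext i
    exact (e (w i) ⟨i, rfl⟩).2
  obtain ⟨σ, rfl⟩ := h2
  exact (hE s v σ).2 hv

variable (ar E) in
/-- Finite sets carry only finitely many relations. -/
def FinOcc : Prop := ∀ A : Finset E, (occ ar Set.univ (A : Set E)).Finite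

variable (ar) in
/-- The predimension as an integer, meaningful if finite sets carry finitely many relations. -/
def dl (K : Set (Symb N)) (A : Finset E) : ℤ := (A.card : ℤ) - ((occ ar K (A : Set E)).ncard : ℤ)

theorem FinOcc.finite (h : FinOcc ar E) (K : Set (Symb N)) (A : Finset E) :
    (occ ar K (A : Set E)).Finite :=
  (h A).subset (occ_mono (Set.subset_univ _) le_rfl)

theorem deltaIn_eq (h : FinOcc ar E) (K : Set (Symb N)) (A : Finset E) :
    deltaIn ar K A = (dl ar K A : WithBot ℤ) := by
  rw [deltaIn, if_pos (h.finite K A)]; rfl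

theorem delta_eq (h : FinOcc ar E) (A : Finset E) :
    delta ar A = (dl ar Set.univ A : WithBot ℤ) := deltaIn_eq h _ _

theorem finite_of_delta_ne_bot {A : Finset E} (h : delta ar A ≠ ⊥) :
    (occ ar Set.univ (A : Set E)).Finite := by
  by_contra hn
  exact h (by rw [delta, deltaIn, if_neg hn])

theorem finOcc_of_nonneg (h : ∀ A : Finset E, 0 ≤ delta ar A) : FinOcc ar E := fun A =>
  finite_of_delta_ne_bot fun hb => by
    have := h A
    rw [hb] at this
    exact absurd this (by simp)

theorem dl_nonneg_iff (h : FinOcc ar E) (A : Finset E) : 0 ≤ delta ar A ↔ 0 ≤ dl ar Set.univ A := by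
  rw [delta_eq h]; exact_mod_cast Iff.rfl

/-- The defect of modularity is exactly the number of relations on the union that lie in neither
part. Submodularity, its strict form and modularity of free joins are all read off from this. -/
theorem dl_union_add_inter (h : FinOcc ar E) (K : Set (Symb N)) (A B : Finset E) :
    dl ar K (A ∪ B) + dl ar K (A ∩ B) + (((occ ar K ((A ∪ B : Finset E) : Set E)) \
      (occ ar K (A : Set E) ∪ occ ar K (B : Set E))).ncard : ℤ) = dl ar K A + dl ar K B := by
  have hc := Finset.card_union_add_card_inter A B
  have hu : occ ar K (A : Set E) ∪ occ ar K (B : Set E) ⊆ occ ar K ((A ∪ B : Finset E) : Set E) :=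
    Set.union_subset (occ_mono le_rfl (by simp)) (occ_mono le_rfl (by simp))
  have h1 := Set.ncard_sdiff_add_ncard_of_subset hu (h.finite K _)
  have h2 := Set.ncard_union_add_ncard_inter (occ ar K (A : Set E)) (occ ar K (B : Set E))
    (h.finite K _) (h.finite K _)
  rw [← occ_inter, ← Finset.coe_inter] at h2
  unfold dl
  omega

theorem dl_submod (h : FinOcc ar E) (K : Set (Symb N)) (A B : Finset E) :
    dl ar K (A ∪ B) + dl ar K (A ∩ B) ≤ dl ar K A + dl ar K B := by
  have := dl_union_add_inter h K A B
  omega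

theorem dl_submod_lt (h : FinOcc ar E) {K : Set (Symb N)} {A B : Finset E}
    {p : Symb N × Multiset E} (hp : p ∈ occ ar K ((A ∪ B : Finset E) : Set E))
    (hA : ∃ x ∈ p.2, x ∉ A) (hB : ∃ x ∈ p.2, x ∉ B) :
    dl ar K (A ∪ B) + dl ar K (A ∩ B) < dl ar K A + dl ar K B := by
  have h1 := dl_union_add_inter h K A B
  have : 0 < ((occ ar K ((A ∪ B : Finset E) : Set E)) \
      (occ ar K (A : Set E) ∪ occ ar K (B : Set E))).ncard := by
    rw [Set.ncard_pos ((h.finite K _).sdiff)]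
    refine ⟨p, hp, ?_⟩
    rintro (h | h)
    · obtain ⟨x, hx, hx'⟩ := hA
      exact hx' ((mem_occ.1 h).2.2 x hx)
    · obtain ⟨x, hx, hx'⟩ := hB
      exact hx' ((mem_occ.1 h).2.2 x hx)
  omega

theorem dl_modular (h : FinOcc ar E) (K : Set (Symb N)) {A B : Finset E}
    (hf : ∀ p ∈ occ ar K ((A ∪ B : Finset E) : Set E), (∀ x ∈ p.2, x ∈ A) ∨ ∀ x ∈ p.2, x ∈ B) :
    dl ar K (A ∪ B) + dl ar K (A ∩ B) = dl ar K A + dl ar K B := by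
  have h1 := dl_union_add_inter h K A B
  rw [show (occ ar K ((A ∪ B : Finset E) : Set E)) \
      (occ ar K (A : Set E) ∪ occ ar K (B : Set E)) = ∅ from ?_, Set.ncard_empty] at h1
  · simpa using h1
  · rw [Set.sdiff_eq_empty]
    intro p hp
    have hp' := mem_occ.1 hp
    rcases hf p hp with h | h
    · exact Or.inl (mem_occ.2 ⟨hp'.1, hp'.2.1, h⟩)
    · exact Or.inr (mem_occ.2 ⟨hp'.1, hp'.2.1, h⟩)

theorem dl_modular_of_freelyJoined (h : FinOcc ar E) (K : Set (Symb N)) {D₁ D₂ : Set E}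
    (hf : FreelyJoined ar D₁ D₂) {A B : Finset E} (hA : (A : Set E) ⊆ D₁) (hB : (B : Set E) ⊆ D₂)
    (hA' : (B : Set E) ∩ D₁ ⊆ A) (hB' : (A : Set E) ∩ D₂ ⊆ B) :
    dl ar K (A ∪ B) + dl ar K (A ∩ B) = dl ar K A + dl ar K B := by
  refine dl_modular h K fun p hp => ?_
  obtain ⟨_, v, hv, hvm, hp2⟩ := hp
  rw [hp2]
  have hvm' : ∀ j, v j ∈ A ∨ v j ∈ B := fun j => by simpa using hvm j
  rcases hf p.1 v hv fun j => (hvm' j).imp (fun h => hA h) (fun h => hB h) with h | h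
  · left
    simp only [Multiset.mem_map, forall_exists_index, and_imp]
    rintro x j - rfl
    rcases hvm' j with h' | h'
    · exact h'
    · exact hA' ⟨h', h j⟩
  · right
    simp only [Multiset.mem_map, forall_exists_index, and_imp]
    rintro x j - rfl
    rcases hvm' j with h' | h'
    · exact hB' ⟨h', h j⟩
    · exact h'

/-- The sublanguage with more symbols sees more relations. -/
theorem dl_sub_dl_anti (h : FinOcc ar E) {K K' : Set (Symb N)} (hK : K ⊆ K') {A B : Finset E}
    (hAB : A ⊆ B) : dl ar K' B - dl ar K' A ≤ dl ar K B - dl ar K A := by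
  have h1 := Set.ncard_sdiff_add_ncard_of_subset
    (occ_mono (ar := ar) (le_refl K) (show (A : Set E) ⊆ B by simpa using hAB)) (h.finite K _)
  have h2 := Set.ncard_sdiff_add_ncard_of_subset
    (occ_mono (ar := ar) (le_refl K') (show (A : Set E) ⊆ B by simpa using hAB)) (h.finite K' _)
  have h3 : (occ ar K (B : Set E) \ occ ar K (A : Set E)).ncard ≤
      (occ ar K' (B : Set E) \ occ ar K' (A : Set E)).ncard := by
    refine Set.ncard_le_ncard ?_ (h.finite K' _).sdiff
    rintro p ⟨hp, hp'⟩
    refine ⟨occ_mono hK le_rfl hp, fun hp'' => hp' ?_⟩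
    exact mem_occ.2 ⟨(mem_occ.1 hp).1, (mem_occ.1 hp'').2⟩
  unfold dl
  omega

theorem dl_empty_le (K : Set (Symb N)) : dl ar K (∅ : Finset E) ≤ 0 := by
  simp [dl]

theorem dl_insert_le (h : FinOcc ar E) (K : Set (Symb N)) (A B : Finset E) :
    dl ar K (A ∪ B) ≤ dl ar K A + (B \ A).card := by
  have h1 : (occ ar K (A : Set E)).ncard ≤ (occ ar K ((A ∪ B : Finset E) : Set E)).ncard :=
    Set.ncard_le_ncard (occ_mono le_rfl (by simp)) (h.finite _ _)
  have h2 : (A ∪ B).card = A.card + (B \ A).card := by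
    rw [Finset.union_comm, ← Finset.sdiff_union_self_eq_union,
      Finset.card_union_of_disjoint Finset.sdiff_disjoint, add_comm]
  unfold dl
  omega

/-! ## Strong subsets -/

/-- The finite set `X ∩ D`. -/
def cap {E : Type*} (X : Finset E) (D : Set E) : Finset E := X.filter (· ∈ D)

@[simp] theorem mem_cap {E : Type*} {X : Finset E} {D : Set E} {x : E} :
    x ∈ cap X D ↔ x ∈ X ∧ x ∈ D := Finset.mem_filter

theorem cap_subset {E : Type*} (X : Finset E) (D : Set E) : cap X D ⊆ X := Finset.filter_subset _ _

theorem cap_subset_right {E : Type*} (X : Finset E) (D : Set E) : (cap X D : Set E) ⊆ D :=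
  fun _ hx => (mem_cap.1 hx).2

variable (ar) in
/-- `D` is strong in `D'`, for sets that may be infinite. -/
def StrongIn (D D' : Set E) : Prop :=
  ∀ X : Finset E, (X : Set E) ⊆ D' → dl ar Set.univ (cap X D) ≤ dl ar Set.univ X

/-- A sublanguage sees fewer new relations, so strongness in the full language is inherited by every
sublanguage. -/
theorem StrongIn.dl_le (h : FinOcc ar E) {D D' : Set E} (hD : StrongIn ar D D')
    (K : Set (Symb N)) {X : Finset E} (hX : (X : Set E) ⊆ D') :
    dl ar K (cap X D) ≤ dl ar K X := by
  have := dl_sub_dl_anti h (Set.subset_univ K) (cap_subset X D)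
  have := hD X hX
  omega

theorem StrongIn.mono {D D' D'' : Set E} (h : StrongIn ar D D'') (h' : D' ⊆ D'') :
    StrongIn ar D D' := fun X hX => h X (hX.trans h')

theorem StrongIn.trans {D D' D'' : Set E} (h : StrongIn ar D D') (h' : StrongIn ar D' D'')
    (hs : D ⊆ D') : StrongIn ar D D'' := fun X hX => by
  refine le_trans ?_ (h' X hX)
  have := h (cap X D') (cap_subset_right _ _)
  rwa [show cap (cap X D') D = cap X D by
    ext x; simp only [mem_cap]; exact ⟨fun h => ⟨h.1.1, h.2⟩, fun h => ⟨⟨h.1, hs h.2⟩, h.2⟩⟩] at this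

theorem strong_iff (h : FinOcc ar E) {A : Finset E} {D : Set E} :
    Strong ar A D ↔ (A : Set E) ⊆ D ∧
      ∀ X : Finset E, A ⊆ X → (X : Set E) ⊆ D → dl ar Set.univ A ≤ dl ar Set.univ X := by
  simp only [Strong, delta_eq h, WithBot.coe_le_coe]

theorem strong_iff_strongIn (h : FinOcc ar E) {A : Finset E} {D : Set E} :
    Strong ar A D ↔ (A : Set E) ⊆ D ∧ StrongIn ar (A : Set E) D := by
  rw [strong_iff h]
  refine and_congr_right fun hAD => ⟨fun hs X hX => ?_, fun hs X hAX hX => ?_⟩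
  · have h1 := dl_submod h Set.univ A X
    have h2 := hs (A ∪ X) Finset.subset_union_left (by simp [hX, hAD])
    rw [show A ∩ X = cap X (A : Set E) by
      ext; simp [and_comm] ] at h1
    omega
  · have := hs X hX
    rwa [show cap X (A : Set E) = A by
      ext x; simpa using @hAX x ] at this

theorem Strong.strongIn (h : FinOcc ar E) {A : Finset E} {D : Set E} (hA : Strong ar A D) :
    StrongIn ar (A : Set E) D := ((strong_iff_strongIn h).1 hA).2

theorem Strong.trans (h : FinOcc ar E) {A B : Finset E} {D : Set E}
    (h1 : Strong ar A (B : Set E)) (h2 : Strong ar B D) : Strong ar A D := by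
  rw [strong_iff_strongIn h] at *
  exact ⟨h1.1.trans h2.1, h1.2.trans h2.2 h1.1⟩

theorem Strong.mono {A : Finset E} {D D' : Set E} (h : Strong ar A D) (hA : (A : Set E) ⊆ D')
    (hD : D' ⊆ D) : Strong ar A D' := ⟨hA, fun X hX hX' => h.2 X hX (hX'.trans hD)⟩

theorem strong_of_dl_eq (h : FinOcc ar E) {A B : Finset E} {D : Set E} (hA : Strong ar A D)
    (hAB : A ⊆ B) (hBD : (B : Set E) ⊆ D) (hd : dl ar Set.univ B ≤ dl ar Set.univ A) :
    Strong ar B D := by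
  rw [strong_iff h] at *
  exact ⟨hBD, fun X hX hX' => hd.trans (hA.2 X (hAB.trans hX) hX')⟩

/-- Every finite set is contained in a finite strong set. -/
theorem exists_strong_superset (h : ∀ A : Finset E, 0 ≤ delta ar A) {A : Finset E} {D : Set E}
    (hA : (A : Set E) ⊆ D) : ∃ X : Finset E, A ⊆ X ∧ Strong ar X D := by
  have hf := finOcc_of_nonneg h
  -- A superset of least predimension is strong. Predimensions are nonnegative here, so `toNat`
  -- loses nothing.
  obtain ⟨X, ⟨hX1, hX2⟩, hmin⟩ := exists_minimalFor_of_wellFoundedLT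
    (fun X : Finset E => A ⊆ X ∧ (X : Set E) ⊆ D) (fun X => (dl ar Set.univ X).toNat)
    ⟨A, le_rfl, hA⟩
  refine ⟨X, hX1, (strong_iff hf).2 ⟨hX2, fun Y hY hYD => ?_⟩⟩
  have h1 := (dl_nonneg_iff hf X).1 (h X)
  have h2 := (dl_nonneg_iff hf Y).1 (h Y)
  by_contra hlt
  have := hmin ⟨hX1.trans hY, hYD⟩ (by simp only; omega)
  simp only at this
  omega

/-- `A` is not strong in some `X ⊆ D` of size at most `|A| + m`, as seen by `m` relations. -/
def Weak (ar : Symb N → ℕ) {E : Type*} [(lang ar).Structure E] (D : Set E) (A : Finset E)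
    (m : ℕ) : Prop :=
  ∃ X : Finset E, A ⊆ X ∧ (X : Set E) ⊆ D ∧ X.card ≤ A.card + m ∧
    dl ar (firstSymb N m) X < dl ar (firstSymb N m) A

theorem gval_eq (h : FinOcc ar E) (D : Set E) (A : Finset E) :
    gval ar D A = ⨅ (m : ℕ) (_ : Weak ar D A m), (m : ℕ∞) := by
  unfold gval Weak
  simp only [deltaIn_eq h, WithBot.coe_lt_coe]

/-- The trace on a strong set of a witness for `g` is again a witness: it is no larger, and in each
sublanguage its predimension is no larger. -/
theorem gval_eq_of_strongIn (h : FinOcc ar E) {D D' : Set E} (hs : StrongIn ar D D')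
    (hD : D ⊆ D') {A : Finset E} (hA : (A : Set E) ⊆ D) : gval ar D A = gval ar D' A := by
  rw [gval_eq h, gval_eq h]
  refine iInf_congr fun m => ?_
  have : Weak ar D A m ↔ Weak ar D' A m := by
    constructor
    · rintro ⟨X, h1, h2, h3, h4⟩
      exact ⟨X, h1, h2.trans hD, h3, h4⟩
    · rintro ⟨X, h1, h2, h3, h4⟩
      refine ⟨cap X D, fun x hx => by simpa using ⟨h1 hx, hA hx⟩, cap_subset_right _ _,
        (Finset.card_le_card (cap_subset _ _)).trans h3, (hs.dl_le h _ h2).trans_lt h4⟩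
  simp only [this]

theorem muBound_of_strongIn {μ : MuFun ar} (h : FinOcc ar E) {D D' : Set E}
    (hs : StrongIn ar D D') (hD : D ⊆ D') (hμ : MuBound μ D') : MuBound μ D := by
  intro k l S hS a r b ha hb hf hd
  rw [gval_eq_of_strongIn h hs hD (by simpa using Set.range_subset_iff.2 ha)]
  exact hμ k l S hS a r b (fun x => hD (ha x)) (fun i y => hD (hb i y)) hf hd

end Predimension

/-! ## Tuples of the same type, embeddings -/

section Transport

variable {E E' X Y : Type*} [(lang ar).Structure E] [(lang ar).Structure E']
  [(lang ar).Structure X] [(lang ar).Structure Y] {ι ι' : Type*}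

variable (ar) in
/-- The tuples `f` and `f'` have the same quantifier-free type in the sublanguage `K`. -/
def SameTp (K : Set (Symb N)) (f : ι → E) (f' : ι → E') : Prop :=
  (∀ i j, f i = f j ↔ f' i = f' j) ∧
    ∀ s ∈ K, ∀ w : Fin (ar s) → ι, Holds ar s (f ∘ w) ↔ Holds ar s (f' ∘ w)

theorem SameTp.symm {K : Set (Symb N)} {f : ι → E} {f' : ι → E'} (h : SameTp ar K f f') :
    SameTp ar K f' f :=
  ⟨fun i j => (h.1 i j).symm, fun s hs w => (h.2 s hs w).symm⟩

theorem SameTp.trans {E'' : Type*} [(lang ar).Structure E''] {K : Set (Symb N)} {f : ι → E}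
    {f' : ι → E'} {f'' : ι → E''} (h : SameTp ar K f f') (h' : SameTp ar K f' f'') :
    SameTp ar K f f'' :=
  ⟨fun i j => (h.1 i j).trans (h'.1 i j), fun s hs w => (h.2 s hs w).trans (h'.2 s hs w)⟩

theorem SameTp.mono {K K' : Set (Symb N)} {f : ι → E} {f' : ι → E'} (h : SameTp ar K f f')
    (hK : K' ⊆ K) : SameTp ar K' f f' := ⟨h.1, fun s hs => h.2 s (hK hs)⟩

theorem SameTp.comp {K : Set (Symb N)} {f : ι → E} {f' : ι → E'} (h : SameTp ar K f f')
    (g : ι' → ι) : SameTp ar K (f ∘ g) (f' ∘ g) :=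
  ⟨fun i j => h.1 (g i) (g j), fun s hs w => h.2 s hs (g ∘ w)⟩

theorem SameTp.injective {K : Set (Symb N)} {f : ι → E} {f' : ι → E'} (h : SameTp ar K f f')
    (hf : Function.Injective f) : Function.Injective f' :=
  fun i j hij => hf ((h.1 i j).2 hij)

theorem exists_comp_eq_of_kernel {f : ι → E} {f' : ι → E'} (h : ∀ i j, f i = f j → f' i = f' j)
    (hι : Nonempty ι) : ∃ φ : E → E', φ ∘ f = f' := by
  refine ⟨f' ∘ Function.invFun f, funext fun i => h _ _ ?_⟩
  exact Function.invFun_eq ⟨i, rfl⟩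

theorem multiset_map_eq_of_kernel {f : ι → E} {f' : ι → E'}
    (h : ∀ i j, f i = f j → f' i = f' j) {u u' : Multiset ι} (hu : u.map f = u'.map f) :
    u.map f' = u'.map f' := by
  rcases isEmpty_or_nonempty ι with hι | hι
  · rw [Subsingleton.elim u u']
  · obtain ⟨φ, rfl⟩ := exists_comp_eq_of_kernel h hι
    rw [← Multiset.map_map, hu, Multiset.map_map]

/-- Occurrences in the image of a tuple, indexed by the entries of the tuple. -/
def occIdx (ar : Symb N → ℕ) {E ι : Type*} [(lang ar).Structure E] (K : Set (Symb N)) (f : ι → E)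
    (T : Finset ι) : Set (Symb N × Multiset ι) :=
  {q | q.1 ∈ K ∧ ∃ w : Fin (ar q.1) → ι, Holds ar q.1 (f ∘ w) ∧ (∀ j, w j ∈ T) ∧
    q.2 = (Finset.univ : Finset (Fin (ar q.1))).val.map w}

theorem occ_image (K : Set (Symb N)) (f : ι → E) (T : Finset ι) :
    occ ar K ((T.image f : Finset E) : Set E) =
      (fun q : Symb N × Multiset ι => (q.1, q.2.map f)) '' occIdx ar K f T := by
  ext p
  constructor
  · rintro ⟨h1, v, hv, hvT, hp⟩
    have hv' : ∀ j, ∃ i ∈ T, f i = v j := fun j => by simpa using hvT j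
    choose w hw hwv using hv'
    obtain rfl : f ∘ w = v := funext hwv
    refine ⟨(p.1, (Finset.univ : Finset (Fin (ar p.1))).val.map w), ⟨h1, w, hv, hw, rfl⟩, ?_⟩
    ext1
    · rfl
    · simp only [hp, Multiset.map_map]
  · rintro ⟨q, ⟨h1, w, hw, hwT, hq⟩, rfl⟩
    refine ⟨h1, f ∘ w, hw, fun j => by simpa using ⟨w j, hwT j, rfl⟩, ?_⟩
    simp only [hq, Multiset.map_map]

theorem SameTp.occIdx_eq {K K' : Set (Symb N)} {f : ι → E} {f' : ι → E'} (h : SameTp ar K f f')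
    (hK : K' ⊆ K) (T : Finset ι) : occIdx ar K' f T = occIdx ar K' f' T := by
  ext q
  unfold occIdx
  constructor
  · rintro ⟨h1, w, hw, h2⟩
    exact ⟨h1, w, (h.2 _ (hK h1) w).1 hw, h2⟩
  · rintro ⟨h1, w, hw, h2⟩
    exact ⟨h1, w, (h.2 _ (hK h1) w).2 hw, h2⟩

/-- On a set of representatives for the fibres of `F`, both maps are injective and have their full
images. -/
theorem encard_image_eq_of_kernel {α β γ : Type*} {F : α → β} {G : α → γ} {Q : Set α}
    (h : ∀ q ∈ Q, ∀ q' ∈ Q, F q = F q' ↔ G q = G q') : (F '' Q).encard = (G '' Q).encard := by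
  obtain ⟨u, hu, hb⟩ := (Set.surjOn_image F Q).exists_bijOn_subset
  have hF : F '' Q = F '' u := hb.image_eq.symm
  have hG : G '' Q = G '' u := by
    refine subset_antisymm ?_ (Set.image_mono hu)
    rintro _ ⟨q, hq, rfl⟩
    obtain ⟨q', hq', he⟩ := hb.surjOn (Set.mem_image_of_mem F hq)
    exact ⟨q', hq', (h q' (hu hq') q hq).1 he⟩
  rw [hF, hG, hb.injOn.encard_image, Set.InjOn.encard_image]
  intro q hq q' hq' he
  exact hb.injOn hq hq' ((h q (hu hq) q' (hu hq')).2 he)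

/-- The tuples may have repetitions, so points and relations are not matched directly: both sets of
occurrences are images of the same index set `occIdx`, and the two maps identify the same indices.
-/
theorem SameTp.encard_occ {K K' : Set (Symb N)} {f : ι → E} {f' : ι → E'} (h : SameTp ar K f f')
    (hK : K' ⊆ K) (T : Finset ι) : (occ ar K' ((T.image f : Finset E) : Set E)).encard =
      (occ ar K' ((T.image f' : Finset E') : Set E')).encard := by
  rw [occ_image, occ_image, ← h.occIdx_eq hK]
  refine encard_image_eq_of_kernel fun q _ q' _ => ?_
  simp only [Prod.mk.injEq]
  refine and_congr_right fun _ => ⟨fun he => ?_, fun he => ?_⟩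
  · exact multiset_map_eq_of_kernel (fun i j => (h.1 i j).1) he
  · exact multiset_map_eq_of_kernel (fun i j => (h.1 i j).2) he

theorem SameTp.card_image {K : Set (Symb N)} {f : ι → E} {f' : ι → E'} (h : SameTp ar K f f')
    (T : Finset ι) : (T.image f).card = (T.image f').card := by
  have := encard_image_eq_of_kernel (F := f) (G := f') (Q := (T : Set ι))
    fun q _ q' _ => h.1 q q'
  rw [← Finset.coe_image, ← Finset.coe_image, Set.encard_coe_eq_coe_finsetCard,
    Set.encard_coe_eq_coe_finsetCard] at this
  exact_mod_cast this

theorem SameTp.deltaIn_image {K K' : Set (Symb N)} {f : ι → E} {f' : ι → E'}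
    (h : SameTp ar K f f') (hK : K' ⊆ K) (T : Finset ι) :
    deltaIn ar K' (T.image f) = deltaIn ar K' (T.image f') := by
  have h1 := h.encard_occ hK T
  unfold deltaIn
  rw [← Set.encard_lt_top_iff, ← Set.encard_lt_top_iff, h1, Set.ncard_def, Set.ncard_def, h1,
    h.card_image T]

theorem SameTp.dl_image {K K' : Set (Symb N)} {f : ι → E} {f' : ι → E'}
    (h : SameTp ar K f f') (hK : K' ⊆ K) (T : Finset ι) :
    dl ar K' (T.image f) = dl ar K' (T.image f') := by
  unfold dl
  rw [Set.ncard_def, Set.ncard_def, h.encard_occ hK T, h.card_image T]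

variable (ar) in
/-- `f` is an embedding of structures. -/
def IsEmb (f : X → E) : Prop :=
  Function.Injective f ∧ ∀ (s : Symb N) (v : Fin (ar s) → X), Holds ar s (f ∘ v) ↔ Holds ar s v

theorem IsEmb.sameTp {f : X → E} (h : IsEmb ar f) : SameTp ar Set.univ (id : X → X) f :=
  ⟨fun _ _ => h.1.eq_iff.symm, fun s _ w => (h.2 s w).symm⟩

theorem IsEmb.sameTp_comp {f : X → E} (h : IsEmb ar f) (g : ι → X) :
    SameTp ar Set.univ g (f ∘ g) := h.sameTp.comp g

theorem IsEmb.comp {g : X → E} {f : Y → X} (hg : IsEmb ar g) (hf : IsEmb ar f) :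
    IsEmb ar (g ∘ f) :=
  ⟨hg.1.comp hf.1, fun s v => (hg.2 s (f ∘ v)).trans (hf.2 s v)⟩

theorem isEmb_id : IsEmb ar (id : X → X) := ⟨Function.injective_id, fun _ _ => Iff.rfl⟩

theorem IsEmb.of_comp {g : X → E} {f : Y → X} (hg : IsEmb ar g) (hf : IsEmb ar (g ∘ f)) :
    IsEmb ar f :=
  ⟨Function.Injective.of_comp hf.1, fun s v => (hg.2 s (f ∘ v)).symm.trans (hf.2 s v)⟩

theorem IsEmb.of_rightInverse {g : X → E} {f : E → X} (hg : IsEmb ar g)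
    (h : Function.RightInverse f g) : IsEmb ar f := by
  refine hg.of_comp ?_
  rw [h.comp_eq_id]
  exact isEmb_id

theorem _root_.FirstOrder.Language.Embedding.isEmb (f : X ↪[lang ar] E) : IsEmb ar f :=
  ⟨f.injective, fun _ _ => f.map_rel _ _⟩

/-- An embedding in the sense of Mathlib. -/
def IsEmb.toEmbedding {f : X → E} (h : IsEmb ar f) : X ↪[lang ar] E where
  toFun := f
  inj' := h.1
  map_fun' g := Empty.elim g
  map_rel' := by
    rintro n ⟨s, rfl⟩ v
    exact h.2 s v

@[simp] theorem IsEmb.coe_toEmbedding {f : X → E} (h : IsEmb ar f) : ⇑h.toEmbedding = f := rfl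

theorem isEmb_val (S : (lang ar).Substructure E) : IsEmb ar (Subtype.val : S → E) :=
  S.subtype.isEmb

@[simp] theorem mem_subOf {D : Set E} {x : E} : x ∈ subOf ar D ↔ x ∈ D := Iff.rfl

theorem isEmb_pull {X : Type*} {f : X → E} (hf : Function.Injective f) :
    letI := pull ar f
    IsEmb ar f :=
  letI := pull ar f
  ⟨hf, fun _ _ => Iff.rfl⟩

theorem structure_ext {X : Type*} {S S' : (lang ar).Structure X}
    (h : ∀ (s : Symb N) (v : Fin (ar s) → X), @Holds N ar X S s v ↔ @Holds N ar X S' s v) :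
    S = S' := by
  apply FirstOrder.Language.Structure.ext
  · funext n g
    exact Empty.elim g
  · funext n r v
    obtain ⟨s, rfl⟩ := r
    exact propext (h s v)

theorem IsEmb.isSymm {f : X → E} (h : IsEmb ar f) (hE : IsSymm ar E) : IsSymm ar X :=
  fun s v σ => by
    rw [← h.2, ← h.2]
    exact hE s (f ∘ v) σ

theorem IsEmb.dl_image {f : X → E} (h : IsEmb ar f) (K : Set (Symb N)) (T : Finset X) :
    dl ar K (T.image f) = dl ar K T := by
  have := h.sameTp.dl_image (Set.subset_univ K) T
  rw [← this]; simp

theorem IsEmb.deltaIn_image {f : X → E} (h : IsEmb ar f) (K : Set (Symb N)) (T : Finset X) :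
    deltaIn ar K (T.image f) = deltaIn ar K T := by
  have := h.sameTp.deltaIn_image (Set.subset_univ K) T
  rw [← this]; simp

theorem IsEmb.delta_image {f : X → E} (h : IsEmb ar f) (T : Finset X) :
    delta ar (T.image f) = delta ar T := h.deltaIn_image _ T

theorem IsEmb.finOcc {f : X → E} (h : IsEmb ar f) (hE : FinOcc ar E) : FinOcc ar X := fun T => by
  have := h.sameTp.encard_occ (le_refl _) T
  rw [Finset.image_id] at this
  rw [← Set.encard_lt_top_iff, this, Set.encard_lt_top_iff]
  exact hE _

theorem IsEmb.delta_nonneg {f : X → E} (h : IsEmb ar f) (hE : ∀ A : Finset E, 0 ≤ delta ar A)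
    (A : Finset X) : 0 ≤ delta ar A := by
  rw [← h.delta_image]; exact hE _

theorem IsEmb.strong_image {f : X → E} (h : IsEmb ar f) {T : Finset X} {D : Set X} :
    Strong ar (T.image f) (f '' D) ↔ Strong ar T D := by
  unfold Strong
  rw [Finset.coe_image, Set.image_subset_image_iff h.1, h.delta_image]
  refine and_congr_right fun _ => ⟨fun hs Z hTZ hZ => ?_, fun hs Z hTZ hZ => ?_⟩
  · rw [← h.delta_image Z]
    exact hs _ (Finset.image_mono f hTZ) (by simpa using Set.image_mono hZ)
  · obtain ⟨Z, hZD, rfl⟩ := Finset.subset_set_image_iff.1 hZ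
    rw [h.delta_image]
    exact hs Z ((Finset.image_subset_image_iff h.1).1 hTZ) hZD

theorem IsEmb.simplyAlg_image {f : X → E} (h : IsEmb ar f) {A B : Finset X} :
    SimplyAlg ar (A.image f) (B.image f) ↔ SimplyAlg ar A B := by
  unfold SimplyAlg
  rw [Finset.image_nonempty, Finset.disjoint_image h.1, ← Finset.image_union, Finset.coe_image,
    h.strong_image, h.delta_image, h.delta_image]
  refine and_congr_right fun _ => and_congr_right fun _ => and_congr_right fun _ =>
    and_congr_right fun _ => and_congr_right fun _ => ⟨fun hs Z hZ hZn => ?_, fun hs Z hZ hZn => ?_⟩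
  · have := hs (Z.image f) ((Finset.image_ssubset_image h.1).2 hZ) (by simpa using hZn)
    rwa [← Finset.image_union, h.delta_image] at this
  · obtain ⟨Z, rfl⟩ : ∃ Z', Z'.image f = Z :=
      let ⟨Z', _, h⟩ := Finset.subset_image_iff.1 hZ.1
      ⟨Z', h⟩
    rw [← Finset.image_union, h.delta_image]
    exact hs Z ((Finset.image_ssubset_image h.1).1 hZ) (by simpa using hZn)

theorem IsEmb.minSimplyAlg_image {f : X → E} (h : IsEmb ar f) {A B : Finset X} :
    MinSimplyAlg ar (A.image f) (B.image f) ↔ MinSimplyAlg ar A B := by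
  unfold MinSimplyAlg
  rw [h.simplyAlg_image]
  refine and_congr_right fun _ => ⟨fun hs Z hZ => ?_, fun hs Z hZ => ?_⟩
  · rw [← h.simplyAlg_image]
    exact hs _ ((Finset.image_ssubset_image h.1).2 hZ)
  · obtain ⟨Z, rfl⟩ : ∃ Z', Z'.image f = Z :=
      let ⟨Z', _, h⟩ := Finset.subset_image_iff.1 hZ.1
      ⟨Z', h⟩
    rw [h.simplyAlg_image]
    exact hs Z ((Finset.image_ssubset_image h.1).1 hZ)

theorem IsEmb.gval_image {f : X → E} (h : IsEmb ar f) (D : Set X) (A : Finset X) :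
    gval ar (f '' D) (A.image f) = gval ar D A := by
  unfold gval
  refine iInf_congr fun m => iInf_congr_Prop ?_ fun _ => rfl
  constructor
  · rintro ⟨Z, hAZ, hZ, hc, hd⟩
    obtain ⟨Z, hZD, rfl⟩ := Finset.subset_set_image_iff.1 hZ
    rw [h.deltaIn_image, h.deltaIn_image] at hd
    rw [Finset.card_image_of_injective _ h.1, Finset.card_image_of_injective _ h.1] at hc
    exact ⟨Z, (Finset.image_subset_image_iff h.1).1 hAZ, hZD, hc, hd⟩
  · rintro ⟨Z, hAZ, hZ, hc, hd⟩
    refine ⟨Z.image f, Finset.image_mono f hAZ, by simpa using Set.image_mono hZ, ?_, ?_⟩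
    · rwa [Finset.card_image_of_injective _ h.1, Finset.card_image_of_injective _ h.1]
    · rwa [h.deltaIn_image, h.deltaIn_image]

theorem IsEmb.ofForm_comp {f : X → E} (h : IsEmb ar f) {k l : ℕ} {S : Ext ar k l} {a : Fin k → X}
    {b : Fin l → X} : OfForm S (f ∘ a) (f ∘ b) ↔ OfForm S a b := by
  unfold OfForm
  rw [← Sum.comp_elim, h.1.of_comp_iff]
  simp only [Function.comp_assoc, h.2]

theorem image_comp_univ {k : ℕ} (f : X → E) (a : Fin k → X) :
    (Finset.univ.image (f ∘ a) : Finset E) = (Finset.univ.image a).image f := by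
  rw [Finset.image_image]

theorem IsEmb.muBound_image {μ : MuFun ar} {f : X → E} (h : IsEmb ar f) {D : Set X} :
    MuBound μ (f '' D) ↔ MuBound μ D := by
  constructor
  · intro hμ k l S hS a r b ha hb hf hd
    have := hμ k l S hS (f ∘ a) r (fun i => f ∘ b i) (fun x => ⟨_, ha x, rfl⟩)
      (fun i y => ⟨_, hb i y, rfl⟩) (fun i => h.ofForm_comp.2 (hf i)) fun i j hij => by
        rw [Set.range_comp, Set.range_comp, Set.disjoint_image_iff h.1]; exact hd i j hij
    rwa [image_comp_univ, h.gval_image] at this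
  · intro hμ k l S hS a r b ha hb hf hd
    choose a' ha' haa using ha
    choose b' hb' hbb using hb
    obtain rfl : f ∘ a' = a := funext haa
    obtain rfl : (fun i => f ∘ b' i) = b := funext fun i => funext (hbb i)
    rw [image_comp_univ, h.gval_image]
    refine hμ k l S hS a' r b' ha' hb' (fun i => h.ofForm_comp.1 (hf i)) fun i j hij => ?_
    have := hd i j hij
    rwa [Set.range_comp, Set.range_comp, Set.disjoint_image_iff h.1] at this

theorem models_of_isEmb {ζ : (lang ar).Theory} (hζ : ζ.IsUniversal) {f : X → E}
    (h : IsEmb ar f) (hE : E ⊨ ζ) : X ⊨ ζ :=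
  hζ.models_of_embedding h.toEmbedding

theorem models_subOf_iff {ζ : (lang ar).Theory} (hζ : ζ.IsUniversal) {f : X → E}
    (h : IsEmb ar f) {D : Set E} (hD : Set.range f = D) : (subOf ar D) ⊨ ζ ↔ X ⊨ ζ := by
  subst hD
  constructor
  · intro hs
    refine models_of_isEmb hζ (E := subOf ar (Set.range f)) (f := fun x => ⟨f x, x, rfl⟩) ?_ hs
    exact (isEmb_val _).of_comp h
  · intro hs
    refine models_of_isEmb hζ (f := fun x : subOf ar (Set.range f) => x.2.choose) ?_ hs
    refine h.of_comp ?_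
    rw [show f ∘ (fun x : subOf ar (Set.range f) => x.2.choose) = Subtype.val from
      funext fun x => x.2.choose_spec]
    exact isEmb_val _

theorem models_subOf_of_subset {ζ : (lang ar).Theory} (hζ : ζ.IsUniversal) {D D' : Set E}
    (hD : D ⊆ D') (h : (subOf ar D') ⊨ ζ) : (subOf ar D) ⊨ ζ := by
  refine models_of_isEmb hζ (E := subOf ar D') (f := fun x => ⟨x.1, hD x.2⟩) ?_ h
  exact (isEmb_val _).of_comp (isEmb_val (subOf ar D))

theorem models_subOf {ζ : (lang ar).Theory} (hζ : ζ.IsUniversal) (D : Set E)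
    (h : E ⊨ ζ) : (subOf ar D) ⊨ ζ := models_of_isEmb hζ (isEmb_val _) h

theorem IsEmb.inClass_image {ζ : (lang ar).Theory} (hζ : ζ.IsUniversal) {μ : MuFun ar}
    {f : X → E} (h : IsEmb ar f) {D : Set X} : InClass ζ μ (f '' D) ↔ InClass ζ μ D := by
  unfold InClass
  rw [Set.finite_image_iff h.1.injOn, h.muBound_image,
    models_subOf_iff hζ (f := f ∘ (Subtype.val : subOf ar D → X)) (h.comp (isEmb_val _))
      (by rw [Set.range_comp]; congr 1; exact Subtype.range_coe)]
  refine and_congr_right fun _ => and_congr_left fun _ => ⟨fun hs A hA => ?_, fun hs A hA => ?_⟩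
  · rw [← h.delta_image]
    exact hs _ (by simpa using Set.image_mono hA)
  · obtain ⟨A, hAD, rfl⟩ := Finset.subset_set_image_iff.1 hA
    rw [h.delta_image]
    exact hs _ hAD

end Transport

/-! ## Simply algebraic extensions -/

section Extensions

variable {E X : Type*} [(lang ar).Structure E] [(lang ar).Structure X]

theorem dl_sub_dl (h : FinOcc ar E) (K : Set (Symb N)) {A B : Finset E} (hAB : A ⊆ B) :
    dl ar K B - dl ar K A =
      (B.card : ℤ) - A.card - (occ ar K (B : Set E) \ occ ar K (A : Set E)).ncard := by
  have h1 := Set.ncard_sdiff_add_ncard_of_subset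
    (occ_mono (ar := ar) (le_refl K) (show (A : Set E) ⊆ B by simpa using hAB)) (h.finite K _)
  unfold dl
  omega

theorem mem_occ_diff {K : Set (Symb N)} {A B : Finset E} {p : Symb N × Multiset E} :
    p ∈ occ ar K (B : Set E) \ occ ar K (A : Set E) ↔
      p ∈ occ ar K (B : Set E) ∧ ∃ x ∈ p.2, x ∉ A := by
  rw [Set.mem_sdiff]
  refine and_congr_right fun h => ?_
  constructor
  · intro hn
    by_contra! hA
    exact hn (mem_occ.2 ⟨(mem_occ.1 h).1, (mem_occ.1 h).2.1, hA⟩)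
  · rintro ⟨x, hx, hxA⟩ hp
    exact hxA ((mem_occ.1 hp).2.2 x hx)

/-- Copies preserve relations only positively, and nothing is asked of relations inside `U`. An
occurrence that leaves `P ⊇ U` has an entry outside `U` and hence transfers, and `hZ` keeps its
image from falling into `Z`. -/
theorem image_occ_diff_subset {f : X → E} {U : Set X} {K : Set (Symb N)}
    (hp : ∀ (s : Symb N) (v : Fin (ar s) → X), Holds ar s v → (∃ j, v j ∉ U) →
      s ∈ K ∧ Holds ar s (f ∘ v))
    {P P' : Finset X} {Z Z' : Finset E} (hU : U ⊆ P) (hP' : P'.image f ⊆ Z')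
    (hZ : ∀ x ∈ P', f x ∈ Z → x ∈ P) :
    (fun q : Symb N × Multiset X => (q.1, q.2.map f)) ''
        (occ ar Set.univ (P' : Set X) \ occ ar Set.univ (P : Set X)) ⊆
      occ ar K (Z' : Set E) \ occ ar K (Z : Set E) := by
  rintro _ ⟨q, hq, rfl⟩
  rw [mem_occ_diff] at hq ⊢
  obtain ⟨⟨-, v, hv, hvP, hq2⟩, x, hx, hxP⟩ := hq
  rw [hq2] at hx
  obtain ⟨j, -, rfl⟩ := Multiset.mem_map.1 hx
  obtain ⟨h1, h2⟩ := hp q.1 v hv ⟨j, fun h => hxP (hU h)⟩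
  refine ⟨⟨h1, f ∘ v, h2, fun j => hP' (Finset.mem_image_of_mem f (hvP j)), ?_⟩, f (v j), ?_, ?_⟩
  · simp only [hq2, Multiset.map_map]
  · simp only [hq2, Multiset.map_map]
    exact Multiset.mem_map.2 ⟨j, Finset.mem_univ_val j, rfl⟩
  · exact fun h => hxP (hZ _ (hvP j) h)

theorem map_pair_injective {f : X → E} (hf : Function.Injective f) :
    Function.Injective (fun q : Symb N × Multiset X => (q.1, q.2.map f)) := by
  rintro ⟨s, u⟩ ⟨s', u'⟩ h
  simp only [Prod.mk.injEq] at h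
  exact Prod.ext h.1 (Multiset.map_injective hf h.2)

theorem ncard_occ_diff_le (hE : FinOcc ar E) {f : X → E} (hf : Function.Injective f) {U : Set X}
    {K : Set (Symb N)}
    (hp : ∀ (s : Symb N) (v : Fin (ar s) → X), Holds ar s v → (∃ j, v j ∉ U) →
      s ∈ K ∧ Holds ar s (f ∘ v))
    {P P' : Finset X} {Z Z' : Finset E} (hU : U ⊆ P) (hP' : P'.image f ⊆ Z')
    (hZ : ∀ x ∈ P', f x ∈ Z → x ∈ P) :
    (occ ar Set.univ (P' : Set X) \ occ ar Set.univ (P : Set X)).ncard ≤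
      (occ ar K (Z' : Set E) \ occ ar K (Z : Set E)).ncard := by
  rw [← Set.ncard_image_of_injective _ (map_pair_injective hf)]
  exact Set.ncard_le_ncard (image_occ_diff_subset hp hU hP' hZ) (hE.finite _ _).sdiff

/-- If there are no more relations in the target than in the source, every relation of the target
comes from the source. -/
theorem holds_of_ncard_le (hX : IsSymm ar X) (hE : FinOcc ar E) {f : X → E}
    (hf : Function.Injective f) {U : Set X}
    (hp : ∀ (s : Symb N) (v : Fin (ar s) → X), Holds ar s v → (∃ j, v j ∉ U) →
      Holds ar s (f ∘ v))
    {P P' : Finset X} {Z Z' : Finset E} (hU : U ⊆ P) (hP' : P'.image f ⊆ Z')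
    (hZ : ∀ x ∈ P', f x ∈ Z → x ∈ P)
    (hc : (occ ar Set.univ (Z' : Set E) \ occ ar Set.univ (Z : Set E)).ncard ≤
      (occ ar Set.univ (P' : Set X) \ occ ar Set.univ (P : Set X)).ncard)
    {s : Symb N} {v : Fin (ar s) → X} (hv : Holds ar s (f ∘ v)) (hvZ : ∀ j, f (v j) ∈ Z')
    (hvn : ∃ j, f (v j) ∉ Z) : Holds ar s v := by
  have h1 := image_occ_diff_subset (K := Set.univ) (fun s v h h' => ⟨trivial, hp s v h h'⟩)
    hU hP' hZ
  rw [← Set.ncard_image_of_injective _ (map_pair_injective hf)] at hc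
  have h2 := Set.eq_of_subset_of_ncard_le h1 hc (hE.finite _ _).sdiff
  have h3 : (s, (Finset.univ : Finset (Fin (ar s))).val.map (f ∘ v)) ∈
      occ ar Set.univ (Z' : Set E) \ occ ar Set.univ (Z : Set E) := by
    rw [mem_occ_diff]
    obtain ⟨j, hj⟩ := hvn
    exact ⟨⟨trivial, f ∘ v, hv, hvZ, rfl⟩, f (v j), Multiset.mem_map.2 ⟨j, Finset.mem_univ_val j, rfl⟩, hj⟩
  rw [← h2] at h3
  obtain ⟨⟨s', u⟩, ⟨⟨-, w, hw, -, hu⟩, -⟩, he⟩ := h3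
  simp only [Prod.mk.injEq] at he hu hw
  obtain ⟨rfl, he⟩ := he
  rw [hu, ← Multiset.map_map] at he
  exact holds_of_map_eq hX (Multiset.map_injective hf he) hw

theorem simplyAlg_iff (h : FinOcc ar E) {A B : Finset E} :
    SimplyAlg ar A B ↔ B.Nonempty ∧ Disjoint A B ∧ dl ar Set.univ (A ∪ B) = dl ar Set.univ A ∧
      ∀ T ⊆ B, T.Nonempty → T ≠ B → dl ar Set.univ A < dl ar Set.univ (A ∪ T) := by
  unfold SimplyAlg
  rw [strong_iff h]
  simp only [delta_eq h, WithBot.coe_inj, ne_eq, WithBot.coe_ne_bot, not_false_eq_true, true_and]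
  refine and_congr_right fun _ => and_congr_right fun _ => ⟨?_, ?_⟩
  · rintro ⟨⟨h1, h2⟩, h3, h4⟩
    refine ⟨h3, fun T hT hTn hTB => lt_of_le_of_ne ?_ (Ne.symm (h4 T ⟨hT, fun h => hTB (hT.antisymm h)⟩ hTn))⟩
    exact h2 _ Finset.subset_union_left (by
      rw [Finset.coe_subset]; exact Finset.union_subset_union_right hT)
  · rintro ⟨h1, h2⟩
    refine ⟨⟨by simp, fun Z hAZ hZ => ?_⟩, h1, fun T hT hTn => (h2 T hT.1 hTn hT.ne).ne'⟩
    have hZ' : Z = A ∪ (Z ∩ B) := by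
      ext x
      have h3 : x ∈ Z → x ∈ A ∨ x ∈ B := fun hx => by simpa using hZ hx
      have := @hAZ x
      simp only [Finset.mem_union, Finset.mem_inter]
      tauto
    rw [hZ']
    by_cases hn : (Z ∩ B).Nonempty
    · by_cases hB : Z ∩ B = B
      · rw [hB, h1]
      · exact (h2 _ Finset.inter_subset_right hn hB).le
    · rw [Finset.not_nonempty_iff_eq_empty.1 hn, Finset.union_empty]

theorem SimplyAlg.strong {A B : Finset E} (h : SimplyAlg ar A B) :
    Strong ar A ((A ∪ B : Finset E) : Set E) := h.2.2.1

variable (ar) in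
/-- `a` occurs in a relation on `A ∪ B` together with an element of `B`. -/
def Linked (A B : Finset E) (a : E) : Prop :=
  ∃ p ∈ occ ar Set.univ ((A ∪ B : Finset E) : Set E), a ∈ p.2 ∧ ∃ b ∈ B, b ∈ p.2

/-- If `a` were in no relation with `B`, each `A ∪ T` with `T ⊆ B` would be a free join of `A` and
`A \ {a} ∪ T`. By modularity `T` would have the same predimension over `A \ {a}` as over `A`, and
`B` would be simply algebraic over the smaller base. -/
theorem linked_of_minSimplyAlg (h : FinOcc ar E) {A B : Finset E} (hAB : MinSimplyAlg ar A B)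
    {a : E} (ha : a ∈ A) : Linked ar A B a := by
  by_contra hn
  refine hAB.2 (A.erase a) (Finset.erase_ssubset ha) ?_
  have h1 := (simplyAlg_iff h).1 hAB.1
  have key : ∀ T ⊆ B, dl ar Set.univ (A.erase a ∪ T) - dl ar Set.univ (A.erase a) =
      dl ar Set.univ (A ∪ T) - dl ar Set.univ A := fun T hT => by
    have h2 := dl_modular (A := A) (B := A.erase a ∪ T) h Set.univ ?_
    · rw [show A ∪ (A.erase a ∪ T) = A ∪ T by
        rw [← Finset.union_assoc, Finset.union_eq_left.2 (Finset.erase_subset a A)],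
        show A ∩ (A.erase a ∪ T) = A.erase a by
          have := Finset.disjoint_left.1 h1.2.1
          ext x
          have h3 := @this x
          have h4 := @hT x
          simp only [Finset.mem_inter, Finset.mem_union, Finset.mem_erase]
          tauto] at h2
      omega
    · intro p hp
      by_cases hap : a ∈ p.2
      · left
        intro x hx
        by_contra hxA
        have hp' := (mem_occ.1 hp).2
        have hxT : x ∈ T := by
          have := hp'.2 x hx
          simp only [Finset.coe_union, Set.mem_union, Finset.mem_coe, Finset.mem_erase] at this
          tauto
        refine hn ⟨p, mem_occ.2 ⟨trivial, hp'.1, fun z hz => ?_⟩, hap, x, hT hxT, hx⟩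
        have := hp'.2 z hz
        have h4 := @hT z
        simp only [Finset.coe_union, Set.mem_union, Finset.mem_coe, Finset.mem_erase] at this ⊢
        tauto
      · right
        intro x hx
        have := (mem_occ.1 hp).2.2 x hx
        have hxa : x ≠ a := fun h => hap (h ▸ hx)
        simp only [Finset.coe_union, Set.mem_union, Finset.mem_coe, Finset.mem_erase,
          Finset.mem_union] at this ⊢
        tauto
  rw [simplyAlg_iff h]
  refine ⟨h1.1, h1.2.1.mono_left (Finset.erase_subset a A), ?_, fun T hT hTn hTB => ?_⟩
  · have := key B le_rfl
    have := h1.2.2.1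
    omega
  · have := key T hT
    have := h1.2.2.2 T hT hTn hTB
    omega

theorem dl_union_sub_le (h : FinOcc ar E) (K : Set (Symb N)) {A B Z : Finset E} (hAZ : A ⊆ Z)
    (hd : Disjoint Z B) : dl ar K (Z ∪ B) - dl ar K Z ≤ dl ar K (A ∪ B) - dl ar K A := by
  have h1 := dl_submod h K Z (A ∪ B)
  rw [← Finset.union_assoc, Finset.union_eq_left.2 hAZ, Finset.inter_union_distrib_left,
    Finset.inter_eq_right.2 hAZ, Finset.disjoint_iff_inter_eq_empty.1 hd,
    Finset.union_empty] at h1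
  omega

/-- Any base over which `Y` attaches contains all elements linked to `Y`. -/
theorem mem_of_linked (h : FinOcc ar E) {B Y G : Finset E} (hBY : Disjoint B Y)
    (hd : dl ar Set.univ B ≤ dl ar Set.univ (B ∪ Y)) (hG : G ⊆ B)
    (hatt : ∀ Z : Finset E, G ⊆ Z → Disjoint Z Y → dl ar Set.univ (Z ∪ Y) ≤ dl ar Set.univ Z)
    {f : E} (hf : f ∈ B) (hl : Linked ar B Y f) : f ∈ G := by
  by_contra hfG
  obtain ⟨p, hp, hfp, y, hyY, hyp⟩ := hl
  -- Over `B` without `f` the set `Y` costs nothing. The relation linking `f` to `Y` lies neither in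
  -- `B` nor in `B \ {f} ∪ Y`, so by strict submodularity adding `Y` to all of `B` would lower the
  -- predimension.
  have h1 := hatt (B.erase f) (fun x hx => Finset.mem_erase.2 ⟨fun h => hfG (h ▸ hx), hG hx⟩)
    (hBY.mono_left (Finset.erase_subset f B))
  have hu : B ∪ (B.erase f ∪ Y) = B ∪ Y := by
    rw [← Finset.union_assoc, Finset.union_eq_left.2 (Finset.erase_subset f B)]
  have hi : B ∩ (B.erase f ∪ Y) = B.erase f := by
    rw [Finset.inter_union_distrib_left, Finset.disjoint_iff_inter_eq_empty.1 hBY,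
      Finset.union_empty, Finset.inter_eq_right.2 (Finset.erase_subset f B)]
  have h2 := dl_submod_lt (A := B) (B := B.erase f ∪ Y) h (p := p) (K := Set.univ)
    (by rwa [hu]) ⟨y, hyp, fun hy => Finset.disjoint_left.1 hBY hy hyY⟩
    ⟨f, hfp, by simpa using fun hy => Finset.disjoint_left.1 hBY hf hy⟩
  rw [hu, hi] at h2
  omega

theorem Linked.mono {A A' B : Finset E} {a : E} (h : Linked ar A B a) (hA : A ⊆ A') :
    Linked ar A' B a := by
  obtain ⟨p, hp, h2⟩ := h
  exact ⟨p, occ_mono le_rfl (by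
    rw [Finset.coe_subset]; exact Finset.union_subset_union_left hA) hp, h2⟩

theorem exists_minSimplyAlg {A B : Finset E} (hAB : SimplyAlg ar A B) :
    ∃ F ⊆ A, MinSimplyAlg ar F B := by
  obtain ⟨F, ⟨hF1, hF2⟩, hmin⟩ := exists_minimal_of_wellFoundedLT
    (fun F : Finset E => F ⊆ A ∧ SimplyAlg ar F B) ⟨A, le_rfl, hAB⟩
  refine ⟨F, hF1, hF2, fun F' hF' hs => ?_⟩
  exact hF'.2 (hmin ⟨hF'.1.trans hF1, hs⟩ hF'.1)

/-- The part of `B` that `f` sends into `Z` is credited to the pattern: what remains adds equally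
many points on both sides, and at least as many relations to `Z` as to the pattern. -/
theorem dl_union_image_aux (hE : FinOcc ar E) (hX : FinOcc ar X) {A B : Finset X}
    (hd : Disjoint A B) (hcov : ∀ x, x ∈ A ∨ x ∈ B) {f : X → E} (hf : Function.Injective f)
    {K : Set (Symb N)}
    (hp : ∀ (s : Symb N) (v : Fin (ar s) → X), Holds ar s v → (∃ j, v j ∈ B) →
      s ∈ K ∧ Holds ar s (f ∘ v)) {Z : Finset E} (hZ : A.image f ⊆ Z) :
    dl ar K (Z ∪ B.image f) - dl ar K Z ≤
      dl ar Set.univ (A ∪ B) - dl ar Set.univ (A ∪ B.filter (f · ∈ Z)) := by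
  have hT : B.filter (f · ∈ Z) ⊆ B := Finset.filter_subset _ _
  have h1 := ncard_occ_diff_le (K := K) hE hf (U := (A : Set X))
    (P := A ∪ B.filter (f · ∈ Z)) (P' := A ∪ B) (Z := Z) (Z' := Z ∪ B.image f)
    (fun s v hv ⟨j, hj⟩ => hp s v hv ⟨j, (hcov (v j)).resolve_left hj⟩)
    (by simp)
    (by rw [Finset.image_union]; exact Finset.union_subset_union_left hZ)
    (by
      intro x _ hxZ
      rcases hcov x with h | h
      · exact Finset.mem_union_left _ h
      · exact Finset.mem_union_right _ (Finset.mem_filter.2 ⟨h, hxZ⟩))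
  rw [dl_sub_dl hE K Finset.subset_union_left,
    dl_sub_dl hX Set.univ (Finset.union_subset_union_right hT)]
  have h2 : ((Z ∪ B.image f).card : ℤ) - Z.card = B.card - (B.filter (f · ∈ Z)).card := by
    have e1 : (Z ∪ B.image f).card = Z.card + ((B \ B.filter (f · ∈ Z)).image f).card := by
      rw [← Finset.card_union_of_disjoint]
      · congr 1
        ext z
        simp only [Finset.mem_union, Finset.mem_image, Finset.mem_sdiff, Finset.mem_filter]
        constructor
        · rintro (hz | ⟨y, hy, rfl⟩)
          · exact Or.inl hz
          · by_cases hyZ : f y ∈ Z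
            · exact Or.inl hyZ
            · exact Or.inr ⟨y, ⟨hy, fun h => hyZ h.2⟩, rfl⟩
        · rintro (hz | ⟨y, ⟨hy, -⟩, rfl⟩)
          · exact Or.inl hz
          · exact Or.inr ⟨y, hy, rfl⟩
      · rw [Finset.disjoint_left]
        intro z hz hz'
        obtain ⟨x, hx, rfl⟩ := Finset.mem_image.1 hz'
        rw [Finset.mem_sdiff] at hx
        exact hx.2 (Finset.mem_filter.2 ⟨hx.1, hz⟩)
    have e2 := Finset.card_sdiff_add_card_eq_card hT
    rw [Finset.card_image_of_injective _ hf] at e1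
    omega
  have h3 : ((A ∪ B).card : ℤ) - (A ∪ B.filter (f · ∈ Z)).card =
      B.card - (B.filter (f · ∈ Z)).card := by
    rw [Finset.card_union_of_disjoint hd, Finset.card_union_of_disjoint (hd.mono_right hT)]
    push_cast; ring
  omega

/-- By strongness of the base, what remains of `B` after the part already in `Z` has nonpositive
predimension. -/
theorem SimplyAlg.dl_union_image_le (hE : FinOcc ar E) (hX : FinOcc ar X) {A B : Finset X}
    (hAB : SimplyAlg ar A B) (hcov : ∀ x, x ∈ A ∨ x ∈ B) {f : X → E} (hf : Function.Injective f)
    {K : Set (Symb N)}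
    (hp : ∀ (s : Symb N) (v : Fin (ar s) → X), Holds ar s v → (∃ j, v j ∈ B) →
      s ∈ K ∧ Holds ar s (f ∘ v)) {Z : Finset E} (hZ : A.image f ⊆ Z) :
    dl ar K (Z ∪ B.image f) ≤ dl ar K Z := by
  have h1 := dl_union_image_aux hE hX hAB.2.1 hcov hf hp hZ
  have h2 := (strong_iff hX).1 hAB.strong
  have h3 := ((simplyAlg_iff hX).1 hAB).2.2.1
  have h4 := h2.2 (A ∪ B.filter (f · ∈ Z)) Finset.subset_union_left (by
    rw [Finset.coe_subset]; exact Finset.union_subset_union_right (Finset.filter_subset _ _))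
  omega

/-- The part inside `Z` is a proper nonempty part of `B`, which has positive predimension over `A`,
so the remainder has negative predimension. -/
theorem SimplyAlg.dl_union_image_lt (hE : FinOcc ar E) (hX : FinOcc ar X) {A B : Finset X}
    (hAB : SimplyAlg ar A B) (hcov : ∀ x, x ∈ A ∨ x ∈ B) {f : X → E} (hf : Function.Injective f)
    {K : Set (Symb N)}
    (hp : ∀ (s : Symb N) (v : Fin (ar s) → X), Holds ar s v → (∃ j, v j ∈ B) →
      s ∈ K ∧ Holds ar s (f ∘ v)) {Z : Finset E} (hZ : A.image f ⊆ Z)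
    (hm : ∃ y ∈ B, f y ∈ Z) (hn : ∃ y ∈ B, f y ∉ Z) :
    dl ar K (Z ∪ B.image f) < dl ar K Z := by
  have h1 := dl_union_image_aux hE hX hAB.2.1 hcov hf hp hZ
  have h3 := (simplyAlg_iff hX).1 hAB
  have h4 := h3.2.2.2 (B.filter (f · ∈ Z)) (Finset.filter_subset _ _)
    (by
      obtain ⟨y, hy, hyZ⟩ := hm
      exact ⟨y, Finset.mem_filter.2 ⟨hy, hyZ⟩⟩)
    (by
      obtain ⟨y, hy, hyZ⟩ := hn
      intro he
      rw [← he] at hy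
      exact hyZ (Finset.mem_filter.1 hy).2)
  have h5 := h3.2.2.1
  omega

/-- If the copy does not lower the predimension, it has no more new relations than the pattern, and
the injection of the relations of the pattern is onto. -/
theorem SimplyAlg.holds_of_dl_le (hXs : IsSymm ar X) (hE : FinOcc ar E) (hX : FinOcc ar X)
    {A B : Finset X}
    (hAB : SimplyAlg ar A B) (hcov : ∀ x, x ∈ A ∨ x ∈ B) {f : X → E} (hf : Function.Injective f)
    (hp : ∀ (s : Symb N) (v : Fin (ar s) → X), Holds ar s v → (∃ j, v j ∈ B) → Holds ar s (f ∘ v))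
    (hd : dl ar Set.univ (A.image f) ≤ dl ar Set.univ (A.image f ∪ B.image f))
    {s : Symb N} {v : Fin (ar s) → X} (hv : Holds ar s (f ∘ v)) (hj : ∃ j, v j ∈ B) :
    Holds ar s v := by
  refine holds_of_ncard_le hXs hE hf (U := (A : Set X)) (P := A) (P' := A ∪ B) (Z := A.image f)
    (Z' := A.image f ∪ B.image f)
    (fun s v hv ⟨j, hj⟩ => hp s v hv ⟨j, (hcov (v j)).resolve_left hj⟩) le_rfl ?_ ?_ ?_ hv ?_ ?_
  · rw [Finset.image_union]
  · rintro x _ hx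
    obtain ⟨y, hy, hyx⟩ := Finset.mem_image.1 hx
    rwa [← hf hyx]
  · have h1 := dl_sub_dl hE Set.univ
      (Finset.subset_union_left (s₁ := A.image f) (s₂ := B.image f))
    have h2 := dl_sub_dl hX Set.univ (Finset.subset_union_left (s₁ := A) (s₂ := B))
    have h3 := ((simplyAlg_iff hX).1 hAB).2.2.1
    rw [Finset.card_union_of_disjoint ((Finset.disjoint_image hf).2 hAB.2.1),
      Finset.card_image_of_injective _ hf, Finset.card_image_of_injective _ hf] at h1
    rw [Finset.card_union_of_disjoint hAB.2.1] at h2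
    push_cast at h1 h2
    rw [← Finset.coe_union, ← Finset.coe_image, ← Finset.coe_image, ← Finset.coe_union] at *
    omega
  · intro j
    rw [← Finset.image_union]
    exact Finset.mem_image_of_mem f (Finset.mem_union.2 (hcov _))
  · obtain ⟨j, hj⟩ := hj
    refine ⟨j, fun h => ?_⟩
    obtain ⟨y, hy, hyx⟩ := Finset.mem_image.1 h
    rw [hf hyx] at hy
    exact Finset.disjoint_left.1 hAB.2.1 hy hj

end Extensions

/-! ## Tuples of the form of a minimally simply algebraic extension -/

section Form

variable {E : Type*} [(lang ar).Structure E]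

@[simp] theorem mem_baseSet {k l : ℕ} {x : Fin k ⊕ Fin l} :
    x ∈ baseSet k l ↔ ∃ i, Sum.inl i = x := by simp [baseSet]

@[simp] theorem mem_topSet {k l : ℕ} {x : Fin k ⊕ Fin l} :
    x ∈ topSet k l ↔ ∃ i, Sum.inr i = x := by simp [topSet]

/-- The symbols of the relative type of an extension. -/
def relSymb {k l : ℕ} (S : Ext ar k l) : Set (Symb N) :=
  {s | ∃ v : Fin (ar s) → Fin k ⊕ Fin l, @Holds N ar _ S s v ∧ ∃ j y, v j = Sum.inr y}

/-- Predimension `⊥` is excluded for the base, and the whole extension has the predimension of its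
base. -/
theorem IsMSAExt.finOcc {k l : ℕ} {S : Ext ar k l} (hS : IsMSAExt S) :
    @FinOcc N ar _ S := by
  let := S
  have h1 := hS.2.1.2.2.2.2.1
  have h2 := finite_of_delta_ne_bot (h1.trans_ne hS.2.1.2.2.2.1)
  exact fun A => h2.subset (occ_mono le_rfl fun x _ => by
    rcases x with x | x <;> simp)

theorem OfForm.pos {k l : ℕ} {S : Ext ar k l} {a : Fin k → E} {b : Fin l → E}
    (h : OfForm S a b) (s : Symb N) (v : Fin (ar s) → Fin k ⊕ Fin l)
    (hv : @Holds N ar _ S s v) : Holds ar s (Sum.elim a b ∘ v) := by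
  by_cases hn : ∃ j y, v j = Sum.inr y
  · exact h.2.2 s v hn hv
  · push Not at hn
    have : ∀ j, ∃ i, v j = Sum.inl i := fun j => by
      rcases hj : v j with i | y
      · exact ⟨i, rfl⟩
      · exact absurd hj (hn j y)
    choose w hw using this
    obtain rfl : v = Sum.inl ∘ w := funext hw
    exact (h.2.1 s w).1 hv

theorem OfForm.disjoint {k l : ℕ} {S : Ext ar k l} {a : Fin k → E} {b : Fin l → E}
    (h : OfForm S a b) : Disjoint (Finset.univ.image a) (Finset.univ.image b) := by
  rw [Finset.disjoint_left]
  intro x hx hy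
  obtain ⟨i, -, rfl⟩ := Finset.mem_image.1 hx
  obtain ⟨j, -, hj⟩ := Finset.mem_image.1 hy
  exact absurd (h.1 (a₁ := Sum.inr j) (a₂ := Sum.inl i) hj) (by simp)

theorem OfForm.injective_left {k l : ℕ} {S : Ext ar k l} {a : Fin k → E} {b : Fin l → E}
    (h : OfForm S a b) : Function.Injective a := h.1.comp Sum.inl_injective

theorem OfForm.injective_right {k l : ℕ} {S : Ext ar k l} {a : Fin k → E} {b : Fin l → E}
    (h : OfForm S a b) : Function.Injective b := h.1.comp Sum.inr_injective

theorem exists_inr_iff {n k l : ℕ} {v : Fin n → Fin k ⊕ Fin l} :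
    (∃ j, v j ∈ topSet k l) ↔ ∃ j y, v j = Sum.inr y := by
  simp only [mem_topSet, eq_comm]

theorem mem_base_or_top {k l : ℕ} (x : Fin k ⊕ Fin l) : x ∈ baseSet k l ∨ x ∈ topSet k l := by
  rcases x with x | x <;> simp

theorem image_baseSet {k l : ℕ} (a : Fin k → E) (b : Fin l → E) :
    (baseSet k l).image (Sum.elim a b) = Finset.univ.image a := by
  ext; simp

theorem image_topSet {k l : ℕ} (a : Fin k → E) (b : Fin l → E) :
    (topSet k l).image (Sum.elim a b) = Finset.univ.image b := by
  ext; simp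

/-- A copy of a minimally simply algebraic extension does not increase the predimension. -/
theorem OfForm.dl_union_le (hE : FinOcc ar E) {k l : ℕ} {S : Ext ar k l} (hS : IsMSAExt S)
    {a : Fin k → E} {b : Fin l → E} (h : OfForm S a b) {K : Set (Symb N)} (hK : relSymb S ⊆ K)
    {Z : Finset E} (hZ : Finset.univ.image a ⊆ Z) :
    dl ar K (Z ∪ Finset.univ.image b) ≤ dl ar K Z := by
  let := S
  rw [← image_topSet a b]
  refine hS.2.1.dl_union_image_le hE hS.finOcc mem_base_or_top h.1 (fun s v hv hj => ?_)
    (by rwa [image_baseSet])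
  rw [exists_inr_iff] at hj
  exact ⟨hK ⟨v, hv, hj⟩, h.2.2 s v hj hv⟩

/-- A copy that meets `Z` without being contained in it decreases the predimension. -/
theorem OfForm.dl_union_lt (hE : FinOcc ar E) {k l : ℕ} {S : Ext ar k l} (hS : IsMSAExt S)
    {a : Fin k → E} {b : Fin l → E} (h : OfForm S a b) {K : Set (Symb N)} (hK : relSymb S ⊆ K)
    {Z : Finset E} (hZ : Finset.univ.image a ⊆ Z) (hm : ∃ y, b y ∈ Z) (hn : ∃ y, b y ∉ Z) :
    dl ar K (Z ∪ Finset.univ.image b) < dl ar K Z := by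
  let := S
  rw [← image_topSet a b]
  refine hS.2.1.dl_union_image_lt hE hS.finOcc mem_base_or_top h.1 (fun s v hv hj => ?_)
    (by rwa [image_baseSet]) (hm.imp' Sum.inr fun y hy => ⟨by simp, hy⟩)
    (hn.imp' Sum.inr fun y hy => ⟨by simp, hy⟩)
  rw [exists_inr_iff] at hj
  exact ⟨hK ⟨v, hv, hj⟩, h.2.2 s v hj hv⟩

/-- In a copy, every element of the base occurs in a relation with an element of the top. -/
theorem OfForm.linked {k l : ℕ} {S : Ext ar k l} (hS : IsMSAExt S)
    {a : Fin k → E} {b : Fin l → E} (h : OfForm S a b) (i : Fin k) :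
    ∃ s ∈ relSymb S, ∃ v : Fin (ar s) → Fin k ⊕ Fin l, @Holds N ar _ S s v ∧
      Holds ar s (Sum.elim a b ∘ v) ∧ (∃ j, v j = Sum.inl i) ∧ ∃ j y, v j = Sum.inr y := by
  let := S
  obtain ⟨p, hp, hi, x, hx, hxp⟩ := linked_of_minSimplyAlg hS.finOcc hS.2 (a := Sum.inl i) (by simp)
  obtain ⟨-, v, hv, -, hp2⟩ := hp
  obtain ⟨y, rfl⟩ := mem_topSet.1 hx
  rw [hp2] at hi hxp
  obtain ⟨j, -, hj⟩ := Multiset.mem_map.1 hi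
  obtain ⟨j', -, hj'⟩ := Multiset.mem_map.1 hxp
  exact ⟨p.1, ⟨v, hv, j', y, hj'⟩, v, hv, h.2.2 _ v ⟨j', y, hj'⟩ hv, ⟨j, hj⟩, j', y, hj'⟩

/-- A copy that does not decrease the predimension is an exact copy. -/
theorem OfForm.isEmb (hE : FinOcc ar E) {k l : ℕ} {S : Ext ar k l} (hS : IsMSAExt S)
    {a : Fin k → E} {b : Fin l → E} (h : OfForm S a b)
    (hd : dl ar Set.univ (Finset.univ.image a) ≤
      dl ar Set.univ (Finset.univ.image a ∪ Finset.univ.image b)) :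
    let := S
    IsEmb ar (Sum.elim a b) := by
  let := S
  refine ⟨h.1, fun s v => ⟨fun hv => ?_, h.pos s v⟩⟩
  by_cases hn : ∃ j y, v j = Sum.inr y
  · refine hS.2.1.holds_of_dl_le hS.1 hE hS.finOcc mem_base_or_top h.1
      (fun s v hv _ => h.pos s v hv) ?_ hv (exists_inr_iff.2 hn)
    rwa [image_baseSet, image_topSet]
  · push Not at hn
    have : ∀ j, ∃ i, v j = Sum.inl i := fun j => by
      rcases hj : v j with i | y
      · exact ⟨i, rfl⟩
      · exact absurd hj (hn j y)
    choose w hw using this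
    obtain rfl : v = Sum.inl ∘ w := funext hw
    exact (h.2.1 s w).2 hv

end Form

/-! ## Free joins -/

section Join

variable {E : Type*} [(lang ar).Structure E]

variable (ar) in
/-- The structure is the free join of `D` and `C` over `B = D ∩ C`. -/
structure JoinOver (D : Set E) (B C : Finset E) : Prop where
  inter : (B : Set E) = D ∩ C
  union : D ∪ C = Set.univ
  free : FreelyJoined ar D (C : Set E)

variable {D : Set E} {B C : Finset E}

theorem JoinOver.mem_iff (hJ : JoinOver ar D B C) {x : E} : x ∈ B ↔ x ∈ D ∧ x ∈ C := by
  have : x ∈ (B : Set E) ↔ x ∈ D ∩ (C : Set E) := by rw [hJ.inter]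
  simpa using this

theorem JoinOver.mem_or (hJ : JoinOver ar D B C) (x : E) : x ∈ D ∨ x ∈ C := by
  have : x ∈ D ∪ (C : Set E) := by rw [hJ.union]; trivial
  simpa using this

theorem JoinOver.subset (hJ : JoinOver ar D B C) : B ⊆ C := fun _ hx => (hJ.mem_iff.1 hx).2

theorem JoinOver.subset_left (hJ : JoinOver ar D B C) : (B : Set E) ⊆ D :=
  fun _ hx => (hJ.mem_iff.1 hx).1

theorem JoinOver.holds (hJ : JoinOver ar D B C) {s : Symb N} {v : Fin (ar s) → E}
    (hv : Holds ar s v) : (∀ j, v j ∈ D) ∨ ∀ j, v j ∈ C :=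
  hJ.free s v hv fun j => hJ.mem_or (v j)

theorem JoinOver.dl_eq (hJ : JoinOver ar D B C) (hf : FinOcc ar E) (K : Set (Symb N))
    (X : Finset E) : dl ar K X + dl ar K (cap X (B : Set E)) =
      dl ar K (cap X D) + dl ar K (cap X (C : Set E)) := by
  have h := dl_modular_of_freelyJoined (A := cap X D) (B := cap X (C : Set E)) hf K hJ.free
    (cap_subset_right _ _) (cap_subset_right _ _)
    (fun x hx => mem_cap.2 ⟨(mem_cap.1 hx.1).1, hx.2⟩)
    (fun x hx => mem_cap.2 ⟨(mem_cap.1 hx.1).1, hx.2⟩)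
  rwa [show cap X D ∪ cap X (C : Set E) = X by
      ext x; have := hJ.mem_or x; simp only [Finset.mem_union, mem_cap, Finset.mem_coe]; tauto,
    show cap X D ∩ cap X (C : Set E) = cap X (B : Set E) by
      ext x
      simp only [Finset.mem_inter, mem_cap, Finset.mem_coe, hJ.mem_iff]; tauto ] at h

/-- In a free join `δ(X) - δ(X ∩ D) = δ(X ∩ C) - δ(X ∩ B)`, and the right side is nonnegative
because `B` is strong in `C`. -/
theorem JoinOver.strongIn_left (hJ : JoinOver ar D B C) (hf : FinOcc ar E)
    (hB : Strong ar B (C : Set E)) : StrongIn ar D Set.univ := fun X _ => by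
  have h1 := hJ.dl_eq hf Set.univ X
  have h2 := hB.strongIn hf (cap X (C : Set E)) (cap_subset_right _ _)
  rw [show cap (cap X (C : Set E)) (B : Set E) = cap X (B : Set E) by
    ext x; have : x ∈ B → x ∈ C := fun h => hJ.subset h; simp only [mem_cap, Finset.mem_coe]; tauto] at h2
  omega

theorem JoinOver.strongIn_right (hJ : JoinOver ar D B C) (hf : FinOcc ar E)
    (hB : Strong ar B D) : StrongIn ar (C : Set E) Set.univ := fun X _ => by
  have h1 := hJ.dl_eq hf Set.univ X
  have h2 := hB.strongIn hf (cap X D) (cap_subset_right _ _)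
  rw [show cap (cap X D) (B : Set E) = cap X (B : Set E) by
    ext x; have : x ∈ B → x ∈ D := fun h => hJ.subset_left h; simp only [mem_cap, Finset.mem_coe] at *; tauto] at h2
  omega

theorem JoinOver.finOcc (hJ : JoinOver ar D B C)
    (hD : ∀ A : Finset E, (A : Set E) ⊆ D → (occ ar Set.univ (A : Set E)).Finite)
    (hC : (occ ar Set.univ (C : Set E)).Finite) : FinOcc ar E := fun X => by
  refine ((hD (cap X D) (cap_subset_right _ _)).union hC).subset ?_
  rintro p ⟨_, v, hv, hX, hp⟩
  rcases hJ.holds hv with h | h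
  · exact Or.inl ⟨trivial, v, hv, fun j => mem_cap.2 ⟨hX j, h j⟩, hp⟩
  · exact Or.inr ⟨trivial, v, hv, h, hp⟩

theorem JoinOver.delta_nonneg (hJ : JoinOver ar D B C) (hf : FinOcc ar E)
    (hB : Strong ar B (C : Set E)) (h0 : ∀ A : Finset E, (A : Set E) ⊆ D → 0 ≤ delta ar A)
    (A : Finset E) : 0 ≤ delta ar A := by
  rw [dl_nonneg_iff hf]
  have h1 := hJ.strongIn_left hf hB A (Set.subset_univ _)
  have h2 := (dl_nonneg_iff hf _).1 (h0 _ (cap_subset_right A D))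
  omega

/-- The transcendental counterpart of `strongIn_left`. -/
theorem JoinOver.dl_union_right (hJ : JoinOver ar D B C) (hf : FinOcc ar E) (K : Set (Symb N))
    {X : Finset E} (hX : (X : Set E) ⊆ D) (hBX : B ⊆ X) :
    dl ar K (X ∪ C) + dl ar K B = dl ar K X + dl ar K C := by
  have h := hJ.dl_eq hf K (X ∪ C)
  rwa [show cap (X ∪ C) (B : Set E) = B by
      ext x
      have : x ∈ B → x ∈ C := fun h => hJ.subset h
      simp only [mem_cap, Finset.mem_union, Finset.mem_coe]; tauto,
    show cap (X ∪ C) D = X by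
      ext x
      have h1 := @hX x
      have h2 := @hBX x
      have h3 := hJ.mem_iff (x := x)
      simp only [mem_cap, Finset.mem_union, Finset.mem_coe] at *
      tauto,
    show cap (X ∪ C) (C : Set E) = C by
      ext x; simp only [mem_cap, Finset.mem_union, Finset.mem_coe]; tauto ] at h

theorem ofForm_dl_base {p q : ℕ} {S : Ext ar p q} {x : Fin p → E} {y : Fin q → E}
    (h : OfForm S x y) (K : Set (Symb N)) :
    letI := S
    dl ar K (baseSet p q) = dl ar K (Finset.univ.image x) := by
  let := S
  have : SameTp ar Set.univ (Sum.inl : Fin p → Fin p ⊕ Fin q) x :=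
    ⟨fun i j => by rw [h.injective_left.eq_iff, Sum.inl_injective.eq_iff],
      fun s _ w => h.2.1 s w⟩
  rw [← this.dl_image (Set.subset_univ K)]
  congr 1
  ext; simp

theorem ofForm_dl_le_mu {μ : MuFun ar} (hμ : IsMu μ) {p q : ℕ} {S : Ext ar p q}
    (hS : IsMSAExt S) {x : Fin p → E} {y : Fin q → E} (h : OfForm S x y) (m : ℕ∞) :
    dl ar Set.univ (Finset.univ.image x) ≤ μ p q S m := by
  have h1 := hμ.lower p q S hS m
  let := S
  rw [delta_eq hS.finOcc, ofForm_dl_base h] at h1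
  exact_mod_cast h1

theorem IsMSAExt.top_pos {k l : ℕ} {S : Ext ar k l} (hS : IsMSAExt S) : 0 < l := by
  let := S
  obtain ⟨y, hy⟩ := hS.2.1.1
  obtain ⟨i, -⟩ := mem_topSet.1 hy
  exact i.pos

/-- The relations that link `g` to the disjoint sets `H i` are distinct. Each `H i` thus makes `G`
cheaper by one more over the rest, by one application of strict submodularity. -/
theorem dl_add_card_le_of_linked (hf : FinOcc ar E) {ι : Type*} (H : ι → Finset E)
    {G G' P : Finset E} {g : E} (hG' : G' ⊆ G) (hg : g ∈ G) (hgG' : g ∉ G') (hgP : g ∉ P)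
    (hPG : ∀ z ∈ P, z ∉ G) (J : Finset ι) (hHG : ∀ i ∈ J, ∀ z ∈ H i, z ∉ G)
    (hHP : ∀ i ∈ J, ∀ z ∈ H i, z ∉ P) (hHH : ∀ i j z, z ∈ H i → z ∈ H j → i = j)
    (hl : ∀ i ∈ J, ∃ p ∈ occ ar Set.univ ((G ∪ H i : Finset E) : Set E), g ∈ p.2 ∧
      ∃ h ∈ H i, h ∈ p.2) :
    dl ar Set.univ (G ∪ P ∪ J.biUnion H) - dl ar Set.univ (G' ∪ P ∪ J.biUnion H) + J.card ≤
      dl ar Set.univ G - dl ar Set.univ G' := by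
  induction J using Finset.induction_on with
  | empty =>
    have h1 := dl_submod hf Set.univ G (G' ∪ P)
    rw [show G ∪ (G' ∪ P) = G ∪ P by grind, show G ∩ (G' ∪ P) = G' by grind] at h1
    simp only [Finset.biUnion_empty, Finset.union_empty, Finset.card_empty]
    omega
  | insert i J hiJ ih =>
    have ih := ih (fun j hj => hHG j (Finset.mem_insert_of_mem hj))
      (fun j hj => hHP j (Finset.mem_insert_of_mem hj))
      (fun j hj => hl j (Finset.mem_insert_of_mem hj))
    obtain ⟨p, hp, hgp, h, hhi, hhp⟩ := hl i (Finset.mem_insert_self i J)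
    have hi1 := hHG i (Finset.mem_insert_self i J)
    have hi2 := hHP i (Finset.mem_insert_self i J)
    have hiW : ∀ z ∈ H i, z ∉ J.biUnion H := fun z hz hzW => by
      obtain ⟨j, hj, hzj⟩ := Finset.mem_biUnion.1 hzW
      exact hiJ (hHH i j z hz hzj ▸ hj)
    have hWG : ∀ z ∈ J.biUnion H, z ∉ G := fun z hzW => by
      obtain ⟨j, hj, hzj⟩ := Finset.mem_biUnion.1 hzW
      exact hHG j (Finset.mem_insert_of_mem hj) z hzj
    rw [Finset.biUnion_insert, Finset.card_insert_of_notMem hiJ]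
    generalize J.biUnion H = W at *
    generalize H i = Y at *
    have hu : (G' ∪ P ∪ (Y ∪ W)) ∪ (G ∪ P ∪ W) = G ∪ P ∪ (Y ∪ W) := by grind
    have hi : (G' ∪ P ∪ (Y ∪ W)) ∩ (G ∪ P ∪ W) = G' ∪ P ∪ W := by grind
    have h1 := dl_submod_lt hf (K := Set.univ) (A := G' ∪ P ∪ (Y ∪ W)) (B := G ∪ P ∪ W) (p := p)
      (by rw [hu]; exact occ_mono le_rfl (by rw [Finset.coe_subset]; grind) hp)
      ⟨g, hgp, by grind⟩ ⟨h, hhp, by grind⟩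
    rw [hu, hi] at h1
    push_cast
    omega

/-- Copies that meet `Z` without lying in it lower the predimension. By disjointness the earlier
copies do not absorb the later ones, so the drops add up. -/
theorem dl_add_card_le_of_meets (hf : FinOcc ar E) {p q : ℕ} {S : Ext ar p q} (hS : IsMSAExt S)
    {x : Fin p → E} {ι : Type*} {y : ι → Fin q → E} (hy : ∀ i, OfForm S x (y i))
    (hHH : ∀ i j z, z ∈ Finset.univ.image (y i) → z ∈ Finset.univ.image (y j) → i = j)
    {Z : Finset E} (hZ : Finset.univ.image x ⊆ Z) (J : Finset ι)
    (hm : ∀ i ∈ J, ∃ t, y i t ∈ Z) (hn : ∀ i ∈ J, ∃ t, y i t ∉ Z) :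
    dl ar Set.univ (Z ∪ J.biUnion fun i => Finset.univ.image (y i)) + J.card ≤
      dl ar Set.univ Z := by
  induction J using Finset.induction_on with
  | empty => simp
  | insert i J hiJ ih =>
    have ih := ih (fun j hj => hm j (Finset.mem_insert_of_mem hj))
      (fun j hj => hn j (Finset.mem_insert_of_mem hj))
    have h1 := (hy i).dl_union_lt hf hS (Set.subset_univ _)
      (Z := Z ∪ J.biUnion fun i => Finset.univ.image (y i))
      (hZ.trans Finset.subset_union_left) ?_ ?_
    · rw [Finset.biUnion_insert, Finset.card_insert_of_notMem hiJ, Finset.union_comm (Finset.image _ _),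
        ← Finset.union_assoc]
      push_cast
      omega
    · obtain ⟨t, ht⟩ := hm i (Finset.mem_insert_self i J)
      exact ⟨t, Finset.mem_union_left _ ht⟩
    · obtain ⟨t, ht⟩ := hn i (Finset.mem_insert_self i J)
      refine ⟨t, fun h => ?_⟩
      rcases Finset.mem_union.1 h with h | h
      · exact ht h
      · obtain ⟨j, hj, hzj⟩ := Finset.mem_biUnion.1 h
        exact hiJ (hHH i j _ (by simp) hzj ▸ hj)

/-- If the base of a family of disjoint copies is not contained in the strong set `D`, and every
copy meets `D`, then the family is small. -/
theorem card_le_dl_of_meets (hf : FinOcc ar E) (hD : StrongIn ar D Set.univ)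
    (h0 : ∀ A : Finset E, (A : Set E) ⊆ D → 0 ≤ dl ar Set.univ A)
    {p q : ℕ} {S : Ext ar p q} (hS : IsMSAExt S) {x : Fin p → E} {r : ℕ} {y : Fin r → Fin q → E}
    (hy : ∀ i, OfForm S x (y i))
    (hd : ∀ i j, i ≠ j → Disjoint (Set.range (y i)) (Set.range (y j)))
    (hx : ∃ t, x t ∉ D) (hm : ∀ i, ∃ t, y i t ∈ D) :
    (r : ℤ) ≤ dl ar Set.univ (Finset.univ.image x) := by
  obtain ⟨t₀, ht₀⟩ := hx
  have hHG : ∀ i z, z ∈ Finset.univ.image (y i) → z ∉ Finset.univ.image x :=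
    fun i z hz => Finset.disjoint_right.1 (OfForm.disjoint (hy i)) hz
  have hHH : ∀ i j z, z ∈ Finset.univ.image (y i) → z ∈ Finset.univ.image (y j) → i = j :=
    fun i j z hi hj => by
      by_contra hij
      exact Set.disjoint_left.1 (hd i j hij) (show z ∈ Set.range (y i) by simpa using hi)
        (by simpa using hj)
  have hl : ∀ i, ∃ p ∈ occ ar Set.univ
      ((Finset.univ.image x ∪ Finset.univ.image (y i) : Finset E) : Set E), x t₀ ∈ p.2 ∧
        ∃ h ∈ Finset.univ.image (y i), h ∈ p.2 := fun i => by
    obtain ⟨s, -, v, -, hv, ⟨j, hj⟩, j', t, hj'⟩ := (hy i).linked hS t₀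
    refine ⟨(s, Finset.univ.val.map (Sum.elim x (y i) ∘ v)), ⟨trivial, _, hv, fun j => ?_, rfl⟩,
      Multiset.mem_map.2 ⟨j, Finset.mem_univ_val j, by simp [hj]⟩, y i t, by simp,
      Multiset.mem_map.2 ⟨j', Finset.mem_univ_val j', by simp [hj']⟩⟩
    rcases hvj : v j with w | w <;> simp [hvj]
  have hyi : ∀ i t, y i t ∈ Finset.univ.image (y i) := fun i t => by simp
  have hG : x t₀ ∈ Finset.univ.image x := by simp
  -- Copies inside `D` are counted by the relations that link them to the point `x t₀` outside `D`.
  -- The others are counted by the drop of the predimension that they cause, since they meet `D` and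
  -- leave it.
  let I : Finset (Fin r) := Finset.univ.filter fun i => ∀ t, y i t ∈ D
  have hI : ∀ i, i ∈ I ↔ ∀ t, y i t ∈ D := fun i => by simp [I]
  have hID : ∀ i ∈ I, ∀ z ∈ Finset.univ.image (y i), z ∈ D := fun i hi z hz => by
    obtain ⟨t, -, rfl⟩ := Finset.mem_image.1 hz
    exact (hI i).1 hi t
  have hB := dl_add_card_le_of_meets hf hS hy hHH
    (Z := Finset.univ.image x ∪ cap (Iᶜ.biUnion fun i => Finset.univ.image (y i)) D ∪
      I.biUnion fun i => Finset.univ.image (y i))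
    (Finset.subset_union_left.trans Finset.subset_union_left) Iᶜ
    (fun i hi => by
      obtain ⟨t, ht⟩ := hm i
      refine ⟨t, Finset.mem_union_left _ (Finset.mem_union_right _ (mem_cap.2 ⟨?_, ht⟩))⟩
      exact Finset.mem_biUnion.2 ⟨i, hi, hyi i t⟩)
    (fun i hi => by
      have : ¬ ∀ t, y i t ∈ D := fun h => Finset.mem_compl.1 hi ((hI i).2 h)
      push Not at this
      obtain ⟨t, ht⟩ := this
      refine ⟨t, fun h => ?_⟩
      rcases Finset.mem_union.1 h with h | h
      · rcases Finset.mem_union.1 h with h | h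
        · exact hHG i _ (hyi i t) h
        · exact ht (mem_cap.1 h).2
      · obtain ⟨j, hj, hzj⟩ := Finset.mem_biUnion.1 h
        exact ht (hID j hj _ hzj))
  have hA := dl_add_card_le_of_linked hf (fun i => Finset.univ.image (y i))
    (G := Finset.univ.image x) (G' := cap (Finset.univ.image x) D)
    (P := cap (Iᶜ.biUnion fun i => Finset.univ.image (y i)) D) (g := x t₀) (cap_subset _ _) hG
    (fun h => ht₀ (mem_cap.1 h).2) (fun h => ht₀ (mem_cap.1 h).2)
    (fun z hz => by
      obtain ⟨j, hj, hzj⟩ := Finset.mem_biUnion.1 (mem_cap.1 hz).1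
      exact hHG j z hzj) I (fun i _ => hHG i)
    (fun i hi z hz hzP => by
      obtain ⟨j, hj, hzj⟩ := Finset.mem_biUnion.1 (mem_cap.1 hzP).1
      exact Finset.mem_compl.1 hj (hHH i j z hz hzj ▸ hi)) hHH (fun i _ => hl i)
  have hID' : ∀ z ∈ I.biUnion fun i => Finset.univ.image (y i), z ∈ D := fun z h => by
    obtain ⟨j, hj, hzj⟩ := Finset.mem_biUnion.1 h
    exact hID j hj _ hzj
  have := h0 (cap (Finset.univ.image x) D) (cap_subset_right _ _)
  have hcard : I.card + Iᶜ.card = r := by rw [Finset.card_add_card_compl]; simp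
  generalize (I.biUnion fun i => Finset.univ.image (y i)) = W at *
  generalize (Iᶜ.biUnion fun i => Finset.univ.image (y i)) = W' at *
  generalize Finset.univ.image x = G at *
  -- Strongness of `D` bounds the total drop: together with `hA` and `hB` it yields `r ≤ δ(G) - δ(G
  -- ∩ D)`.
  have hC := hD (G ∪ cap W' D ∪ W ∪ W') (Set.subset_univ _)
  rw [show cap (G ∪ cap W' D ∪ W ∪ W') D = cap G D ∪ cap W' D ∪ W by
    ext z
    have := hID' z
    simp only [mem_cap, Finset.mem_union]; tauto] at hC
  omega

end Join

/-! ## The `μ`-bound in a free join -/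

section Key

variable {E : Type*} [(lang ar).Structure E]

/-- There are `r` pairwise disjoint tuples in `D` of the form of `S` over `a`. -/
def Copies {k l : ℕ} (S : Ext ar k l) (a : Fin k → E) (D : Set E) (r : ℕ) : Prop :=
  ∃ b : Fin r → Fin l → E, (∀ i t, b i t ∈ D) ∧ (∀ i, OfForm S a (b i)) ∧
    ∀ i j, i ≠ j → Disjoint (Set.range (b i)) (Set.range (b j))

theorem Copies.mono {k l : ℕ} {S : Ext ar k l} {a : Fin k → E} {D : Set E} {r r' : ℕ}
    (h : Copies S a D r) (hr : r' ≤ r) : Copies S a D r' := by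
  obtain ⟨b, h1, h2, h3⟩ := h
  exact ⟨fun i => b (Fin.castLE hr i), fun i => h1 _, fun i => h2 _,
    fun i j hij => h3 _ _ fun h => hij (Fin.castLE_injective hr h)⟩

theorem Copies.succ {k l : ℕ} {S : Ext ar k l} {a : Fin k → E} {D : Set E} {r : ℕ}
    {b : Fin r → Fin l → E} (h1 : ∀ i t, b i t ∈ D) (h2 : ∀ i, OfForm S a (b i))
    (h3 : ∀ i j, i ≠ j → Disjoint (Set.range (b i)) (Set.range (b j)))
    {c : Fin l → E} (hc1 : ∀ t, c t ∈ D) (hc2 : OfForm S a c)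
    (hc3 : ∀ i, Disjoint (Set.range c) (Set.range (b i))) : Copies S a D (r + 1) := by
  refine ⟨Fin.cons c b, fun i => ?_, fun i => ?_, fun i j => ?_⟩
  · refine Fin.cases ?_ (fun i => ?_) i
    · exact hc1
    · exact h1 i
  · refine Fin.cases ?_ (fun i => ?_) i
    · exact hc2
    · exact h2 i
  · refine Fin.cases ?_ (fun i => ?_) i <;> refine Fin.cases ?_ (fun j => ?_) j
    · exact fun h => absurd rfl h
    · exact fun _ => hc3 j
    · exact fun _ => (hc3 i).symm
    · exact fun h => h3 i j fun h' => h (by rw [h'])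

/-- Since `x`, `y` embed `S`, the structure pulled back along the permuted tuples is a
re-enumeration of `S`. -/
theorem mu_pull_eq {μ : MuFun ar} (hμ : IsMu μ) {k l : ℕ} {S : Ext ar k l} (hS : IsMSAExt S)
    {x : Fin k → E} {y : Fin l → E} (he : @IsEmb N ar _ _ _ S (Sum.elim x y))
    (σ : Equiv.Perm (Fin k)) (τ : Equiv.Perm (Fin l)) (m : ℕ∞) :
    μ k l (pull ar (Sum.elim (x ∘ σ) (y ∘ τ))) m = μ k l S m := by
  rw [← hμ.iso k l S hS σ τ m]
  congr 1
  refine structure_ext fun s v => ?_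
  have := he.2 s (Sum.map σ τ ∘ v)
  rw [← Function.comp_assoc, Sum.elim_comp_map] at this
  exact this

theorem ofForm_pull {k l : ℕ} {S : Ext ar k l}
    {x : Fin k → E} {y y' : Fin l → E} (he : @IsEmb N ar _ _ _ S (Sum.elim x y))
    (h : OfForm S x y')
    (σ : Equiv.Perm (Fin k)) (τ : Equiv.Perm (Fin l)) :
    OfForm (pull ar (Sum.elim (x ∘ σ) (y ∘ τ))) (x ∘ σ) (y' ∘ τ) := by
  refine ⟨?_, fun s v => Iff.rfl, fun s v hv hvS => ?_⟩
  · rw [← Sum.elim_comp_map]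
    exact h.1.comp (Sum.map_injective.2 ⟨σ.injective, τ.injective⟩)
  · have h1 := he.2 s (Sum.map σ τ ∘ v)
    rw [← Function.comp_assoc, Sum.elim_comp_map] at h1
    have h2 := h.2.2 s (Sum.map σ τ ∘ v) (by
      obtain ⟨j, w, hj⟩ := hv
      exact ⟨j, τ w, by simp [hj]⟩) (h1.1 hvS)
    rwa [← Function.comp_assoc, Sum.elim_comp_map] at h2

theorem exists_equiv_of_image_eq {k p : ℕ} {a : Fin k → E} {x : Fin p → E}
    (ha : Function.Injective a) (hx : Function.Injective x)
    (h : (Finset.univ.image a : Finset E) = Finset.univ.image x) :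
    ∃ σ : Fin k ≃ Fin p, a = x ∘ σ := by
  have h' : Set.range a = Set.range x := by
    have := congrArg (fun s : Finset E => (s : Set E)) h
    simpa using this
  refine ⟨(Equiv.ofInjective a ha).trans ((Equiv.setCongr h').trans
    (Equiv.ofInjective x hx).symm), ?_⟩
  ext i
  have := Equiv.apply_ofInjective_symm hx ((Equiv.setCongr h') (Equiv.ofInjective a ha i))
  simpa using this.symm

variable {D : Set E} {B C : Finset E}

/-- A copy outside `D` over a base inside `D` is the extension `C` itself. -/
theorem image_eq_of_form_outside (hf : FinOcc ar E) (hJ : JoinOver ar D B C)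
    (hBC : SimplyAlg ar B (C \ B)) {F : Finset E} (hFB : F ⊆ B)
    (hm : MinSimplyAlg ar F (C \ B)) {p q : ℕ} {S : Ext ar p q} (hS : IsMSAExt S)
    {x : Fin p → E} {y : Fin q → E} (h : OfForm S x y) (hx : ∀ t, x t ∈ D) (hy : ∀ t, y t ∉ D) :
    Finset.univ.image y = C \ B ∧ Finset.univ.image x = F := by
  have hyC : ∀ t, y t ∈ C \ B := fun t =>
    Finset.mem_sdiff.2 ⟨(hJ.mem_or (y t)).resolve_left (hy t), fun h => hy t (hJ.subset_left h)⟩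
  have hYsub : Finset.univ.image y ⊆ C \ B := by
    intro z hz
    obtain ⟨t, -, rfl⟩ := Finset.mem_image.1 hz
    exact hyC t
  -- A relation linking `x i` to the copy has a point outside `D`, so it lies in `C` by freeness;
  -- hence `x i ∈ D ∩ C = B`.
  have hlink : ∀ i, x i ∈ B ∧ Linked ar B (Finset.univ.image y) (x i) := fun i => by
    obtain ⟨s, -, v, -, hv, ⟨j, hj⟩, j', t, hj'⟩ := h.linked hS i
    have hC : ∀ j, (Sum.elim x y ∘ v) j ∈ C := (hJ.holds hv).resolve_left fun hD =>
      hy t (by simpa [hj'] using hD j')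
    have hxB : ∀ i', x i' ∈ C → x i' ∈ B := fun i' hi => hJ.mem_iff.2 ⟨hx i', hi⟩
    refine ⟨hxB i (by simpa [hj] using hC j),
      (s, Finset.univ.val.map (Sum.elim x y ∘ v)), ⟨trivial, _, hv, fun j => ?_, rfl⟩,
      Multiset.mem_map.2 ⟨j, Finset.mem_univ_val j, by simp [hj]⟩, y t, by simp,
      Multiset.mem_map.2 ⟨j', Finset.mem_univ_val j', by simp [hj']⟩⟩
    have := hC j
    rcases hvj : v j with w | w
    · simp only [Function.comp_apply, hvj, Sum.elim_inl] at this ⊢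
      simp [hxB w this]
    · simp [hvj]
  have hGB : Finset.univ.image x ⊆ B := by
    intro z hz
    obtain ⟨t, -, rfl⟩ := Finset.mem_image.1 hz
    exact (hlink t).1
  have hBC' := (simplyAlg_iff hf).1 hBC
  -- A proper nonempty part of `C \ B` raises the predimension over `B`, which a copy cannot do.
  have hY : Finset.univ.image y = C \ B := by
    by_contra hne
    have h1 := hBC'.2.2.2 _ hYsub (by
      obtain ⟨t⟩ : Nonempty (Fin q) := ⟨⟨0, hS.top_pos⟩⟩
      exact ⟨y t, by simp⟩) hne
    have h2 := h.dl_union_le hf hS (Set.subset_univ _) hGB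
    omega
  -- Each of the two bases contains every point of `B` linked to `C \ B`, and consists of such
  -- points.
  refine ⟨hY, subset_antisymm (fun z hz => ?_) fun z hz => ?_⟩
  · obtain ⟨t, -, rfl⟩ := Finset.mem_image.1 hz
    refine mem_of_linked hf hBC'.2.1 hBC'.2.2.1.ge hFB (fun Z hZ hZd => ?_) (hlink t).1
      (hY ▸ (hlink t).2)
    have h1 := dl_union_sub_le hf Set.univ hZ hZd
    have h2 := ((simplyAlg_iff hf).1 hm.1).2.2.1
    omega
  · refine mem_of_linked hf hBC'.2.1 hBC'.2.2.1.ge hGB (fun Z hZ _ => ?_) (hFB hz)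
      ((linked_of_minSimplyAlg hf hm hz).mono hFB)
    rw [← hY]
    exact h.dl_union_le hf hS (Set.subset_univ _) hZ

/-- The central dichotomy: the free join of `D` and a simply algebraic extension `C` of `B`
satisfies the `μ`-bound unless `D` already contains the maximal number of copies of `C`. -/
theorem muBound_or_copies (hf : FinOcc ar E)
    (h0 : ∀ A : Finset E, (A : Set E) ⊆ D → 0 ≤ delta ar A) (hJ : JoinOver ar D B C)
    (hBC : SimplyAlg ar B (C \ B)) {μ : MuFun ar} (hμ : IsMu μ) (hD : MuBound μ D) {k l : ℕ}
    {a : Fin k → E} {c : Fin l → E} (ha : Function.Injective a) (hc : Function.Injective c)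
    (haB : ∀ t, a t ∈ B) (hcC : Finset.univ.image c = C \ B)
    (hm : MinSimplyAlg ar (Finset.univ.image a) (C \ B))
    (hi : ∀ Y : Finset E, (Y : Set E) ⊆ D → Y.card ≤ (C \ B).card →
      dl ar (symbOver ar B C) B ≤ dl ar (symbOver ar B C) (B ∪ Y))
    (hii : ∀ (p q : ℕ) (S : Ext ar p q), IsMSAExt S → ∀ (x : Fin p → E) (r : ℕ)
      (y : Fin r → Fin q → E), (∀ t, x t ∈ C) → (∃ t, x t ∉ B) → (∀ i t, y i t ∈ C) →
      (∀ i, OfForm S x (y i)) → (∀ i j, i ≠ j → Disjoint (Set.range (y i)) (Set.range (y j))) →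
      (∃ i, ∀ t, y i t ∈ C \ B) → r ≤ μ p q S (gval ar Set.univ (Finset.univ.image x))) :
    MuBound μ (Set.univ : Set E) ∨
      Copies (pull ar (Sum.elim a c)) a D
        (μ k l (pull ar (Sum.elim a c)) (gval ar D (Finset.univ.image a))) := by
  have hBsub := hJ.subset
  have hCeq : B ∪ C \ B = C := Finset.union_sdiff_of_subset hBsub
  have hBC' : Strong ar B (C : Set E) := by have := hBC.strong; rwa [hCeq] at this
  have hDs : StrongIn ar D Set.univ := hJ.strongIn_left hf hBC'
  rw [or_iff_not_imp_right]
  intro hcop p q S hS x r y _ _ hy hd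
  by_contra hr
  push Not at hr
  by_cases hxD : ∀ t, x t ∈ D
  · -- the base lies in `D`
    -- A copy over a base in `D` that both meets and leaves `D` would have smaller predimension than
    -- its trace on `D`, against the strongness of `D`.
    have hdich : ∀ i, (∀ t, y i t ∈ D) ∨ ∀ t, y i t ∉ D := fun i => by
      by_contra! hcon
      obtain ⟨⟨t, ht⟩, t', ht'⟩ := hcon
      have h1 := (hy i).dl_union_lt hf hS (Set.subset_univ _)
        (Z := Finset.univ.image x ∪ cap (Finset.univ.image (y i)) D) Finset.subset_union_left
        ⟨t', Finset.mem_union_right _ (mem_cap.2 ⟨by simp, ht'⟩)⟩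
        ⟨t, fun h => by
          rcases Finset.mem_union.1 h with h | h
          · obtain ⟨u, -, hu⟩ := Finset.mem_image.1 h
            exact ht (hu ▸ hxD u)
          · exact ht (mem_cap.1 h).2⟩
      have h2 := hDs (Finset.univ.image x ∪ cap (Finset.univ.image (y i)) D ∪
        Finset.univ.image (y i)) (Set.subset_univ _)
      rw [show cap (Finset.univ.image x ∪ cap (Finset.univ.image (y i)) D ∪
          Finset.univ.image (y i)) D =
          Finset.univ.image x ∪ cap (Finset.univ.image (y i)) D by
        ext z
        have : z ∈ Finset.univ.image x → z ∈ D := fun h => by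
          obtain ⟨u, -, hu⟩ := Finset.mem_image.1 h
          exact hu ▸ hxD u
        simp only [mem_cap, Finset.mem_union]
        tauto] at h2
      omega
    have hGD : ((Finset.univ.image x : Finset E) : Set E) ⊆ D := by
      simpa using Set.range_subset_iff.2 hxD
    have hgv := gval_eq_of_strongIn hf hDs (Set.subset_univ _) hGD
    by_cases hall : ∀ i t, y i t ∈ D
    · have := hD p q S hS x r y hxD hall hy hd
      rw [hgv] at this
      omega
    · push Not at hall
      obtain ⟨i₀, t₀, ht₀⟩ := hall
      have hi₀ := (hdich i₀).resolve_left fun h => ht₀ (h t₀)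
      have haF : Finset.univ.image a ⊆ B := by
        intro z hz
        obtain ⟨t, -, rfl⟩ := Finset.mem_image.1 hz
        exact haB t
      -- The outside copy is `C \ B` over `F`, so `S` is a re-enumeration of the given extension and
      -- its `μ`-value is the given one.
      obtain ⟨hYeq, hXeq⟩ := image_eq_of_form_outside hf hJ hBC haF hm hS (hy i₀) hxD hi₀
      obtain ⟨σ, rfl⟩ := exists_equiv_of_image_eq ha (hy i₀).injective_left hXeq.symm
      obtain ⟨τ, rfl⟩ := exists_equiv_of_image_eq hc (hy i₀).injective_right (hcC.trans hYeq.symm)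
      obtain rfl : k = p := by simpa using Fintype.card_congr σ
      obtain rfl : l = q := by simpa using Fintype.card_congr τ
      have hemb := (hy i₀).isEmb hf hS (by
        rw [hYeq, hXeq]
        exact ((simplyAlg_iff hf).1 hm.1).2.2.1.ge)
      refine hcop ?_
      rw [mu_pull_eq hμ hS hemb, ← hXeq, hgv]
      -- The copy `C \ B` is discarded. The remaining ones are still at least `μ` many and lie in
      -- `D`: another copy outside `D` would also equal `C \ B` and not be disjoint from the first.
      obtain ⟨r, rfl⟩ : ∃ r', r = r' + 1 := ⟨r - 1, by omega⟩
      refine Copies.mono (r := r) ?_ (by omega)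
      refine ⟨fun i => y (i₀.succAbove i) ∘ τ, fun i t => ?_, fun i => ofForm_pull hemb (hy _) σ τ,
        fun i j hij => ?_⟩
      · refine (hdich (i₀.succAbove i)).resolve_right (fun hno => ?_) (τ t)
        have h1 := (image_eq_of_form_outside hf hJ hBC haF hm hS (hy _) hxD hno).1
        have h2 := hd _ _ (Fin.succAbove_ne i₀ i)
        have h3 : y (i₀.succAbove i) (τ t) ∈ Finset.univ.image (y i₀) := by
          rw [hYeq, ← h1]; simp
        exact Set.disjoint_left.1 h2 ⟨τ t, rfl⟩ (by simpa using h3)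
      · rw [τ.surjective.range_comp, τ.surjective.range_comp]
        exact hd _ _ fun h => hij (Fin.succAbove_right_injective h)
  · push Not at hxD
    by_cases hIII : ∃ i, ∀ t, y i t ∉ D
    · -- the base is contained in `C`, not in `D`, and some copy avoids `D`
      obtain ⟨i₀, hi₀⟩ := hIII
      have hyC : ∀ t, y i₀ t ∈ C := fun t => (hJ.mem_or _).resolve_left (hi₀ t)
      have hyB : ∀ t, y i₀ t ∉ B := fun t h => hi₀ t (hJ.subset_left h)
      have hxC : ∀ t, x t ∈ C := fun i => by
        obtain ⟨s, -, v, -, hv, ⟨j, hj⟩, j', t, hj'⟩ := (hy i₀).linked hS i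
        have hC := (hJ.holds hv).resolve_left fun hD => hi₀ t (by simpa [hj'] using hD j')
        simpa [hj] using hC j
      have hxB : ∃ t, x t ∉ B := by
        obtain ⟨t, ht⟩ := hxD
        exact ⟨t, fun h => ht (hJ.subset_left h)⟩
      have hsym : relSymb S ⊆ symbOver ar B C := by
        rintro s ⟨v, hv, j, w, hj⟩
        refine ⟨_, (hy i₀).pos s v hv, fun j => ?_, j, by simpa [hj] using hyB w⟩
        rcases hvj : v j with u | u
        · simpa [hvj] using hxC u
        · simpa [hvj] using hyC u
      -- A copy not contained in `C` still meets it, through a relation with the point `x t₀ ∉ D`.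
      -- It therefore lowers the predimension of `C` as seen by the symbols of `C/B`, and by
      -- freeness its part in `D` lowers that of `B`. This is excluded by `hi`, the part being no
      -- larger than `C \ B`.
      have hallC : ∀ i t, y i t ∈ C := by
        by_contra! hcon
        obtain ⟨i, t, ht⟩ := hcon
        obtain ⟨t₀, ht₀⟩ := hxD
        obtain ⟨s, -, v, -, hv, ⟨j, hj⟩, j', t', hj'⟩ := (hy i).linked hS t₀
        have hC := (hJ.holds hv).resolve_left fun hD => ht₀ (by simpa [hj] using hD j)
        have h1 := (hy i).dl_union_lt hf hS hsym (Z := C)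
          (by
            intro z hz
            obtain ⟨u, -, rfl⟩ := Finset.mem_image.1 hz
            exact hxC u)
          ⟨t', by simpa [hj'] using hC j'⟩ ⟨t, ht⟩
        have hYD : ((Finset.univ.image (y i) \ C : Finset E) : Set E) ⊆ D := fun z hz =>
          (hJ.mem_or z).resolve_right (Finset.mem_sdiff.1 hz).2
        have h2 := hi _ hYD (by
          have e1 : (Finset.univ.image (y i)).card = q := by
            rw [Finset.card_image_of_injective _ (hy i).injective_right]; simp
          have e2 : (Finset.univ.image (y i₀)).card = q := by
            rw [Finset.card_image_of_injective _ (hy i₀).injective_right]; simp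
          have e3 : (Finset.univ.image (y i₀)).card ≤ (C \ B).card := by
            refine Finset.card_le_card fun z hz => ?_
            obtain ⟨u, -, rfl⟩ := Finset.mem_image.1 hz
            exact Finset.mem_sdiff.2 ⟨hyC u, hyB u⟩
          have e4 := Finset.card_le_card (Finset.sdiff_subset (s := Finset.univ.image (y i)) (t := C))
          omega)
        have h3 := hJ.dl_union_right hf (symbOver ar B C)
          (X := B ∪ (Finset.univ.image (y i) \ C))
          (by rw [Finset.coe_union]; exact Set.union_subset hJ.subset_left hYD)
          Finset.subset_union_left
        rw [show B ∪ (Finset.univ.image (y i) \ C) ∪ C = C ∪ Finset.univ.image (y i) by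
          ext z
          have : z ∈ B → z ∈ C := fun h => hBsub h
          simp only [Finset.mem_union, Finset.mem_sdiff]
          tauto] at h3
        omega
      have := hii p q S hS x r y hxC hxB hallC hy hd
        ⟨i₀, fun t => Finset.mem_sdiff.2 ⟨hyC t, hyB t⟩⟩
      omega
    · push Not at hIII
      -- Now every copy meets `D` while the base is not inside `D`, so the predimension of the base
      -- bounds their number, and `μ` is at least this predimension.
      have h1 := card_le_dl_of_meets hf hDs (fun A hA => (dl_nonneg_iff hf A).1 (h0 A hA)) hS hy hd
        hxD hIII
      obtain ⟨i⟩ : Nonempty (Fin r) := ⟨⟨0, by omega⟩⟩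
      have h2 := ofForm_dl_le_mu hμ hS (hy i) (gval ar Set.univ (Finset.univ.image x))
      omega

end Key

/-! ## Adjoining an extension freely -/

section Adjoin

variable {M : Type u} [(lang ar).Structure M]

/-- The free join of `M` and the extension `S` over the image of the base of `S` under `b`. -/
@[reducible] def adjoin {n l : ℕ} (S : Ext ar n l) (b : Fin n → M) :
    (lang ar).Structure (M ⊕ Fin l) where
  funMap g := Empty.elim g
  RelMap r v := (∃ w, FirstOrder.Language.Structure.RelMap r w ∧ v = Sum.inl ∘ w) ∨
    ∃ w, S.RelMap r w ∧ (∃ j y, w j = Sum.inr y) ∧ v = Sum.map b id ∘ w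

variable {n l : ℕ} {S : Ext ar n l} {b : Fin n → M}

theorem holds_adjoin {s : Symb N} {v : Fin (ar s) → M ⊕ Fin l} :
    @Holds N ar _ (adjoin S b) s v ↔ (∃ w, Holds ar s w ∧ v = Sum.inl ∘ w) ∨
      ∃ w, @Holds N ar _ S s w ∧ (∃ j y, w j = Sum.inr y) ∧ v = Sum.map b id ∘ w := Iff.rfl

theorem elim_inl_comp_eq_map : Sum.elim (Sum.inl ∘ b) Sum.inr = (Sum.map b id : _ → M ⊕ Fin l) := by
  funext x; rcases x with x | x <;> rfl

theorem isEmb_inl_adjoin : @IsEmb N ar _ _ (adjoin S b) _ (Sum.inl : M → M ⊕ Fin l) := by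
  let := adjoin S b
  refine ⟨Sum.inl_injective, fun s v => ?_⟩
  rw [holds_adjoin]
  constructor
  · rintro (⟨w, hw, he⟩ | ⟨w, -, ⟨j, y, hj⟩, he⟩)
    · rwa [Sum.inl_injective.comp_left he]
    · have := congrFun he j
      simp [hj] at this
  · exact fun h => Or.inl ⟨v, h, rfl⟩

theorem eq_inl_comp_of_forall {n' : ℕ} {α β : Type*} {v : Fin n' → α ⊕ β}
    (h : ¬ ∃ j y, v j = Sum.inr y) : ∃ w, v = Sum.inl ∘ w := by
  push Not at h
  have : ∀ j, ∃ i, v j = Sum.inl i := fun j => by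
    rcases hj : v j with i | y
    · exact ⟨i, rfl⟩
    · exact absurd hj (h j y)
  choose w hw using this
  exact ⟨w, funext hw⟩

theorem isEmb_map_adjoin (hb : @IsEmb N ar _ _ _ (baseStr S) b) :
    @IsEmb N ar _ _ (adjoin S b) S (Sum.map b id) := by
  let := adjoin S b
  have hinj : Function.Injective (Sum.map b (id : Fin l → Fin l)) :=
    Sum.map_injective.2 ⟨hb.1, Function.injective_id⟩
  refine ⟨hinj, fun s v => ?_⟩
  rw [holds_adjoin]
  constructor
  · rintro (⟨w, hw, he⟩ | ⟨w, hw, -, he⟩)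
    · obtain ⟨u, rfl⟩ := eq_inl_comp_of_forall (v := v) (by
        rintro ⟨j, y, hj⟩
        have := congrFun he j
        simp [hj] at this)
      obtain rfl : b ∘ u = w := Sum.inl_injective.comp_left he
      exact (hb.2 s u).1 hw
    · rwa [hinj.comp_left he]
  · intro hv
    by_cases hn : ∃ j y, v j = Sum.inr y
    · exact Or.inr ⟨v, hv, hn, rfl⟩
    · obtain ⟨u, rfl⟩ := eq_inl_comp_of_forall hn
      exact Or.inl ⟨b ∘ u, (hb.2 s u).2 hv, rfl⟩

theorem isSymm_adjoin (hM : IsSymm ar M) (hS : @IsSymm N ar _ S) :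
    @IsSymm N ar _ (adjoin S b) := by
  have key : ∀ (s : Symb N) (v : Fin (ar s) → M ⊕ Fin l) (σ : Equiv.Perm (Fin (ar s))),
      @Holds N ar _ (adjoin S b) s v → @Holds N ar _ (adjoin S b) s (v ∘ σ) := by
    intro s v σ h
    rw [holds_adjoin] at h ⊢
    rcases h with (⟨w, hw, rfl⟩ | ⟨w, hw, ⟨j, y, hj⟩, rfl⟩)
    · exact Or.inl ⟨w ∘ σ, (hM s w σ).2 hw, rfl⟩
    · exact Or.inr ⟨w ∘ σ, (hS s w σ).2 hw, ⟨σ.symm j, y, by simpa using hj⟩, rfl⟩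
  refine fun s v σ => ⟨fun h => ?_, key s v σ⟩
  have := key s _ σ.symm h
  rwa [Function.comp_assoc, Equiv.self_comp_symm, Function.comp_id] at this

theorem joinOver_adjoin (b : Fin n → M) :
    letI := adjoin S b
    JoinOver ar (Set.range (Sum.inl : M → M ⊕ Fin l)) (Finset.univ.image (Sum.inl ∘ b))
      (Finset.univ.image (Sum.map b id)) := by
  let := adjoin S b
  refine ⟨?_, ?_, fun s v hv _ => ?_⟩
  · ext x
    rcases x with x | x <;> simp
  · ext x
    rcases x with x | x <;> simp
  · rcases holds_adjoin.1 hv with (⟨w, hw, rfl⟩ | ⟨w, hw, -, rfl⟩)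
    · exact Or.inl fun j => ⟨_, rfl⟩
    · exact Or.inr fun j => by
        simp only [Finset.coe_image, Finset.coe_univ, Set.image_univ]
        exact ⟨w j, rfl⟩

end Adjoin

/-! ## Free joins and `ζ` -/

/-- Preservation is assumed only for finite structures in `Type`; the finite union is re-enumerated
by `Fin n` to come under it. -/
theorem models_union_of_freelyJoined {ζ : (lang ar).Theory} (hζ : ζ.IsUniversal)
    (hζj : PreservedByFreeJoins ζ) {E : Type*} [(lang ar).Structure E] (hE : IsSymm ar E)
    {D₁ D₂ : Set E} (h₁ : D₁.Finite) (h₂ : D₂.Finite) (hf : FreelyJoined ar D₁ D₂)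
    (hz₁ : (subOf ar D₁) ⊨ ζ) (hz₂ : (subOf ar D₂) ⊨ ζ) : (subOf ar (D₁ ∪ D₂)) ⊨ ζ := by
  have hfin : Finite ↥(D₁ ∪ D₂) := (h₁.union h₂).to_subtype
  obtain ⟨n, ⟨e⟩⟩ := Finite.exists_equiv_fin ↥(D₁ ∪ D₂)
  let f : Fin n → E := fun i => e.symm i
  have hinj : Function.Injective f := Subtype.val_injective.comp e.symm.injective
  have hr : Set.range f = D₁ ∪ D₂ := by
    ext x
    constructor
    · rintro ⟨i, rfl⟩; exact (e.symm i).2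
    · exact fun hx => ⟨e ⟨x, hx⟩, by simp [f]⟩
  let := pull ar f
  have hemb : IsEmb ar f := isEmb_pull hinj
  have hsub : ∀ D : Set E, D ⊆ D₁ ∪ D₂ → (subOf ar D) ⊨ ζ → (subOf ar (f ⁻¹' D)) ⊨ ζ := by
    intro D hD hz
    refine (models_subOf_iff hζ (f := f ∘ (Subtype.val : subOf ar (f ⁻¹' D) → Fin n))
      (hemb.comp (isEmb_val _)) ?_).1 hz
    ext x
    constructor
    · rintro ⟨y, rfl⟩
      exact y.2
    · intro hx
      obtain ⟨y, rfl⟩ : x ∈ Set.range f := hr ▸ hD hx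
      exact ⟨⟨y, hx⟩, rfl⟩
  rw [models_subOf_iff hζ hemb hr]
  refine hζj (Fin n) (hemb.isSymm hE) (f ⁻¹' D₁) (f ⁻¹' D₂) ?_ ?_
    (hsub _ Set.subset_union_left hz₁) (hsub _ Set.subset_union_right hz₂)
  · rw [← Set.preimage_union, ← hr, Set.preimage_range]
  · intro s v hv hD
    exact hf s (f ∘ v) ((hemb.2 s v).2 hv) hD

/-! ## Algebraic closedness -/

section AlgClosed

/-- The range of a finite tuple, as a finite set. -/
abbrev rng {E : Type*} {k : ℕ} (f : Fin k → E) : Finset E := Finset.univ.image f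

theorem mem_rng {E : Type*} {k : ℕ} {f : Fin k → E} {z : E} : z ∈ rng f ↔ ∃ t, f t = z := by
  simp

theorem rng_subset {E : Type*} {k : ℕ} {f : Fin k → E} {Z : Set E} :
    ((rng f : Finset E) : Set E) ⊆ Z ↔ ∀ t, f t ∈ Z := by
  simp [Set.range_subset_iff]

theorem mem_coe_union {E : Type*} {A B : Finset E} {x : E} (h : x ∈ A ∨ x ∈ B) :
    x ∈ ((A ∪ B : Finset E) : Set E) := by simpa using h

theorem IsEmb.gval_rng {X E : Type*} [(lang ar).Structure X] [(lang ar).Structure E] {f : X → E}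
    (h : IsEmb ar f) (D : Set X) {k : ℕ} (a : Fin k → X) :
    gval ar (f '' D) (rng (f ∘ a)) = gval ar D (rng a) := by
  rw [← h.gval_image D (rng a)]
  congr 1
  ext; simp

/-- The member `S` of the class, as a one-step algebraic extension of its base. -/
structure IsAlgStep (ζ : (lang ar).Theory) (μ : MuFun ar) {n l : ℕ} (S : Ext ar n l) : Prop where
  symm : @IsSymm N ar _ S
  inClass : @InClass N ar _ S ζ μ Set.univ
  simplyAlg : @SimplyAlg N ar _ S (baseSet n l) (topSet n l)

/-- Every simply algebraic extension in the class of a finite strong subset is realized. -/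
def AlgClosed (ζ : (lang ar).Theory) (μ : MuFun ar) (M : Type*) [(lang ar).Structure M] : Prop :=
  ∀ (n l : ℕ) (S : Ext ar n l), IsAlgStep ζ μ S → ∀ b : Fin n → M,
    @IsEmb N ar _ _ _ (baseStr S) b → Strong ar (Finset.univ.image b) Set.univ →
    ∃ c : Fin l → M, @IsEmb N ar _ _ _ S (Sum.elim b c) ∧
      Strong ar (Finset.univ.image (Sum.elim b c)) Set.univ

theorem image_elim {M : Type*} {n l : ℕ} (b : Fin n → M) (c : Fin l → M) :
    (Finset.univ.image (Sum.elim b c) : Finset M) =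
      Finset.univ.image b ∪ Finset.univ.image c := by
  ext; simp

theorem isEmb_inl_baseStr {n l : ℕ} (S : Ext ar n l) :
    @IsEmb N ar _ _ S (baseStr S) (Sum.inl : Fin n → Fin n ⊕ Fin l) :=
  ⟨Sum.inl_injective, fun _ _ => Iff.rfl⟩

variable {M : Type*} [(lang ar).Structure M] {ζ : (lang ar).Theory} {μ : MuFun ar}

theorem IsAlgStep.finOcc {n l : ℕ} {S : Ext ar n l} (hS : IsAlgStep ζ μ S) :
    @FinOcc N ar _ S := by
  let := S
  exact finOcc_of_nonneg fun A => hS.inClass.2.1 A (Set.subset_univ _)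

/-- The restriction of an extension to a part of its base. -/
@[reducible] def restrictBase {n l k : ℕ} (S : Ext ar n l) (α : Fin k → Fin n) : Ext ar k l :=
  letI := S
  pull ar (Sum.map α id : Fin k ⊕ Fin l → Fin n ⊕ Fin l)

theorem isMSAExt_restrictBase {n l k : ℕ} {S : Ext ar n l} (hS : @IsSymm N ar _ S)
    {α : Fin k → Fin n} (hα : Function.Injective α)
    (hm : @MinSimplyAlg N ar _ S (rng (Sum.inl ∘ α)) (topSet n l)) :
    IsMSAExt (restrictBase S α) := by
  let := S
  let := restrictBase S α
  have hemb : IsEmb ar (Sum.map α id : Fin k ⊕ Fin l → Fin n ⊕ Fin l) :=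
    isEmb_pull (Sum.map_injective.2 ⟨hα, Function.injective_id⟩)
  refine ⟨hemb.isSymm hS, ?_⟩
  rw [← hemb.minSimplyAlg_image]
  convert hm using 1
  · ext x; rcases x with x | x <;> simp
  · ext x; rcases x with x | x <;> simp

theorem ofForm_restrictBase {n l k : ℕ} {S : Ext ar n l} {α : Fin k → Fin n}
    (hα : Function.Injective α) {b : Fin n → M} {c : Fin l → M}
    (h : @IsEmb N ar _ _ _ S (Sum.elim b c)) : OfForm (restrictBase S α) (b ∘ α) c := by
  have he : Sum.elim (b ∘ α) c = Sum.elim b c ∘ Sum.map α id := by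
    rw [Sum.elim_comp_map]; rfl
  refine ⟨?_, fun s v => (h.2 s (Sum.map α id ∘ Sum.inl ∘ v)).symm, fun s v _ hv => ?_⟩
  · rw [he]
    exact h.1.comp (Sum.map_injective.2 ⟨hα, Function.injective_id⟩)
  · rw [he]
    exact (h.2 s (Sum.map α id ∘ v)).2 hv

/-- If there are enough copies of a simply algebraic extension of a finite strong set, then the
extension embeds strongly. -/
theorem exists_emb_of_copies (h0 : ∀ A : Finset M, 0 ≤ delta ar A) {n l k : ℕ} {S : Ext ar n l}
    (hS : IsAlgStep ζ μ S) {b : Fin n → M} (hb : @IsEmb N ar _ _ _ (baseStr S) b)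
    (hbs : Strong ar (Finset.univ.image b) Set.univ) {α : Fin k → Fin n}
    (hα : Function.Injective α)
    (hm : @MinSimplyAlg N ar _ S (rng (Sum.inl ∘ α)) (topSet n l))
    (hc : Copies (restrictBase S α) (b ∘ α) Set.univ
      (μ k l (restrictBase S α) (gval ar Set.univ (Finset.univ.image (b ∘ α))))) :
    ∃ c : Fin l → M, @IsEmb N ar _ _ _ S (Sum.elim b c) ∧
      Strong ar (Finset.univ.image (Sum.elim b c)) Set.univ := by
  let := S
  have hf := finOcc_of_nonneg h0
  have hSf := hS.finOcc
  have hT := isMSAExt_restrictBase hS.symm hα hm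
  have hSA := (simplyAlg_iff hSf).1 hS.simplyAlg
  obtain ⟨y, -, hy, hd⟩ := hc
  have hαb : Finset.univ.image (b ∘ α) ⊆ Finset.univ.image b := fun z hz => by
    obtain ⟨t, -, rfl⟩ := Finset.mem_image.1 hz
    simp
  have hle : ∀ i, dl ar Set.univ (Finset.univ.image b ∪ Finset.univ.image (y i)) ≤
      dl ar Set.univ (Finset.univ.image b) := fun i =>
    (hy i).dl_union_le hf hT (Set.subset_univ _) hαb
  -- If all copies lay inside the base, they would be present in `S` too, and `S` has its own top as
  -- one further copy; this breaks the `μ`-bound of `S`.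
  by_cases hall : ∀ i t, y i t ∈ Finset.univ.image b
  · exfalso
    have : ∀ i t, ∃ u, b u = y i t := fun i t => by simpa using hall i t
    choose η hη using this
    have hη' : ∀ i, y i = b ∘ η i := fun i => funext fun t => (hη i t).symm
    have hform : ∀ i, OfForm (restrictBase S α) ((Sum.inl : Fin n → Fin n ⊕ Fin l) ∘ α)
        (Sum.inl ∘ η i) := fun i => by
      have h1 := hy i
      rw [hη'] at h1
      let := baseStr S
      rw [hb.ofForm_comp] at h1
      exact (isEmb_inl_baseStr S).ofForm_comp.2 h1
    have hcop : Copies (restrictBase S α) ((Sum.inl : Fin n → Fin n ⊕ Fin l) ∘ α) Set.univ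
        (μ k l (restrictBase S α) (gval ar Set.univ (Finset.univ.image (b ∘ α))) + 1) := by
      refine Copies.succ (b := fun i => Sum.inl ∘ η i) (fun _ _ => trivial) hform (fun i j hij => ?_)
        (c := Sum.inr) (fun _ => trivial) ?_ fun i => ?_
      · have := hd i j hij
        rw [hη', hη', Set.range_comp, Set.range_comp, Set.disjoint_image_iff hb.1] at this
        rw [Set.range_comp, Set.range_comp, Set.disjoint_image_iff Sum.inl_injective]
        exact this
      · refine ofForm_restrictBase hα ?_
        rw [Sum.elim_inl_inr]
        exact isEmb_id
      · rw [Set.disjoint_left]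
        rintro _ ⟨u, rfl⟩ ⟨u', hu'⟩
        simp at hu'
    obtain ⟨y', -, hy', hd'⟩ := hcop
    have h1 := hS.inClass.2.2.1 k l (restrictBase S α) hT _ _ y' (fun _ => trivial)
      (fun _ _ => trivial) hy' hd'
    have hbS : StrongIn ar ((baseSet n l : Finset (Fin n ⊕ Fin l)) : Set (Fin n ⊕ Fin l))
        Set.univ := by
      refine (hS.simplyAlg.strong.strongIn hSf).mono ?_ |>.trans (D' := Set.univ)
        (D'' := Set.univ) (fun X _ => by simp [cap]) (Set.subset_univ _)
      intro x _
      simpa using mem_base_or_top x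
    -- The base is strong both in `S` and in `M`, so on either side `g` can be computed inside the
    -- base, where the two agree.
    rw [← gval_eq_of_strongIn hSf hbS (Set.subset_univ _) (rng_subset.2 fun t => by simp),
      ← gval_eq_of_strongIn hf (hbs.strongIn hf) (Set.subset_univ _)
        (by exact_mod_cast hαb)] at h1
    have h2 : gval ar ((baseSet n l : Finset (Fin n ⊕ Fin l)) : Set (Fin n ⊕ Fin l))
        (rng (Sum.inl ∘ α)) =
        gval ar ((Finset.univ.image b : Finset M) : Set M) (Finset.univ.image (b ∘ α)) := by
      let := baseStr S
      have e1 := (isEmb_inl_baseStr S).gval_rng Set.univ α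
      have e2 := hb.gval_rng Set.univ α
      rw [Finset.coe_image, Finset.coe_univ, e2, ← e1]
      congr 1
      ext x; rcases x with x | x <;> simp
    rw [h2] at h1
    omega
  · push Not at hall
    obtain ⟨i, t, ht⟩ := hall
    -- A copy that leaves the strong base cannot meet it, as it would lower the predimension.
    have hout : ∀ t, y i t ∉ Finset.univ.image b := fun t' ht' => by
      have h1 := (hy i).dl_union_lt hf hT (Set.subset_univ _) hαb ⟨t', ht'⟩ ⟨t, ht⟩
      have h2 := ((strong_iff hf).1 hbs).2 _ (Finset.subset_union_left
        (s₂ := Finset.univ.image (y i))) (Set.subset_univ _)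
      omega
    have hinj : Function.Injective (Sum.elim b (y i)) := by
      refine Function.Injective.sumElim hb.1 (hy i).injective_right fun u u' h => ?_
      exact hout u' (by rw [← h]; simp)
    have hpos : ∀ (s : Symb N) (v : Fin (ar s) → Fin n ⊕ Fin l), Holds ar s v →
        (∃ j, v j ∈ topSet n l) → Holds ar s (Sum.elim b (y i) ∘ v) := by
      intro s v hv hj
      -- Relations of the top involve only points of the minimal base, so a copy over the minimal
      -- base respects the relations over the whole base.
      have hin : ∀ j u, v j = Sum.inl u → ∃ w, α w = u := by
        intro j u hju
        have hl : Linked ar (baseSet n l) (topSet n l) (Sum.inl u) := by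
          obtain ⟨j', hj'⟩ := hj
          refine ⟨(s, Finset.univ.val.map v), ⟨trivial, v, hv, fun j => ?_, rfl⟩,
            Multiset.mem_map.2 ⟨j, Finset.mem_univ_val j, hju⟩, v j', hj',
            Multiset.mem_map.2 ⟨j', Finset.mem_univ_val j', rfl⟩⟩
          exact mem_coe_union (mem_base_or_top (v j))
        have := mem_of_linked hSf hSA.2.1 hSA.2.2.1.ge (G := rng (Sum.inl ∘ α))
          (Finset.coe_subset.1 (rng_subset.2 fun t => by simp)) (fun Z hZ hZd => by
            have h1 := dl_union_sub_le hSf Set.univ hZ hZd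
            have h2 := ((simplyAlg_iff hSf).1 hm.1).2.2.1
            omega) (f := Sum.inl u) (by simp) hl
        simpa using this
      have : ∀ j, ∃ w, Sum.map α id w = v j := fun j => by
        rcases hvj : v j with u | u
        · obtain ⟨w, rfl⟩ := hin j u hvj
          exact ⟨Sum.inl w, rfl⟩
        · exact ⟨Sum.inr u, rfl⟩
      choose w hw using this
      obtain rfl : Sum.map α id ∘ w = v := funext hw
      have := (hy i).pos s w hv
      rwa [← Function.comp_assoc, Sum.elim_comp_map]
    refine ⟨y i, ⟨hinj, fun s v => ?_⟩, ?_⟩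
    · by_cases hn : ∃ j w, v j = Sum.inr w
      · have hn' := exists_inr_iff.2 hn
        refine ⟨fun hv => ?_, fun hv => hpos s v hv hn'⟩
        refine hS.simplyAlg.holds_of_dl_le hS.symm hf hSf mem_base_or_top hinj hpos ?_ hv hn'
        rw [image_baseSet, image_topSet]
        exact ((strong_iff hf).1 hbs).2 _ Finset.subset_union_left (Set.subset_univ _)
      · obtain ⟨w, rfl⟩ := eq_inl_comp_of_forall hn
        exact hb.2 s w
    · rw [image_elim]
      exact strong_of_dl_eq hf hbs Finset.subset_union_left (Set.subset_univ _) (hle i)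

end AlgClosed

/-! ## Realizing copies in algebraically closed structures -/

section Realize

variable {M E : Type*} [(lang ar).Structure M] [(lang ar).Structure E]
  {ζ : (lang ar).Theory} {μ : MuFun ar}

theorem exists_image_eq {i : M → E} {A : Finset E} (h : (A : Set E) ⊆ Set.range i) :
    ∃ A' : Finset M, A'.image i = A := by
  have h1 : (A : Set E) ⊆ i '' Set.univ := by rwa [Set.image_univ]
  obtain ⟨A', -, h'⟩ := Finset.subset_set_image_iff.1 h1
  exact ⟨A', h'⟩

theorem exists_enum (A : Finset M) : ∃ (n : ℕ) (b : Fin n → M), Function.Injective b ∧ rng b = A :=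
  ⟨A.card, fun t => A.equivFin.symm t, Subtype.val_injective.comp A.equivFin.symm.injective, by
    ext x
    rw [mem_rng]
    exact ⟨by rintro ⟨t, rfl⟩; exact (A.equivFin.symm t).2,
      fun hx => ⟨A.equivFin ⟨x, hx⟩, by simp⟩⟩⟩

variable {D : Set E} {B C : Finset E}

theorem JoinOver.extend (hJ : JoinOver ar D B C) {P : Finset E} (hP : (P : Set E) ⊆ D)
    (hBP : B ⊆ P) : JoinOver ar D P (P ∪ C) := by
  refine ⟨?_, ?_, fun s v hv _ => ?_⟩
  · ext x
    have h1 := hJ.mem_iff (x := x)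
    have h2 := @hBP x
    have h3 := @hP x
    simp only [Finset.coe_union, Set.mem_inter_iff, Set.mem_union, Finset.mem_coe] at *
    tauto
  · refine Set.eq_univ_of_forall fun x => ?_
    have := hJ.mem_or x
    simp only [Finset.coe_union, Set.mem_union, Finset.mem_coe] at *
    tauto
  · refine (hJ.holds hv).imp_right fun h j => ?_
    have := h j
    simp only [Finset.coe_union, Set.mem_union, Finset.mem_coe]
    exact Or.inr this

theorem JoinOver.sdiff_eq (hJ : JoinOver ar D B C) {P : Finset E} (hP : (P : Set E) ⊆ D)
    (hBP : B ⊆ P) : (P ∪ C) \ P = C \ B := by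
  ext x
  have h1 := hJ.mem_iff (x := x)
  have h2 := @hBP x
  have h3 := @hP x
  simp only [Finset.mem_sdiff, Finset.mem_union, Finset.mem_coe] at *
  tauto

theorem JoinOver.simplyAlg (hJ : JoinOver ar D B C) (hf : FinOcc ar E)
    (h : SimplyAlg ar B (C \ B)) {P : Finset E} (hP : (P : Set E) ⊆ D) (hBP : B ⊆ P) :
    SimplyAlg ar P (C \ B) := by
  rw [simplyAlg_iff hf] at h ⊢
  have key : ∀ T ⊆ C \ B, dl ar Set.univ (P ∪ T) + dl ar Set.univ B =
      dl ar Set.univ P + dl ar Set.univ (B ∪ T) := fun T hT => by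
    have := hJ.dl_eq hf Set.univ (P ∪ T)
    have e1 : cap (P ∪ T) (B : Set E) = B := by
      ext x; have := @hBP x; simp only [mem_cap, Finset.mem_union, Finset.mem_coe]; tauto
    have e2 : cap (P ∪ T) D = P := by
      ext x
      have h1 := hJ.mem_iff (x := x)
      have h3 := @hP x
      have h4 := @hT x
      simp only [mem_cap, Finset.mem_union, Finset.mem_coe, Finset.mem_sdiff] at *
      tauto
    have e3 : cap (P ∪ T) (C : Set E) = B ∪ T := by
      ext x
      have h1 := hJ.mem_iff (x := x)
      have h2 := @hBP x
      have h3 := @hP x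
      have h4 := @hT x
      simp only [mem_cap, Finset.mem_union, Finset.mem_coe, Finset.mem_sdiff] at *
      tauto
    rwa [e1, e2, e3] at this
  refine ⟨h.1, ?_, ?_, fun T hT hT1 hT2 => ?_⟩
  · rw [Finset.disjoint_left]
    intro x hx hx'
    have h1 := hJ.mem_iff (x := x)
    have h3 := @hP x hx
    simp only [Finset.mem_sdiff] at hx'
    tauto
  · have := key _ subset_rfl
    have := h.2.2.1
    omega
  · have := key T hT
    have := h.2.2.2 T hT hT1 hT2
    omega

theorem freelyJoined_mono {D₁ D₂ P : Set E} (hf : FreelyJoined ar D₁ D₂) (hP : P ⊆ D₁)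
    (h : D₁ ∩ D₂ ⊆ P) : FreelyJoined ar P D₂ := fun s v hv hj => by
  rcases hf s v hv fun j => (hj j).imp_left (@hP _) with h1 | h1
  · exact Or.inl fun j => (hj j).elim id fun h2 => h ⟨h1 j, h2⟩
  · exact Or.inr h1

theorem muBound_mono_emb {i : M → E} (hi : IsEmb ar i) :
    MuBound μ (Set.range i) ↔ MuBound μ (Set.univ : Set M) := by
  rw [← Set.image_univ, hi.muBound_image]

theorem delta_nonneg_range {i : M → E} (hi : IsEmb ar i) (h0 : ∀ A : Finset M, 0 ≤ delta ar A)
    (A : Finset E) (hA : (A : Set E) ⊆ Set.range i) : 0 ≤ delta ar A := by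
  obtain ⟨A', rfl⟩ := exists_image_eq hA
  rw [hi.delta_image]
  exact h0 _

/-- If a free join with a simply algebraic extension satisfies the `μ`-bound, then an
algebraically closed structure contains arbitrarily many copies of the extension. -/
theorem copies_of_muBound (hζ : ζ.IsUniversal) (hζj : PreservedByFreeJoins ζ)
    {i : M → E} (hi : IsEmb ar i) (hE : IsSymm ar E) (hM : AlgClosed ζ μ M)
    (h0 : ∀ A : Finset M, 0 ≤ delta ar A) (hMζ : M ⊨ ζ) (hf : FinOcc ar E)
    (hJ : JoinOver ar (Set.range i) B C) (hBC : SimplyAlg ar B (C \ B))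
    (hCζ : (subOf ar (C : Set E)) ⊨ ζ) {k l : ℕ} {a : Fin k → E} {c : Fin l → E}
    (ha : Function.Injective a) (hc : Function.Injective c) (haB : ∀ t, a t ∈ B)
    (hcC : Finset.univ.image c = C \ B) (hE' : MuBound μ (Set.univ : Set E)) (r : ℕ) :
    Copies (pull ar (Sum.elim a c)) a (Set.range i) r := by
  have h0r := delta_nonneg_range hi h0
  have hBs : Strong ar B (C : Set E) := by
    have := hBC.strong
    rwa [Finset.union_sdiff_of_subset hJ.subset] at this
  have h0E := hJ.delta_nonneg hf hBs h0r
  induction r with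
  | zero => exact ⟨fun t => t.elim0, fun t => t.elim0, fun t => t.elim0, fun t => t.elim0⟩
  | succ r ih =>
    obtain ⟨y, hy1, hy2, hy3⟩ := ih
    -- The next copy is realized over a strong set of `M` that contains the base and all earlier
    -- copies, which makes it disjoint from them.
    obtain ⟨P, hBP, hP⟩ := exists_strong_superset h0E
      (A := B ∪ Finset.univ.biUnion fun t => rng (y t)) (D := Set.range i) (by
        intro x hx
        rw [Finset.mem_coe, Finset.mem_union] at hx
        rcases hx with hx | hx
        · exact hJ.subset_left hx
        · obtain ⟨t, -, ht⟩ := Finset.mem_biUnion.1 hx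
          exact rng_subset.2 (hy1 t) ht)
    have hyP : ∀ t u, y t u ∈ P := fun t u => hBP (Finset.mem_union_right _
      (Finset.mem_biUnion.2 ⟨t, Finset.mem_univ t, mem_rng.2 ⟨u, rfl⟩⟩))
    replace hBP := Finset.union_subset_left hBP
    obtain ⟨P', hP'⟩ := exists_image_eq hP.1
    obtain ⟨n, b, hb, rfl⟩ := exists_enum P'
    have hPb : rng (i ∘ b) = P := by rw [← hP']; ext; simp
    have hPC := hJ.sdiff_eq hP.1 hBP
    have hdis : ∀ t u, i (b t) ≠ c u := fun t u h => by
      have h1 : c u ∈ C \ B := hcC ▸ mem_rng.2 ⟨u, rfl⟩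
      rw [← hPC, ← hPb, Finset.mem_sdiff] at h1
      exact h1.2 (mem_rng.2 ⟨t, h⟩)
    have hinj : Function.Injective (Sum.elim (i ∘ b) c) :=
      (hi.1.comp hb).sumElim hc hdis
    have heS := isEmb_pull (ar := ar) hinj
    set S : Ext ar n l := pull ar (Sum.elim (i ∘ b) c) with hS
    have hbemb : @IsEmb N ar _ _ _ (baseStr S) b :=
      ⟨hb, fun s v => (hi.2 s (b ∘ v)).symm⟩
    have hrange : Sum.elim (i ∘ b) c '' Set.univ = ((P ∪ C : Finset E) : Set E) := by
      rw [Set.image_univ, Set.Sum.elim_range]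
      have e1 : Set.range (i ∘ b) = (P : Set E) := by rw [← hPb]; ext; simp
      have e2 : Set.range c = ((C \ B : Finset E) : Set E) := by rw [← hcC]; simp
      rw [e1, e2, ← hPC, ← Finset.coe_union, Finset.union_sdiff_of_subset
        Finset.subset_union_left]
    have hPCs := (hJ.extend hP.1 hBP).strongIn_right hf hP
    have hbase : (baseSet n l).image (Sum.elim (i ∘ b) c) = P := by
      rw [image_baseSet]; exact hPb
    have htop : (topSet n l).image (Sum.elim (i ∘ b) c) = C \ B := by
      rw [image_topSet]; exact hcC
    -- `P ∪ C` is strong in the free join because `P` is strong in `M`, so it inherits the `μ`-bound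
    -- of `E`. It satisfies `ζ` as the free join of `P` and `C`.
    have hstep : IsAlgStep ζ μ S := by
      let := S
      refine ⟨heS.isSymm hE, ?_, ?_⟩
      · rw [← heS.inClass_image hζ, hrange]
        refine ⟨Finset.finite_toSet _, fun A _ => h0E A,
          muBound_of_strongIn hf hPCs (Set.subset_univ _) hE', ?_⟩
        rw [Finset.coe_union]
        refine models_union_of_freelyJoined hζ hζj hE (Finset.finite_toSet _)
          (Finset.finite_toSet _) (freelyJoined_mono hJ.free hP.1 ?_) ?_ hCζ
        · rw [← hJ.inter]; exact_mod_cast hBP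
        · rw [models_subOf_iff hζ (hi.comp (isEmb_val (subOf ar (rng b : Set M))))]
          · exact models_subOf hζ _ hMζ
          · rw [← hPb]
            ext x
            simp only [Set.mem_range, Function.comp, Finset.mem_coe, mem_rng]
            constructor
            · rintro ⟨⟨z, hz⟩, rfl⟩
              obtain ⟨t, rfl⟩ := mem_rng.1 hz
              exact ⟨t, rfl⟩
            · rintro ⟨t, rfl⟩
              exact ⟨⟨b t, mem_rng.2 ⟨t, rfl⟩⟩, rfl⟩
      · rw [← heS.simplyAlg_image, hbase, htop]
        exact hJ.simplyAlg hf hBC hP.1 hBP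
    have hPs : Strong ar (rng b) Set.univ := by
      rw [← hi.strong_image, Set.image_univ, hP']
      exact hP
    obtain ⟨d, hd, -⟩ := hM n l S hstep b hbemb hPs
    have haα : ∀ t, ∃ u, i (b u) = a t := fun t => by
      have := hBP (haB t)
      rw [← hPb] at this
      exact mem_rng.1 this
    choose α hα using haα
    have hα' : (i ∘ b) ∘ α = a := funext hα
    have hαinj : Function.Injective α := fun t t' h => ha (by rw [← hα t, ← hα t', h])
    have hd' : @IsEmb N ar _ _ _ S (Sum.elim (i ∘ b) (i ∘ d)) := by
      let := S
      rw [← Sum.comp_elim]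
      exact hi.comp hd
    have hform := ofForm_restrictBase hαinj hd'
    have hres : restrictBase S α = pull ar (Sum.elim a c) := by
      refine structure_ext fun s v => ?_
      change Holds ar s (Sum.elim (i ∘ b) c ∘ Sum.map α id ∘ v) ↔ Holds ar s (Sum.elim a c ∘ v)
      rw [← Function.comp_assoc, Sum.elim_comp_map, hα', Function.comp_id]
    rw [hα', hres] at hform
    refine Copies.succ hy1 hy2 hy3 (c := i ∘ d) (fun t => ⟨d t, rfl⟩) hform fun t => ?_
    rw [Set.disjoint_left]
    rintro _ ⟨u, rfl⟩ ⟨u', hu'⟩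
    have := hyP t u'
    rw [hu', ← hPb] at this
    obtain ⟨w, hw⟩ := mem_rng.1 this
    exact absurd (hd.1 (a₁ := Sum.inl w) (a₂ := Sum.inr u) (hi.1 hw)) (by simp)

end Realize

/-! ## The existence axioms and algebraic closedness -/

section AxiomThree

/-- The range of a map on a finite type, as a finite set. -/
abbrev img {X E : Type*} [Fintype X] (f : X → E) : Finset E := Finset.univ.image f

variable {ζ : (lang ar).Theory} {μ : MuFun ar}

/-- A free join over a base that is strong enough has the `μ`-bound, unless the copies that it
could contradict exist already. -/
theorem copies_of_algClosed (hζ : ζ.IsUniversal) (hζj : PreservedByFreeJoins ζ) (hμ : IsMu μ)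
    {M E : Type*} [(lang ar).Structure M] [(lang ar).Structure E]
    {i : M → E} (hi : IsEmb ar i) (hE : IsSymm ar E) (hM : AlgClosed ζ μ M)
    (h0 : ∀ A : Finset M, 0 ≤ delta ar A) (hMb : MuBound μ (Set.univ : Set M)) (hMζ : M ⊨ ζ)
    (hf : FinOcc ar E) {B C : Finset E}
    (hJ : JoinOver ar (Set.range i) B C) (hBC : SimplyAlg ar B (C \ B))
    (hCζ : (subOf ar (C : Set E)) ⊨ ζ) {k l : ℕ} {a : Fin k → E} {c : Fin l → E}
    (ha : Function.Injective a) (hc : Function.Injective c) (haB : ∀ t, a t ∈ B)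
    (hcC : Finset.univ.image c = C \ B) (hm : MinSimplyAlg ar (Finset.univ.image a) (C \ B))
    (hY : ∀ Y : Finset E, (Y : Set E) ⊆ Set.range i → Y.card ≤ (C \ B).card →
      dl ar (symbOver ar B C) B ≤ dl ar (symbOver ar B C) (B ∪ Y))
    (hii : ∀ (p q : ℕ) (S : Ext ar p q), IsMSAExt S → ∀ (x : Fin p → E) (r : ℕ)
      (y : Fin r → Fin q → E), (∀ t, x t ∈ C) → (∃ t, x t ∉ B) → (∀ i t, y i t ∈ C) →
      (∀ i, OfForm S x (y i)) → (∀ i j, i ≠ j → Disjoint (Set.range (y i)) (Set.range (y j))) →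
      (∃ i, ∀ t, y i t ∈ C \ B) → r ≤ μ p q S (gval ar Set.univ (Finset.univ.image x))) :
    Copies (pull ar (Sum.elim a c)) a (Set.range i)
      (μ k l (pull ar (Sum.elim a c)) (gval ar (Set.range i) (Finset.univ.image a))) := by
  rcases muBound_or_copies hf (delta_nonneg_range hi h0) hJ hBC hμ ((muBound_mono_emb hi).2 hMb)
    ha hc haB hcC hm hY hii with h | h
  · exact copies_of_muBound hζ hζj hi hE hM h0 hMζ hf hJ hBC hCζ ha hc haB hcC h _
  · exact h

theorem finOcc_of_joinOver {M E : Type*} [(lang ar).Structure M] [(lang ar).Structure E]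
    {i : M → E} (hi : IsEmb ar i) (h0 : ∀ A : Finset M, 0 ≤ delta ar A) {B C : Finset E}
    (hJ : JoinOver ar (Set.range i) B C) (hC : ∀ A : Finset E, A ⊆ C → 0 ≤ delta ar A) :
    FinOcc ar E := by
  refine hJ.finOcc (fun A hA => finite_of_delta_ne_bot ?_) (finite_of_delta_ne_bot ?_)
  · have := delta_nonneg_range hi h0 A hA
    intro h
    rw [h] at this
    exact absurd this (by simp)
  · have := hC C subset_rfl
    intro h
    rw [h] at this
    exact absurd this (by simp)

/-- By the last proviso of the axiom the `μ`-values of patterns in `C` are the same in `C` and in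
the free join, so the bound that the dichotomy asks for inside `C` is the `μ`-bound of `C`. -/
theorem axiomThree_of_algClosed (hζ : ζ.IsUniversal) (hζj : PreservedByFreeJoins ζ) (hμ : IsMu μ)
    {M : Type u} [(lang ar).Structure M] (hM : AlgClosed ζ μ M) (h2 : AxiomTwo ζ μ M) :
    AxiomThree ζ μ M := by
  intro E _ i B C k l a c hE hBi hU hfr hBs hC hBC ha hc haB hcC hm hY hg
  have hJ : JoinOver ar (Set.range i) B C := ⟨hBi, hU, hfr⟩
  have hf := finOcc_of_joinOver i.isEmb h2.2.1 hJ fun A hA => hC.2.1 A (by exact_mod_cast hA)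
  refine copies_of_algClosed hζ hζj hμ i.isEmb hE hM h2.2.1 h2.2.2 h2.1 hf hJ hBC hC.2.2.2 ha hc
    haB hcC hm (fun Y hY1 hY2 => ?_) ?_
  · by_contra hn
    refine hY ⟨Y, hY1, hY2, ?_⟩
    rw [deltaIn_eq hf, deltaIn_eq hf]
    exact_mod_cast not_le.1 hn
  · rintro p q S hS x r y hx - hy hyf hyd ⟨j, -⟩
    rw [← hg p q S hS x (y j) hx (hy j) (hyf j)]
    exact hC.2.2.1 p q S hS x r y hx hy hyf hyd

/-- The free join of `M` with a one-step algebraic extension of a finite strong subset. -/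
structure AdjoinFacts (ζ : (lang ar).Theory) (μ : MuFun ar) {M : Type*} [(lang ar).Structure M]
    {n l : ℕ} (S : Ext ar n l) (b : Fin n → M) {E : Type*} [(lang ar).Structure E]
    (i : M → E) (e : Fin n ⊕ Fin l → E) : Prop where
  symm : IsSymm ar E
  finOcc : FinOcc ar E
  nonneg : ∀ A : Finset E, 0 ≤ delta ar A
  emb_left : IsEmb ar i
  emb_right : @IsEmb N ar _ _ _ S e
  joinOver : JoinOver ar (Set.range i) (rng (i ∘ b)) (img e)
  strong_left : StrongIn ar (Set.range i) Set.univ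
  strong_right : StrongIn ar ((img e : Finset E) : Set E) Set.univ
  sdiff : (img e) \ (rng (i ∘ b)) = rng (e ∘ Sum.inr)
  inl_eq : e ∘ Sum.inl = i ∘ b
  strong_base : Strong ar (rng (i ∘ b)) ((img e : Finset E) : Set E)
  simplyAlg : SimplyAlg ar (rng (i ∘ b)) ((img e) \ (rng (i ∘ b)))
  inClass : InClass ζ μ ((img e : Finset E) : Set E)

theorem adjoinFacts_of_joinOver (hζ : ζ.IsUniversal) {M E : Type*} [(lang ar).Structure M]
    [(lang ar).Structure E] (hE : IsSymm ar E)
    (h0 : ∀ A : Finset M, 0 ≤ delta ar A) {n l : ℕ} {S : Ext ar n l} (hS : IsAlgStep ζ μ S)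
    {b : Fin n → M} (hbs : Strong ar (rng b) Set.univ) {i : M → E} {e : Fin n ⊕ Fin l → E}
    (hl : IsEmb ar i) (hr : @IsEmb N ar _ _ _ S e)
    (hJ : JoinOver ar (Set.range i) (rng (i ∘ b)) (img e)) (he : e ∘ Sum.inl = i ∘ b) :
    AdjoinFacts ζ μ S b i e := by
  let := S
  have hbase : (baseSet n l).image e = rng (i ∘ b) := by
    rw [← he]; ext; simp
  have htop : (topSet n l).image e = rng (e ∘ Sum.inr) := by
    ext; simp
  have hsd : (img e) \ (rng (i ∘ b)) = rng (e ∘ Sum.inr) := by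
    rw [← he]
    ext x
    simp only [Finset.mem_sdiff, Finset.mem_image, Finset.mem_univ, true_and, Sum.exists,
      Function.comp]
    constructor
    · rintro ⟨h | h, h'⟩
      · exact absurd h h'
      · exact h
    · rintro ⟨t, rfl⟩
      refine ⟨Or.inr ⟨t, rfl⟩, ?_⟩
      rintro ⟨u, hu⟩
      exact absurd (hr.1 hu) (by simp)
  have hBC : SimplyAlg ar (rng (i ∘ b)) ((img e) \ (rng (i ∘ b))) := by
    rw [hsd, ← hbase, ← htop, hr.simplyAlg_image]
    exact hS.simplyAlg
  have hBs : Strong ar (rng (i ∘ b)) ((img e : Finset E) : Set E) := by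
    have := hBC.strong
    rwa [Finset.union_sdiff_of_subset hJ.subset] at this
  have hC : InClass ζ μ ((img e : Finset E) : Set E) := by
    rw [Finset.coe_image, hr.inClass_image hζ]
    convert hS.inClass
    simp
  have hf := finOcc_of_joinOver hl h0 hJ fun A hA => hC.2.1 A (by exact_mod_cast hA)
  have hbs' : Strong ar (rng (i ∘ b)) (Set.range i) := by
    have := hl.strong_image.2 hbs
    rw [Set.image_univ] at this
    convert this using 1
    ext; simp
  exact
    { symm := hE
      finOcc := hf
      nonneg := hJ.delta_nonneg hf hBs (delta_nonneg_range hl h0)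
      emb_left := hl
      emb_right := hr
      joinOver := hJ
      strong_left := hJ.strongIn_left hf hBs
      strong_right := hJ.strongIn_right hf hbs'
      sdiff := hsd
      inl_eq := he
      strong_base := hBs
      simplyAlg := hBC
      inClass := hC }

theorem adjoinFacts (hζ : ζ.IsUniversal) {M : Type u} [(lang ar).Structure M] (hM : IsSymm ar M)
    (h0 : ∀ A : Finset M, 0 ≤ delta ar A) {n l : ℕ} {S : Ext ar n l} (hS : IsAlgStep ζ μ S)
    {b : Fin n → M} (hb : @IsEmb N ar _ _ _ (baseStr S) b) (hbs : Strong ar (rng b) Set.univ) :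
    letI := adjoin S b
    AdjoinFacts ζ μ S b (Sum.inl : M → M ⊕ Fin l) (Sum.map b id) := by
  let := adjoin S b
  refine adjoinFacts_of_joinOver hζ (isSymm_adjoin hM hS.symm) h0 hS hbs isEmb_inl_adjoin
    (isEmb_map_adjoin hb) ?_ rfl
  convert joinOver_adjoin b

/-- The base of a one-step extension contains a minimal base. -/
theorem IsAlgStep.exists_minimal {n l : ℕ} {S : Ext ar n l} (hS : IsAlgStep ζ μ S) :
    ∃ (k : ℕ) (α : Fin k → Fin n), Function.Injective α ∧
      @MinSimplyAlg N ar _ S (rng (Sum.inl ∘ α)) (topSet n l) := by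
  let := S
  obtain ⟨F, hF, hm⟩ := exists_minSimplyAlg hS.simplyAlg
  obtain ⟨k, f, hf, rfl⟩ := exists_enum F
  have : ∀ t, ∃ u, Sum.inl u = f t := fun t => by
    have := hF (mem_rng.2 ⟨t, rfl⟩)
    simpa using this
  choose α hα using this
  obtain rfl : Sum.inl ∘ α = f := funext hα
  exact ⟨k, α, hf.of_comp, hm⟩

section

variable {M E : Type*} [(lang ar).Structure M] [(lang ar).Structure E]
  {n l : ℕ} {S : Ext ar n l} {b : Fin n → M} {i : M → E} {e : Fin n ⊕ Fin l → E}

theorem AdjoinFacts.pull_eq (h : AdjoinFacts ζ μ S b i e) {k : ℕ} (α : Fin k → Fin n) :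
    pull ar (Sum.elim (i ∘ b ∘ α) (e ∘ Sum.inr)) = restrictBase S α := by
  refine structure_ext fun s v => ?_
  let := S
  change Holds ar s (Sum.elim (i ∘ b ∘ α) (e ∘ Sum.inr) ∘ v) ↔ Holds ar s (Sum.map α id ∘ v)
  rw [← h.emb_right.2, ← Function.comp_assoc, ← Function.comp_assoc, ← h.inl_eq]
  have : Sum.elim ((e ∘ Sum.inl) ∘ α) (e ∘ Sum.inr) = e ∘ Sum.map α id := by
    funext x; rcases x with x | x <;> rfl
  rw [this]

theorem AdjoinFacts.minSimplyAlg (h : AdjoinFacts ζ μ S b i e) {k : ℕ} {α : Fin k → Fin n}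
    (hm : @MinSimplyAlg N ar _ S (rng (Sum.inl ∘ α)) (topSet n l)) :
    MinSimplyAlg ar (rng (i ∘ b ∘ α)) ((img e) \ (rng (i ∘ b))) := by
  let := S
  rw [h.sdiff]
  convert h.emb_right.minSimplyAlg_image.2 hm using 1
  · rw [← Function.comp_assoc, ← h.inl_eq]; ext; simp
  · ext; simp

theorem AdjoinFacts.dl_le (h : AdjoinFacts ζ μ S b i e)
    (hbs : Strong ar (rng b) Set.univ) (h0 : ∀ A : Finset M, 0 ≤ delta ar A)
    (K : Set (Symb N)) (Y : Finset E) (hY : (Y : Set E) ⊆ Set.range i) :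
    dl ar K (rng (i ∘ b)) ≤ dl ar K (rng (i ∘ b) ∪ Y) := by
  obtain ⟨Y', rfl⟩ := exists_image_eq hY
  have h1 := (hbs.strongIn (finOcc_of_nonneg h0)).dl_le (finOcc_of_nonneg h0) K
    (X := rng b ∪ Y') (Set.subset_univ _)
  have h2 : cap (rng b ∪ Y') ((rng b : Finset M) : Set M) = rng b := by
    ext x; simp only [mem_cap, Finset.mem_union, Finset.mem_coe]; tauto
  rw [h2, ← h.emb_left.dl_image, ← h.emb_left.dl_image, Finset.image_union] at h1
  have h3 : (rng b).image i = rng (i ∘ b) := by ext; simp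
  rwa [h3] at h1

theorem AdjoinFacts.copies_left (h : AdjoinFacts ζ μ S b i e) {k : ℕ} {T : Ext ar k l}
    {a : Fin k → M} {r : ℕ} (hc : Copies T (i ∘ a) (Set.range i) r) :
    Copies T a Set.univ r := by
  obtain ⟨y, hy1, hy2, hy3⟩ := hc
  choose z hz using hy1
  have hz' : ∀ t, y t = i ∘ z t := fun t => funext fun u => (hz t u).symm
  refine ⟨z, fun _ _ => trivial, fun t => ?_, fun t t' ht => ?_⟩
  · have := hy2 t
    rwa [hz', h.emb_left.ofForm_comp] at this
  · have := hy3 t t' ht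
    rwa [hz', hz', Set.range_comp, Set.range_comp, Set.disjoint_image_iff h.emb_left.1] at this

/-- Either the extension is realized, or the free join has the `μ`-bound. -/
theorem AdjoinFacts.exists_emb_or_muBound (h : AdjoinFacts ζ μ S b i e) (hμ : IsMu μ)
    (h0 : ∀ A : Finset M, 0 ≤ delta ar A) (hMb : MuBound μ (Set.univ : Set M))
    (hS : IsAlgStep ζ μ S) (hb : @IsEmb N ar _ _ _ (baseStr S) b)
    (hbs : Strong ar (rng b) Set.univ) :
    (∃ c : Fin l → M, @IsEmb N ar _ _ _ S (Sum.elim b c) ∧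
      Strong ar (Finset.univ.image (Sum.elim b c)) Set.univ) ∨ MuBound μ (Set.univ : Set E) := by
  obtain ⟨k, α, hα, hm⟩ := hS.exists_minimal
  rcases muBound_or_copies h.finOcc (delta_nonneg_range h.emb_left h0) h.joinOver h.simplyAlg hμ
    ((muBound_mono_emb h.emb_left).2 hMb) (a := i ∘ b ∘ α) (c := e ∘ Sum.inr)
    (h.emb_left.1.comp (hb.1.comp hα)) (h.emb_right.1.comp Sum.inr_injective)
    (fun t => mem_rng.2 ⟨α t, rfl⟩) h.sdiff.symm (h.minSimplyAlg hm)
    (fun Y hY _ => h.dl_le hbs h0 _ Y hY) (by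
      intro p q S' hS' x r y hx _ hy hyf hyd _
      rw [← gval_eq_of_strongIn h.finOcc h.strong_right (Set.subset_univ _) (rng_subset.2 hx)]
      exact h.inClass.2.2.1 p q S' hS' x r y hx hy hyf hyd) with h1 | h1
  · exact Or.inr h1
  · left
    rw [h.pull_eq] at h1
    have h2 := h.emb_left.gval_rng Set.univ (b ∘ α)
    rw [Set.image_univ] at h2
    rw [h2] at h1
    exact exists_emb_of_copies h0 hS hb hbs hα hm (h.copies_left h1)

end

/-- Over a strong base both provisos of the axiom come for free: no set lowers the predimension of
the base in any sublanguage, and `C` is strong in the free join, so no value of `g` changes. -/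
theorem AdjoinFacts.copies_of_axiomThree {M E : Type u} [(lang ar).Structure M]
    [(lang ar).Structure E] {n l : ℕ} {S : Ext ar n l} {b : Fin n → M} {i : M → E}
    {e : Fin n ⊕ Fin l → E} (h : AdjoinFacts ζ μ S b i e) (h0 : ∀ A : Finset M, 0 ≤ delta ar A)
    (h3 : AxiomThree ζ μ M) (hb : Function.Injective b) (hbs : Strong ar (rng b) Set.univ)
    {k : ℕ} {α : Fin k → Fin n} (hα : Function.Injective α)
    (hm : @MinSimplyAlg N ar _ S (rng (Sum.inl ∘ α)) (topSet n l)) :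
    Copies (restrictBase S α) (b ∘ α) Set.univ
      (μ k l (restrictBase S α) (gval ar Set.univ (Finset.univ.image (b ∘ α)))) := by
  have h3' := h3 E h.emb_left.toEmbedding
  rw [IsEmb.coe_toEmbedding] at h3'
  have h1 : Copies _ (i ∘ b ∘ α) (Set.range i) _ := h3' (rng (i ∘ b)) (img e)
    k l (i ∘ b ∘ α) (e ∘ Sum.inr) h.symm h.joinOver.inter h.joinOver.union
    h.joinOver.free h.strong_base h.inClass h.simplyAlg
    (h.emb_left.1.comp (hb.comp hα)) (h.emb_right.1.comp Sum.inr_injective)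
    (fun t => mem_rng.2 ⟨α t, rfl⟩) h.sdiff.symm (h.minSimplyAlg hm) (by
      rintro ⟨Y, hY, -, hlt⟩
      rw [deltaIn_eq h.finOcc, deltaIn_eq h.finOcc] at hlt
      have h4 := h.dl_le hbs h0 (symbOver ar (rng (i ∘ b)) (img e)) Y hY
      exact absurd hlt (not_lt.2 (by exact_mod_cast h4))) (by
      intro p q S' _ x y hx _ _
      rw [gval_eq_of_strongIn h.finOcc h.strong_right (Set.subset_univ _) (rng_subset.2 hx)])
  rw [h.pull_eq] at h1
  have h4 := h.emb_left.gval_rng Set.univ (b ∘ α)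
  rw [Set.image_univ] at h4
  rw [h4] at h1
  exact h.copies_left h1

/-- The axiom, applied to the free join, gives `μ` many copies in `M`; by `exists_emb_of_copies`
this many copies force a strong realization. -/
theorem algClosed_of_axiomThree (hζ : ζ.IsUniversal)
    {M : Type u} [(lang ar).Structure M] (hsy : IsSymm ar M) (h2 : AxiomTwo ζ μ M)
    (h3 : AxiomThree ζ μ M) : AlgClosed ζ μ M := by
  intro n l S hS b hb hbs
  obtain ⟨k, α, hα, hm⟩ := hS.exists_minimal
  let := adjoin S b
  exact exists_emb_of_copies h2.2.1 hS hb hbs hα hm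
    ((adjoinFacts hζ hsy h2.2.1 hS hb hbs).copies_of_axiomThree h2.2.1 h3 hb.1 hbs hα hm)

end AxiomThree

/-! ## Transcendental points and richness -/

section Rich

variable {ζ : (lang ar).Theory} {μ : MuFun ar}

variable (ar) in
/-- Over every finite strong subset there is a point that is free from it. -/
def TransClosed (M : Type*) [(lang ar).Structure M] : Prop :=
  ∀ B : Finset M, Strong ar B Set.univ → ∃ x ∉ B, Strong ar (insert x B) Set.univ ∧
    dl ar Set.univ (insert x B) = dl ar Set.univ B + 1

variable {M C : Type*} [(lang ar).Structure M] [(lang ar).Structure C]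

theorem rng_elim_finSum {X : Type*} {n l : ℕ} (u : Fin n → X) (w : Fin l → X) :
    rng (Sum.elim u w ∘ finSumFinEquiv.symm) = rng u ∪ rng w := by
  ext z
  rw [Finset.mem_union, mem_rng, mem_rng, mem_rng]
  constructor
  · rintro ⟨t, ht⟩
    rcases hx : finSumFinEquiv.symm t with i | i
    · rw [Function.comp_apply, hx] at ht; exact Or.inl ⟨i, ht⟩
    · rw [Function.comp_apply, hx] at ht; exact Or.inr ⟨i, ht⟩
  · rintro (⟨i, hi⟩ | ⟨i, hi⟩)
    · exact ⟨finSumFinEquiv (Sum.inl i), by simpa using hi⟩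
    · exact ⟨finSumFinEquiv (Sum.inr i), by simpa using hi⟩

theorem union_rng_const {X : Type*} (Z : Finset X) (z : X) :
    Z ∪ rng (fun _ : Fin 1 => z) = insert z Z := by
  ext; simp [or_comm, eq_comm]

theorem inClass_of_strongIn (hζ : ζ.IsUniversal) (hf : FinOcc ar C) {D D' : Set C}
    (hD : StrongIn ar D D') (hDD' : D ⊆ D') (hD' : InClass ζ μ D') : InClass ζ μ D :=
  ⟨hD'.1.subset hDD', fun A hA => hD'.2.1 A (hA.trans hDD'),
    muBound_of_strongIn hf hD hDD' hD'.2.2.1, models_subOf_of_subset hζ hDD' hD'.2.2.2⟩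

theorem InClass.finOcc (h : InClass ζ μ (Set.univ : Set C)) : FinOcc ar C :=
  finOcc_of_nonneg fun A => h.2.1 A (Set.subset_univ _)

/-- A new point raises the predimension by a full unit only if no relation passes through it. -/
theorem ne_of_dl_insert (hf : FinOcc ar C) {B : Finset C} {x : C} (hx : x ∉ B)
    (hd : dl ar Set.univ B + 1 ≤ dl ar Set.univ (insert x B)) {s : Symb N}
    {v : Fin (ar s) → C} (hv : Holds ar s v) (hB : ∀ j, v j ∈ insert x B) (j : Fin (ar s)) :
    v j ≠ x := by
  rintro rfl
  have h1 := dl_sub_dl hf Set.univ (Finset.subset_insert (v j) B)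
  rw [Finset.card_insert_of_notMem hx, Nat.cast_add, Nat.cast_one] at h1
  have h2 : (occ ar Set.univ ((insert (v j) B : Finset C) : Set C) \
      occ ar Set.univ (B : Set C)).ncard = 0 := by omega
  rw [Set.ncard_eq_zero ((hf.finite _ _).subset Set.sdiff_subset)] at h2
  have : (s, Finset.univ.val.map v) ∈ (occ ar Set.univ ((insert (v j) B : Finset C) : Set C) \
      occ ar Set.univ (B : Set C)) :=
    mem_occ_diff.2 ⟨⟨trivial, v, hv, hB, rfl⟩, v j, Multiset.mem_map.2 ⟨j, Finset.mem_univ_val j, rfl⟩, hx⟩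
  rw [h2] at this
  exact this

/-- A strong subset that is not everything can be extended by a simply algebraic extension or by a
free point. -/
theorem exists_step (hf : FinOcc ar C) {B : Finset C} (hB : Strong ar B Set.univ)
    (hne : ∃ x, x ∉ B) :
    (∃ T, SimplyAlg ar B T ∧ Strong ar (B ∪ T) Set.univ) ∨
      ∃ x ∉ B, Strong ar (insert x B) Set.univ ∧
        dl ar Set.univ (insert x B) = dl ar Set.univ B + 1 := by
  have hB' := ((strong_iff hf).1 hB).2
  -- A minimal nonempty extension of predimension zero is simply algebraic. If there is none, every
  -- strong-set extension containing a new point costs at least one, and one point costs at most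
  -- one.
  by_cases h : ∃ T : Finset C, T.Nonempty ∧ Disjoint B T ∧
      dl ar Set.univ (B ∪ T) = dl ar Set.univ B
  · left
    obtain ⟨T, hT⟩ := exists_minimal_of_wellFoundedLT (fun T : Finset C => T.Nonempty ∧
      Disjoint B T ∧ dl ar Set.univ (B ∪ T) = dl ar Set.univ B) h
    refine ⟨T, (simplyAlg_iff hf).2 ⟨hT.prop.1, hT.prop.2.1, hT.prop.2.2, fun T' h1 h2 h3 => ?_⟩,
      strong_of_dl_eq hf hB Finset.subset_union_left (Set.subset_univ _) hT.prop.2.2.le⟩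
    refine lt_of_le_of_ne (hB' _ Finset.subset_union_left (Set.subset_univ _)) fun h4 => ?_
    exact h3 (Finset.Subset.antisymm h1
      (hT.le_of_le ⟨h2, hT.prop.2.1.mono_right h1, h4.symm⟩ h1))
  · right
    obtain ⟨x, hx⟩ := hne
    have key : ∀ X : Finset C, B ⊆ X → x ∈ X → dl ar Set.univ B + 1 ≤ dl ar Set.univ X := by
      intro X h1 h2
      have h3 := hB' X h1 (Set.subset_univ _)
      by_contra h4
      refine h ⟨X \ B, ⟨x, Finset.mem_sdiff.2 ⟨h2, hx⟩⟩, Finset.disjoint_sdiff, ?_⟩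
      rw [Finset.union_sdiff_of_subset h1]
      omega
    have h1 := dl_insert_le hf Set.univ B {x}
    have h2 : B ∪ {x} = insert x B := by ext; simp
    have h3 : (({x} : Finset C) \ B).card ≤ 1 := by
      simpa using Finset.card_le_card (Finset.sdiff_subset (s := ({x} : Finset C)) (t := B))
    have h4 := key (insert x B) (Finset.subset_insert _ _) (Finset.mem_insert_self _ _)
    rw [h2] at h1
    have h5 : dl ar Set.univ (insert x B) = dl ar Set.univ B + 1 := by omega
    refine ⟨x, hx, (strong_iff hf).2 ⟨Set.subset_univ _, fun X hX _ => ?_⟩, h5⟩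
    rw [h5]
    exact key X (fun y hy => hX (Finset.mem_insert_of_mem hy)) (hX (Finset.mem_insert_self _ _))

theorem SameTp.emb_of_bijective {ι : Type*} {β : ι → C} {b : ι → M}
    (h : SameTp ar Set.univ β b) (hβ : Function.Bijective β) :
    ∃ f : C → M, IsEmb ar f ∧ f ∘ β = b := by
  let e := Equiv.ofBijective β hβ
  have hb : (b ∘ e.symm) ∘ β = b := by
    funext t
    change b (e.symm (e t)) = b t
    rw [e.symm_apply_apply]
  have hβe : β ∘ e.symm = id := funext fun x => e.apply_symm_apply x
  have h1 := h.comp e.symm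
  rw [hβe] at h1
  exact ⟨b ∘ e.symm, ⟨h1.injective Function.injective_id, fun s v => (h1.2 s trivial v).symm⟩, hb⟩

theorem sameTp_insert (hfM : FinOcc ar M) (hfC : FinOcc ar C) {n : ℕ} {β : Fin n → C}
    {b : Fin n → M} (h : SameTp ar Set.univ β b) {x : C} {y : M} (hx : x ∉ rng β)
    (hy : y ∉ rng b)
    (hdx : dl ar Set.univ (insert x (rng β)) = dl ar Set.univ (rng β) + 1)
    (hdy : dl ar Set.univ (insert y (rng b)) = dl ar Set.univ (rng b) + 1) :
    SameTp ar Set.univ (Sum.elim β fun _ : Fin 1 => x) (Sum.elim b fun _ : Fin 1 => y) := by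
  constructor
  · rintro (i | i) (j | j)
    · exact h.1 i j
    · exact iff_of_false (fun h' => hx (mem_rng.2 ⟨i, h'⟩)) fun h' => hy (mem_rng.2 ⟨i, h'⟩)
    · exact iff_of_false (fun h' => hx (mem_rng.2 ⟨j, h'.symm⟩))
        fun h' => hy (mem_rng.2 ⟨j, h'.symm⟩)
    · simp
  · intro s _ w
    by_cases hw : ∃ j u, w j = Sum.inr u
    · obtain ⟨j, u, hj⟩ := hw
      refine iff_of_false (fun h' => ?_) fun h' => ?_
      · refine ne_of_dl_insert hfC hx hdx.ge h' (fun i => ?_) j (by simp [hj])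
        rcases hwi : w i with t | t <;> simp [hwi]
      · refine ne_of_dl_insert hfM hy hdy.ge h' (fun i => ?_) j (by simp [hj])
        rcases hwi : w i with t | t <;> simp [hwi]
    · obtain ⟨w, rfl⟩ := eq_inl_comp_of_forall hw
      exact h.2 s trivial w

theorem isAlgStep_pull (hζ : ζ.IsUniversal) (hC : IsSymm ar C)
    (hCc : InClass ζ μ (Set.univ : Set C)) {n l : ℕ} {β : Fin n → C} {γ : Fin l → C}
    (hinj : Function.Injective (Sum.elim β γ)) (hT : SimplyAlg ar (rng β) (rng γ))
    (hs : Strong ar (rng β ∪ rng γ) Set.univ) :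
    IsAlgStep ζ μ (pull ar (Sum.elim β γ)) := by
  let := pull ar (Sum.elim β γ)
  have he := isEmb_pull (ar := ar) hinj
  refine ⟨he.isSymm hC, ?_, ?_⟩
  · rw [← he.inClass_image hζ, Set.image_univ]
    have : Set.range (Sum.elim β γ) = ((rng β ∪ rng γ : Finset C) : Set C) := by
      ext; simp
    rw [this]
    exact inClass_of_strongIn hζ hCc.finOcc (hs.strongIn hCc.finOcc) (Set.subset_univ _) hCc
  · rw [← he.simplyAlg_image, image_baseSet, image_topSet]
    exact hT

/-- In an algebraically and transcendentally closed structure, members of the class can be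
realized strongly over strong subsets. -/
theorem exists_strong_emb (hζ : ζ.IsUniversal) (hM0 : ∀ A : Finset M, 0 ≤ delta ar A)
    (hMa : AlgClosed ζ μ M) (hMt : TransClosed ar M) (hC : IsSymm ar C)
    (hCc : InClass ζ μ (Set.univ : Set C)) (m : ℕ) : ∀ (n : ℕ) (β : Fin n → C) (b : Fin n → M),
    Nat.card C ≤ n + m → SameTp ar Set.univ β b → Function.Injective β →
      Strong ar (rng β) Set.univ → Strong ar (rng b) Set.univ →
      ∃ f : C → M, IsEmb ar f ∧ f ∘ β = b ∧
        ∃ A : Finset M, (A : Set M) = Set.range f ∧ Strong ar A Set.univ := by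
  have hf := hCc.finOcc
  have hfM := finOcc_of_nonneg hM0
  have hfin : Finite C := Set.finite_univ_iff.1 hCc.1
  -- `m` bounds the number of points of `C` not yet enumerated by `β`.
  induction m with
  | zero =>
    intro n β b hm hβb hβ hβs hbs
    have hbij : Function.Bijective β := by
      rw [Nat.bijective_iff_injective_and_card]
      refine ⟨hβ, le_antisymm (Nat.card_le_card_of_injective β hβ) (by simpa using hm)⟩
    obtain ⟨f, hf, rfl⟩ := hβb.emb_of_bijective hbij
    exact ⟨f, hf, rfl, _, by simp only [Finset.coe_image, Finset.coe_univ, Set.image_univ, hbij.2.range_comp], hbs⟩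
  | succ m ih =>
    intro n β b hm hβb hβ hβs hbs
    have extend : ∀ (l : ℕ) (γ : Fin l → C) (d : Fin l → M), 0 < l →
        SameTp ar Set.univ (Sum.elim β γ) (Sum.elim b d) → Function.Injective (Sum.elim β γ) →
        Strong ar (rng β ∪ rng γ) Set.univ → Strong ar (rng b ∪ rng d) Set.univ →
        ∃ f : C → M, IsEmb ar f ∧ f ∘ β = b ∧
          ∃ A : Finset M, (A : Set M) = Set.range f ∧ Strong ar A Set.univ := by
      intro l γ d hl h1 h2 h3 h4
      obtain ⟨f, hf1, hf2, hf3⟩ := ih (n + l) (Sum.elim β γ ∘ finSumFinEquiv.symm)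
        (Sum.elim b d ∘ finSumFinEquiv.symm) (by omega) (h1.comp _)
        (h2.comp finSumFinEquiv.symm.injective) (by rw [rng_elim_finSum]; exact h3) (by rw [rng_elim_finSum]; exact h4)
      refine ⟨f, hf1, ?_, hf3⟩
      funext t
      simpa using congrFun hf2 (finSumFinEquiv (Sum.inl t))
    by_cases hall : ∀ x, x ∈ rng β
    · have hbij : Function.Bijective β := ⟨hβ, fun x => mem_rng.1 (hall x)⟩
      obtain ⟨f, hf, rfl⟩ := hβb.emb_of_bijective hbij
      exact ⟨f, hf, rfl, _, by simp only [Finset.coe_image, Finset.coe_univ, Set.image_univ, hbij.2.range_comp], hbs⟩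
    · rcases exists_step hf hβs (not_forall.1 hall) with ⟨T, hT, hTs⟩ | ⟨x, hx, hxs, hxd⟩
      · obtain ⟨l, γ, hγ, rfl⟩ := exists_enum T
        have hdis := Finset.disjoint_left.1 hT.2.1
        have hinj : Function.Injective (Sum.elim β γ) := hβ.sumElim hγ fun t u h =>
          hdis (mem_rng.2 ⟨t, rfl⟩) (mem_rng.2 ⟨u, h.symm⟩)
        have hbemb : @IsEmb N ar _ _ _ (baseStr (pull ar (Sum.elim β γ))) b :=
          ⟨hβb.injective hβ, fun s v => (hβb.2 s trivial v).symm⟩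
        obtain ⟨d, hd, hds⟩ := hMa n l _ (isAlgStep_pull hζ hC hCc hinj hT hTs) b hbemb hbs
        refine extend l γ d ?_ ⟨fun i j => ?_, fun s _ w => ?_⟩ hinj hTs ?_
        · obtain ⟨z, hz⟩ := hT.1
          obtain ⟨t, -⟩ := mem_rng.1 hz
          exact t.pos
        · rw [hinj.eq_iff, hd.1.eq_iff]
        · exact (hd.2 s w).symm
        · rwa [image_elim] at hds
      · obtain ⟨y, hy, hys, hyd⟩ := hMt _ hbs
        have hsame := sameTp_insert hfM hf hβb hx hy hxd hyd
        refine extend 1 (fun _ => x) (fun _ => y) one_pos hsame ?_ ?_ ?_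
        · exact hβ.sumElim (fun _ _ _ => Subsingleton.elim _ _)
            fun t _ h => hx (mem_rng.2 ⟨t, h⟩)
        · rw [union_rng_const]; exact hxs
        · rw [union_rng_const]; exact hys

end Rich

/-! ## Isolated points -/

section Isolated

variable {ζ : (lang ar).Theory} {μ : MuFun ar} {E : Type*} [(lang ar).Structure E]

/-- A universal theory holds if it holds in all finite substructures. -/
theorem models_of_finite (hζ : ζ.IsUniversal)
    (h : ∀ A : Finset E, (subOf ar (A : Set E)) ⊨ ζ) : E ⊨ ζ := by
  have key : ∀ {n : ℕ} {φ : (lang ar).BoundedFormula Empty n}, φ.IsUniversal →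
      ∀ (xs : Fin n → E), ¬ φ.Realize default xs → ∃ A : Finset E, ∀ (D : Set E), (A : Set E) ⊆ D →
        ∀ xs' : Fin n → subOf ar D, Subtype.val ∘ xs' = xs → ¬ φ.Realize default xs' := by
    intro n φ hφ
    induction hφ with
    | of_isQF hq =>
      intro xs hx
      refine ⟨∅, fun D _ xs' h' hr => hx ?_⟩
      rw [← h', Subsingleton.elim (default : Empty → E) ((subOf ar D).subtype ∘ default)]
      exact (hq.realize_embedding (subOf ar D).subtype).2 hr
    | all _ ih =>
      intro xs hx
      rw [FirstOrder.Language.BoundedFormula.realize_all, not_forall] at hx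
      obtain ⟨a, ha⟩ := hx
      obtain ⟨A, hA⟩ := ih _ ha
      refine ⟨insert a A, fun D hD xs' h' hr => ?_⟩
      rw [Finset.coe_insert] at hD
      refine hA D ((Set.subset_insert _ _).trans hD)
        (Fin.snoc xs' ⟨a, hD (Set.mem_insert _ _)⟩) ?_ (hr _)
      rw [Fin.comp_snoc, h']
  rw [FirstOrder.Language.Theory.model_iff]
  intro φ hφ
  by_contra hn
  obtain ⟨A, hA⟩ := key (hζ.isUniversal_of_mem hφ) default hn
  exact hA _ subset_rfl default (Subsingleton.elim _ _) ((h A).realize_of_mem φ hφ)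

variable (ar) in
/-- The point occurs in no relation. -/
def Isolated (x : E) : Prop :=
  ∀ (s : Symb N) (v : Fin (ar s) → E), Holds ar s v → ∀ j, v j ≠ x

theorem dl_insert_isolated (hf : FinOcc ar E) (K : Set (Symb N)) {x : E} (hx : Isolated ar x)
    {A : Finset E} (hA : x ∉ A) : dl ar K (insert x A) = dl ar K A + 1 := by
  have h1 := dl_sub_dl hf K (Finset.subset_insert x A)
  have h2 : occ ar K ((insert x A : Finset E) : Set E) \ occ ar K (A : Set E) = ∅ := by
    refine Set.eq_empty_of_forall_notMem fun p hp => ?_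
    obtain ⟨⟨-, v, hv, hvA, hp⟩, y, hy, hyA⟩ := mem_occ_diff.1 hp
    rw [hp] at hy
    obtain ⟨j, -, rfl⟩ := Multiset.mem_map.1 hy
    have := hvA j
    rw [Finset.mem_coe, Finset.mem_insert] at this
    exact this.elim (hx _ v hv j) hyA
  rw [h2, Set.ncard_empty, Finset.card_insert_of_notMem hA, Nat.cast_add] at h1
  simp only [Nat.cast_one, Nat.cast_zero] at h1
  omega

/-- Removing isolated points removes points but no relations. -/
theorem strongIn_of_isolated (hf : FinOcc ar E) {D : Set E} (hD : ∀ z ∉ D, Isolated ar z) :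
    StrongIn ar D Set.univ := fun X _ => by
  have h1 := dl_sub_dl hf Set.univ (cap_subset X D)
  have h2 : occ ar Set.univ (X : Set E) \ occ ar Set.univ (cap X D : Set E) = ∅ := by
    refine Set.eq_empty_of_forall_notMem fun p hp => ?_
    obtain ⟨⟨-, v, hv, hvA, hp⟩, y, hy, hyA⟩ := mem_occ_diff.1 hp
    rw [hp] at hy
    obtain ⟨j, -, rfl⟩ := Multiset.mem_map.1 hy
    refine hyA (mem_cap.2 ⟨hvA j, ?_⟩)
    by_contra hn
    exact hD _ hn _ v hv j rfl
  have h3 := Finset.card_le_card (cap_subset X D)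
  rw [h2, Set.ncard_empty] at h1
  omega

theorem OfForm.not_isolated_left {k l : ℕ} {S : Ext ar k l} (hS : IsMSAExt S) {a : Fin k → E}
    {b : Fin l → E} (h : OfForm S a b) (t : Fin k) : ¬ Isolated ar (a t) := fun hi => by
  obtain ⟨s, -, v, -, hv, ⟨j, hj⟩, -⟩ := h.linked hS t
  exact hi s _ hv j (by simp [hj])

/-- An isolated point always raises the predimension by one, but completing a copy by its last point
never raises it. -/
theorem OfForm.not_isolated_right (hf : FinOcc ar E) {k l : ℕ} {S : Ext ar k l} (hS : IsMSAExt S)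
    {a : Fin k → E} {b : Fin l → E} (h : OfForm S a b) (t : Fin l) : ¬ Isolated ar (b t) :=
  fun hi => by
  have h1 := h.dl_union_le hf hS (Set.subset_univ _) (Z := rng a ∪ (rng b).erase (b t))
    Finset.subset_union_left
  have h2 : rng a ∪ (rng b).erase (b t) ∪ rng b = insert (b t) (rng a ∪ (rng b).erase (b t)) := by
    ext x
    have : b t ∈ rng b := mem_rng.2 ⟨t, rfl⟩
    simp only [Finset.mem_union, Finset.mem_insert, Finset.mem_erase]
    by_cases hx : x = b t
    · subst hx; tauto
    · tauto
  have h3 : b t ∉ rng a ∪ (rng b).erase (b t) := by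
    rw [Finset.mem_union, not_or]
    exact ⟨fun h' => Finset.disjoint_left.1 h.disjoint h' (mem_rng.2 ⟨t, rfl⟩), by simp⟩
  have h4 := dl_insert_isolated hf Set.univ hi h3
  rw [h2] at h1
  omega

theorem muBound_of_isolated (hf : FinOcc ar E) {D : Set E} (hD : ∀ z ∉ D, Isolated ar z)
    (h : MuBound μ D) : MuBound μ (Set.univ : Set E) := by
  intro k l S hS a r b _ _ hb hd
  rcases Nat.eq_zero_or_pos r with rfl | hr
  · exact Nat.zero_le _
  have ha : ∀ x, a x ∈ D := fun x => by
    by_contra hn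
    exact (hb ⟨0, hr⟩).not_isolated_left hS x (hD _ hn)
  rw [← gval_eq_of_strongIn hf (strongIn_of_isolated hf hD) (Set.subset_univ _) (rng_subset.2 ha)]
  refine h k l S hS a r b ha (fun i y => ?_) hb hd
  by_contra hn
  exact (hb i).not_isolated_right hf hS y (hD _ hn)

/-- A nullary relation that holds would make the predimension of the empty set negative. -/
theorem arity_pos (h0 : ∀ A : Finset E, 0 ≤ delta ar A) {s : Symb N} {v : Fin (ar s) → E}
    (hv : Holds ar s v) : 0 < ar s := by
  by_contra hn
  have hf := finOcc_of_nonneg h0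
  have h1 := (dl_nonneg_iff hf ∅).1 (h0 ∅)
  have h2 : (occ ar Set.univ ((∅ : Finset E) : Set E)).ncard = 0 := by
    simp only [dl, Finset.card_empty] at h1
    omega
  rw [Set.ncard_eq_zero (hf.finite _ _)] at h2
  have : (s, Finset.univ.val.map v) ∈ occ ar Set.univ ((∅ : Finset E) : Set E) :=
    ⟨trivial, v, hv, fun j => absurd j.pos hn, rfl⟩
  rw [h2] at this
  exact this

theorem models_singleton_of_isolated (hζ : ζ.IsUniversal) (hp : Sat ar (discrete ar Unit) ζ)
    (h0 : ∀ A : Finset E, 0 ≤ delta ar A) {x : E} (hx : Isolated ar x) :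
    (subOf ar ({x} : Set E)) ⊨ ζ := by
  let := discrete ar Unit
  refine (models_subOf_iff hζ (f := fun _ : Unit => x) ⟨fun _ _ _ => rfl, fun s v => ?_⟩ (by simp)).2
    hp
  exact iff_of_false (fun h => hx s _ h ⟨0, arity_pos h0 h⟩ rfl) id

/-- Since `ζ` is universal, finite substructures suffice. Each isolated point is adjoined by a free
join with the one-point structure, in which `ζ` holds by assumption. -/
theorem models_of_isolated (hζ : ζ.IsUniversal) (hζj : PreservedByFreeJoins ζ)
    (hp : Sat ar (discrete ar Unit) ζ) (hE : IsSymm ar E) (h0 : ∀ A : Finset E, 0 ≤ delta ar A)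
    {D : Set E} (hD : ∀ z ∉ D, Isolated ar z)
    (h : ∀ A : Finset E, (A : Set E) ⊆ D → (subOf ar (A : Set E)) ⊨ ζ) : E ⊨ ζ := by
  refine models_of_finite hζ fun A => ?_
  have key : ∀ Z : Finset E, (∀ z ∈ Z, z ∉ D) →
      (subOf ar ((cap A D ∪ Z : Finset E) : Set E)) ⊨ ζ := by
    intro Z
    induction Z using Finset.induction_on with
    | empty =>
      intro _
      rw [Finset.union_empty]
      exact h _ (cap_subset_right _ _)
    | insert x Z hx ih =>
      intro hZ
      have h1 := ih fun z hz => hZ z (Finset.mem_insert_of_mem hz)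
      have hxi := hD x (hZ x (Finset.mem_insert_self _ _))
      have h2 := models_union_of_freelyJoined hζ hζj hE (Finset.finite_toSet (cap A D ∪ Z))
        (Set.finite_singleton x) (fun s v hv hj => Or.inl fun j =>
          (hj j).resolve_right (hxi s v hv j)) h1 (models_singleton_of_isolated hζ hp h0 hxi)
      have h3 : ((cap A D ∪ insert x Z : Finset E) : Set E) =
          ((cap A D ∪ Z : Finset E) : Set E) ∪ {x} := by
        ext z; simp only [Finset.coe_union, Finset.coe_insert, Set.mem_union, Set.mem_insert_iff,
          Set.mem_singleton_iff]; tauto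
      rw [h3]
      exact h2
  have h1 := key (A \ cap A D) fun z hz hzD => by
    rw [Finset.mem_sdiff, mem_cap] at hz
    exact hz.2 ⟨hz.1, hzD⟩
  rwa [Finset.union_sdiff_of_subset (cap_subset _ _)] at h1

end Isolated

/-! ## Generic structures are closed -/

section Generic

variable {ζ : (lang ar).Theory} {μ : MuFun ar} {M : Type u} [(lang ar).Structure M]

theorem exists_strong_finset (h0 : ∀ A : Finset M, 0 ≤ delta ar A) (A : Finset M) :
    ∃ X : Finset M, A ⊆ X ∧ Strong ar X Set.univ :=
  exists_strong_superset h0 (Set.subset_univ _)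

/-- The axioms that hold in all substructures can be checked on the finite strong subsets. -/
theorem axiomTwo_of_strong (hζ : ζ.IsUniversal) (h0 : ∀ A : Finset M, 0 ≤ delta ar A)
    (h : ∀ A : Finset M, Strong ar A Set.univ → InClass ζ μ (A : Set M)) : AxiomTwo ζ μ M := by
  have hf := finOcc_of_nonneg h0
  refine ⟨models_of_finite hζ fun A => ?_, h0, ?_⟩
  · obtain ⟨X, hAX, hX⟩ := exists_strong_finset h0 A
    exact models_subOf_of_subset hζ (by exact_mod_cast hAX) (h X hX).2.2.2
  · intro k l S hS a r b _ _ hb hd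
    obtain ⟨X, hAX, hX⟩ := exists_strong_finset h0 (rng a ∪ Finset.univ.biUnion fun i => rng (b i))
    have ha : ∀ t, a t ∈ X := fun t => hAX (Finset.mem_union_left _ (mem_rng.2 ⟨t, rfl⟩))
    have hbX : ∀ i t, b i t ∈ X := fun i t => hAX (Finset.mem_union_right _
      (Finset.mem_biUnion.2 ⟨i, Finset.mem_univ i, mem_rng.2 ⟨t, rfl⟩⟩))
    rw [← gval_eq_of_strongIn hf (hX.strongIn hf) (Set.subset_univ _) (rng_subset.2 ha)]
    exact (h X hX).2.2.1 k l S hS a r b ha hbX hb hd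

theorem inClass_of_axiomTwo (hζ : ζ.IsUniversal) (h2 : AxiomTwo ζ μ M) {A : Finset M}
    (hA : Strong ar A Set.univ) : InClass ζ μ (A : Set M) :=
  ⟨Finset.finite_toSet _, fun B _ => h2.2.1 B, muBound_of_strongIn (finOcc_of_nonneg h2.2.1)
    (hA.strongIn (finOcc_of_nonneg h2.2.1)) (Set.subset_univ _) h2.2.2, models_subOf hζ _ h2.1⟩

theorem isGeneric_of_closed (hζ : ζ.IsUniversal) [Countable M] (hM : IsSymm ar M)
    (h2 : AxiomTwo ζ μ M) (ha : AlgClosed ζ μ M) (ht : TransClosed ar M) : IsGeneric ζ μ M where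
  symm := hM
  delta_nonneg := h2.2.1
  countable := inferInstance
  strong_mem _ hA := inClass_of_axiomTwo hζ h2 hA
  extend C _ hC hCc B hB j hj := by
    obtain ⟨A, hA, hAs⟩ := hj
    obtain ⟨n, β, hβ, rfl⟩ := exists_enum B
    let β' : Fin n → subOf ar ((rng β : Finset C) : Set C) := fun t => ⟨β t, mem_rng.2 ⟨t, rfl⟩⟩
    have h1 : SameTp ar Set.univ β (j ∘ β') :=
      ((isEmb_val (subOf ar ((rng β : Finset C) : Set C))).sameTp_comp β').symm.trans
        (j.isEmb.sameTp_comp β')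
    have h3 : rng (j ∘ β') = A := by
      rw [← Finset.coe_inj, hA]
      ext z
      rw [Finset.mem_coe, mem_rng]
      constructor
      · rintro ⟨t, rfl⟩; exact ⟨_, rfl⟩
      · rintro ⟨⟨x, hx⟩, rfl⟩
        obtain ⟨t, rfl⟩ := mem_rng.1 hx
        exact ⟨t, rfl⟩
    obtain ⟨f, hf, hfβ, hfs⟩ := exists_strong_emb hζ h2.2.1 ha ht hC hCc (Nat.card C) n β (j ∘ β')
      (by omega) h1 hβ hB (by rw [h3]; exact hAs)
    refine ⟨hf.toEmbedding, ?_, hfs⟩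
    rintro ⟨x, hx⟩
    obtain ⟨t, rfl⟩ := mem_rng.1 hx
    exact congrFun hfβ t

theorem IsGeneric.axiomTwo (hζ : ζ.IsUniversal) (hM : IsGeneric ζ μ M) : AxiomTwo ζ μ M :=
  axiomTwo_of_strong hζ hM.delta_nonneg hM.strong_mem

theorem IsGeneric.exists_emb_of_sameTp (hM : IsGeneric ζ μ M) {C : Type u}
    [(lang ar).Structure C] (hC : IsSymm ar C) (hCc : InClass ζ μ (Set.univ : Set C)) {n : ℕ}
    {β : Fin n → C} {b : Fin n → M} (hβ : Function.Injective β) (h : SameTp ar Set.univ β b)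
    (hβs : Strong ar (rng β) Set.univ) (hbs : Strong ar (rng b) Set.univ) :
    ∃ f : C → M, IsEmb ar f ∧ f ∘ β = b ∧
      ∃ A : Finset M, (A : Set M) = Set.range f ∧ Strong ar A Set.univ := by
  have hτ : ∀ x : subOf ar ((rng β : Finset C) : Set C), ∃ t, β t = x.1 :=
    fun x => mem_rng.1 (Finset.mem_coe.1 x.2)
  choose τ hτ using hτ
  have hτ' : β ∘ τ = Subtype.val := funext hτ
  have hj : IsEmb ar (b ∘ τ) := by
    have h1 : SameTp ar Set.univ (β ∘ τ) (b ∘ τ) := h.comp τ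
    rw [hτ'] at h1
    refine ⟨h1.injective Subtype.val_injective, fun s v => ?_⟩
    exact (h1.2 s trivial v).symm.trans ((isEmb_val _).2 s v)
  have hmem : ∀ t, β t ∈ subOf ar ((rng β : Finset C) : Set C) := fun t =>
    Finset.mem_coe.2 (mem_rng.2 ⟨t, rfl⟩)
  have hτb : ∀ t, τ ⟨β t, hmem t⟩ = t := fun t => hβ (hτ ⟨β t, hmem t⟩)
  obtain ⟨f, hf1, hf2⟩ := hM.extend C hC hCc (rng β) hβs hj.toEmbedding
    ⟨rng b, by
      ext z
      rw [Finset.mem_coe, mem_rng]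
      constructor
      · rintro ⟨t, rfl⟩
        exact ⟨⟨β t, hmem t⟩, congrArg b (hτb t)⟩
      · rintro ⟨x, rfl⟩
        exact ⟨τ x, rfl⟩, hbs⟩
  exact ⟨f, f.isEmb, funext fun t => (hf1 ⟨β t, hmem t⟩).trans (congrArg b (hτb t)), hf2⟩

/-- The extension property speaks of structures in the universe of `M`; structures in `Type`, such
as those on `Fin` types, are lifted to it. -/
theorem IsGeneric.exists_emb (hζ : ζ.IsUniversal) (hM : IsGeneric ζ μ M) {X : Type}
    [(lang ar).Structure X] (hX : IsSymm ar X) (hXc : InClass ζ μ (Set.univ : Set X)) {n : ℕ}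
    {β : Fin n → X} {b : Fin n → M} (hβ : Function.Injective β) (h : SameTp ar Set.univ β b)
    (hβs : Strong ar (rng β) Set.univ) (hbs : Strong ar (rng b) Set.univ) :
    ∃ f : X → M, IsEmb ar f ∧ f ∘ β = b ∧
      ∃ A : Finset M, (A : Set M) = Set.range f ∧ Strong ar A Set.univ := by
  let := pull ar (ULift.down : ULift.{u} X → X)
  have hd : IsEmb ar (ULift.down : ULift.{u} X → X) := isEmb_pull ULift.down_injective
  have hu : IsEmb ar (ULift.up : X → ULift.{u} X) := hd.of_rightInverse fun x => rfl
  have hc : InClass ζ μ (Set.univ : Set (ULift.{u} X)) := by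
    rw [← hd.inClass_image hζ, Set.image_univ, ULift.down_surjective.range_eq]
    exact hXc
  have hs : Strong ar (rng (ULift.up ∘ β) : Finset (ULift.{u} X)) Set.univ := by
    have := hu.strong_image.2 hβs
    rw [Set.image_univ, ULift.up_surjective.range_eq] at this
    convert this
    ext; simp
  obtain ⟨f, hf1, hf2, hf3⟩ := hM.exists_emb_of_sameTp (hd.isSymm hX) hc
    (ULift.up_injective.comp hβ) ((hu.sameTp_comp β).symm.trans h) hs hbs
  refine ⟨f ∘ ULift.up, hf1.comp hu, hf2, ?_⟩
  rw [Set.range_comp, ULift.up_surjective.range_eq, Set.image_univ]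
  exact hf3

theorem IsEmb.dl_insert_isolated {X E : Type*} [(lang ar).Structure X] [(lang ar).Structure E]
    {f : X → E} (hf : IsEmb ar f) (hX : FinOcc ar X) {x : X} (hx : Isolated ar x) {n : ℕ}
    {β : Fin n → X} (hβ : ∀ t, β t ≠ x) :
    dl ar Set.univ (insert (f x) (rng (f ∘ β))) = dl ar Set.univ (rng (f ∘ β)) + 1 := by
  have h1 : insert (f x) (rng (f ∘ β)) = (insert x (rng β)).image f := by
    ext; simp [eq_comm]
  have h2 : rng (f ∘ β) = (rng β).image f := by
    ext; simp
  rw [h1, h2, hf.dl_image, hf.dl_image,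
    HG.dl_insert_isolated hX Set.univ hx fun h => (mem_rng.1 h).elim hβ]

theorem IsGeneric.algClosed (hζ : ζ.IsUniversal) (hM : IsGeneric ζ μ M) : AlgClosed ζ μ M := by
  intro n l S hS b hb hbs
  let := S
  have hβ : SameTp ar Set.univ (Sum.inl : Fin n → Fin n ⊕ Fin l) b := by
    let := baseStr S
    exact ((isEmb_inl_baseStr S).sameTp).symm.trans hb.sameTp
  have hr : rng (Sum.inl : Fin n → Fin n ⊕ Fin l) = baseSet n l := by
    ext x; simp
  have hf := hS.finOcc
  have hbase : Strong ar (rng (Sum.inl : Fin n → Fin n ⊕ Fin l)) Set.univ := by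
    rw [hr]
    have := hS.simplyAlg.strong
    refine ⟨Set.subset_univ _, fun X hX _ => this.2 X hX fun x _ => mem_coe_union (mem_base_or_top x)⟩
  obtain ⟨f, hf1, hf2, A, hA, hAs⟩ := hM.exists_emb hζ hS.symm hS.inClass Sum.inl_injective hβ
    hbase hbs
  have hfe : Sum.elim b (f ∘ Sum.inr) = f := by
    rw [← hf2, Sum.elim_comp_inl_inr]
  refine ⟨f ∘ Sum.inr, by rw [hfe]; exact hf1, ?_⟩
  rw [hfe]
  convert hAs
  rw [← Finset.coe_inj, hA]
  simp

/-- The extension of `B` by one isolated point belongs to the class, because isolated points enter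
no copy and `ζ` survives the free join. Realizing it strongly over `B` gives the free point. -/
theorem IsGeneric.transClosed (hζ : ζ.IsUniversal) (hζj : PreservedByFreeJoins ζ)
    (hp : Sat ar (discrete ar Unit) ζ) (hM : IsGeneric ζ μ M) : TransClosed ar M := by
  intro B hB
  obtain ⟨n, b, hb, rfl⟩ := exists_enum B
  have h2 := hM.axiomTwo hζ
  have hfM := finOcc_of_nonneg hM.delta_nonneg
  -- the one-point free extension of `B`, on `Option (Fin n)`
  let : (lang ar).Structure (Option (Fin n)) :=
    { funMap := fun g => Empty.elim g
      RelMap := fun r v => ∃ w, v = some ∘ w ∧ FirstOrder.Language.Structure.RelMap r (b ∘ w) }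
  have hhold : ∀ (s : Symb N) (v : Fin (ar s) → Option (Fin n)),
      Holds ar s v ↔ ∃ w, v = some ∘ w ∧ Holds ar s (b ∘ w) := fun s v => Iff.rfl
  let := pull ar b
  have heb : IsEmb ar b := isEmb_pull hb
  have hes : IsEmb ar (some : Fin n → Option (Fin n)) := by
    refine ⟨Option.some_injective _, fun s v => ?_⟩
    rw [hhold]
    constructor
    · rintro ⟨w, hw, h⟩
      rwa [(Option.some_injective _).comp_left hw]
    · exact fun h => ⟨v, rfl, h⟩
  have hiso : ∀ z ∉ Set.range (some : Fin n → Option (Fin n)), Isolated ar z := by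
    rintro z hz s v hv j rfl
    obtain ⟨w, rfl, -⟩ := (hhold s v).1 hv
    exact hz ⟨w j, rfl⟩
  have hsymm : IsSymm ar (Option (Fin n)) := by
    intro s v σ
    rw [hhold, hhold]
    constructor
    · rintro ⟨w, hw, h⟩
      refine ⟨w ∘ σ.symm, ?_, (hM.symm s (b ∘ w) σ.symm).2 h⟩
      rw [← Function.comp_assoc, ← hw, Function.comp_assoc, Equiv.self_comp_symm,
        Function.comp_id]
    · rintro ⟨w, rfl, h⟩
      exact ⟨w ∘ σ, rfl, (hM.symm s (b ∘ w) σ).2 h⟩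
  have hn0 : ∀ A : Finset (Fin n), 0 ≤ delta ar A := heb.delta_nonneg hM.delta_nonneg
  have hocc : FinOcc ar (Option (Fin n)) := by
    intro A
    refine (((heb.finOcc hfM) Finset.univ).image
      (fun q : Symb N × Multiset (Fin n) => (q.1, q.2.map some))).subset ?_
    rintro ⟨s, u⟩ ⟨-, v, hv, -, hu⟩
    obtain ⟨w, hw, h⟩ := (hhold s v).1 hv
    refine ⟨(s, Finset.univ.val.map w), ⟨trivial, w, h,
      fun _ => Finset.mem_coe.2 (Finset.mem_univ _), rfl⟩, Prod.ext rfl ?_⟩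
    change (Finset.univ.val.map w).map some = u
    rw [Multiset.map_map, ← hw]
    exact hu.symm
  have hst := strongIn_of_isolated hocc hiso
  have h0 : ∀ A : Finset (Option (Fin n)), 0 ≤ delta ar A := by
    intro A
    rw [dl_nonneg_iff hocc]
    refine le_trans ?_ (hst A (Set.subset_univ _))
    rw [← dl_nonneg_iff hocc]
    exact delta_nonneg_range hes hn0 _ (cap_subset_right _ _)
  have hBc := inClass_of_axiomTwo hζ h2 hB
  have hB' : InClass ζ μ (Set.univ : Set (Fin n)) := by
    rw [← heb.inClass_image hζ]
    convert hBc
    ext; simp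
  have hC : InClass ζ μ (Set.univ : Set (Option (Fin n))) := by
    refine ⟨Set.finite_univ, fun A _ => h0 A, muBound_of_isolated hocc hiso
      ((muBound_mono_emb hes).2 hB'.2.2.1), models_subOf hζ _ (models_of_isolated hζ hζj hp hsymm h0
      hiso fun A hA => ?_)⟩
    refine models_subOf_of_subset hζ hA ((models_subOf_iff hζ hes rfl).2 ?_)
    exact models_of_isEmb hζ heb h2.1
  have hsr : Strong ar (rng (some : Fin n → Option (Fin n))) Set.univ := by
    rw [strong_iff_strongIn hocc]
    refine ⟨Set.subset_univ _, ?_⟩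
    convert hst
    ext; simp
  obtain ⟨f, hf1, hf2, A, hA, hAs⟩ := hM.exists_emb hζ hsymm hC (Option.some_injective _)
    ((hes.sameTp).symm.trans heb.sameTp) hsr hB
  have hx : f none ∉ rng b := by
    rw [mem_rng]
    rintro ⟨t, ht⟩
    rw [← hf2] at ht
    exact absurd (hf1.1 ht) (by simp)
  refine ⟨f none, hx, ?_, ?_⟩
  · have : A = insert (f none) (rng b) := by
      rw [← Finset.coe_inj, hA, Finset.coe_insert]
      ext z
      simp only [Set.mem_range, Set.mem_insert_iff, Finset.mem_coe, mem_rng, Option.exists, ← hf2,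
        Function.comp, eq_comm]
    rw [← this]
    exact hAs
  · have := hf1.dl_insert_isolated hocc (hiso none (by simp)) (β := some) (by simp)
    rwa [hf2] at this

end Generic

/-! ## Existence of the generic -/

section Agree

variable {W : Type*}

/-- Two structures agree on the tuples from `D`. -/
def Agree (S S' : (lang ar).Structure W) (D : Set W) : Prop :=
  ∀ (s : Symb N) (v : Fin (ar s) → W), (∀ j, v j ∈ D) →
    (@Holds N ar W S s v ↔ @Holds N ar W S' s v)

variable {S S' : (lang ar).Structure W} {D : Set W}

theorem Agree.symm (h : Agree S S' D) : Agree S' S D := fun s v hv => (h s v hv).symm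

theorem Agree.occ_eq (h : Agree S S' D) (K : Set (Symb N)) {A : Set W} (hA : A ⊆ D) :
    @occ N ar W S K A = @occ N ar W S' K A := by
  ext p
  refine and_congr_right fun _ => exists_congr fun v => ?_
  constructor
  · rintro ⟨h1, h2, h3⟩
    exact ⟨(h _ v fun j => hA (h2 j)).1 h1, h2, h3⟩
  · rintro ⟨h1, h2, h3⟩
    exact ⟨(h _ v fun j => hA (h2 j)).2 h1, h2, h3⟩

theorem Agree.delta_eq (h : Agree S S' D) {A : Finset W} (hA : (A : Set W) ⊆ D) :
    @delta N ar W S A = @delta N ar W S' A := by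
  unfold delta deltaIn
  rw [h.occ_eq _ hA]

theorem Agree.strong_iff (h : Agree S S' D) {A : Finset W} {D' : Set W} (hD : D' ⊆ D) :
    @Strong N ar W S A D' ↔ @Strong N ar W S' A D' := by
  refine and_congr_right fun hA => forall_congr' fun X => imp_congr_right fun _ =>
    imp_congr_right fun hX => ?_
  rw [h.delta_eq (hA.trans hD), h.delta_eq (hX.trans hD)]

theorem Agree.isEmb (h : Agree S S' D) {X : Type*} [(lang ar).Structure X] {f : X → W}
    (hf : ∀ x, f x ∈ D) (he : @IsEmb N ar _ _ S _ f) : @IsEmb N ar _ _ S' _ f :=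
  ⟨he.1, fun s v => (h s _ fun j => hf (v j)).symm.trans (he.2 s v)⟩

theorem Agree.inClass (hA : Agree S S' D) {ζ : (lang ar).Theory} (hζ : ζ.IsUniversal)
    {μ : MuFun ar} (h : @InClass N ar W S ζ μ D) : @InClass N ar W S' ζ μ D := by
  let := @pull N ar _ _ S (Subtype.val : D → W)
  have h1 : @IsEmb N ar _ _ S _ (Subtype.val : D → W) :=
    @isEmb_pull N ar _ S _ _ Subtype.val_injective
  have h2 := hA.isEmb (fun x : D => x.2) h1
  have e : (Subtype.val : D → W) '' Set.univ = D := by simp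
  rw [← e] at h ⊢
  rw [@IsEmb.inClass_image _ _ _ _ S' _ _ hζ _ _ h2]
  exact (@IsEmb.inClass_image _ _ _ _ S _ _ hζ _ _ h1).1 h

end Agree

/-! ### Strong sets and the universal axioms under embeddings and free joins -/

section AdjoinMore

theorem IsEmb.strong_img {X E ι : Type*} [(lang ar).Structure X] [(lang ar).Structure E]
    [Fintype ι] {f : X → E} (h : IsEmb ar f) (g : ι → X) (D : Set X) :
    Strong ar (img (f ∘ g)) (f '' D) ↔ Strong ar (img g) D := by
  rw [← h.strong_image, Finset.image_image]

theorem IsEmb.strong_img_univ {X E ι : Type*} [(lang ar).Structure X] [(lang ar).Structure E]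
    [Fintype ι] {f : X → E} (h : IsEmb ar f) (hf : Function.Surjective f) (g : ι → X) :
    Strong ar (img (f ∘ g)) Set.univ ↔ Strong ar (img g) Set.univ := by
  rw [← h.strong_img, Set.image_univ, hf.range_eq]

theorem IsEmb.strong_img_of_strongIn {X E ι : Type*} [(lang ar).Structure X]
    [(lang ar).Structure E] [Fintype ι] {f : X → E} (h : IsEmb ar f) (hE : FinOcc ar E)
    (hs : StrongIn ar (Set.range f) Set.univ) {g : ι → X} (hg : Strong ar (img g) Set.univ) :
    Strong ar (img (f ∘ g)) Set.univ := by
  rw [← h.strong_img, Set.image_univ] at hg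
  exact (strong_iff_strongIn hE).2 ⟨Set.subset_univ _, (hg.strongIn hE).trans hs hg.1⟩

theorem IsEmb.strong_img_of_strong {X E ι : Type*} [(lang ar).Structure X]
    [(lang ar).Structure E] [Fintype ι] {f : X → E} (h : IsEmb ar f) {g : ι → X}
    (hg : Strong ar (img (f ∘ g)) Set.univ) : Strong ar (img g) Set.univ := by
  rw [← h.strong_img]
  refine hg.mono ?_ (Set.subset_univ _)
  rw [Finset.coe_image, Set.image_comp]
  exact Set.image_mono (Set.subset_univ _)

variable {ζ : (lang ar).Theory} {μ : MuFun ar} {M E : Type*} [(lang ar).Structure M]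
  [(lang ar).Structure E] {n l : ℕ} {S : Ext ar n l} {b : Fin n → M} {i : M → E}
  {e : Fin n ⊕ Fin l → E}

/-- A finite set lies in the free join of `C` with the trace on `M`, enlarged by the base; both of
these satisfy `ζ`. -/
theorem AdjoinFacts.models (h : AdjoinFacts ζ μ S b i e) (hζ : ζ.IsUniversal)
    (hζj : PreservedByFreeJoins ζ) (hM : M ⊨ ζ) : E ⊨ ζ := by
  refine models_of_finite hζ fun A => ?_
  have hJ := h.joinOver
  have h1 : ((cap A (Set.range i) ∪ rng (i ∘ b) : Finset E) : Set E) ⊆ Set.range i := by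
    intro x hx
    rw [Finset.mem_coe, Finset.mem_union] at hx
    exact hx.elim (fun h => (mem_cap.1 h).2) fun h => hJ.subset_left h
  have h2 := models_union_of_freelyJoined hζ hζj h.symm (Finset.finite_toSet _)
    (Finset.finite_toSet _) (freelyJoined_mono hJ.free h1 (by
      rw [← hJ.inter]
      exact Finset.coe_subset.2 Finset.subset_union_right))
    (models_subOf_of_subset hζ h1 ((models_subOf_iff hζ h.emb_left rfl).2 hM)) h.inClass.2.2.2
  refine models_subOf_of_subset hζ (fun x hx => ?_) h2
  rcases hJ.mem_or x with h3 | h3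
  · exact Or.inl (Finset.mem_coe.2 (Finset.mem_union_left _ (mem_cap.2 ⟨hx, h3⟩)))
  · exact Or.inr h3

theorem AdjoinFacts.axiomTwo {M E : Type u} [(lang ar).Structure M]
    [(lang ar).Structure E] {b : Fin n → M} {i : M → E} {e : Fin n ⊕ Fin l → E}
    (h : AdjoinFacts ζ μ S b i e) (hζ : ζ.IsUniversal)
    (hζj : PreservedByFreeJoins ζ) (hM : M ⊨ ζ) (hE : MuBound μ (Set.univ : Set E)) :
    AxiomTwo ζ μ E :=
  ⟨h.models hζ hζj hM, h.nonneg, hE⟩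

theorem IsEmb.axiomTwo {M E : Type u} [(lang ar).Structure M] [(lang ar).Structure E]
    {f : M → E} (hf : IsEmb ar f) (hζ : ζ.IsUniversal) (h2 : AxiomTwo ζ μ E)
    (hs : StrongIn ar (Set.range f) Set.univ) : AxiomTwo ζ μ M :=
  ⟨models_of_isEmb hζ hf h2.1, hf.delta_nonneg h2.2.1, (muBound_mono_emb hf).1
    (muBound_of_strongIn (finOcc_of_nonneg h2.2.1) hs (Set.subset_univ _) h2.2.2)⟩

end AdjoinMore

/-- A finite approximation of the generic with universe `W`: a structure on `W` satisfying the
universal axioms in which only the points of a finite set occur in relations. -/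
structure Code (ζ : (lang ar).Theory) (μ : MuFun ar) (W : Type u) where
  dom : Finset W
  str : (lang ar).Structure W
  supp : ∀ (s : Symb N) (v : Fin (ar s) → W), Holds ar s v → ∀ j, v j ∈ dom
  symm : IsSymm ar W
  axiomTwo : AxiomTwo ζ μ W

/-! ### Finite approximations of the generic, ordered by strong extension -/

namespace Code

variable {ζ : (lang ar).Theory} {μ : MuFun ar} {W : Type u}

theorem isolated (p : Code ζ μ W) {z : W} (hz : z ∉ p.dom) : @Isolated N ar W p.str z := by
  let := p.str
  rintro s v hv j rfl
  exact hz (p.supp s v hv j)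

theorem finOcc (p : Code ζ μ W) : @FinOcc N ar W p.str := by
  let := p.str
  exact finOcc_of_nonneg p.axiomTwo.2.1

theorem strong_of_dom_subset (p : Code ζ μ W) {A : Finset W} (hA : p.dom ⊆ A) :
    @Strong N ar W p.str A Set.univ := by
  let := p.str
  exact (strong_iff_strongIn p.finOcc).2 ⟨Set.subset_univ _,
    strongIn_of_isolated p.finOcc fun z hz => p.isolated fun h => hz (hA h)⟩

/-- The second code is a strong extension of the first. -/
def Le (p q : Code ζ μ W) : Prop :=
  p.dom ⊆ q.dom ∧ Agree p.str q.str p.dom ∧ @Strong N ar W q.str p.dom Set.univ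

instance : Preorder (Code ζ μ W) where
  le := Le
  le_refl p := ⟨subset_rfl, fun _ _ _ => Iff.rfl, p.strong_of_dom_subset subset_rfl⟩
  le_trans p q r h h' := by
    refine ⟨h.1.trans h'.1, fun s v hv => (h.2.1 s v hv).trans (h'.2.1 s v fun j => h.1 (hv j)), ?_⟩
    let := r.str
    refine Strong.trans r.finOcc ?_ h'.2.2
    refine (h'.2.1.strong_iff subset_rfl).1 ?_
    let := q.str
    exact h.2.2.mono (by exact_mod_cast h.1) (Set.subset_univ _)

/-- Enlarge the distinguished finite set of a code. -/
def enlarge (p : Code ζ μ W) (A : Finset W) : Code ζ μ W where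
  dom := p.dom ∪ A
  str := p.str
  supp s v hv j := Finset.mem_union_left _ (p.supp s v hv j)
  symm := p.symm
  axiomTwo := p.axiomTwo

theorem le_enlarge (p : Code ζ μ W) (A : Finset W) : p ≤ p.enlarge A :=
  ⟨Finset.subset_union_left, fun _ _ _ => Iff.rfl, p.strong_of_dom_subset subset_rfl⟩

/-- The code without relations. -/
theorem nonempty (hζ : ζ.IsUniversal) (hζj : PreservedByFreeJoins ζ)
    (hp : Sat ar (discrete ar Unit) ζ) : Nonempty (Code ζ μ W) := by
  let := discrete ar W
  have hn : ∀ (s : Symb N) (v : Fin (ar s) → W), ¬ Holds ar s v := fun s v => id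
  have hiso : ∀ z ∉ (∅ : Set W), Isolated ar z := fun z _ s v hv => absurd hv (hn s v)
  have hocc : ∀ (K : Set (Symb N)) (A : Set W), occ ar K A = ∅ := fun K A =>
    Set.eq_empty_of_forall_notMem fun p ⟨_, v, hv, _⟩ => hn _ v hv
  have hf : FinOcc ar W := fun A => by rw [hocc]; exact Set.finite_empty
  have h0 : ∀ A : Finset W, 0 ≤ delta ar A := fun A => by
    rw [dl_nonneg_iff hf, dl, hocc]
    simp
  have hsy : IsSymm ar W := fun s v σ => iff_of_false (hn _ _) (hn _ _)
  refine ⟨∅, discrete ar W, fun s v hv => absurd hv (hn s v), hsy, models_of_isolated hζ hζj hp hsy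
    h0 hiso fun A hA => ?_, h0, muBound_of_isolated hf hiso fun k l S hS a r b _ hb hbf _ => ?_⟩
  · obtain rfl : A = ∅ := by
      rw [← Finset.coe_eq_empty]
      exact Set.subset_empty_iff.1 hA
    let := discrete ar Unit
    refine models_of_isEmb hζ (f := fun _ => ()) ⟨?_, fun s v => iff_of_false id fun h => ?_⟩ hp
    · rintro ⟨x, hx⟩
      simp at hx
    · exact hn s _ (((isEmb_val (subOf ar ((∅ : Finset W) : Set W))).2 s v).2 h)
  · rcases Nat.eq_zero_or_pos r with rfl | hr
    · exact Nat.zero_le _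
    · exact (hb ⟨0, hr⟩ ⟨0, hS.top_pos⟩).elim

variable [Infinite W]

theorem exists_notMem (A : Finset W) : ∃ x, x ∉ A := Infinite.exists_notMem_finset A

/-- A one-step algebraic extension can be realized in a stronger code. -/
theorem exists_algStep (hζ : ζ.IsUniversal) (hζj : PreservedByFreeJoins ζ) (hμ : IsMu μ)
    (p : Code ζ μ W) {n l : ℕ} {S : Ext ar n l} (hS : IsAlgStep ζ μ S) {b : Fin n → W}
    (hb : ∀ t, b t ∈ p.dom) (hbe : @IsEmb N ar _ _ p.str (baseStr S) b)
    (hbs : @Strong N ar W p.str (rng b) Set.univ) :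
    ∃ q, p ≤ q ∧ ∃ c : Fin l → W, (∀ t, c t ∈ q.dom) ∧ @IsEmb N ar _ _ q.str S (Sum.elim b c) ∧
      @Strong N ar W q.str (img (Sum.elim b c)) Set.univ := by
  have hinf : Infinite {x // x ∉ p.dom} := by
    have := (Finset.finite_toSet p.dom).infinite_compl
    exact this.to_subtype
  let g := Infinite.natEmbedding {x // x ∉ p.dom}
  let c' : Fin l → W := fun t => g t
  have hc' : Function.Injective c' := fun t t' h => Fin.ext (g.injective (Subtype.ext h))
  have hc'p : ∀ t, c' t ∉ p.dom := fun t => (g t).2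
  -- The points `c'` are isolated and are set aside as room for the new top. The rest `D` is strong,
  -- hence still satisfies the universal axioms, and `D ⊕ Fin l` is again in bijection with `W`.
  let D := {x // x ∉ Set.range c'}
  have hpD : ∀ x ∈ p.dom, x ∉ Set.range c' := by
    rintro _ hx ⟨t, rfl⟩
    exact hc'p t hx
  let b' : Fin n → D := fun t => ⟨b t, hpD _ (hb t)⟩
  let sp := p.str
  let sD := pull ar (Subtype.val : D → W)
  have hv : IsEmb ar (Subtype.val : D → W) := isEmb_pull Subtype.val_injective
  have hvs : StrongIn ar (Set.range (Subtype.val : D → W)) Set.univ := by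
    refine strongIn_of_isolated p.finOcc fun z hz => p.isolated fun hz' => hz ?_
    exact ⟨⟨z, hpD z hz'⟩, rfl⟩
  have h2D : AxiomTwo ζ μ D := hv.axiomTwo hζ p.axiomTwo hvs
  have hb'e : @IsEmb N ar _ _ _ (baseStr S) b' := by
    let := baseStr S
    exact hv.of_comp hbe
  have hb's : Strong ar (rng b') Set.univ := hv.strong_img_of_strong hbs
  have hds : ∀ {m : ℕ} {d : Fin m → D}, rng (Subtype.val ∘ d) = p.dom → Strong ar (rng d) Set.univ :=
    fun {m d} hd => hv.strong_img_of_strong (p.strong_of_dom_subset hd.ge)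
  let sE := adjoin S b'
  have h := adjoinFacts hζ (hv.isSymm p.symm) h2D.2.1 hS hb'e hb's
  -- Either the extension is realized in `D`, and only the domain has to grow, or the free join
  -- satisfies the `μ`-bound and becomes the new code after transport to `W`.
  rcases h.exists_emb_or_muBound hμ h2D.2.1 h2D.2.2 hS hb'e hb's with ⟨c, hc, hcs⟩ | hmb
  · refine ⟨p.enlarge (rng (Subtype.val ∘ c)), p.le_enlarge _, Subtype.val ∘ c, fun t =>
      Finset.mem_union_right _ (mem_rng.2 ⟨t, rfl⟩), ?_, ?_⟩
    · let := S
      have := hv.comp hc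
      rwa [Sum.comp_elim] at this
    · have h1 := hv.strong_img_of_strongIn p.finOcc hvs hcs
      rwa [Sum.comp_elim] at h1
  · have hφ : Function.Bijective (Sum.elim Subtype.val c' : D ⊕ Fin l → W) := by
      refine ⟨Subtype.val_injective.sumElim hc' fun x t hx => x.2 ⟨t, hx.symm⟩, fun x => ?_⟩
      by_cases hx : x ∈ Set.range c'
      · obtain ⟨t, rfl⟩ := hx
        exact ⟨Sum.inr t, rfl⟩
      · exact ⟨Sum.inl ⟨x, hx⟩, rfl⟩
    let φ := Equiv.ofBijective _ hφ
    let sq : (lang ar).Structure W := pull ar φ.symm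
    have hqe : @IsEmb N ar _ _ sE sq φ.symm := isEmb_pull φ.symm.injective
    have hqφ : @IsEmb N ar _ _ sq sE φ :=
      @IsEmb.of_rightInverse _ _ _ _ sE sq _ _ hqe φ.symm_apply_apply
    have hagree : ∀ (s : Symb N) (w : Fin (ar s) → D),
        @Holds N ar W sq s (Subtype.val ∘ w) ↔ @Holds N ar W sp s (Subtype.val ∘ w) := fun s w =>
      (hqφ.2 s (Sum.inl ∘ w)).trans ((h.emb_left.2 s w).trans (hv.2 s w).symm)
    have hag : Agree sp sq p.dom := fun s v hvd =>
      (hagree s fun j => ⟨v j, hpD _ (hvd j)⟩).symm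
    have h2E : @AxiomTwo N ar ζ μ _ sE := h.axiomTwo hζ hζj h2D.1 hmb
    let q : Code ζ μ W :=
      { dom := p.dom ∪ rng c'
        str := sq
        supp := by
          intro s v hvq j
          have h1 : Holds ar s (φ.symm ∘ v) := hvq
          have h3 : v = φ ∘ φ.symm ∘ v := by
            rw [← Function.comp_assoc, Equiv.self_comp_symm, Function.id_comp]
          rcases holds_adjoin.1 h1 with ⟨w, hw, he⟩ | ⟨w, hw, -, he⟩
          · rw [h3, he]
            exact Finset.mem_union_left _ (p.supp s _ hw j)
          · rw [h3, he]
            change φ (Sum.map b' id (w j)) ∈ _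
            rcases w j with t | t
            · exact Finset.mem_union_left _ (hb t)
            · exact Finset.mem_union_right _ (mem_rng.2 ⟨t, rfl⟩)
        symm := @IsEmb.isSymm _ _ _ _ sE sq _ hqe h.symm
        axiomTwo := @IsEmb.axiomTwo _ _ _ _ _ _ sq sE _ hqe hζ h2E (by
          rw [φ.symm.surjective.range_eq]
          intro X _
          simp [cap]) }
    refine ⟨q, ⟨Finset.subset_union_left, hag, ?_⟩, c', fun t =>
      Finset.mem_union_right _ (mem_rng.2 ⟨t, rfl⟩), ?_, ?_⟩
    · obtain ⟨A, hA⟩ : ∃ A : Finset D, A.image Subtype.val = p.dom :=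
        exists_image_eq fun x hx => ⟨⟨x, hpD x hx⟩, rfl⟩
      obtain ⟨m, d, -, rfl⟩ := exists_enum A
      have hd : rng (Subtype.val ∘ d) = p.dom := by
        rw [← hA]
        ext; simp
      have h3 := (@IsEmb.strong_img_univ _ _ _ _ _ sE sq _ _ hqφ φ.surjective _).2
        (h.emb_left.strong_img_of_strongIn h.finOcc h.strong_left (hds hd))
      rw [← hd]
      exact h3
    · let := S
      have := @IsEmb.comp _ _ _ _ _ sq sE _ _ _ hqφ h.emb_right
      convert this using 1
      funext x
      rcases x with x | x <;> rfl
    · have h1 := (strong_iff_strongIn h.finOcc).2 ⟨Set.subset_univ _, h.strong_right⟩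
      have h3 := (@IsEmb.strong_img_univ _ _ _ _ _ sE sq _ _ hqφ φ.surjective _).2 h1
      convert h3 using 1
      congr 1
      funext x
      rcases x with x | x <;> rfl

end Code

/-! ### The generic as the union of a sufficiently generic ideal of codes -/

section Existence

variable {ζ : (lang ar).Theory} {μ : MuFun ar}

/-- Members of the class carry finitely many relations, so such an extension is determined by a
finite set of occurrences, of which there are countably many. -/
instance countable_isAlgStep (n l : ℕ) : Countable {S : Ext ar n l // IsAlgStep ζ μ S} := by
  let F : {S : Ext ar n l // IsAlgStep ζ μ S} → Set (Symb N × Multiset (Fin n ⊕ Fin l)) :=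
    fun S => @occ N ar _ S.1 Set.univ Set.univ
  have hF : ∀ S, (F S).Finite := fun S => by
    have := S.2.finOcc Finset.univ
    rwa [Finset.coe_univ] at this
  have hinj : Function.Injective fun S => (hF S).toFinset := by
    intro S S' h
    have h' : F S = F S' := by simpa using h
    refine Subtype.ext (structure_ext fun s v => ?_)
    have key : ∀ S S' : {S : Ext ar n l // IsAlgStep ζ μ S}, F S = F S' →
        @Holds N ar _ S.1 s v → @Holds N ar _ S'.1 s v := by
      intro S S' h hv
      have h1 : (s, Finset.univ.val.map v) ∈ F S := ⟨trivial, v, hv, fun _ => trivial, rfl⟩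
      rw [h] at h1
      obtain ⟨-, w, hw, -, he⟩ := h1
      exact @holds_of_map_eq _ _ _ S'.1 S'.2.symm _ _ _ he.symm hw
    exact ⟨key S S' h', key S' S h'.symm⟩
  exact hinj.countable

variable {W : Type u}

namespace Code

/-- The union of a directed set of codes. -/
@[reducible] def union (I : Order.Ideal (Code ζ μ W)) : (lang ar).Structure W where
  funMap g := Empty.elim g
  RelMap r v := ∃ p ∈ I, p.str.RelMap r v

theorem agree_union {I : Order.Ideal (Code ζ μ W)} {p : Code ζ μ W} (hp : p ∈ I) :
    Agree p.str (union I) p.dom := fun s v hv => by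
  refine ⟨fun h => ⟨p, hp, h⟩, ?_⟩
  rintro ⟨q, hq, h⟩
  obtain ⟨r, -, hpr, hqr⟩ := I.directed p hp q hq
  exact (hpr.2.1 s v hv).2 ((hqr.2.1 s v (q.supp s v h)).1 h)

/-- Strongness is tested on finite sets, and each of them lies in the domain of a code above `p`,
where `p.dom` is strong. -/
theorem strong_union {I : Order.Ideal (Code ζ μ W)} (hI : ∀ A : Finset W, ∃ p ∈ I, A ⊆ p.dom)
    {p : Code ζ μ W} (hp : p ∈ I) : @Strong N ar W (union I) p.dom Set.univ := by
  let := union I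
  refine ⟨Set.subset_univ _, fun X hX _ => ?_⟩
  obtain ⟨q, hq, hXq⟩ := hI X
  obtain ⟨r, hr, hpr, hqr⟩ := I.directed p hp q hq
  have hXr : (X : Set W) ⊆ r.dom := Finset.coe_subset.2 (hXq.trans hqr.1)
  rw [← (agree_union hr).delta_eq hXr,
    ← (agree_union hr).delta_eq (Finset.coe_subset.2 hpr.1)]
  exact hpr.2.2.2 X hX (Set.subset_univ _)

/-- Whether a subset of `p.dom` is strong is thus settled at `p`, and a task that is vacuous at `p`
remains so in the union. -/
theorem strong_iff_union {I : Order.Ideal (Code ζ μ W)} (hI : ∀ A : Finset W, ∃ p ∈ I, A ⊆ p.dom)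
    (h0 : ∀ A : Finset W, 0 ≤ @delta N ar W (union I) A)
    {p : Code ζ μ W} (hp : p ∈ I) {A : Finset W} (hA : A ⊆ p.dom) :
    @Strong N ar W p.str A Set.univ ↔ @Strong N ar W (union I) A Set.univ := by
  constructor
  · intro h
    have h1 : @Strong N ar W p.str A p.dom := by
      let := p.str
      exact h.mono (by exact_mod_cast hA) (Set.subset_univ _)
    rw [(agree_union hp).strong_iff subset_rfl] at h1
    let := union I
    exact h1.trans (finOcc_of_nonneg h0) (strong_union hI hp)
  · intro h
    have h1 : @Strong N ar W (union I) A p.dom := by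
      let := union I
      exact h.mono (by exact_mod_cast hA) (Set.subset_univ _)
    rw [← (agree_union hp).strong_iff subset_rfl] at h1
    let := p.str
    exact h1.trans p.finOcc (p.strong_of_dom_subset subset_rfl)

end Code

/-- The tasks in the construction of the generic: realize a one-step extension over a tuple, or
capture a finite set and an isolated point outside it. -/
abbrev Task (ζ : (lang ar).Theory) (μ : MuFun ar) (W : Type u) : Type u :=
  (Σ n l : ℕ, {S : Ext ar n l // IsAlgStep ζ μ S} × (Fin n → W)) ⊕ Finset W

/-- The codes in which a task is done. -/
def Done : Task ζ μ W → Set (Code ζ μ W)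
  | .inl ⟨_, l, S, b⟩ => {p | (∀ t, b t ∈ p.dom) ∧ (@IsEmb N ar _ _ p.str (baseStr S.1) b →
      @Strong N ar W p.str (rng b) Set.univ → ∃ c : Fin l → W, (∀ t, c t ∈ p.dom) ∧
        @IsEmb N ar _ _ p.str S.1 (Sum.elim b c) ∧
        @Strong N ar W p.str (img (Sum.elim b c)) Set.univ)}
  | .inr A => {p | A ⊆ p.dom ∧ ∃ x ∈ p.dom, x ∉ A ∧ @Isolated N ar W p.str x}

theorem isCofinal_done [Infinite W] (hζ : ζ.IsUniversal) (hζj : PreservedByFreeJoins ζ)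
    (hμ : IsMu μ) (t : Task ζ μ W) : IsCofinal (Done t) := by
  intro p
  rcases t with ⟨n, l, S, b⟩ | A
  · have hb : ∀ t, b t ∈ (p.enlarge (rng b)).dom := fun t =>
      Finset.mem_union_right _ (mem_rng.2 ⟨t, rfl⟩)
    by_cases h : @IsEmb N ar _ _ p.str (baseStr S.1) b ∧ @Strong N ar W p.str (rng b) Set.univ
    · obtain ⟨q, hq, hc⟩ := (p.enlarge (rng b)).exists_algStep hζ hζj hμ S.2 hb h.1 h.2
      exact ⟨q, ⟨fun t => hq.1 (hb t), fun _ _ => hc⟩, (p.le_enlarge _).trans hq⟩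
    · exact ⟨p.enlarge (rng b), ⟨hb, fun h1 h2 => absurd ⟨h1, h2⟩ h⟩, p.le_enlarge _⟩
  · obtain ⟨x, hx⟩ := Code.exists_notMem (p.dom ∪ A)
    rw [Finset.mem_union, not_or] at hx
    exact ⟨p.enlarge (insert x A), ⟨fun y hy => Finset.mem_union_right _
      (Finset.mem_insert_of_mem hy), x, Finset.mem_union_right _ (Finset.mem_insert_self _ _),
      hx.2, p.isolated hx.1⟩, p.le_enlarge _⟩

theorem exists_isGeneric_on [Infinite W] [Countable W] (hζ : ζ.IsUniversal) (hζj : PreservedByFreeJoins ζ)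
    (hp : Sat ar (discrete ar Unit) ζ) (hμ : IsMu μ) :
    ∃ _ : (lang ar).Structure W, IsGeneric ζ μ W := by
  obtain ⟨p₀⟩ := Code.nonempty (W := W) (μ := μ) hζ hζj hp
  have : Countable (Task ζ μ W) := inferInstance
  let := Encodable.ofCountable (Task ζ μ W)
  -- There are countably many tasks and each can be done above any code, so some ideal of codes does
  -- all of them.
  let I := Order.idealOfCofinals p₀ fun t : Task ζ μ W => ⟨Done t, isCofinal_done hζ hζj hμ t⟩
  have hmeet : ∀ t : Task ζ μ W, ∃ p ∈ Done t, p ∈ I := fun t =>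
    Order.cofinal_meets_idealOfCofinals p₀
      (fun t : Task ζ μ W => ⟨Done t, isCofinal_done hζ hζj hμ t⟩) t
  have hI : ∀ A : Finset W, ∃ p ∈ I, A ⊆ p.dom := fun A => by
    obtain ⟨p, hp, hpI⟩ := hmeet (.inr A)
    exact ⟨p, hpI, hp.1⟩
  let sI := Code.union I
  have h0 : ∀ A : Finset W, 0 ≤ delta ar A := fun A => by
    obtain ⟨p, hpI, hA⟩ := hI A
    rw [← (Code.agree_union hpI).delta_eq (Finset.coe_subset.2 hA)]
    exact p.axiomTwo.2.1 A
  have hf := finOcc_of_nonneg h0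
  have hsy : IsSymm ar W := by
    rintro s v σ
    refine exists_congr fun p => and_congr_right fun _ => ?_
    exact p.symm s v σ
  have h2 : AxiomTwo ζ μ W := by
    refine axiomTwo_of_strong hζ h0 fun A hA => ?_
    obtain ⟨p, hpI, hAp⟩ := hI A
    have h1 := (Code.strong_iff_union hI h0 hpI hAp).2 hA
    have h3 : @InClass N ar W p.str ζ μ A := by
      let := p.str
      exact inClass_of_axiomTwo hζ p.axiomTwo h1
    refine Agree.inClass (fun s v hv => ?_) hζ h3
    exact Code.agree_union hpI s v fun j => hAp (hv j)
  refine ⟨sI, isGeneric_of_closed hζ hsy h2 ?_ ?_⟩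
  · intro n l S hS b hb hbs
    obtain ⟨p, ⟨hbp, hpd⟩, hpI⟩ := hmeet (.inl ⟨n, l, ⟨S, hS⟩, b⟩)
    have hbp' : rng b ⊆ p.dom := Finset.coe_subset.1 (rng_subset.2 hbp)
    obtain ⟨c, hc, hce, hcs⟩ := hpd
      (@Agree.isEmb _ _ _ _ _ _ (Code.agree_union hpI).symm _ (baseStr S) _ hbp hb)
      ((Code.strong_iff_union hI h0 hpI hbp').2 hbs)
    have hbc : ∀ x, Sum.elim b c x ∈ p.dom := by rintro (t | t); exacts [hbp t, hc t]
    refine ⟨c, @Agree.isEmb _ _ _ _ _ _ (Code.agree_union hpI) _ S _ hbc hce, ?_⟩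
    refine (Code.strong_iff_union hI h0 hpI ?_).1 hcs
    intro z hz
    obtain ⟨x, -, rfl⟩ := Finset.mem_image.1 hz
    exact hbc x
  · intro B hB
    obtain ⟨p, ⟨hBp, x, hxp, hxB, hxi⟩, hpI⟩ := hmeet (.inr B)
    have hins : insert x B ⊆ p.dom := Finset.insert_subset hxp hBp
    have hag := Code.agree_union hpI
    have hd : ∀ Z : Finset W, x ∉ Z → Z ⊆ p.dom →
        dl ar Set.univ (insert x Z) = dl ar Set.univ Z + 1 := fun Z hxZ hZp => by
      have h1 := @dl_insert_isolated N ar W p.str p.finOcc Set.univ x hxi Z hxZ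
      unfold dl at h1 ⊢
      rwa [hag.occ_eq _ (Finset.coe_subset.2 (Finset.insert_subset hxp hZp)),
        hag.occ_eq _ (Finset.coe_subset.2 hZp)] at h1
    -- It suffices to be strong in `p.dom`, which is strong in the union. There `x` is isolated, so
    -- removing it from a set costs exactly one.
    refine ⟨x, hxB, Strong.trans hf ?_ (Code.strong_union hI hpI), hd B hxB hBp⟩
    rw [strong_iff hf]
    refine ⟨Finset.coe_subset.2 hins, fun X hX hXp => ?_⟩
    have hxX : x ∈ X := hX (Finset.mem_insert_self _ _)
    have h1 := hd (X.erase x) (Finset.notMem_erase _ _)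
      ((Finset.erase_subset _ _).trans (Finset.coe_subset.1 hXp))
    have h3 := ((strong_iff hf).1 hB).2 (X.erase x) (fun z hz => Finset.mem_erase.2
      ⟨fun h => hxB (h ▸ hz), hX (Finset.mem_insert_of_mem hz)⟩) (Set.subset_univ _)
    rw [Finset.insert_erase hxX] at h1
    rw [h1, hd B hxB hBp]
    omega

theorem exists_isGeneric (hζ : ζ.IsUniversal) (hζj : PreservedByFreeJoins ζ)
    (hp : Sat ar (discrete ar Unit) ζ) (hμ : IsMu μ) :
    ∃ (M : Type u) (_ : (lang ar).Structure M), IsGeneric ζ μ M :=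
  ⟨ULift.{u} ℕ, exists_isGeneric_on hζ hζj hp hμ⟩

end Existence

/-! ## Changing the base of an extension -/

section Rebase

theorem occ_diff_congr {X : Type*} {S S' : (lang ar).Structure X} {A B T : Finset X}
    (h : ∀ (s : Symb N) (v : Fin (ar s) → X), (∃ j, v j ∈ B) →
      (@Holds N ar X S s v ↔ @Holds N ar X S' s v)) (hT : T ⊆ B) (K : Set (Symb N)) :
    @occ N ar X S K ((A ∪ T : Finset X) : Set X) \ @occ N ar X S K (A : Set X) =
      @occ N ar X S' K ((A ∪ T : Finset X) : Set X) \ @occ N ar X S' K (A : Set X) := by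
  have key : ∀ S S' : (lang ar).Structure X, (∀ (s : Symb N) (v : Fin (ar s) → X),
      (∃ j, v j ∈ B) → (@Holds N ar X S s v ↔ @Holds N ar X S' s v)) → ∀ p,
      p ∈ @occ N ar X S K ((A ∪ T : Finset X) : Set X) \ @occ N ar X S K (A : Set X) →
      p ∈ @occ N ar X S' K ((A ∪ T : Finset X) : Set X) \ @occ N ar X S' K (A : Set X) := by
    intro S S' h p hp
    obtain ⟨⟨hK, v, hv, hvA, hpv⟩, x, hx, hxA⟩ := (@mem_occ_diff _ _ _ S _ _ _ _).1 hp
    refine (@mem_occ_diff _ _ _ S' _ _ _ _).2 ⟨⟨hK, v, (h _ v ?_).1 hv, hvA, hpv⟩, x, hx, hxA⟩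
    rw [hpv] at hx
    obtain ⟨j, -, rfl⟩ := Multiset.mem_map.1 hx
    exact ⟨j, hT ((Finset.mem_union.1 (hvA j)).resolve_left hxA)⟩
  exact Set.Subset.antisymm (key S S' h) (key S' S fun s v hv => (h s v hv).symm)

/-- Only differences of predimensions matter, and these count only relations with an entry in the
top. The relations on the base may therefore be exchanged, as long as there are finitely many. -/
theorem simplyAlg_congr {X : Type*} {S S' : (lang ar).Structure X} {A B : Finset X}
    (h : ∀ (s : Symb N) (v : Fin (ar s) → X), (∃ j, v j ∈ B) →
      (@Holds N ar X S s v ↔ @Holds N ar X S' s v)) (hS : @FinOcc N ar X S)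
    (hS' : @FinOcc N ar X S') (hAB : @SimplyAlg N ar X S A B) : @SimplyAlg N ar X S' A B := by
  rw [@simplyAlg_iff _ _ _ S hS] at hAB
  rw [@simplyAlg_iff _ _ _ S' hS']
  have key : ∀ T ⊆ B, @dl N ar X S Set.univ (A ∪ T) - @dl N ar X S Set.univ A =
      @dl N ar X S' Set.univ (A ∪ T) - @dl N ar X S' Set.univ A := fun T hT => by
    rw [@dl_sub_dl _ _ _ S hS _ _ _ Finset.subset_union_left,
      @dl_sub_dl _ _ _ S' hS' _ _ _ Finset.subset_union_left, occ_diff_congr h hT]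
  refine ⟨hAB.1, hAB.2.1, ?_, fun T hT h1 h2 => ?_⟩
  · have := key B subset_rfl
    have := hAB.2.2.1
    omega
  · have := key T hT
    have := hAB.2.2.2 T hT h1 h2
    omega

theorem minSimplyAlg_congr {X : Type*} {S S' : (lang ar).Structure X} {A B : Finset X}
    (h : ∀ (s : Symb N) (v : Fin (ar s) → X), (∃ j, v j ∈ B) →
      (@Holds N ar X S s v ↔ @Holds N ar X S' s v)) (hS : @FinOcc N ar X S)
    (hS' : @FinOcc N ar X S') (hAB : @MinSimplyAlg N ar X S A B) :
    @MinSimplyAlg N ar X S' A B :=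
  ⟨simplyAlg_congr h hS hS' hAB.1, fun A' hA' h' => hAB.2 A' hA'
    (simplyAlg_congr (fun s v hv => (h s v hv).symm) hS' hS h')⟩

theorem SameRelType.symm {k l : ℕ} {S S' : Ext ar k l} (h : SameRelType S S') :
    SameRelType S' S := fun s v hv => (h s v hv).symm

theorem SameRelType.congr {k l : ℕ} {S S' : Ext ar k l} (h : SameRelType S S') (s : Symb N)
    (v : Fin (ar s) → Fin k ⊕ Fin l) (hv : ∃ j, v j ∈ topSet k l) :
    @Holds N ar _ S s v ↔ @Holds N ar _ S' s v := h s v (exists_inr_iff.1 hv)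

theorem SameRelType.isMSAExt {k l : ℕ} {S S' : Ext ar k l} (h : SameRelType S S')
    (hS : IsMSAExt S) (hS' : @IsSymm N ar _ S') (hf : @FinOcc N ar _ S') : IsMSAExt S' :=
  ⟨hS', minSimplyAlg_congr h.congr hS.finOcc hf hS.2⟩

/-- Replace the structure on the base of an extension. -/
@[reducible] def rebase {k l : ℕ} (S : Ext ar k l) (R : (lang ar).Structure (Fin k)) :
    Ext ar k l where
  funMap g := Empty.elim g
  RelMap r v := (S.RelMap r v ∧ ∃ j y, v j = Sum.inr y) ∨ ∃ w, v = Sum.inl ∘ w ∧ R.RelMap r w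

variable {k l : ℕ} {S : Ext ar k l} {R : (lang ar).Structure (Fin k)}

theorem holds_rebase {s : Symb N} {v : Fin (ar s) → Fin k ⊕ Fin l} :
    @Holds N ar _ (rebase S R) s v ↔ (@Holds N ar _ S s v ∧ ∃ j y, v j = Sum.inr y) ∨
      ∃ w, v = Sum.inl ∘ w ∧ @Holds N ar _ R s w := Iff.rfl

theorem sameRelType_rebase : SameRelType (rebase S R) S := by
  rintro s v ⟨j, y, hj⟩
  rw [holds_rebase]
  constructor
  · rintro (h | ⟨w, rfl, -⟩)
    · exact h.1
    · simp at hj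
  · exact fun h => Or.inl ⟨h, j, y, hj⟩

theorem holds_rebase_inl {s : Symb N} {w : Fin (ar s) → Fin k} :
    @Holds N ar _ (rebase S R) s (Sum.inl ∘ w) ↔ @Holds N ar _ R s w := by
  rw [holds_rebase]
  constructor
  · rintro (⟨-, j, y, hj⟩ | ⟨w', hw, h⟩)
    · simp at hj
    · rwa [Sum.inl_injective.comp_left hw]
  · exact fun h => Or.inr ⟨w, rfl, h⟩

theorem baseStr_rebase : baseStr (rebase S R) = R :=
  structure_ext fun _ _ => holds_rebase_inl

theorem isSymm_rebase (hS : @IsSymm N ar _ S) (hR : @IsSymm N ar _ R) :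
    @IsSymm N ar _ (rebase S R) := by
  intro s v σ
  by_cases h : ∃ j y, v j = Sum.inr y
  · have h' : ∃ j y, (v ∘ σ) j = Sum.inr y := by
      obtain ⟨j, y, hj⟩ := h
      exact ⟨σ.symm j, y, by simpa using hj⟩
    rw [sameRelType_rebase s _ h, sameRelType_rebase s _ h']
    exact hS s v σ
  · obtain ⟨w, rfl⟩ := eq_inl_comp_of_forall h
    rw [Function.comp_assoc, holds_rebase_inl, holds_rebase_inl]
    exact hR s w σ

theorem finOcc_of_parts {T : Ext ar k l} (hS : @FinOcc N ar _ S) (hT : SameRelType T S)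
    (hR : @FinOcc N ar _ (baseStr T)) : @FinOcc N ar _ T := by
  intro A
  have h1 := @FinOcc.finite _ _ _ S hS Set.univ A
  have h2 := (@FinOcc.finite _ _ _ (baseStr T) hR Set.univ Finset.univ).image
    (fun q : Symb N × Multiset (Fin k) => (q.1, q.2.map (Sum.inl : Fin k → Fin k ⊕ Fin l)))
  refine (h1.union h2).subset ?_
  rintro ⟨s, u⟩ ⟨hs, v, hv, hA, hu⟩
  by_cases h : ∃ j y, v j = Sum.inr y
  · exact Or.inl ⟨hs, v, (hT s v h).1 hv, hA, hu⟩
  · obtain ⟨w, hw⟩ := eq_inl_comp_of_forall h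
    refine Or.inr ⟨(s, Finset.univ.val.map w), ⟨trivial, w, ?_, fun _ =>
      Finset.mem_coe.2 (Finset.mem_univ _), rfl⟩, Prod.ext rfl ?_⟩
    · rw [hw] at hv
      exact hv
    · change (Finset.univ.val.map w).map Sum.inl = u
      rw [Multiset.map_map, ← hw]
      exact hu.symm

theorem finOcc_rebase (hS : @FinOcc N ar _ S) (hR : @FinOcc N ar _ R) :
    @FinOcc N ar _ (rebase S R) :=
  finOcc_of_parts hS sameRelType_rebase (by rw [baseStr_rebase]; exact hR)

theorem isMSAExt_rebase (hS : IsMSAExt S) (hR : @IsSymm N ar _ R) (hRf : @FinOcc N ar _ R) :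
    IsMSAExt (rebase S R) :=
  sameRelType_rebase.symm.isMSAExt hS (isSymm_rebase hS.1 hR) (finOcc_rebase hS.finOcc hRf)

theorem SameRelType.restrictBase {n k l : ℕ} {S S' : Ext ar n l} (h : SameRelType S S')
    (α : Fin k → Fin n) : SameRelType (restrictBase S α) (restrictBase S' α) := by
  rintro s v ⟨j, y, hj⟩
  exact h s (Sum.map α id ∘ v) ⟨j, y, by simp [hj]⟩

end Rebase

/-! ## Transfer of `g` and `μ` along partial isomorphisms in finite sublanguages -/

section Transfer

theorem gval_le {E : Type*} [(lang ar).Structure E] (hf : FinOcc ar E) {D : Set E} {A : Finset E}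
    {j : ℕ} (h : Weak ar D A j) : gval ar D A ≤ j := by
  rw [gval_eq hf]
  exact iInf₂_le j h

theorem weak_of_gval_eq {E : Type*} [(lang ar).Structure E] (hf : FinOcc ar E) {D : Set E}
    {A : Finset E} {j : ℕ} (h : gval ar D A = j) : Weak ar D A j := by
  by_contra hn
  have h1 : ((j + 1 : ℕ) : ℕ∞) ≤ gval ar D A ∨ ∃ i < j, Weak ar D A i := by
    by_contra hc
    push Not at hc
    obtain ⟨h2, h3⟩ := hc
    refine absurd h2 (not_lt.2 ?_)
    rw [gval_eq hf]
    refine le_iInf₂ fun i hi => ?_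
    have h4 : i ≠ j := fun h => hn (h ▸ hi)
    have h5 : ¬ i < j := fun h => h3 i h hi
    exact_mod_cast (by omega : j + 1 ≤ i)
  rcases h1 with h1 | ⟨i, hi, hw⟩
  · rw [h] at h1
    have : j + 1 ≤ j := by exact_mod_cast h1
    omega
  · have h2 := gval_le hf hw
    rw [h] at h2
    have : j ≤ i := by exact_mod_cast h2
    omega

theorem le_gval {E : Type*} [(lang ar).Structure E] (hf : FinOcc ar E) {D : Set E} {A : Finset E}
    {c : ℕ∞} (h : ∀ j : ℕ, Weak ar D A j → c ≤ j) : c ≤ gval ar D A := by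
  rw [gval_eq hf]
  exact le_iInf₂ h

variable {E E' : Type*} [(lang ar).Structure E] [(lang ar).Structure E'] {ι : Type*}

/-- The tuples have the same type in the first `m` relations, and the extensions of the second
tuple by at most `j` points are realized over the first. -/
def Matches (ar : Symb N → ℕ) [(lang ar).Structure E] [(lang ar).Structure E'] (m j : ℕ)
    (u₀ : ι → E) (u : ι → E') : Prop :=
  SameTp ar (firstSymb N m) u₀ u ∧ ∀ X' : Finset E', X'.card ≤ j → ∃ (q : ℕ) (z : Fin q → E)
    (z' : Fin q → E'), SameTp ar (firstSymb N m) (Sum.elim u₀ z) (Sum.elim u z') ∧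
      (X' : Set E') ⊆ Set.range (Sum.elim u z')

/-- The value of `g` on `F` is at most `m` if it is finite, and then it is witnessed in `P`. -/
def Witnessed (ar : Symb N → ℕ) [(lang ar).Structure E] (m : ℕ) (P : Set E) (F : Finset E) : Prop :=
  ∀ j : ℕ, gval ar Set.univ F = j → j ≤ m ∧ Weak ar P F j

theorem Witnessed.mono {m m' : ℕ} {P P' : Set E} {F : Finset E} (h : Witnessed ar m P F)
    (hm : m ≤ m') (hP : P ⊆ P') : Witnessed ar m' P' F := fun j hj => by
  obtain ⟨h1, X, h2, h3, h4⟩ := h j hj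
  exact ⟨h1.trans hm, X, h2, h3.trans hP, h4⟩

theorem exists_witnessed (hf : FinOcc ar E) (F : Finset E) :
    ∃ (m : ℕ) (P : Finset E), Witnessed ar m (P : Set E) F := by
  by_cases h : ∃ j : ℕ, gval ar Set.univ F = j
  · obtain ⟨j, hj⟩ := h
    obtain ⟨X, h2, -, h4⟩ := weak_of_gval_eq hf hj
    refine ⟨j, X, fun i hi => ?_⟩
    have : j = i := by
      rw [hj] at hi
      exact_mod_cast hi
    subst this
    exact ⟨le_rfl, X, h2, subset_rfl, h4⟩
  · exact ⟨0, ∅, fun j hj => absurd ⟨j, hj⟩ h⟩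

theorem firstSymb_mono {m m' : ℕ} (h : m ≤ m') : firstSymb N m ⊆ firstSymb N m' :=
  fun _ hs => lt_of_lt_of_le hs h

theorem exists_firstSymb {K : Set (Symb N)} (hK : K.Finite) : ∃ m, K ⊆ firstSymb N m := by
  obtain ⟨m, hm⟩ := (hK.image Subtype.val).bddAbove
  exact ⟨m + 1, fun s hs => Nat.lt_succ_of_le (hm ⟨s, hs, rfl⟩)⟩

theorem SameTp.weak {m j : ℕ} (hj : j ≤ m) {p : ℕ} {u₀ : ι → E} {u : ι → E'}
    (h : SameTp ar (firstSymb N m) u₀ u) {ξ : Fin p → ι}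
    (hw : Weak ar (Set.range u₀) (rng (u₀ ∘ ξ)) j) : Weak ar Set.univ (rng (u ∘ ξ)) j := by
  obtain ⟨X, h1, h2, h3, h4⟩ := hw
  have : ∀ x : X, ∃ i, u₀ i = x := fun x => h2 x.2
  choose τ hτ using this
  let T : Finset ι := Finset.univ.image τ
  have hTX : T.image u₀ = X := by
    ext y
    simp only [T, Finset.mem_image, Finset.mem_univ, true_and, exists_exists_eq_and]
    constructor
    · rintro ⟨x, rfl⟩
      rw [hτ]
      exact x.2
    · exact fun hy => ⟨⟨y, hy⟩, hτ _⟩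
  have hξ : ∀ v : ι → E, (rng ξ).image v = rng (v ∘ ξ) := fun v => by ext; simp
  have hξ' : (rng ξ).image u = rng (u ∘ ξ) := by ext; simp
  refine ⟨T.image u, ?_, Set.subset_univ _, ?_, ?_⟩
  · intro y hy
    obtain ⟨t, rfl⟩ := mem_rng.1 hy
    have h5 : u₀ (ξ t) ∈ T.image u₀ := hTX ▸ h1 (mem_rng.2 ⟨t, rfl⟩)
    obtain ⟨i, hi, hi'⟩ := Finset.mem_image.1 h5
    exact Finset.mem_image.2 ⟨i, hi, (h.1 _ _).1 hi'⟩
  · rw [← h.card_image, ← hξ', ← h.card_image, hξ, hTX]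
    exact h3
  · rw [← hξ', ← h.dl_image (firstSymb_mono hj), ← h.dl_image (firstSymb_mono hj), hξ, hTX]
    exact h4

/-- A finite value has a witness inside the tuple, which transfers. A witness of bound at most `m'`
on the other side has at most `p + m'` points and is pulled back by the matching. If the value is
infinite, the same pull-back excludes all witnesses of bound below `m'`. -/
theorem Matches.gval_eq (hf : FinOcc ar E) (hf' : FinOcc ar E') {m m' p : ℕ} {u₀ : ι → E}
    {u : ι → E'} (h : Matches ar m (p + m') u₀ u) (hm : m' ≤ m) (ξ : Fin p → ι)
    (hw : Witnessed ar m' (Set.range u₀) (rng (u₀ ∘ ξ))) :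
    gval ar Set.univ (rng (u ∘ ξ)) = gval ar Set.univ (rng (u₀ ∘ ξ)) ∨
      gval ar Set.univ (rng (u₀ ∘ ξ)) = ⊤ ∧ (m' : ℕ∞) ≤ gval ar Set.univ (rng (u ∘ ξ)) := by
  have back : ∀ j ≤ m', Weak ar Set.univ (rng (u ∘ ξ)) j →
      gval ar Set.univ (rng (u₀ ∘ ξ)) ≤ j := by
    rintro j hj ⟨X, h1, -, h3, h4⟩
    have hp : (rng (u ∘ ξ)).card ≤ p := by
      simpa using Finset.card_image_le (s := Finset.univ) (f := u ∘ ξ)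
    obtain ⟨q, z, z', hz, hX⟩ := h.2 X (by omega)
    refine gval_le hf ?_
    have h5 := hz.symm.weak (ξ := Sum.inl ∘ ξ) (hj.trans hm) ⟨X, h1, fun x hx => ?_, h3, h4⟩
    · exact h5
    · exact hX hx
  by_cases ht : gval ar Set.univ (rng (u₀ ∘ ξ)) = ⊤
  · refine Or.inr ⟨ht, le_gval hf' fun j hj => ?_⟩
    by_contra hn
    have hn' : j < m' := by exact_mod_cast not_le.1 hn
    have h1 := back j hn'.le hj
    rw [ht] at h1
    simp at h1
  · obtain ⟨j, hj⟩ := ENat.ne_top_iff_exists.1 ht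
    obtain ⟨hjm, hjw⟩ := hw j hj.symm
    left
    rw [← hj]
    refine le_antisymm (gval_le hf' (h.1.weak (hjm.trans hm) hjw)) (le_gval hf' fun i hi => ?_)
    by_cases him : i ≤ m'
    · rw [hj]
      exact back i him hi
    · exact_mod_cast (by omega : j ≤ i)

/-- In the second case both arguments lie where `μ` is constant. -/
theorem mu_eq_of_gval {μ : MuFun ar} {p q : ℕ} {S : Ext ar p q} {m' : ℕ}
    (hS : ∀ j : ℕ, m' ≤ j → μ p q S j = μ p q S ⊤) {g g' : ℕ∞}
    (h : g' = g ∨ g = ⊤ ∧ (m' : ℕ∞) ≤ g') : μ p q S g' = μ p q S g := by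
  rcases h with rfl | ⟨rfl, h⟩
  · rfl
  · induction g' using ENat.recTopCoe with
    | top => rfl
    | coe j => exact hS j (by exact_mod_cast h)

/-- The values `μ(S, j)` are constant for `j ≥ m`, and depend only on the first `m` relations of
the base. -/
def Stable (μ : MuFun ar) {p q : ℕ} (S : Ext ar p q) (m : ℕ) : Prop :=
  (∀ j : ℕ, m ≤ j → μ p q S j = μ p q S ⊤) ∧
    ∀ S' : Ext ar p q, IsMSAExt S' → SameRelType S' S → SameBaseType (firstSymb N m) S' S →
      ∀ g : ℕ∞, μ p q S' g = μ p q S g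

theorem Stable.mono {μ : MuFun ar} {p q : ℕ} {S : Ext ar p q} {m m' : ℕ} (h : Stable μ S m)
    (hm : m ≤ m') : Stable μ S m' :=
  ⟨fun j hj => h.1 j (hm.trans hj), fun S' h1 h2 h3 => h.2 S' h1 h2 fun s hs =>
    h3 s (firstSymb_mono hm hs)⟩

theorem IsMu.exists_stable {μ : MuFun ar} (hμ : IsMu μ) {p q : ℕ} {S : Ext ar p q}
    (hS : IsMSAExt S) : ∃ m, Stable μ S m := by
  obtain ⟨K, hK, h1⟩ := hμ.determined p q S hS
  obtain ⟨m₁, hm₁⟩ := exists_firstSymb hK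
  have h2 := hμ.lim p q S hS
  -- Convergence of natural numbers is eventual constancy.
  rw [nhds_discrete, Filter.tendsto_pure, Filter.eventually_atTop] at h2
  obtain ⟨m₂, hm₂⟩ := h2
  refine ⟨max m₁ m₂, fun j hj => hm₂ j (le_of_max_le_right hj), fun S' hS' hr hb g =>
    h1 S' S hS' hS hr (fun _ _ _ => Iff.rfl) (fun s hs v => hb s ?_ v) g⟩
  exact firstSymb_mono (le_max_left _ _) (hm₁ hs)

end Transfer

/-! ## Structures that look locally like closed models -/

section Locally

/-- The models of the universal axioms that are closed under algebraic extensions. -/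
structure ClosedModel (ζ : (lang ar).Theory) (μ : MuFun ar) (M : Type u)
    [(lang ar).Structure M] : Prop where
  symm : IsSymm ar M
  axiomTwo : AxiomTwo ζ μ M
  algClosed : AlgClosed ζ μ M

theorem ClosedModel.finOcc {ζ : (lang ar).Theory} {μ : MuFun ar} {M : Type u}
    [(lang ar).Structure M] (h : ClosedModel ζ μ M) : FinOcc ar M :=
  finOcc_of_nonneg h.axiomTwo.2.1

/-- Every finite tuple is matched by a tuple in a closed model. -/
def LocallyModel (ζ : (lang ar).Theory) (μ : MuFun ar) (A : Type u) [(lang ar).Structure A] : Prop :=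
  ∀ (n : ℕ) (u₀ : Fin n → A) (m k : ℕ), ∃ (M : Type u) (_ : (lang ar).Structure M),
    ClosedModel ζ μ M ∧ ∃ u : Fin n → M, Matches ar m k u₀ u

variable {ζ : (lang ar).Theory} {μ : MuFun ar} {A : Type u} [(lang ar).Structure A]

theorem Matches.comp_equiv {E E' ι ι' : Type*} [(lang ar).Structure E] [(lang ar).Structure E']
    {m k : ℕ} {u₀ : ι → E} {u : ι → E'} (h : Matches ar m k u₀ u) (e : ι' ≃ ι) :
    Matches ar m k (u₀ ∘ e) (u ∘ e) := by
  refine ⟨h.1.comp e, fun X hX => ?_⟩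
  obtain ⟨q, z, z', h1, h2⟩ := h.2 X hX
  refine ⟨q, z, z', ?_, fun x hx => ?_⟩
  · have := h1.comp (Sum.map e id)
    rwa [Sum.elim_comp_map, Sum.elim_comp_map] at this
  · obtain ⟨t | t, rfl⟩ := h2 hx
    · exact ⟨Sum.inl (e.symm t), by simp⟩
    · exact ⟨Sum.inr t, rfl⟩

theorem Matches.mono {E E' ι : Type*} [(lang ar).Structure E] [(lang ar).Structure E']
    {m k m' k' : ℕ} {u₀ : ι → E} {u : ι → E'} (h : Matches ar m k u₀ u) (hm : m' ≤ m)
    (hk : k' ≤ k) : Matches ar m' k' u₀ u := by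
  refine ⟨h.1.mono (firstSymb_mono hm), fun X hX => ?_⟩
  obtain ⟨q, z, z', h1, h2⟩ := h.2 X (hX.trans hk)
  exact ⟨q, z, z', h1.mono (firstSymb_mono hm), h2⟩

theorem LocallyModel.exists_matches (h : LocallyModel ζ μ A) {ι : Type*} [Finite ι] (u₀ : ι → A)
    (m k : ℕ) : ∃ (M : Type u) (_ : (lang ar).Structure M),
      ClosedModel ζ μ M ∧ ∃ u : ι → M, Matches ar m k u₀ u := by
  obtain ⟨n, ⟨e⟩⟩ := Finite.exists_equiv_fin ι
  obtain ⟨M, _, hM, u, hu⟩ := h n (u₀ ∘ e.symm) m k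
  refine ⟨M, _, hM, u ∘ e, ?_⟩
  have := hu.comp_equiv e
  rwa [Function.comp_assoc, Equiv.symm_comp_self, Function.comp_id] at this

theorem LocallyModel.symm (h : LocallyModel ζ μ A) : IsSymm ar A := by
  intro s v σ
  obtain ⟨M, _, hM, u, hu, -⟩ := h _ v (s.1 + 1) 0
  have hs : s ∈ firstSymb N (s.1 + 1) := Nat.lt_succ_self s.1
  have h1 := hu.2 s hs σ
  have h2 := hu.2 s hs id
  rw [h1, hM.symm]
  exact h2.symm

/-- A negative predimension means more occurrences than points. One occurrence too many already
shows in a finite sublanguage, where the set is matched by a set of nonnegative predimension. -/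
theorem LocallyModel.delta_nonneg (h : LocallyModel ζ μ A) (X : Finset A) : 0 ≤ delta ar X := by
  obtain ⟨n, b, hb, rfl⟩ := exists_enum X
  have key : ∀ m, (occ ar (firstSymb N m) ((rng b : Finset A) : Set A)).encard ≤ (rng b).card := by
    intro m
    obtain ⟨M, _, hM, u, hu, -⟩ := h n b m 0
    have h1 := hu.encard_occ subset_rfl Finset.univ
    have h2 := hu.card_image Finset.univ
    rw [h1, h2]
    have h3 := (dl_nonneg_iff hM.finOcc _).1 (hM.axiomTwo.2.1 (rng u))
    have h4 : (occ ar Set.univ ((rng u : Finset M) : Set M)).ncard ≤ (rng u).card := by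
      unfold dl at h3
      omega
    refine (Set.encard_le_encard (occ_mono (Set.subset_univ _) le_rfl)).trans ?_
    rw [← (hM.finOcc.finite Set.univ _).cast_ncard_eq]
    exact_mod_cast h4
  have key2 : (occ ar Set.univ ((rng b : Finset A) : Set A)).encard ≤ (rng b).card := by
    by_contra hn
    rw [not_le, ← ENat.add_one_le_iff (ENat.natCast_ne_top _)] at hn
    obtain ⟨Q, hQ, hQc⟩ := Set.exists_subset_encard_eq hn
    have hQf : Q.Finite := Set.encard_lt_top_iff.1 (by rw [hQc]; exact_mod_cast ENat.natCast_lt_top _)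
    obtain ⟨m, hm⟩ := exists_firstSymb (hQf.image Prod.fst)
    have h1 : Q ⊆ occ ar (firstSymb N m) ((rng b : Finset A) : Set A) := fun p hp => by
      rw [mem_occ]
      exact ⟨hm ⟨p, hp, rfl⟩, (mem_occ.1 (hQ hp)).2⟩
    have h2 := (Set.encard_le_encard h1).trans (key m)
    rw [hQc] at h2
    have h3 : (rng b).card + 1 ≤ (rng b).card := by exact_mod_cast h2
    omega
  have hfin : (occ ar Set.univ ((rng b : Finset A) : Set A)).Finite :=
    Set.encard_lt_top_iff.1 (key2.trans_lt (ENat.natCast_lt_top _))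
  rw [delta, deltaIn, if_pos hfin]
  rw [← hfin.cast_ncard_eq] at key2
  have h3 : (occ ar Set.univ ((rng b : Finset A) : Set A)).ncard ≤ (rng b).card := by
    exact_mod_cast key2
  have h4 : (0 : ℤ) ≤ ((rng b).card : ℤ) -
      ((occ ar Set.univ ((rng b : Finset A) : Set A)).ncard : ℤ) := by omega
  exact_mod_cast h4

theorem finite_relSymb {k l : ℕ} {S : Ext ar k l} (hS : @FinOcc N ar _ S) : (relSymb S).Finite := by
  let := S
  refine ((hS Finset.univ).image Prod.fst).subset ?_
  rintro s ⟨v, hv, -⟩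
  exact ⟨(s, Finset.univ.val.map v), ⟨trivial, v, hv, fun _ =>
    Finset.mem_coe.2 (Finset.mem_univ _), rfl⟩, rfl⟩

theorem OfForm.transfer {E E' : Type*} [(lang ar).Structure E] [(lang ar).Structure E'] {k l : ℕ}
    {S S' : Ext ar k l} {a : Fin k → E} {b : Fin l → E} {a' : Fin k → E'} {b' : Fin l → E'}
    (h : OfForm S a b) {K : Set (Symb N)} (hK : relSymb S ⊆ K)
    (ht : SameTp ar K (Sum.elim a b) (Sum.elim a' b')) (hr : SameRelType S' S)
    (hb : baseStr S' = pull ar a') : OfForm S' a' b' := by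
  refine ⟨ht.injective h.1, fun s v => ?_, fun s v hv hS => ?_⟩
  · change @Holds N ar _ (baseStr S') s v ↔ _
    rw [hb]
    exact Iff.rfl
  · have h1 := (hr s v hv).1 hS
    exact (ht.2 s (hK ⟨v, h1, hv⟩) v).1 (h.2.2 s v hv h1)

/-- Stability makes `μ` insensitive to the symbols beyond `m'` in the base and to the size of large
values of `g`, the only respects in which matched bases can differ. -/
theorem Matches.mu_eq {E E' ι : Type*} [(lang ar).Structure E] [(lang ar).Structure E']
    (hf : FinOcc ar E) (hf' : FinOcc ar E') {m m' p q : ℕ} {u₀ : ι → E} {u : ι → E'}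
    (h : Matches ar m (p + m') u₀ u) (hm : m' ≤ m) {S S' : Ext ar p q}
    (hst : Stable μ S m') (hS' : IsMSAExt S') (hr : SameRelType S' S) {ξ : Fin p → ι}
    (hb : baseStr S = pull ar (u₀ ∘ ξ)) (hb' : baseStr S' = pull ar (u ∘ ξ))
    (hw : Witnessed ar m' (Set.range u₀) (rng (u₀ ∘ ξ))) :
    μ p q S' (gval ar Set.univ (rng (u ∘ ξ))) = μ p q S (gval ar Set.univ (rng (u₀ ∘ ξ))) := by
  rw [hst.2 S' hS' hr fun s hs v => ?_]
  · exact mu_eq_of_gval hst.1 (h.gval_eq hf hf' hm ξ hw)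
  · rw [hb, hb']
    exact (h.1.2 s (firstSymb_mono hm hs) (ξ ∘ v)).symm

theorem OfForm.baseStr_eq {E : Type*} [(lang ar).Structure E] {k l : ℕ} {S : Ext ar k l}
    {a : Fin k → E} {b : Fin l → E} (h : OfForm S a b) : baseStr S = pull ar a :=
  structure_ext fun s v => h.2.1 s v

theorem isSymm_pull {X E : Type*} [(lang ar).Structure E] (hE : IsSymm ar E) (f : X → E) :
    @IsSymm N ar X (pull ar f) := fun s v σ => hE s (f ∘ v) σ

theorem finOcc_pull {X E : Type*} [(lang ar).Structure E] (hE : FinOcc ar E) {f : X → E}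
    (hf : Function.Injective f) : @FinOcc N ar X (pull ar f) := by
  let := pull ar f
  exact (isEmb_pull hf).finOcc hE

/-- The base, the copies and a witness for `g` form a finite tuple. In a matching closed model it
becomes a family of equally many copies of the extension rebased to the new base, and the `μ`-value
is the same. -/
theorem LocallyModel.muBound (hμ : IsMu μ) (h : LocallyModel ζ μ A) :
    MuBound μ (Set.univ : Set A) := by
  intro k l S hS a r b _ _ hab hd
  rcases Nat.eq_zero_or_pos r with rfl | hr
  · exact Nat.zero_le _
  have hf := finOcc_of_nonneg h.delta_nonneg
  obtain ⟨m₁, hst⟩ := hμ.exists_stable hS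
  obtain ⟨m₂, P, hw⟩ := exists_witnessed hf (rng a)
  obtain ⟨m₃, hK⟩ := exists_firstSymb (finite_relSymb hS.finOcc)
  obtain ⟨n', P, hP, rfl⟩ := exists_enum P
  let u₀ : (Fin k ⊕ (Fin r × Fin l)) ⊕ Fin n' → A :=
    Sum.elim (Sum.elim a fun p => b p.1 p.2) P
  obtain ⟨M, _, hM, u, hu⟩ :=
    h.exists_matches u₀ (max m₃ (max m₁ m₂)) (k + max m₁ m₂)
  have hm : max m₁ m₂ ≤ max m₃ (max m₁ m₂) := le_max_right _ _
  let a' : Fin k → M := u ∘ Sum.inl ∘ Sum.inl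
  let b' : Fin r → Fin l → M := fun t => u ∘ Sum.inl ∘ Sum.inr ∘ fun y => (t, y)
  have ha' : Function.Injective a' := (hu.1.comp (Sum.inl ∘ Sum.inl)).injective
    ((hab ⟨0, hr⟩).1.comp Sum.inl_injective)
  have hS' : IsMSAExt (rebase S (pull ar a')) :=
    isMSAExt_rebase hS (isSymm_pull hM.symm _) (finOcc_pull hM.finOcc ha')
  have hab' : ∀ t, OfForm (rebase S (pull ar a')) a' (b' t) := fun t => by
    refine (hab t).transfer hK ?_ sameRelType_rebase baseStr_rebase
    have h1 := (hu.1.mono (firstSymb_mono (le_max_left m₃ _))).comp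
      (Sum.elim (Sum.inl ∘ Sum.inl) (Sum.inl ∘ Sum.inr ∘ fun y => (t, y)))
    rwa [Sum.comp_elim, Sum.comp_elim] at h1
  have h1 := hM.axiomTwo.2.2 k l _ hS' a' r b' (fun _ => trivial) (fun _ _ => trivial) hab'
    (fun i j hij => ?_)
  · have h2 := hu.mu_eq (μ := μ) (q := l) (S := S) hf hM.finOcc hm (hst.mono (le_max_left _ _)) hS'
      sameRelType_rebase (ξ := Sum.inl ∘ Sum.inl) (hab ⟨0, hr⟩).baseStr_eq baseStr_rebase
      (hw.mono (le_max_right _ _) fun x hx => ?_)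
    · rw [h2] at h1
      exact h1
    · obtain ⟨t, rfl⟩ := mem_rng.1 hx
      exact ⟨Sum.inr t, rfl⟩
  · rw [Set.disjoint_left]
    rintro _ ⟨x, rfl⟩ ⟨y, hy⟩
    exact Set.disjoint_left.1 (hd i j hij) ⟨x, rfl⟩
      ⟨y, (hu.1.1 (Sum.inl (Sum.inr (j, y))) (Sum.inl (Sum.inr (i, x)))).2 hy⟩

end Locally

/-! ## Free extensions by finitely many points -/

section FreeExt

variable {M M' E E' : Type*} [(lang ar).Structure M] [(lang ar).Structure M']
  [(lang ar).Structure E] [(lang ar).Structure E'] {n l : ℕ}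

/-- `E` is the free join of `M` and the extension `T` of the tuple `b`. -/
structure FreeExt (T : Ext ar n l) (i : M → E) (b : Fin n → M) (c : Fin l → E) : Prop where
  symm : IsSymm ar E
  finOcc : FinOcc ar E
  emb : IsEmb ar i
  emb_ext : @IsEmb N ar _ _ _ T (Sum.elim (i ∘ b) c)
  notMem : ∀ t, c t ∉ Set.range i
  cover : ∀ x, x ∈ Set.range i ∨ x ∈ Set.range c
  free : ∀ (s : Symb N) (v : Fin (ar s) → E), Holds ar s v →
    (∃ w, v = i ∘ w) ∨ ∃ w, v = Sum.elim (i ∘ b) c ∘ w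

variable {T T' : Ext ar n l} {i : M → E} {b : Fin n → M} {c : Fin l → E} {i' : M' → E'}
  {b' : Fin n → M'} {c' : Fin l → E'}

theorem FreeExt.injective_right (h : FreeExt T i b c) : Function.Injective c :=
  h.emb_ext.1.comp Sum.inr_injective

theorem FreeExt.injective_left (h : FreeExt T i b c) : Function.Injective b :=
  Function.Injective.of_comp (f := i) (h.emb_ext.1.comp Sum.inl_injective)

/-- By freeness a relation through a new point comes from the extension and transfers by `hT`, while
any other relation lies in `M` and transfers by `ht`. -/
theorem FreeExt.holds_of_sameTp (h : FreeExt T i b c) (h' : FreeExt T' i' b' c')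
    (hT : SameRelType T T') {ι : Type*} {K : Set (Symb N)} {u₀ : ι → M} {u : ι → M'}
    {β : Fin n → ι} (hb : u₀ ∘ β = b) (hb' : u ∘ β = b') (ht : SameTp ar K u₀ u) {s : Symb N}
    (hs : s ∈ K) {w : Fin (ar s) → ι ⊕ Fin l} (hw : Holds ar s (Sum.elim (i ∘ u₀) c ∘ w)) :
    Holds ar s (Sum.elim (i' ∘ u) c' ∘ w) := by
  by_cases hn : ∃ j y, w j = Sum.inr y
  · obtain ⟨j, y, hj⟩ := hn
    rcases h.free s _ hw with ⟨z, hz⟩ | ⟨z, hz⟩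
    · refine absurd ⟨z j, ?_⟩ (h.notMem y)
      rw [← Function.comp_apply (f := i), ← hz, Function.comp_apply, hj]
      rfl
    · have hz' : Sum.elim (i' ∘ u) c' ∘ w = Sum.elim (i' ∘ b') c' ∘ z := by
        funext t
        have h1 := congrFun hz t
        simp only [Function.comp_apply] at h1 ⊢
        rcases hwt : w t with x | x <;> rcases hzt : z t with x' | x' <;>
          simp only [hwt, hzt, Sum.elim_inl, Sum.elim_inr, Function.comp_apply] at h1 ⊢
        · rw [← hb', Function.comp_apply]
          congr 1
          refine (ht.1 _ _).1 ?_
          rw [h.emb.1 h1, ← hb]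
          rfl
        · exact absurd ⟨_, h1⟩ (h.notMem x')
        · exact absurd ⟨_, h1.symm⟩ (h.notMem x)
        · rw [h.injective_right h1]
      rw [hz'] 
      rw [hz] at hw
      have hj' : ∃ y', z j = Sum.inr y' := by
        have h1 := congrFun hz j
        simp only [Function.comp_apply, hj, Sum.elim_inr] at h1
        rcases hzj : z j with x' | x'
        · rw [hzj] at h1
          exact absurd ⟨_, h1.symm⟩ (h.notMem y)
        · exact ⟨x', rfl⟩
      rw [h'.emb_ext.2]
      rw [h.emb_ext.2] at hw
      exact (hT s z ⟨j, hj'⟩).1 hw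
  · obtain ⟨z, rfl⟩ := eq_inl_comp_of_forall hn
    rw [← Function.comp_assoc, Sum.elim_comp_inl, Function.comp_assoc] at hw ⊢
    rw [h'.emb.2]
    rw [h.emb.2] at hw
    exact (ht.2 s hs z).1 hw

theorem FreeExt.sameTp (h : FreeExt T i b c) (h' : FreeExt T' i' b' c') (hT : SameRelType T T')
    {ι : Type*} {K : Set (Symb N)} {u₀ : ι → M} {u : ι → M'} {β : Fin n → ι}
    (hb : u₀ ∘ β = b) (hb' : u ∘ β = b') (ht : SameTp ar K u₀ u) :
    SameTp ar K (Sum.elim (i ∘ u₀) c) (Sum.elim (i' ∘ u) c') := by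
  refine ⟨fun x y => ?_, fun s hs w => ⟨fun hw => h.holds_of_sameTp h' hT hb hb' ht hs hw,
    fun hw => h'.holds_of_sameTp h hT.symm hb' hb ht.symm hs hw⟩⟩
  rcases x with x | x <;> rcases y with y | y <;>
    simp only [Sum.elim_inl, Sum.elim_inr, Function.comp_apply]
  · rw [h.emb.1.eq_iff, h'.emb.1.eq_iff]
    exact ht.1 x y
  · exact iff_of_false (fun e => h.notMem y ⟨_, e⟩) fun e => h'.notMem y ⟨_, e⟩
  · exact iff_of_false (fun e => h.notMem x ⟨_, e.symm⟩) fun e => h'.notMem x ⟨_, e.symm⟩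
  · rw [h.injective_right.eq_iff, h'.injective_right.eq_iff]

/-- The new points are part of the tuple, so only the trace on `M'` of a given set has to be pulled
back. -/
theorem FreeExt.matches (h : FreeExt T i b c) (h' : FreeExt T' i' b' c') (hT : SameRelType T T')
    {ι : Type*} {m k : ℕ} {u₀ : ι → M} {u : ι → M'} {β : Fin n → ι}
    (hb : u₀ ∘ β = b) (hb' : u ∘ β = b') (ht : Matches ar m k u₀ u) :
    Matches ar m k (Sum.elim (i ∘ u₀) c) (Sum.elim (i' ∘ u) c') := by
  refine ⟨h.sameTp h' hT hb hb' ht.1, fun X hX => ?_⟩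
  obtain ⟨Y, hY⟩ := exists_image_eq (cap_subset_right X (Set.range i'))
  have hYc : Y.card ≤ k := by
    rw [← Finset.card_image_of_injective Y h'.emb.1, hY]
    exact (Finset.card_le_card (cap_subset _ _)).trans hX
  obtain ⟨q, z, z', h1, h2⟩ := ht.2 Y hYc
  refine ⟨q, i ∘ z, i' ∘ z', ?_, fun x hx => ?_⟩
  · have h3 := (h.sameTp h' hT (β := Sum.inl ∘ β) (by rw [← hb]; rfl) (by rw [← hb']; rfl) h1).comp
      (Sum.elim (Sum.map Sum.inl id) (Sum.inl ∘ Sum.inr))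
    convert h3 using 1
    · funext t; rcases t with (t | t) | t <;> rfl
    · funext t; rcases t with (t | t) | t <;> rfl
  · rcases h'.cover x with hi | ⟨t, rfl⟩
    · have h4 : x ∈ Y.image i' := by
        rw [hY]
        exact mem_cap.2 ⟨hx, hi⟩
      obtain ⟨y, hy, rfl⟩ := Finset.mem_image.1 h4
      obtain ⟨t | t, rfl⟩ := h2 hy
      · exact ⟨Sum.inl (Sum.inl t), rfl⟩
      · exact ⟨Sum.inr t, rfl⟩
    · exact ⟨Sum.inl (Sum.inr t), rfl⟩

theorem FreeExt.sdiff (h : FreeExt T i b c) :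
    (rng (i ∘ b) ∪ rng c) \ rng (i ∘ b) = rng c := by
  rw [Finset.union_sdiff_left, Finset.sdiff_eq_self_iff_disjoint, Finset.disjoint_left]
  intro x hx hx'
  obtain ⟨t, rfl⟩ := mem_rng.1 hx
  obtain ⟨t', ht'⟩ := mem_rng.1 hx'
  exact h.notMem t ⟨_, ht'⟩

theorem FreeExt.joinOver (h : FreeExt T i b c) :
    JoinOver ar (Set.range i) (rng (i ∘ b)) (rng (i ∘ b) ∪ rng c) := by
  refine ⟨?_, Set.eq_univ_of_forall fun x => ?_, fun s v hv _ => ?_⟩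
  · ext x
    simp only [Finset.mem_coe, Set.mem_inter_iff, Finset.mem_union, mem_rng]
    constructor
    · rintro ⟨t, rfl⟩
      exact ⟨⟨_, rfl⟩, Or.inl ⟨t, rfl⟩⟩
    · rintro ⟨hx, h1 | ⟨t, rfl⟩⟩
      · exact h1
      · exact absurd hx (h.notMem t)
  · rcases h.cover x with h1 | ⟨t, rfl⟩
    · exact Or.inl h1
    · exact Or.inr (mem_coe_union (Or.inr (mem_rng.2 ⟨t, rfl⟩)))
  · rcases h.free s v hv with ⟨w, rfl⟩ | ⟨w, rfl⟩
    · exact Or.inl fun j => ⟨_, rfl⟩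
    · refine Or.inr fun j => ?_
      rcases hw : w j with t | t
      · exact mem_coe_union (Or.inl (mem_rng.2 ⟨t, by simp [hw]⟩))
      · exact mem_coe_union (Or.inr (mem_rng.2 ⟨t, by simp [hw]⟩))

theorem freeExt_adjoin {M : Type u} [(lang ar).Structure M] (hM : IsSymm ar M)
    (hf : FinOcc ar M) {T : Ext ar n l} (hT : @IsSymm N ar _ T) (hTf : @FinOcc N ar _ T)
    {b : Fin n → M} (hb : @IsEmb N ar _ _ _ (baseStr T) b) :
    letI := adjoin T b
    FreeExt T (Sum.inl : M → M ⊕ Fin l) b Sum.inr := by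
  let := adjoin T b
  have he : @IsEmb N ar _ _ _ T (Sum.elim (Sum.inl ∘ b) Sum.inr : _ → M ⊕ Fin l) := by
    rw [elim_inl_comp_eq_map]
    exact isEmb_map_adjoin hb
  refine
    { symm := isSymm_adjoin hM hT
      finOcc := (joinOver_adjoin b).finOcc (fun X hX => ?_) ?_
      emb := isEmb_inl_adjoin
      emb_ext := he
      notMem := by simp
      cover := fun x => by rcases x with x | x <;> simp
      free := fun s v hv => ?_ }
  · obtain ⟨Y, rfl⟩ := exists_image_eq hX
    rw [← Set.encard_lt_top_iff, ← isEmb_inl_adjoin.sameTp.encard_occ subset_rfl Y,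
      Set.encard_lt_top_iff]
    exact hf _
  · let := T
    have h1 := he.sameTp.encard_occ subset_rfl Finset.univ
    rw [elim_inl_comp_eq_map] at h1
    rw [← Set.encard_lt_top_iff]
    refine lt_of_eq_of_lt ?_ (Set.encard_lt_top_iff.2 (hTf Finset.univ))
    refine Eq.trans ?_ (h1.symm.trans ?_)
    · congr!
    · congr!
      simp
  · rcases holds_adjoin.1 hv with ⟨w, -, rfl⟩ | ⟨w, -, -, rfl⟩
    · exact Or.inl ⟨w, rfl⟩
    · exact Or.inr ⟨w, by rw [elim_inl_comp_eq_map]⟩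

end FreeExt

/-! ## Transfer of the existence axioms -/

section TransferThree

variable {ζ : (lang ar).Theory} {μ : MuFun ar}

/-- Over a minimal base, the relations that involve the top lie over this base. -/
theorem exists_map_comp_eq {n l k : ℕ} {S : Ext ar n l} (hf : @FinOcc N ar _ S)
    (hS : @SimplyAlg N ar _ S (baseSet n l) (topSet n l)) {α : Fin k → Fin n}
    (hm : @MinSimplyAlg N ar _ S (rng (Sum.inl ∘ α)) (topSet n l)) {s : Symb N}
    {v : Fin (ar s) → Fin n ⊕ Fin l} (hv : @Holds N ar _ S s v) (hj : ∃ j, v j ∈ topSet n l) :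
    ∃ w, v = Sum.map α id ∘ w := by
  let := S
  have hSA := (simplyAlg_iff hf).1 hS
  have hin : ∀ j u, v j = Sum.inl u → ∃ w, α w = u := by
    intro j u hju
    have hl : Linked ar (baseSet n l) (topSet n l) (Sum.inl u) := by
      obtain ⟨j', hj'⟩ := hj
      refine ⟨(s, Finset.univ.val.map v), ⟨trivial, v, hv, fun j => ?_, rfl⟩,
        Multiset.mem_map.2 ⟨j, Finset.mem_univ_val j, hju⟩, v j', hj',
        Multiset.mem_map.2 ⟨j', Finset.mem_univ_val j', rfl⟩⟩
      exact mem_coe_union (mem_base_or_top (v j))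
    have := mem_of_linked hf hSA.2.1 hSA.2.2.1.ge (G := rng (Sum.inl ∘ α))
      (Finset.coe_subset.1 (rng_subset.2 fun t => by simp)) (fun Z hZ hZd => by
        have h1 := dl_union_sub_le hf Set.univ hZ hZd
        have h2 := ((simplyAlg_iff hf).1 hm.1).2.2.1
        omega) (f := Sum.inl u) (by simp) hl
    simpa using this
  have : ∀ j, ∃ w, Sum.map α id w = v j := fun j => by
    rcases hvj : v j with u | u
    · obtain ⟨w, rfl⟩ := hin j u hvj
      exact ⟨Sum.inl w, rfl⟩
    · exact ⟨Sum.inr u, rfl⟩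
  choose w hw using this
  exact ⟨w, (funext hw).symm⟩

/-- By `exists_map_comp_eq` the extension is the free join of its base and of the extension of its
minimal base. -/
theorem sat_of_restrictBase (hζ : ζ.IsUniversal) (hζj : PreservedByFreeJoins ζ) {n l k : ℕ}
    {S : Ext ar n l} (hs : @IsSymm N ar _ S) (hf : @FinOcc N ar _ S)
    (hS : @SimplyAlg N ar _ S (baseSet n l) (topSet n l)) {α : Fin k → Fin n}
    (hα : Function.Injective α) (hm : @MinSimplyAlg N ar _ S (rng (Sum.inl ∘ α)) (topSet n l))
    (hb : Sat ar (baseStr S) ζ) (hr : Sat ar (restrictBase S α) ζ) : Sat ar S ζ := by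
  let := S
  have h1 : (subOf ar (Set.range (Sum.inl : Fin n → Fin n ⊕ Fin l))) ⊨ ζ := by
    let := baseStr S
    exact (models_subOf_iff hζ (isEmb_inl_baseStr S) rfl).2 hb
  have h2 : (subOf ar (Set.range (Sum.map α id : Fin k ⊕ Fin l → Fin n ⊕ Fin l))) ⊨ ζ := by
    let := restrictBase S α
    exact (models_subOf_iff hζ (isEmb_pull (Sum.map_injective.2 ⟨hα, Function.injective_id⟩))
      rfl).2 hr
  have h3 := models_union_of_freelyJoined hζ hζj hs (Set.toFinite _) (Set.toFinite _)
    (fun s v hv _ => ?_) h1 h2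
  · refine (models_subOf_iff hζ isEmb_id ?_).1 h3
    refine Set.range_id.trans (Set.eq_univ_of_forall fun x => ?_).symm
    rcases x with x | x
    · exact Or.inl ⟨x, rfl⟩
    · exact Or.inr ⟨Sum.inr x, rfl⟩
  · by_cases hn : ∃ j, v j ∈ topSet n l
    · obtain ⟨w, rfl⟩ := exists_map_comp_eq hf hS hm hv hn
      exact Or.inr fun j => ⟨_, rfl⟩
    · obtain ⟨w, rfl⟩ := eq_inl_comp_of_forall (mt exists_inr_iff.2 hn)
      exact Or.inl fun j => ⟨_, rfl⟩

theorem exists_forall_of_mono {I : Type*} [Finite I] {P : I → ℕ → Prop}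
    (hmono : ∀ i m m', m ≤ m' → P i m → P i m') (h : ∀ i, ∃ m, P i m) : ∃ m, ∀ i, P i m := by
  choose f hf using h
  obtain ⟨m, hm⟩ := (Set.finite_range f).bddAbove
  exact ⟨m, fun i => hmono i _ _ (hm ⟨i, rfl⟩) (hf i)⟩

/-- Outside the fixed base, such a structure only chooses which of the finitely many tuples satisfy
each of the finitely many symbols. -/
theorem finite_ext_of_relSymb {p q : ℕ} {K : Set (Symb N)} (hK : K.Finite)
    (R : (lang ar).Structure (Fin p)) :
    {S : Ext ar p q | relSymb S ⊆ K ∧ baseStr S = R}.Finite := by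
  have := hK.to_subtype
  let F : Ext ar p q → Set (Σ s : K, (Fin (ar s.1) → Fin p ⊕ Fin q)) :=
    fun S => {x | @Holds N ar _ S x.1.1 x.2}
  refine Set.Finite.of_finite_image (Set.toFinite (F '' _)) ?_
  rintro S ⟨h1, h2⟩ S' ⟨h1', h2'⟩ he
  refine structure_ext fun s v => ?_
  by_cases hn : ∃ j y, v j = Sum.inr y
  · by_cases hs : s ∈ K
    · have : (⟨⟨s, hs⟩, v⟩ : Σ s : K, (Fin (ar s.1) → Fin p ⊕ Fin q)) ∈ F S ↔
          (⟨⟨s, hs⟩, v⟩ : Σ s : K, (Fin (ar s.1) → Fin p ⊕ Fin q)) ∈ F S' := by rw [he]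
      exact this
    · exact iff_of_false (fun h => hs (h1 ⟨v, h, hn⟩)) fun h => hs (h1' ⟨v, h, hn⟩)
  · obtain ⟨w, rfl⟩ := eq_inl_comp_of_forall hn
    change @Holds N ar _ (baseStr S) s w ↔ @Holds N ar _ (baseStr S') s w
    rw [h2, h2']

/-- A single bound is needed for all patterns that occur inside `C`. With lengths and symbols
bounded there are finitely many of them. -/
theorem exists_uniform_stable (hμ : IsMu μ) {E J : Type*} [(lang ar).Structure E] [Finite J]
    {K : Set (Symb N)} (hK : K.Finite) (e : J → E) (d : ℕ) : ∃ m, ∀ p < d, ∀ q < d,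
      ∀ (x : Fin p → J) (S : Ext ar p q), IsMSAExt S → relSymb S ⊆ K →
        baseStr S = pull ar (e ∘ x) → Stable μ S m := by
  have key : ∀ (p q : ℕ) (x : Fin p → J), ∃ m, ∀ S : Ext ar p q, IsMSAExt S → relSymb S ⊆ K →
      baseStr S = pull ar (e ∘ x) → Stable μ S m := by
    intro p q x
    have := (finite_ext_of_relSymb (q := q) hK (pull ar (e ∘ x))).to_subtype
    obtain ⟨m, hm⟩ := exists_forall_of_mono
      (P := fun (S : {S : Ext ar p q | relSymb S ⊆ K ∧ baseStr S = pull ar (e ∘ x)}) m =>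
        IsMSAExt S.1 → Stable μ S.1 m) (fun S m m' h hP hS => (hP hS).mono h) (fun S => by
          by_cases hS : IsMSAExt S.1
          · exact (hμ.exists_stable hS).imp fun m hm _ => hm
          · exact ⟨0, fun h => absurd h hS⟩)
    exact ⟨m, fun S hS h1 h2 => hm ⟨S, h1, h2⟩ hS⟩
  obtain ⟨m, hm⟩ := exists_forall_of_mono (I := Σ p : Fin d, Fin d × (Fin p → J))
    (P := fun i m => ∀ S : Ext ar i.1 i.2.1, IsMSAExt S → relSymb S ⊆ K →
      baseStr S = pull ar (e ∘ i.2.2) → Stable μ S m)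
    (fun i m m' h hP S h1 h2 h3 => (hP S h1 h2 h3).mono h) fun i => key _ _ _
  exact ⟨m, fun p hp q hq x S => hm ⟨⟨p, hp⟩, ⟨q, hq⟩, x⟩ S⟩

theorem exists_uniform_witnessed {E J : Type*} [(lang ar).Structure E] (hf : FinOcc ar E)
    [Finite J] (e : J → E) (d : ℕ) : ∃ (m : ℕ) (P : Finset E), ∀ p < d, ∀ x : Fin p → J,
      Witnessed ar m (P : Set E) (rng (e ∘ x)) := by
  have : ∀ i : Σ p : Fin d, (Fin p → J), ∃ (m : ℕ) (P : Finset E),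
      Witnessed ar m (P : Set E) (rng (e ∘ i.2)) := fun i => exists_witnessed hf _
  choose f P hP using this
  obtain ⟨m, hm⟩ := (Set.finite_range f).bddAbove
  have := Fintype.ofFinite J
  refine ⟨m, Finset.univ.biUnion P, fun p hp x => (hP ⟨⟨p, hp⟩, x⟩).mono (hm ⟨_, rfl⟩) ?_⟩
  exact_mod_cast Finset.subset_biUnion_of_mem P (Finset.mem_univ _)

variable {M M' E E' : Type*} [(lang ar).Structure M] [(lang ar).Structure M']
  [(lang ar).Structure E] [(lang ar).Structure E'] {n l : ℕ} {T T' : Ext ar n l} {i : M → E}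
  {b : Fin n → M} {c : Fin l → E} {i' : M' → E'} {b' : Fin n → M'} {c' : Fin l → E'}

theorem FreeExt.simplyAlg (h : FreeExt T i b c)
    (hS : @SimplyAlg N ar _ T (baseSet n l) (topSet n l)) :
    SimplyAlg ar (rng (i ∘ b)) (rng c) := by
  let := T
  have := h.emb_ext.simplyAlg_image.2 hS
  rwa [image_baseSet, image_topSet] at this

theorem FreeExt.minSimplyAlg (h : FreeExt T i b c) {k : ℕ} {α : Fin k → Fin n}
    (hS : @MinSimplyAlg N ar _ T (rng (Sum.inl ∘ α)) (topSet n l)) :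
    MinSimplyAlg ar (rng (i ∘ b ∘ α)) (rng c) := by
  let := T
  have := h.emb_ext.minSimplyAlg_image.2 hS
  rw [image_topSet] at this
  convert this using 1
  ext; simp

theorem FreeExt.pull_eq (h : FreeExt T i b c) {k : ℕ} (α : Fin k → Fin n) :
    pull ar (Sum.elim (i ∘ b ∘ α) c) = restrictBase T α := by
  refine structure_ext fun s v => ?_
  let := T
  change Holds ar s (Sum.elim (i ∘ b ∘ α) c ∘ v) ↔ Holds ar s (Sum.map α id ∘ v)
  have he : Sum.elim (i ∘ b ∘ α) c = Sum.elim (i ∘ b) c ∘ Sum.map α id := by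
    rw [Sum.elim_comp_map]; rfl
  rw [← h.emb_ext.2, he]
  rfl

theorem FreeExt.symbOver_eq (h : FreeExt T i b c) :
    symbOver ar (rng (i ∘ b)) (rng (i ∘ b) ∪ rng c) = relSymb T := by
  let := T
  ext s
  constructor
  · rintro ⟨v, hv, hvC, j, hj⟩
    have : ∀ j, ∃ t, Sum.elim (i ∘ b) c t = v j := fun j => by
      rcases Finset.mem_union.1 (hvC j) with h1 | h1
      · obtain ⟨t, ht⟩ := mem_rng.1 h1
        exact ⟨Sum.inl t, ht⟩
      · obtain ⟨t, ht⟩ := mem_rng.1 h1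
        exact ⟨Sum.inr t, ht⟩
    choose w hw using this
    obtain rfl : Sum.elim (i ∘ b) c ∘ w = v := funext hw
    refine ⟨w, (h.emb_ext.2 s w).1 hv, j, ?_⟩
    rcases hwj : w j with t | t
    · exact absurd (mem_rng.2 ⟨t, by simp [hwj]⟩) hj
    · exact ⟨t, rfl⟩
  · rintro ⟨v, hv, j, y, hj⟩
    refine ⟨Sum.elim (i ∘ b) c ∘ v, (h.emb_ext.2 s v).2 hv, fun j' => ?_, j, ?_⟩
    · rcases hw : v j' with t | t
      · exact Finset.mem_union_left _ (mem_rng.2 ⟨t, by simp [hw]⟩)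
      · exact Finset.mem_union_right _ (mem_rng.2 ⟨t, by simp [hw]⟩)
    · simp only [Function.comp_apply, hj, Sum.elim_inr, mem_rng, not_exists]
      exact fun t ht => h.notMem y ⟨_, ht⟩

theorem exists_comp_of_forall_mem {p : ℕ} {J E : Type*} {e : J → E} {x : Fin p → E}
    (hx : ∀ t, ∃ j, e j = x t) : ∃ x', x = e ∘ x' := by
  choose x' hx' using hx
  exact ⟨x', (funext hx').symm⟩

theorem card_le_of_injective_comp {p n l : ℕ} {E : Type*} {e : Fin n ⊕ Fin l → E}
    {x : Fin p → Fin n ⊕ Fin l} (h : Function.Injective (e ∘ x)) : p ≤ n + l := by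
  simpa using Fintype.card_le_of_injective x h.of_comp

/-- The data of the existence axiom transfers to a matching tuple in a closed model. -/
theorem FreeExt.copies_of_matches (hζ : ζ.IsUniversal) (hζj : PreservedByFreeJoins ζ)
    (hμ : IsMu μ) (h : FreeExt T i b c) (h' : FreeExt T' i' b' c') (hT : SameRelType T T')
    (hM' : AlgClosed ζ μ M') (h0 : ∀ A : Finset M', 0 ≤ delta ar A)
    (hMb : MuBound μ (Set.univ : Set M')) (hMζ : M' ⊨ ζ)
    {ι : Type*} {m m' : ℕ} {u₀ : ι → M} {u : ι → M'} {β : Fin n → ι}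
    (hb : u₀ ∘ β = b) (hb' : u ∘ β = b') (hmat : Matches ar m (n + l + m') u₀ u) (hmm : m' ≤ m)
    (hK : relSymb T ⊆ firstSymb N m) {k : ℕ} {α : Fin k → Fin n} (hα : Function.Injective α)
    (hS : @SimplyAlg N ar _ T (baseSet n l) (topSet n l))
    (hm : @MinSimplyAlg N ar _ T (rng (Sum.inl ∘ α)) (topSet n l))
    (hT'ζ : Sat ar T' ζ)
    (hY : ∀ Y : Finset M, Y.card ≤ l → dl ar (relSymb T) (rng b) ≤ dl ar (relSymb T) (rng b ∪ Y))
    (hst : ∀ p < n + l + 1, ∀ q < n + l + 1, ∀ (x : Fin p → Fin n ⊕ Fin l) (S : Ext ar p q),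
      IsMSAExt S → relSymb S ⊆ relSymb T → baseStr S = pull ar (Sum.elim (i ∘ b) c ∘ x) →
      Stable μ S m')
    (hw : ∀ p < n + l + 1, ∀ x : Fin p → Fin n ⊕ Fin l,
      Witnessed ar m' (Set.range (Sum.elim (i ∘ u₀) c)) (rng (Sum.elim (i ∘ b) c ∘ x)))
    (hii : ∀ (p q : ℕ) (S : Ext ar p q), IsMSAExt S → ∀ (x : Fin p → Fin n ⊕ Fin l) (r : ℕ)
      (y : Fin r → Fin q → Fin n ⊕ Fin l),
      (∀ t, OfForm S (Sum.elim (i ∘ b) c ∘ x) (Sum.elim (i ∘ b) c ∘ y t)) →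
      (∀ t t', t ≠ t' → Disjoint (Set.range (y t)) (Set.range (y t'))) → 0 < r →
      r ≤ μ p q S (gval ar Set.univ (rng (Sum.elim (i ∘ b) c ∘ x)))) :
    Copies (restrictBase T' α) (b' ∘ α) Set.univ
      (μ k l (restrictBase T' α) (gval ar Set.univ (rng (b' ∘ α)))) := by
  have hTf : @FinOcc N ar _ T := by
    let := T
    exact h.emb_ext.finOcc h.finOcc
  have hT'f : @FinOcc N ar _ T' := by
    let := T'
    exact h'.emb_ext.finOcc h'.finOcc
  have hrel : relSymb T' = relSymb T := by
    ext s
    exact exists_congr fun v => and_congr_left fun hv => (hT s v hv).symm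
  have hS' := simplyAlg_congr hT.congr hTf hT'f hS
  have hm' := minSimplyAlg_congr hT.congr hTf hT'f hm
  have hmatE := h.matches h' hT hb hb' hmat
  have hE : SameTp ar (firstSymb N m) (Sum.elim (i ∘ b) c) (Sum.elim (i' ∘ b') c') := by
    have := hmatE.1.comp (Sum.map β id)
    rw [Sum.elim_comp_map, Sum.elim_comp_map] at this
    rw [← hb, ← hb']
    exact this
  have hmem : ∀ x, x ∈ rng (i' ∘ b') ∪ rng c' → ∃ t, Sum.elim (i' ∘ b') c' t = x := fun x hx => by
    rcases Finset.mem_union.1 hx with h1 | h1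
    · obtain ⟨t, ht⟩ := mem_rng.1 h1
      exact ⟨Sum.inl t, ht⟩
    · obtain ⟨t, ht⟩ := mem_rng.1 h1
      exact ⟨Sum.inr t, ht⟩
  have h1 := copies_of_algClosed hζ hζj hμ h'.emb h'.symm hM' h0 hMb hMζ h'.finOcc h'.joinOver
    (by rw [h'.sdiff]; exact h'.simplyAlg hS') (by
      let := T'
      refine (models_subOf_iff hζ h'.emb_ext ?_).2 hT'ζ
      rw [Set.Sum.elim_range]
      simp
      rfl)
    (a := i' ∘ b' ∘ α) (c := c') (h'.emb.1.comp (h'.injective_left.comp hα)) h'.injective_right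
    (fun t => mem_rng.2 ⟨α t, rfl⟩) h'.sdiff.symm
    (by rw [h'.sdiff]; exact h'.minSimplyAlg hm') ?_ ?_
  · rw [h'.pull_eq] at h1
    have h4 := h'.emb.gval_rng Set.univ (b' ∘ α)
    rw [Set.image_univ] at h4
    rw [h4] at h1
    obtain ⟨y, hy1, hy2, hy3⟩ := h1
    choose z hz using hy1
    have hz' : ∀ t, y t = i' ∘ z t := fun t => funext fun u => (hz t u).symm
    refine ⟨z, fun _ _ => trivial, fun t => ?_, fun t t' ht => ?_⟩
    · have := hy2 t
      rwa [hz', h'.emb.ofForm_comp] at this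
    · have := hy3 t t' ht
      rwa [hz', hz', Set.range_comp, Set.range_comp, Set.disjoint_image_iff h'.emb.1] at this
  · intro Y hYr hYc
    rw [h'.sdiff, Finset.card_image_of_injective _ h'.injective_right, Finset.card_univ,
      Fintype.card_fin] at hYc
    obtain ⟨Y, rfl⟩ := exists_image_eq hYr
    rw [Finset.card_image_of_injective _ h'.emb.1] at hYc
    have hb2 : rng (i' ∘ b') = (rng b').image i' := by ext; simp
    rw [h'.symbOver_eq, hrel, hb2, ← Finset.image_union, h'.emb.dl_image, h'.emb.dl_image]
    obtain ⟨q, z, z', h2, h3⟩ := hmat.2 Y (by omega)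
    obtain ⟨X, hX⟩ := exists_image_eq h3
    obtain ⟨X, hXY⟩ : ∃ X : Finset (ι ⊕ Fin q), X.image (Sum.elim u z') = Y := ⟨X, hX⟩
    have e1 : rng b' = (rng (Sum.inl ∘ β)).image (Sum.elim u z') := by
      rw [← hb']; ext; simp
    have e2 : rng b = (rng (Sum.inl ∘ β)).image (Sum.elim u₀ z) := by
      rw [← hb]; ext; simp
    rw [e1, ← hXY, ← Finset.image_union, ← h2.dl_image hK, ← h2.dl_image hK, Finset.image_union,
      ← e2]
    refine hY _ ?_
    rw [h2.card_image, hXY]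
    exact hYc
  · intro p q S hSm x r y hx _ hy hxy hd ⟨t₀, ht₀⟩
    obtain ⟨x, rfl⟩ := exists_comp_of_forall_mem fun t => hmem _ (hx t)
    choose y₁ hy₁ using fun t t' => hmem _ (hy t t')
    obtain rfl : (fun t => Sum.elim (i' ∘ b') c' ∘ y₁ t) = y := funext fun t => funext (hy₁ t)
    -- Because one of the copies lies outside the base, every symbol of the relative type of `S`
    -- occurs in that of `C` over `B`; this keeps the patterns to be considered finite in number.
    have hSr : relSymb S ⊆ relSymb T := by
      rintro s ⟨v, hv, j, y', hj⟩
      rw [← hrel, ← h'.symbOver_eq]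
      refine ⟨_, (hxy t₀).pos s v hv, fun j' => ?_, j, ?_⟩
      · rcases hvj : v j' with w | w
        · simpa [hvj] using hx w
        · simpa [hvj] using hy t₀ w
      · have := ht₀ y'
        rw [Finset.mem_sdiff] at this
        simpa [hj] using this.2
    have hp : p ≤ n + l :=
      card_le_of_injective_comp ((hxy t₀).1.comp Sum.inl_injective)
    have hq : q ≤ n + l :=
      card_le_of_injective_comp (x := y₁ t₀) ((hxy t₀).1.comp Sum.inr_injective)
    let e := Sum.elim (i ∘ b) c
    -- The pattern in the matched extension is rebased to the corresponding pattern in the original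
    -- one, where `hii` gives the bound; the two `μ`-values agree by `Matches.mu_eq`.
    let S₀ := rebase S (pull ar (e ∘ x))
    have hxinj : Function.Injective x :=
      Function.Injective.of_comp ((hxy t₀).1.comp Sum.inl_injective)
    have hS₀ : IsMSAExt S₀ := isMSAExt_rebase hSm (isSymm_pull h.symm _)
      (finOcc_pull h.finOcc (h.emb_ext.1.comp hxinj))
    have hS₀r : relSymb S₀ = relSymb S := by
      ext s
      exact exists_congr fun v => and_congr_left fun hv => sameRelType_rebase s v hv
    have hform : ∀ t, OfForm S₀ (e ∘ x) (e ∘ y₁ t) := fun t => by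
      refine (hxy t).transfer (hSr.trans hK) ?_ sameRelType_rebase baseStr_rebase
      rw [← Sum.comp_elim, ← Sum.comp_elim]
      exact (hE.comp _).symm
    have h2 := hii p q S₀ hS₀ x r y₁ hform (fun t t' ht => by
      have := hd t t' ht
      rwa [Set.range_comp, Set.range_comp, Set.disjoint_image_iff h'.emb_ext.1] at this)
      t₀.pos
    refine h2.trans_eq ?_
    have hx' : Sum.elim (i ∘ b) c ∘ x = Sum.elim (i ∘ u₀) c ∘ Sum.map β id ∘ x := by
      rw [← Function.comp_assoc, Sum.elim_comp_map, ← hb]; rfl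
    have hx'' : Sum.elim (i' ∘ b') c' ∘ x = Sum.elim (i' ∘ u) c' ∘ Sum.map β id ∘ x := by
      rw [← Function.comp_assoc, Sum.elim_comp_map, ← hb']; rfl
    have h3 := (hmatE.mono le_rfl (show p + m' ≤ n + l + m' by omega)).mu_eq (μ := μ) (q := q)
      (S := S₀) (S' := S) (ξ := Sum.map β id ∘ x) h.finOcc h'.finOcc hmm
      (hst p (by omega) q (by omega) x S₀ hS₀ (hS₀r ▸ hSr) baseStr_rebase) hSm
      sameRelType_rebase.symm (by rw [← hx']; exact baseStr_rebase)
      (by rw [← hx'']; exact (hxy t₀).baseStr_eq) (by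
        rw [← hx']
        exact hw p (by omega) x)
    rw [← hx', ← hx''] at h3
    exact h3.symm

end TransferThree

/-! ### The existence axioms in structures that are locally closed models -/

section LocallyThree

variable {ζ : (lang ar).Theory} {μ : MuFun ar}

theorem freeExt_of_joinOver {M E : Type*} [(lang ar).Structure M] [(lang ar).Structure E]
    {i : M → E} (hi : IsEmb ar i) (hE : IsSymm ar E) (hf : FinOcc ar E) {B C : Finset E}
    (hJ : JoinOver ar (Set.range i) B C) {n l : ℕ} {b : Fin n → M} {c : Fin l → E}
    (hb : rng (i ∘ b) = B) (hbi : Function.Injective b) (hc : rng c = C \ B)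
    (hci : Function.Injective c) : FreeExt (pull ar (Sum.elim (i ∘ b) c)) i b c := by
  have hcm : ∀ t, c t ∈ C \ B := fun t => hc ▸ mem_rng.2 ⟨t, rfl⟩
  have hn : ∀ t, c t ∉ Set.range i := fun t ht => by
    have := Finset.mem_sdiff.1 (hcm t)
    exact this.2 (hJ.mem_iff.2 ⟨ht, this.1⟩)
  have hC : ∀ x ∈ C, ∃ t, Sum.elim (i ∘ b) c t = x := fun x hx => by
    by_cases hxB : x ∈ B
    · rw [← hb] at hxB
      obtain ⟨t, ht⟩ := mem_rng.1 hxB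
      exact ⟨Sum.inl t, ht⟩
    · have : x ∈ rng c := hc ▸ Finset.mem_sdiff.2 ⟨hx, hxB⟩
      obtain ⟨t, ht⟩ := mem_rng.1 this
      exact ⟨Sum.inr t, ht⟩
  refine ⟨hE, hf, hi, ?_, hn, fun x => ?_, fun s v hv => ?_⟩
  · let := pull ar (Sum.elim (i ∘ b) c)
    exact isEmb_pull (Function.Injective.sumElim (hi.1.comp hbi) hci
      fun t t' h => hn t' ⟨_, h⟩)
  · rcases hJ.mem_or x with h | h
    · exact Or.inl h
    · by_cases hxB : x ∈ B
      · exact Or.inl (hJ.mem_iff.1 hxB).1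
      · exact Or.inr (mem_rng.1 (hc ▸ Finset.mem_sdiff.2 ⟨h, hxB⟩ : x ∈ rng c))
  · rcases hJ.holds hv with h | h
    · exact Or.inl (exists_comp_of_forall_mem h)
    · exact Or.inr (exists_comp_of_forall_mem fun j => hC _ (h j))

/-- An instance of the axiom concerns finitely many points and, up to stability of `μ`, finitely
many symbols. It is moved to a matching closed model, where the copies exist, and the copies are
pulled back. -/
theorem LocallyModel.copies (hζ : ζ.IsUniversal) (hζj : PreservedByFreeJoins ζ)
    (hζf : FinitelyDetermined ζ) (hμ : IsMu μ) {A : Type u} {E : Type*} [(lang ar).Structure A]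
    [(lang ar).Structure E] (hA : LocallyModel ζ μ A) (hAζ : A ⊨ ζ) {n l k : ℕ} {T : Ext ar n l}
    {i : A → E} {b : Fin n → A} {c : Fin l → E} (h : FreeExt T i b c) {α : Fin k → Fin n}
    (hα : Function.Injective α) (hS : @SimplyAlg N ar _ T (baseSet n l) (topSet n l))
    (hm : @MinSimplyAlg N ar _ T (rng (Sum.inl ∘ α)) (topSet n l)) (hTζ : Sat ar T ζ)
    (hY : ∀ Y : Finset A, Y.card ≤ l → dl ar (relSymb T) (rng b) ≤ dl ar (relSymb T) (rng b ∪ Y))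
    (hii : ∀ (p q : ℕ) (S : Ext ar p q), IsMSAExt S → ∀ (x : Fin p → Fin n ⊕ Fin l) (r : ℕ)
      (y : Fin r → Fin q → Fin n ⊕ Fin l),
      (∀ t, OfForm S (Sum.elim (i ∘ b) c ∘ x) (Sum.elim (i ∘ b) c ∘ y t)) →
      (∀ t t', t ≠ t' → Disjoint (Set.range (y t)) (Set.range (y t'))) → 0 < r →
      r ≤ μ p q S (gval ar Set.univ (rng (Sum.elim (i ∘ b) c ∘ x)))) :
    Copies (restrictBase T α) (b ∘ α) Set.univ
      (μ k l (restrictBase T α) (gval ar Set.univ (rng (b ∘ α)))) := by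
  have hAf := finOcc_of_nonneg hA.delta_nonneg
  have hTs : @IsSymm N ar _ T := by
    let := T
    exact h.emb_ext.isSymm h.symm
  have hTf : @FinOcc N ar _ T := by
    let := T
    exact h.emb_ext.finOcc h.finOcc
  have hR : IsMSAExt (restrictBase T α) := isMSAExt_restrictBase hTs hα hm
  have hRr : relSymb (restrictBase T α) ⊆ relSymb T := by
    rintro s ⟨v, hv, j, y, hj⟩
    exact ⟨Sum.map α id ∘ v, hv, j, y, by simp [hj]⟩
  have hbase : baseStr T = pull ar b := structure_ext fun s v => by
    let := T
    change Holds ar s (Sum.inl ∘ v) ↔ Holds ar s (b ∘ v)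
    rw [← h.emb_ext.2, ← Function.comp_assoc, Sum.elim_comp_inl, Function.comp_assoc, h.emb.2]
  obtain ⟨m₁, hm₁⟩ := hμ.exists_stable hR
  obtain ⟨m₂, P₂, hm₂⟩ := exists_witnessed hAf (rng (b ∘ α))
  obtain ⟨m₃, hm₃⟩ := exists_uniform_stable hμ (finite_relSymb hTf) (Sum.elim (i ∘ b) c) (n + l + 1)
  obtain ⟨m₄, P₄, hm₄⟩ := exists_uniform_witnessed h.finOcc (Sum.elim (i ∘ b) c) (n + l + 1)
  obtain ⟨K, hKf, hK⟩ := hζf k l _ hR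
  obtain ⟨m₅, hm₅⟩ := exists_firstSymb hKf
  obtain ⟨m₆, hm₆⟩ := exists_firstSymb (finite_relSymb hTf)
  obtain ⟨P₄', hP₄⟩ := exists_image_eq (cap_subset_right P₄ (Set.range i))
  obtain ⟨q, P, -, hP⟩ := exists_enum (P₂ ∪ P₄')
  -- `m'` covers stability of all `μ`-values involved and the witnesses for `g`; `m` also covers the
  -- symbols that decide `ζ` and those of `T`.
  obtain ⟨m', hm'⟩ : ∃ m', m' = m₁ + m₂ + m₃ + m₄ := ⟨_, rfl⟩
  obtain ⟨m, hmm⟩ : ∃ m, m = m' + m₅ + m₆ := ⟨_, rfl⟩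
  obtain ⟨r, hr⟩ : ∃ r, r = μ k l (restrictBase T α) (gval ar Set.univ (rng (b ∘ α))) := ⟨_, rfl⟩
  -- The matching has to reach `n + l + m'` points for values of `g` in the free join, `k + m'` for
  -- that of the minimal base, and `r * l` for the copies to be pulled back. The witnesses for `g`
  -- are included in the tuple as `P`.
  obtain ⟨M, _, hM, u, hu⟩ := hA.exists_matches (Sum.elim b P) m (n + l + m' + k + r * l)
  let b' : Fin n → M := u ∘ Sum.inl
  have hb' : Function.Injective b' := (hu.1.comp Sum.inl).injective h.injective_left
  let T' := rebase T (pull ar b')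
  have hT'b : baseStr T' = pull ar b' := baseStr_rebase
  have hT'e : @IsEmb N ar _ _ _ (baseStr T') b' := by
    rw [hT'b]
    exact isEmb_pull hb'
  have hTT' : SameRelType T' T := sameRelType_rebase
  have hT's : @IsSymm N ar _ T' := isSymm_rebase hTs (isSymm_pull hM.symm _)
  have hT'f : @FinOcc N ar _ T' := finOcc_rebase hTf (finOcc_pull hM.finOcc hb')
  have hR' : IsMSAExt (restrictBase T' α) :=
    isMSAExt_restrictBase hT's hα (minSimplyAlg_congr hTT'.symm.congr hTf hT'f hm)
  have hRb : baseStr (restrictBase T α) = pull ar (b ∘ α) := structure_ext fun s v => by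
    change @Holds N ar _ (baseStr T) s (α ∘ v) ↔ Holds ar s (b ∘ α ∘ v)
    rw [hbase]
    rfl
  have hRb' : baseStr (restrictBase T' α) = pull ar (b' ∘ α) := structure_ext fun s v => by
    change @Holds N ar _ (baseStr T') s (α ∘ v) ↔ Holds ar s (b' ∘ α ∘ v)
    rw [hT'b]
    rfl
  -- `ζ` holds in the rebased extension of the minimal base by finite determinacy, and then in `T'`
  -- because this is a free join.
  have hT'ζ : Sat ar T' ζ := by
    have hz : Sat ar (baseStr T') ζ := by
      let := baseStr T'
      exact models_of_isEmb hζ hT'e hM.axiomTwo.1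
    have hzR' : Sat ar (baseStr (restrictBase T' α)) ζ := by
      rw [hRb']
      let := pull ar (b' ∘ α)
      exact models_of_isEmb hζ (isEmb_pull (hb'.comp hα)) hM.axiomTwo.1
    have hzR : Sat ar (baseStr (restrictBase T α)) ζ := by
      rw [hRb]
      let := pull ar (b ∘ α)
      exact models_of_isEmb hζ (isEmb_pull (h.injective_left.comp hα)) hAζ
    refine sat_of_restrictBase hζ hζj hT's hT'f (simplyAlg_congr hTT'.symm.congr hTf hT'f hS) hα
      (minSimplyAlg_congr hTT'.symm.congr hTf hT'f hm) hz ?_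
    refine (hK (restrictBase T α) (restrictBase T' α) hR hR' (fun _ _ _ => Iff.rfl)
      (hTT'.restrictBase α) (fun s hs v => ?_) hzR hzR').1 ?_
    · rw [hRb, hRb']
      exact hu.1.2 s (firstSymb_mono (by omega) (hm₅ hs)) (Sum.inl ∘ α ∘ v)
    · let := T
      let := restrictBase T α
      exact models_of_isEmb hζ (isEmb_pull (Sum.map_injective.2 ⟨hα, Function.injective_id⟩)) hTζ
  let := adjoin T' b'
  have h' : FreeExt T' (Sum.inl : M → M ⊕ Fin l) b' Sum.inr :=
    freeExt_adjoin hM.symm hM.finOcc hT's hT'f hT'e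
  have hP2 : ∀ x ∈ P₂ ∪ P₄', ∃ t, P t = x := fun x hx => mem_rng.1 (hP ▸ hx)
  have hcop := h.copies_of_matches hζ hζj hμ h' hTT'.symm hM.algClosed hM.axiomTwo.2.1
    hM.axiomTwo.2.2 hM.axiomTwo.1 (β := Sum.inl) (u₀ := Sum.elim b P) rfl rfl
    (hu.mono le_rfl (show n + l + m' ≤ _ by omega)) (show m' ≤ m by omega)
    (hm₆.trans (firstSymb_mono (by omega))) hα hS hm hT'ζ hY
    (fun p hp q hq x S h1 h2 h3 => (hm₃ p hp q hq x S h1 h2 h3).mono (by omega))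
    (fun p hp x => (hm₄ p hp x).mono (by omega) fun z hz => by
      rcases h.cover z with h1 | ⟨t, rfl⟩
      · have : z ∈ P₄'.image i := by
          rw [hP₄]
          exact mem_cap.2 ⟨hz, h1⟩
        obtain ⟨y, hy, rfl⟩ := Finset.mem_image.1 this
        obtain ⟨t, rfl⟩ := hP2 y (Finset.mem_union_right _ hy)
        exact ⟨Sum.inl (Sum.inr t), rfl⟩
      · exact ⟨Sum.inr t, rfl⟩) hii
  have hμeq := (hu.mono le_rfl (show k + m' ≤ _ by omega)).mu_eq (μ := μ) (q := l)
    (S := restrictBase T α) (S' := restrictBase T' α) (ξ := Sum.inl ∘ α) hAf hM.finOcc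
    (show m' ≤ m by omega) (hm₁.mono (by omega)) hR' (hTT'.restrictBase α) hRb hRb'
    (hm₂.mono (by omega) fun x hx => by
      obtain ⟨t, rfl⟩ := hP2 x (Finset.mem_union_left _ hx)
      exact ⟨Sum.inr t, rfl⟩)
  have hμeq' : μ k l (restrictBase T' α) (gval ar Set.univ (rng (b' ∘ α))) = r := hμeq.trans hr.symm
  rw [hμeq'] at hcop
  rw [← hr]
  obtain ⟨y, -, hy2, hy3⟩ := hcop
  let X : Finset M := img fun p : Fin r × Fin l => y p.1 p.2
  have hX : X.card ≤ r * l := by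
    refine Finset.card_image_le.trans ?_
    simp
  obtain ⟨q', z, z', hz1, hz2⟩ := hu.2 X (by omega)
  have : ∀ t t', ∃ j, Sum.elim u z' j = y t t' := fun t t' =>
    hz2 (Finset.mem_coe.2 (Finset.mem_image.2 ⟨(t, t'), Finset.mem_univ _, rfl⟩))
  choose η hη using this
  have hη' : ∀ t, Sum.elim u z' ∘ η t = y t := fun t => funext (hη t)
  refine ⟨fun t => Sum.elim (Sum.elim b P) z ∘ η t, fun _ _ => trivial, fun t => ?_,
    fun t t' ht => ?_⟩
  · refine (hy2 t).transfer (K := firstSymb N m) ?_ ?_ (hTT'.restrictBase α).symm hRb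
    · refine Set.Subset.trans ?_ (hm₆.trans (firstSymb_mono (by omega)))
      rintro s ⟨v, hv, hj⟩
      exact hRr ⟨v, (hTT'.restrictBase α s v hj).1 hv, hj⟩
    · have h1 := hz1.symm.comp (Sum.elim (Sum.inl ∘ Sum.inl ∘ α) (η t))
      rw [Sum.comp_elim, Sum.comp_elim, hη'] at h1
      exact h1
  · rw [Set.disjoint_left]
    rintro _ ⟨x, rfl⟩ ⟨x', hx'⟩
    refine Set.disjoint_left.1 (hy3 t t' ht) ⟨x, rfl⟩ ⟨x', ?_⟩
    rw [← hη, ← hη]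
    exact (hz1.1 _ _).1 hx'

theorem LocallyModel.axiomThree (hζ : ζ.IsUniversal) (hζj : PreservedByFreeJoins ζ)
    (hζf : FinitelyDetermined ζ) (hμ : IsMu μ) {A : Type u} [(lang ar).Structure A]
    (hA : LocallyModel ζ μ A) (hAζ : A ⊨ ζ) : AxiomThree ζ μ A := by
  intro E _ i B C k l a c hE hBi hU hfr hBs hC hBC ha hc haB hcC hm hY hg
  have hi := i.isEmb
  have hJ : JoinOver ar (Set.range i) B C := ⟨hBi, hU, hfr⟩
  have hf := finOcc_of_joinOver hi hA.delta_nonneg hJ fun A hA => hC.2.1 A (by exact_mod_cast hA)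
  obtain ⟨B', hB'⟩ := exists_image_eq hJ.subset_left
  obtain ⟨n, b, hb, hbB'⟩ := exists_enum B'
  have hbB : rng (i ∘ b) = B := by
    rw [← hB', ← hbB']; ext; simp
  have : ∀ t, ∃ w, i (b w) = a t := fun t => mem_rng.1 (hbB ▸ haB t)
  choose α hα using this
  obtain rfl : i ∘ b ∘ α = a := funext hα
  have hαi : Function.Injective α :=
    Function.Injective.of_comp (f := b) (Function.Injective.of_comp (f := i) ha)
  let T : Ext ar n l := pull ar (Sum.elim (i ∘ b) c)
  have h : FreeExt T i b c := freeExt_of_joinOver hi hE hf hJ hbB hb hcC hc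
  have hCr : rng (i ∘ b) ∪ rng c = C := by
    rw [hbB, show rng c = C \ B from hcC, Finset.union_sdiff_of_subset hJ.subset]
  have hS : @SimplyAlg N ar _ T (baseSet n l) (topSet n l) := by
    let := T
    rw [← h.emb_ext.simplyAlg_image, image_baseSet, image_topSet, hcC]
    exact (show rng (i ∘ b) = B from hbB) ▸ hBC
  have hTm : @MinSimplyAlg N ar _ T (rng (Sum.inl ∘ α)) (topSet n l) := by
    let := T
    rw [← h.emb_ext.minSimplyAlg_image, image_topSet, hcC]
    convert hm using 1
    ext; simp
  have hran : Set.range (Sum.elim (i ∘ b) c) = (C : Set E) := by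
    rw [← hCr, Set.Sum.elim_range]
    simp
    rfl
  have hTζ : Sat ar T ζ := by
    let := T
    exact (models_subOf_iff hζ h.emb_ext hran).1 hC.2.2.2
  have hsym : symbOver ar B C = relSymb T := by
    rw [← hCr, ← hbB]
    exact h.symbOver_eq
  have hl : (C \ B).card = l := by
    rw [← hcC, Finset.card_image_of_injective _ hc, Finset.card_univ, Fintype.card_fin]
  have hcop := hA.copies hζ hζj hζf hμ hAζ h hαi hS hTm hTζ (fun Y hYc => ?_)
    fun p q S hSm x r y hxy hd hr => ?_
  · obtain ⟨y, -, hy2, hy3⟩ := hcop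
    rw [h.pull_eq]
    have h4 := hi.gval_rng Set.univ (b ∘ α)
    rw [Set.image_univ] at h4
    rw [h4]
    refine ⟨fun t => i ∘ y t, fun t t' => ⟨_, rfl⟩, fun t => ?_, fun t t' ht => ?_⟩
    · exact hi.ofForm_comp.2 (hy2 t)
    · rw [Set.range_comp, Set.range_comp, Set.disjoint_image_iff hi.1]
      exact hy3 t t' ht
  · by_contra hn
    refine hY ⟨Y.image i, ?_, ?_, ?_⟩
    · simp
    · rw [hl]
      exact Finset.card_image_le.trans hYc
    · rw [deltaIn_eq hf, deltaIn_eq hf, hsym, ← hB', ← Finset.image_union, hi.dl_image,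
        hi.dl_image, ← hbB']
      exact_mod_cast not_le.1 hn
  · have hxC : ∀ {j : ℕ} (x : Fin j → Fin n ⊕ Fin l) t, (Sum.elim (i ∘ b) c ∘ x) t ∈ C :=
      fun x t => Finset.mem_coe.1 (hran ▸ ⟨_, rfl⟩)
    rw [← hg p q S hSm _ _ (hxC x) (hxC (y ⟨0, hr⟩)) (hxy ⟨0, hr⟩)]
    refine hC.2.2.1 p q S hSm _ r _ (hxC x) (fun t => hxC (y t)) hxy fun t t' ht => ?_
    rw [Set.range_comp, Set.range_comp, Set.disjoint_image_iff h.emb_ext.1]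
    exact hd t t' ht

theorem LocallyModel.closedModel (hζ : ζ.IsUniversal) (hζj : PreservedByFreeJoins ζ)
    (hζf : FinitelyDetermined ζ) (hμ : IsMu μ) {A : Type u} [(lang ar).Structure A]
    (hA : LocallyModel ζ μ A) (hAζ : A ⊨ ζ) : ClosedModel ζ μ A := by
  have h2 : AxiomTwo ζ μ A := ⟨hAζ, hA.delta_nonneg, hA.muBound hμ⟩
  exact ⟨hA.symm, h2, algClosed_of_axiomThree hζ hA.symm h2 (hA.axiomThree hζ hζj hζf hμ hAζ)⟩

theorem closedModel_iff (hζ : ζ.IsUniversal) (hζj : PreservedByFreeJoins ζ) (hμ : IsMu μ)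
    {A : Type u} [(lang ar).Structure A] :
    ClosedModel ζ μ A ↔ IsSymm ar A ∧ AxiomTwo ζ μ A ∧ AxiomThree ζ μ A :=
  ⟨fun h => ⟨h.symm, h.axiomTwo, axiomThree_of_algClosed hζ hζj hμ h.algClosed h.axiomTwo⟩,
    fun h => ⟨h.1, h.2.1, algClosed_of_axiomThree hζ h.1 h.2.1 h.2.2⟩⟩

end LocallyThree

/-! ## Types in finite sublanguages as sentences -/

section Sentences

open FirstOrder.Language

theorem isQF_iInf {L : FirstOrder.Language.{0, 0}} {α β : Type*} [Finite β] {n : ℕ}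
    {f : β → L.BoundedFormula α n} (h : ∀ i, (f i).IsQF) : (BoundedFormula.iInf f).IsQF := by
  have key : ∀ l : List β, (List.foldr (· ⊓ ·) ⊤ (l.map f)).IsQF := fun l => by
    induction l with
    | nil => exact BoundedFormula.IsQF.top
    | cons a l ih => exact (h a).inf ih
  exact key _

/-- Quantifier-free definable properties of `p`-tuples. -/
def QFDefinable (ar : Symb N → ℕ) (p : ℕ)
    (P : ∀ (M : Type u) [(lang ar).Structure M], (Fin p → M) → Prop) : Prop :=
  ∃ θ : (lang ar).BoundedFormula Empty p, θ.IsQF ∧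
    ∀ (M : Type u) [(lang ar).Structure M] (v : Fin p → M), θ.Realize default v ↔ P M v

variable {p : ℕ} {P Q : ∀ (M : Type u) [(lang ar).Structure M], (Fin p → M) → Prop}

theorem QFDefinable.congr (h : QFDefinable ar p P)
    (hPQ : ∀ (M : Type u) [(lang ar).Structure M] (v : Fin p → M), P M v ↔ Q M v) :
    QFDefinable ar p Q :=
  h.imp fun _ hθ => ⟨hθ.1, fun M _ v => (hθ.2 M v).trans (hPQ M v)⟩

theorem QFDefinable.not (h : QFDefinable ar p P) : QFDefinable ar p fun M _ v => ¬ P M v := by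
  obtain ⟨θ, h1, h2⟩ := h
  exact ⟨θ.not, h1.not, fun M _ v => by rw [BoundedFormula.realize_not, h2]⟩

theorem QFDefinable.forall {I : Type*} [Finite I]
    {P : I → ∀ (M : Type u) [(lang ar).Structure M], (Fin p → M) → Prop}
    (h : ∀ i, QFDefinable ar p (P i)) : QFDefinable ar p fun M _ v => ∀ i, P i M v := by
  choose θ h1 h2 using h
  exact ⟨BoundedFormula.iInf θ, isQF_iInf h1, fun M _ v => by
    rw [BoundedFormula.realize_iInf]
    exact forall_congr' fun i => h2 i M v⟩

theorem QFDefinable.iff_const (h : QFDefinable ar p P) (c : Prop) :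
    QFDefinable ar p fun M _ v => (c ↔ P M v) := by
  by_cases hc : c
  · exact h.congr fun M _ v => by simp [hc]
  · exact h.not.congr fun M _ v => by simp [hc]

theorem qfDefinable_eq (i j : Fin p) : QFDefinable.{u} ar p fun _ _ v => v i = v j :=
  ⟨Term.bdEqual (Term.var (Sum.inr i)) (Term.var (Sum.inr j)),
    BoundedFormula.IsAtomic.isQF (BoundedFormula.IsAtomic.equal _ _), fun M _ v => by
      rw [BoundedFormula.realize_bdEqual]
      rfl⟩

theorem qfDefinable_holds (s : Symb N) (w : Fin (ar s) → Fin p) :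
    QFDefinable.{u} ar p fun _ _ v => Holds ar s (v ∘ w) :=
  ⟨Relations.boundedFormula (L := lang ar) (l := p) (n := ar s) ⟨s, rfl⟩
      fun j => Term.var (Sum.inr (w j)),
    BoundedFormula.IsAtomic.isQF (BoundedFormula.IsAtomic.rel _ _), fun _ _ _ => Iff.rfl⟩

theorem finite_firstSymb (m : ℕ) : (firstSymb N m).Finite :=
  Set.Finite.of_finite_image ((Set.finite_Iio m).subset (by rintro _ ⟨s, hs, rfl⟩; exact hs))
    Subtype.val_injective.injOn

theorem qfDefinable_sameTp {X : Type u} [(lang ar).Structure X] (m : ℕ) (w : Fin p → X) :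
    QFDefinable.{u} ar p fun _ _ v => SameTp ar (firstSymb N m) w v := by
  have := (finite_firstSymb (N := N) m).to_subtype
  have h1 : QFDefinable.{u} ar p fun _ _ v => ∀ i : Fin p × Fin p, w i.1 = w i.2 ↔ v i.1 = v i.2 :=
    QFDefinable.forall fun i => (qfDefinable_eq i.1 i.2).iff_const _
  have h2 : QFDefinable.{u} ar p fun _ _ v =>
      ∀ i : Σ s : firstSymb N m, (Fin (ar s.1) → Fin p), Holds ar i.1.1 (w ∘ i.2) ↔
        Holds ar i.1.1 (v ∘ i.2) :=
    QFDefinable.forall fun i => (qfDefinable_holds i.1.1 i.2).iff_const _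
  refine (QFDefinable.forall (I := Bool) (P := fun i M _ v => match i with
    | true => ∀ i : Fin p × Fin p, w i.1 = w i.2 ↔ v i.1 = v i.2
    | false => ∀ i : Σ s : firstSymb N m, (Fin (ar s.1) → Fin p), Holds ar i.1.1 (w ∘ i.2) ↔
        Holds ar i.1.1 (v ∘ i.2)) (fun i => ?_)).congr fun M _ v => ?_
  · cases i
    · exact h2
    · exact h1
  · constructor
    · exact fun h => ⟨fun i j => h true (i, j), fun s hs z => h false ⟨⟨s, hs⟩, z⟩⟩
    · rintro ⟨h3, h4⟩ (_ | _)
      · exact fun i => h4 _ i.1.2 i.2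
      · exact fun i => h3 i.1 i.2

/-- Only finitely many types in the first `m` relations occur. -/
theorem exists_finite_sameTp {X : Type u} [(lang ar).Structure X] (m : ℕ) (W : Set (Fin p → X)) :
    ∃ W' ⊆ W, W'.Finite ∧ ∀ w ∈ W, ∃ w' ∈ W', SameTp ar (firstSymb N m) w w' := by
  have := (finite_firstSymb (N := N) m).to_subtype
  let F : (Fin p → X) → Set (Fin p × Fin p) ×
      Set (Σ s : firstSymb N m, (Fin (ar s.1) → Fin p)) := fun w =>
    ({i | w i.1 = w i.2}, {i | Holds ar i.1.1 (w ∘ i.2)})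
  obtain ⟨W', hW, hb⟩ := (Set.surjOn_image F W).exists_bijOn_subset
  refine ⟨W', hW, hb.finite_iff_finite.2 (Set.toFinite _), fun w hw => ?_⟩
  obtain ⟨w', hw', he⟩ := hb.surjOn (Set.mem_image_of_mem F hw)
  refine ⟨w', hw', fun i j => ?_, fun s hs z => ?_⟩
  · have : (i, j) ∈ (F w').1 ↔ (i, j) ∈ (F w).1 := by rw [he]
    exact this.symm
  · have : (⟨⟨s, hs⟩, z⟩ : Σ s : firstSymb N m, (Fin (ar s.1) → Fin p)) ∈ (F w').2 ↔
        (⟨⟨s, hs⟩, z⟩ : Σ s : firstSymb N m, (Fin (ar s.1) → Fin p)) ∈ (F w).2 := by rw [he]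
    exact this.symm

/-- `W` may be infinite, but its tuples have only finitely many types in the first `m` symbols, so
the conjunction is finite. -/
theorem qfDefinable_forall_not_sameTp {X : Type u} [(lang ar).Structure X] (m : ℕ)
    (W : Set (Fin p → X)) :
    QFDefinable.{u} ar p fun _ _ v => ∀ w ∈ W, ¬ SameTp ar (firstSymb N m) w v := by
  obtain ⟨W', hW, hf, h⟩ := exists_finite_sameTp (ar := ar) m W
  have := hf.to_subtype
  refine (QFDefinable.forall (I := W') (P := fun w M _ v => ¬ SameTp ar (firstSymb N m) w.1 v)
    fun w => (qfDefinable_sameTp (ar := ar) m w.1).not).congr fun M _ v => ?_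
  constructor
  · intro h1 w hw h2
    obtain ⟨w', hw', h3⟩ := h w hw
    exact h1 ⟨w', hw'⟩ (h3.symm.trans h2)
  · exact fun h1 w => h1 w.1 (hW w.2)

theorem exists_isExistential {L : FirstOrder.Language.{0, 0}} {n : ℕ} (k : ℕ) :
    ∀ {θ : L.BoundedFormula Empty (n + k)}, θ.IsExistential →
      ∃ φ : L.BoundedFormula Empty n, φ.IsExistential ∧
        ∀ (M : Type u) [L.Structure M] (v : Fin n → M),
          φ.Realize default v ↔ ∃ y : Fin k → M, θ.Realize default (Fin.append v y) := by
  induction k with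
  | zero =>
    refine fun {θ} h => ⟨θ, h, fun M _ v => ?_⟩
    constructor
    · exact fun h => ⟨Fin.elim0, by rwa [Fin.append_elim0]⟩
    · rintro ⟨y, hy⟩
      rw [Subsingleton.elim y Fin.elim0, Fin.append_elim0] at hy
      exact hy
  | succ k ih =>
    intro θ h
    obtain ⟨φ, h1, h2⟩ := ih (θ := BoundedFormula.ex (n := n + k) θ) h.ex
    refine ⟨φ, h1, fun M _ v => ?_⟩
    rw [h2]
    constructor
    · rintro ⟨y, hy⟩
      obtain ⟨x, hx⟩ := BoundedFormula.realize_ex.1 hy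
      refine ⟨Fin.snoc y x, ?_⟩
      rw [Fin.append_snoc]
      exact hx
    · rintro ⟨y, hy⟩
      refine ⟨Fin.init y, BoundedFormula.realize_ex.2 ⟨y (Fin.last k), ?_⟩⟩
      rw [← Fin.snoc_init_self y, Fin.append_snoc] at hy
      exact hy

theorem isForallExists_alls {L : FirstOrder.Language.{0, 0}} {n : ℕ} : ∀ {φ : L.BoundedFormula Empty n},
    IsForallExists φ → IsForallExists φ.alls := by
  induction n with
  | zero => exact fun h => h
  | succ n ih => exact fun h => ih h.all

theorem exists_forallExists {X : Type u} [(lang ar).Structure X] (m n k : ℕ)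
    (W : Set (Fin n ⊕ Fin k → X)) : ∃ φ : (lang ar).Sentence, IsForallExists φ ∧
      ∀ (M : Type u) [(lang ar).Structure M], M ⊨ φ ↔ ∀ x : Fin n → M, ∃ y : Fin k → M,
        ∀ w ∈ W, ¬ SameTp ar (firstSymb N m) w (Sum.elim x y) := by
  obtain ⟨θ, h1, h2⟩ := qfDefinable_forall_not_sameTp.{u} (ar := ar) m
    ((fun w => w ∘ (finSumFinEquiv (m := n) (n := k)).symm) '' W)
  obtain ⟨φ, h3, h4⟩ := exists_isExistential.{u} k (BoundedFormula.IsExistential.of_isQF h1)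
  refine ⟨φ.alls, isForallExists_alls (IsForallExists.of_isExistential h3), fun M _ => ?_⟩
  refine BoundedFormula.realize_alls.trans (forall_congr' fun x => ?_)
  rw [h4]
  refine exists_congr fun y => ?_
  rw [h2]
  have e : Fin.append x y = Sum.elim x y ∘ finSumFinEquiv.symm := by
    rw [← Fin.append_comp_sumElim, Function.comp_assoc]
    funext t
    obtain ⟨t, rfl⟩ := finSumFinEquiv.surjective t
    rcases t with t | t <;> simp
  have key : ∀ w : Fin n ⊕ Fin k → X, SameTp ar (firstSymb N m) (w ∘ finSumFinEquiv.symm)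
      (Fin.append x y) ↔ SameTp ar (firstSymb N m) w (Sum.elim x y) := fun w => by
    rw [e]
    constructor
    · intro h
      have := h.comp (finSumFinEquiv (m := n) (n := k))
      rwa [Function.comp_assoc, Function.comp_assoc, Equiv.symm_comp_self] at this
    · exact fun h => h.comp _
  refine Set.forall_mem_image.trans ?_
  exact forall₂_congr fun w _ => not_congr (key w)

end Sentences

/-! ### The `∀∃`-theory of the closed models -/

section Axioms

variable {ζ : (lang ar).Theory} {μ : MuFun ar}

theorem SameTp.matches_of_forall {E E' : Type*} [(lang ar).Structure E] [(lang ar).Structure E']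
    {ι : Type*} {m k : ℕ} {u₀ : ι → E} {u : ι → E'} (h : SameTp ar (firstSymb N m) u₀ u)
    (hk : ∀ y : Fin k → E', ∃ w : Fin k → E, SameTp ar (firstSymb N m) (Sum.elim u₀ w)
      (Sum.elim u y)) : Matches ar m k u₀ u := by
  refine ⟨h, fun X hX => ?_⟩
  rcases X.eq_empty_or_nonempty with rfl | ⟨x, hx⟩
  · refine ⟨0, Fin.elim0, Fin.elim0, ?_, by simp⟩
    have h1 := h.comp (Sum.elim id Fin.elim0)
    convert h1 using 1 <;>
    · funext t
      rcases t with t | t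
      · rfl
      · exact t.elim0
  · obtain ⟨n, b, -, hb⟩ := exists_enum X
    have hn : n ≤ k ∨ k < n := le_or_gt n k
    -- Sets of fewer than `k` points are enumerated with repetitions.
    have hc : ∃ y : Fin k → E', (X : Set E') ⊆ Set.range y := by
      refine ⟨fun t => if ht : t.1 < X.card then (X.equivFin.symm ⟨t, ht⟩).1 else x, fun z hz => ?_⟩
      refine ⟨⟨X.equivFin ⟨z, hz⟩, (X.equivFin ⟨z, hz⟩).2.trans_le hX⟩, ?_⟩
      simp
    obtain ⟨y, hy⟩ := hc
    obtain ⟨w, hw⟩ := hk y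
    refine ⟨k, w, y, hw, fun z hz => ?_⟩
    obtain ⟨t, rfl⟩ := hy hz
    exact ⟨Sum.inr t, rfl⟩

theorem SameTp.of_isEmpty {E E' : Type*} [(lang ar).Structure E] [(lang ar).Structure E']
    {ι : Type*} [IsEmpty ι] (h0 : ∀ A : Finset E, 0 ≤ delta ar A)
    (h0' : ∀ A : Finset E', 0 ≤ delta ar A) (K : Set (Symb N)) (f : ι → E) (f' : ι → E') :
    SameTp ar K f f' :=
  ⟨fun i => isEmptyElim i, fun _ _ w => iff_of_false
    (fun h => isEmptyElim (w ⟨0, arity_pos h0 h⟩)) fun h => isEmptyElim (w ⟨0, arity_pos h0' h⟩)⟩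

/-- The `∀∃`-sentences that hold in all closed models. -/
def closedTheory (ζ : (lang ar).Theory) (μ : MuFun ar) : (lang ar).Theory :=
  {φ | IsForallExists φ ∧ ∀ (M : Type u) [(lang ar).Structure M], ClosedModel ζ μ M → M ⊨ φ}

theorem ClosedModel.models_closedTheory {M : Type u} [(lang ar).Structure M] (h : ClosedModel ζ μ M) :
    M ⊨ closedTheory.{u} ζ μ := (FirstOrder.Language.Theory.model_iff _).2 fun _ hφ => hφ.2 M h

theorem IsUniversal.isForallExists {n : ℕ} {φ : (lang ar).BoundedFormula Empty n}
    (h : FirstOrder.Language.BoundedFormula.IsUniversal φ) : IsForallExists φ := by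
  induction h with
  | of_isQF h => exact IsForallExists.of_isExistential (.of_isQF h)
  | all _ ih => exact ih.all

theorem models_of_models_closedTheory (hζ : ζ.IsUniversal) {A : Type u} [(lang ar).Structure A]
    (hA : A ⊨ closedTheory.{u} ζ μ) : A ⊨ ζ := by
  rw [FirstOrder.Language.Theory.model_iff] at hA ⊢
  refine fun φ hφ => hA φ ⟨IsUniversal.isForallExists (hζ.isUniversal_of_mem hφ), fun M _ hM => ?_⟩
  exact (FirstOrder.Language.Theory.model_iff _).1 hM.axiomTwo.1 φ hφ

/-- If `u₀` had no match, every tuple of its type in a closed model would extend by `k` points to a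
tuple of a type not realized over `u₀`. This is a `∀∃` sentence true in all closed models, hence in
`A`, but it fails at `u₀`. -/
theorem locallyModel_of_models_closedTheory {A : Type u} [(lang ar).Structure A]
    (hA : A ⊨ closedTheory.{u} ζ μ) : LocallyModel ζ μ A := by
  rw [FirstOrder.Language.Theory.model_iff] at hA
  intro n u₀ m k
  by_contra hn
  push Not at hn
  -- The same argument without existential variables shows that the type of `u₀` occurs in some
  -- closed model.
  have hex : ∃ (M : Type u) (_ : (lang ar).Structure M), ClosedModel ζ μ M ∧
      ∃ u : Fin n → M, SameTp ar (firstSymb N m) u₀ u := by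
    by_contra hc
    push Not at hc
    obtain ⟨φ, h1, h2⟩ := exists_forallExists.{u} (ar := ar) m n 0 {Sum.elim u₀ Fin.elim0}
    have h3 : A ⊨ φ := hA φ ⟨h1, fun M _ hM => (h2 M).2 fun x => ⟨Fin.elim0, ?_⟩⟩
    · obtain ⟨y, hy⟩ := (h2 A).1 h3 u₀
      refine hy _ rfl ?_
      rw [Subsingleton.elim y Fin.elim0]
      exact ⟨fun _ _ => Iff.rfl, fun _ _ _ => Iff.rfl⟩
    · rintro w rfl h
      exact hc M _ hM x (h.comp Sum.inl)
  obtain ⟨M₁, _, hM₁, u₁, hu₁⟩ := hex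
  obtain ⟨φ, h1, h2⟩ := exists_forallExists.{u} (ar := ar) m n k
    (Set.range fun w : Fin k → A => Sum.elim u₀ w)
  have h3 : A ⊨ φ := hA φ ⟨h1, fun M _ hM => (h2 M).2 fun x => ?_⟩
  · obtain ⟨y, hy⟩ := (h2 A).1 h3 u₀
    exact hy _ ⟨y, rfl⟩ ⟨fun _ _ => Iff.rfl, fun _ _ _ => Iff.rfl⟩
  · by_cases hs : SameTp ar (firstSymb N m) u₀ x
    · by_contra hc
      push Not at hc
      refine hn M _ hM x (hs.matches_of_forall fun y => ?_)
      obtain ⟨_, ⟨w, rfl⟩, hw⟩ := hc y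
      exact ⟨w, hw⟩
    · have hM' : Nonempty M := by
        by_contra he
        rw [not_nonempty_iff] at he
        have : IsEmpty (Fin n) := ⟨fun t => isEmptyElim (x t)⟩
        exact hs (hu₁.trans (.of_isEmpty hM₁.axiomTwo.2.1 hM.axiomTwo.2.1 _ _ _))
      refine ⟨fun _ => hM'.some, ?_⟩
      rintro _ ⟨w, rfl⟩ h
      exact hs (h.comp Sum.inl)

theorem models_closedTheory_iff (hζ : ζ.IsUniversal) (hζj : PreservedByFreeJoins ζ)
    (hζf : FinitelyDetermined ζ) (hμ : IsMu μ) {A : Type u} [(lang ar).Structure A] :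
    A ⊨ closedTheory.{u} ζ μ ↔ ClosedModel ζ μ A :=
  ⟨fun h => (locallyModel_of_models_closedTheory h).closedModel hζ hζj hζf hμ
    (models_of_models_closedTheory hζ h), ClosedModel.models_closedTheory⟩

end Axioms

/-! ## Points that are algebraic in a bounded way form finite sets -/

section Bad

variable {A : Type*} [(lang ar).Structure A] {μ : MuFun ar}

/-- An intersection that is a proper nonempty part of one of them has positive predimension over
`B`. By submodularity the union would then lie below the strong set `B`. -/
theorem SimplyAlg.eq_or_disjoint (hf : FinOcc ar A) {B Y Y' : Finset A}
    (hB : Strong ar B Set.univ) (h : SimplyAlg ar B Y) (h' : SimplyAlg ar B Y') :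
    Y = Y' ∨ Disjoint Y Y' := by
  rw [simplyAlg_iff hf] at h h'
  rw [or_iff_not_imp_right]
  intro hd
  have h1 := dl_submod hf Set.univ (B ∪ Y) (B ∪ Y')
  rw [← Finset.union_inter_distrib_left] at h1
  have h2 := ((strong_iff hf).1 hB).2 (B ∪ Y ∪ (B ∪ Y'))
    (Finset.subset_union_left.trans Finset.subset_union_left) (Set.subset_univ _)
  have h3 : (Y ∩ Y').Nonempty := by
    rwa [Finset.nonempty_iff_ne_empty, ne_eq, ← Finset.disjoint_iff_inter_eq_empty]
  have h4 : Y ∩ Y' = Y := by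
    by_contra hn
    have := h.2.2.2 _ Finset.inter_subset_left h3 hn
    omega
  have h5 : Y ∩ Y' = Y' := by
    by_contra hn
    have := h'.2.2.2 _ Finset.inter_subset_right h3 hn
    omega
  exact h4.symm.trans h5

theorem finite_of_copies (hμ : MuBound μ (Set.univ : Set A)) {k l : ℕ} {S : Ext ar k l}
    (hS : IsMSAExt S) (a : Fin k → A) {𝒴 : Set (Finset A)} (hd : 𝒴.PairwiseDisjoint id)
    (h : ∀ Y ∈ 𝒴, ∃ b, OfForm S a b ∧ rng b = Y) : 𝒴.Finite := by
  by_contra hn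
  obtain ⟨t, ht, htc⟩ := Set.Infinite.exists_subset_card_eq hn
    (μ k l S (gval ar Set.univ (rng a)) + 1)
  have e := (t.equivFinOfCardEq htc).symm
  choose b hb hbr using fun i => h _ (ht (e i).2)
  have : _ ≤ μ k l S (gval ar Set.univ (rng a)) := hμ k l S hS a _ b (fun _ => trivial)
      (fun _ _ => trivial) hb fun i j hij => by
    have h1 := hd (ht (e i).2) (ht (e j).2) fun he => hij (e.injective (Subtype.ext he))
    have h2 : Disjoint (rng (b i)) (rng (b j)) := by
      rw [hbr, hbr]
      exact h1
    rw [← Finset.disjoint_coe] at h2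
    simpa using h2
  omega

/-- Bounding size and symbols leaves finitely many patterns and bases inside `B`. For each of them
the extensions are pairwise disjoint copies, so the `μ`-bound leaves finitely many. -/
theorem finite_simplyAlg (hsy : IsSymm ar A) (hf : FinOcc ar A) (hμ : MuBound μ (Set.univ : Set A))
    {B : Finset A} (hB : Strong ar B Set.univ) (m d : ℕ) :
    {Y : Finset A | SimplyAlg ar B Y ∧ Y.card ≤ d ∧ ∀ (s : Symb N) (v : Fin (ar s) → A),
      Holds ar s v → (∀ j, v j ∈ B ∪ Y) → (∃ j, v j ∈ Y) → s ∈ firstSymb N m}.Finite := by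
  obtain ⟨n, β, hβ, hβB⟩ := exists_enum B
  have hfin : (⋃ k ∈ Set.Iio (n + 1), ⋃ l ∈ Set.Iio (d + 1), ⋃ α : Fin k → Fin n,
      ⋃ S ∈ {S : Ext ar k l | relSymb S ⊆ firstSymb N m ∧ baseStr S = pull ar (β ∘ α)},
        {Y : Finset A | SimplyAlg ar B Y ∧ IsMSAExt S ∧
          ∃ b, OfForm S (β ∘ α) b ∧ rng b = Y}).Finite := by
    refine (Set.finite_Iio _).biUnion fun k _ => (Set.finite_Iio _).biUnion fun l _ =>
      Set.finite_iUnion fun α => (finite_ext_of_relSymb (finite_firstSymb m) _).biUnion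
        fun S _ => ?_
    by_cases hS : IsMSAExt S
    · refine finite_of_copies hμ hS (β ∘ α) (fun Y hY Y' hY' hne => ?_) fun Y hY => hY.2.2
      exact (hY.1.eq_or_disjoint hf hB hY'.1).resolve_left hne
    · convert Set.finite_empty
      ext Y
      simp [hS]
  refine hfin.subset ?_
  rintro Y ⟨hY, hYd, hYs⟩
  obtain ⟨F, hFB, hF⟩ := exists_minSimplyAlg hY
  obtain ⟨k, a, ha, rfl⟩ := exists_enum F
  obtain ⟨l, c, hc, rfl⟩ := exists_enum Y
  have : ∀ t, ∃ w, β w = a t := fun t => mem_rng.1 (hβB ▸ hFB (mem_rng.2 ⟨t, rfl⟩))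
  choose α hα using this
  obtain rfl : β ∘ α = a := funext hα
  have hk : k ≤ n := by
    simpa using Fintype.card_le_of_injective α (Function.Injective.of_comp ha)
  have hl : l ≤ d := by
    rwa [Finset.card_image_of_injective _ hc, Finset.card_univ, Fintype.card_fin] at hYd
  have hdis := Finset.disjoint_left.1 hF.1.2.1
  have hinj : Function.Injective (Sum.elim (β ∘ α) c) := ha.sumElim hc fun t u h =>
    hdis (mem_rng.2 ⟨t, rfl⟩) (mem_rng.2 ⟨u, h.symm⟩)
  let S : Ext ar k l := pull ar (Sum.elim (β ∘ α) c)
  have hSe : @IsEmb N ar _ _ _ S (Sum.elim (β ∘ α) c) := isEmb_pull hinj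
  have hS : IsMSAExt S := by
    let := S
    refine ⟨hSe.isSymm hsy, ?_⟩
    rw [← hSe.minSimplyAlg_image, image_baseSet, image_topSet]
    exact hF
  simp only [Set.mem_iUnion]
  refine ⟨k, Nat.lt_succ_of_le hk, l, Nat.lt_succ_of_le hl, α, S, ⟨?_, rfl⟩, hY, hS, c,
    ⟨hinj, fun _ _ => Iff.rfl, fun _ _ _ h => h⟩, rfl⟩
  rintro s ⟨v, hv, j, y, hj⟩
  refine hYs s (Sum.elim (β ∘ α) c ∘ v) hv (fun j' => ?_) ⟨j, ?_⟩
  · rcases hw : v j' with t | t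
    · exact Finset.mem_union_left _ (hFB (mem_rng.2 ⟨t, by simp [hw]⟩))
    · exact Finset.mem_union_right _ (mem_rng.2 ⟨t, by simp [hw]⟩)
  · exact mem_rng.2 ⟨y, by simp [hj]⟩

variable (ar) in
/-- The points of sets of size at most `m` that are algebraic over `B`, as witnessed by the first
`m` relations. -/
def badSet (m : ℕ) (B : Finset A) : Set A :=
  {y | ∃ Y : Finset A, y ∈ Y ∧ Y.card ≤ m ∧
    dl ar (firstSymb N m) (B ∪ Y) ≤ dl ar (firstSymb N m) B}

/-- `K` sees at most as many new relations as the full language, in which `B` is strong. So neither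
predimension changes, and all new relations have symbols in `K`. -/
theorem symb_mem_of_dl_le (hf : FinOcc ar A) {B C : Finset A} (hB : Strong ar B Set.univ)
    (hBC : B ⊆ C) {K : Set (Symb N)} (h : dl ar K C ≤ dl ar K B) :
    dl ar Set.univ C = dl ar Set.univ B ∧ ∀ (s : Symb N) (v : Fin (ar s) → A), Holds ar s v →
      (∀ j, v j ∈ C) → (∃ j, v j ∉ B) → s ∈ K := by
  have h1 := ((strong_iff hf).1 hB).2 C hBC (Set.subset_univ _)
  have h2 := dl_sub_dl_anti hf (Set.subset_univ K) hBC
  have h3 := dl_sub_dl hf K hBC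
  have h4 := dl_sub_dl hf Set.univ hBC
  refine ⟨by omega, fun s v hv hvC ⟨j, hj⟩ => ?_⟩
  have hsub : occ ar K (C : Set A) \ occ ar K (B : Set A) ⊆
      occ ar Set.univ (C : Set A) \ occ ar Set.univ (B : Set A) := fun p hp => by
    rw [mem_occ_diff] at hp ⊢
    exact ⟨occ_mono (Set.subset_univ _) le_rfl hp.1, hp.2⟩
  have heq := Set.eq_of_subset_of_ncard_le hsub (by omega) ((hf.finite _ _).subset Set.sdiff_subset)
  have : (s, Finset.univ.val.map v) ∈ occ ar Set.univ (C : Set A) \ occ ar Set.univ (B : Set A) :=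
    mem_occ_diff.2 ⟨⟨trivial, v, hv, hvC, rfl⟩, v j,
      Multiset.mem_map.2 ⟨j, Finset.mem_univ_val j, rfl⟩, hj⟩
  rw [← heq] at this
  exact this.1.1

/-- Induction on the number of new points: a minimal part of predimension zero is simply algebraic
over `B` with symbols among the first `m`, so there are finitely many choices. `B` together with it
is strong again and fewer points remain. -/
theorem finite_badSet_aux (hsy : IsSymm ar A) (hf : FinOcc ar A)
    (hμ : MuBound μ (Set.univ : Set A)) (m d : ℕ) : ∀ B : Finset A, Strong ar B Set.univ →
    {y | ∃ Y : Finset A, y ∈ Y ∧ (Y \ B).card ≤ d ∧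
      dl ar (firstSymb N m) (B ∪ Y) ≤ dl ar (firstSymb N m) B}.Finite := by
  induction d with
  | zero =>
    intro B hB
    refine B.finite_toSet.subset ?_
    rintro y ⟨Y, hyY, hYB, -⟩
    have : Y \ B = ∅ := by simpa using hYB
    exact (Finset.sdiff_eq_empty_iff_subset.1 this) hyY
  | succ d ih =>
    intro B hB
    have hf1 := finite_simplyAlg hsy hf hμ hB m (d + 1)
    refine (B.finite_toSet.union (hf1.biUnion (t := fun Y₀ => {y | dl ar Set.univ (B ∪ Y₀) ≤
      dl ar Set.univ B ∧ ∃ Y : Finset A, y ∈ Y ∧ (Y \ (B ∪ Y₀)).card ≤ d ∧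
      dl ar (firstSymb N m) (B ∪ Y₀ ∪ Y) ≤ dl ar (firstSymb N m) (B ∪ Y₀)})
      fun Y₀ hY₀ => ?_)).subset ?_
    · by_cases h : dl ar Set.univ (B ∪ Y₀) ≤ dl ar Set.univ B
      · have := ih (B ∪ Y₀) (strong_of_dl_eq hf hB Finset.subset_union_left (Set.subset_univ _) h)
        exact this.subset fun y hy => hy.2
      · exact Set.finite_empty.subset fun y hy => h hy.1
    · rintro y ⟨Y, hyY, hYc, hYd⟩
      by_cases hYB : Y ⊆ B
      · exact Or.inl (hYB hyY)
      right
      obtain ⟨hd1, hsym⟩ := symb_mem_of_dl_le hf hB Finset.subset_union_left hYd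
      obtain ⟨Y₀, ⟨hY₀, hY₀n, hY₀d⟩, hmin⟩ := exists_minimal_of_wellFoundedLT
        (fun Z : Finset A => Z ⊆ Y \ B ∧ Z.Nonempty ∧ dl ar Set.univ (B ∪ Z) ≤ dl ar Set.univ B)
        ⟨Y \ B, subset_rfl, Finset.sdiff_nonempty.2 hYB, by
          rw [Finset.union_sdiff_self_eq_union]; exact hd1.le⟩
      have hsub : B ∪ Y₀ ⊆ B ∪ Y := Finset.union_subset_union_right
        (hY₀.trans Finset.sdiff_subset)
      have hle : ∀ Z, dl ar Set.univ B ≤ dl ar Set.univ (B ∪ Z) := fun Z =>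
        ((strong_iff hf).1 hB).2 _ Finset.subset_union_left (Set.subset_univ _)
      have hdis : Disjoint B Y₀ :=
        (Finset.disjoint_sdiff (s := B) (t := Y)).mono_right hY₀
      have hSA : SimplyAlg ar B Y₀ := by
        rw [simplyAlg_iff hf]
        refine ⟨hY₀n, hdis, le_antisymm hY₀d (hle _), fun T hT hTn hne => ?_⟩
        by_contra hn
        exact hne (hT.antisymm (hmin ⟨hT.trans hY₀, hTn, not_lt.1 hn⟩ hT))
      refine Set.mem_biUnion (x := Y₀) ⟨hSA, (Finset.card_le_card hY₀).trans hYc,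
        fun s v hv hvm ⟨j, hj⟩ => hsym s v hv (fun j => hsub (hvm j))
          ⟨j, fun hB' => Finset.disjoint_left.1 hdis hB' hj⟩⟩ ⟨hY₀d, Y, hyY, ?_, ?_⟩
      · have h1 : Y \ (B ∪ Y₀) ⊂ Y \ B := by
          refine ⟨Finset.sdiff_subset_sdiff subset_rfl Finset.subset_union_left, fun h => ?_⟩
          obtain ⟨z, hz⟩ := hY₀n
          have := Finset.mem_sdiff.1 (h (hY₀ hz))
          exact this.2 (Finset.mem_union_right _ hz)
        have := Finset.card_lt_card h1
        omega
      · rw [Finset.union_right_comm, Finset.union_assoc B Y Y₀,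
          Finset.union_eq_left.2 (hY₀.trans Finset.sdiff_subset)]
        refine hYd.trans ?_
        have h1 := (hB.strongIn hf).dl_le hf (firstSymb N m) (X := B ∪ Y₀) (Set.subset_univ _)
        rwa [show cap (B ∪ Y₀) (B : Set A) = B by
          ext x; simp only [mem_cap, Finset.mem_union, Finset.mem_coe]; tauto] at h1

theorem finite_badSet (hsy : IsSymm ar A) (hf : FinOcc ar A) (hμ : MuBound μ (Set.univ : Set A))
    (m : ℕ) {B : Finset A} (hB : Strong ar B Set.univ) : (badSet ar m B).Finite :=
  (finite_badSet_aux hsy hf hμ m m B hB).subset fun _ ⟨Y, h1, h2, h3⟩ =>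
    ⟨Y, h1, (Finset.card_le_card Finset.sdiff_subset).trans h2, h3⟩

theorem badSet_mono (hf : FinOcc ar A) {m m' : ℕ} (hm : m ≤ m') (B : Finset A) :
    badSet ar m B ⊆ badSet ar m' B := fun y ⟨Y, h1, h2, h3⟩ => by
  refine ⟨Y, h1, h2.trans hm, ?_⟩
  have := dl_sub_dl_anti hf (firstSymb_mono (N := N) hm)
    (Finset.subset_union_left (s₁ := B) (s₂ := Y))
  omega

/-- Finitely many relations involve finitely many symbols. -/
theorem exists_dl_firstSymb_eq (hf : FinOcc ar A) (W : Finset A) : ∃ m, W.card ≤ m ∧ ∀ m' ≥ m,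
    ∀ X ⊆ W, dl ar (firstSymb N m') X = dl ar Set.univ X := by
  obtain ⟨m, hm⟩ := exists_firstSymb ((hf.finite Set.univ W).image Prod.fst)
  refine ⟨max m W.card, le_max_right _ _, fun m' hm' X hX => ?_⟩
  unfold dl
  congr 3
  refine Set.Subset.antisymm (occ_mono (Set.subset_univ _) le_rfl) fun p hp => ?_
  have hp' : p ∈ occ ar Set.univ (W : Set A) := occ_mono le_rfl (by exact_mod_cast hX) hp
  rw [mem_occ] at hp ⊢
  exact ⟨firstSymb_mono ((le_max_left _ _).trans hm') (hm ⟨p, hp', rfl⟩), hp.2⟩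

end Bad

/-! ## Ultrapowers -/

section Ultrapower

open FirstOrder.Language Filter

/-- The ultrapower over the natural numbers. -/
abbrev Upow (A : Type u) : Type u := ((hyperfilter ℕ : Ultrafilter ℕ) : Filter ℕ).Product fun _ => A

variable {A : Type u}

/-- The element of the ultrapower given by a sequence. -/
def Upow.mk (x : ℕ → A) : Upow A := (x : ((hyperfilter ℕ : Ultrafilter ℕ) : Filter ℕ).Product fun _ => A)

theorem Upow.exists_rep (z : Upow A) : ∃ x, Upow.mk x = z := Quotient.exists_rep z

theorem Upow.mk_eq {x y : ℕ → A} : Upow.mk x = Upow.mk y ↔ ∀ᶠ i in hyperfilter ℕ, x i = y i :=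
  Quotient.eq''

/-- The diagonal embedding. -/
def diag (a : A) : Upow A := Upow.mk fun _ => a

variable [(lang ar).Structure A]

theorem SameTp.refl {E ι : Type*} [(lang ar).Structure E] (K : Set (Symb N)) (f : ι → E) :
    SameTp ar K f f := ⟨fun _ _ => Iff.rfl, fun _ _ _ => Iff.rfl⟩

/-- In finitely many symbols the type is expressed by one quantifier-free formula, to which Łoś's
theorem applies. -/
theorem eventually_sameTp [Nonempty A] (m : ℕ) {p : ℕ} (w : Fin p → ℕ → A) :
    ∀ᶠ i in hyperfilter ℕ, SameTp ar (firstSymb N m) (fun t => Upow.mk (w t)) (fun t => w t i) := by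
  obtain ⟨θ, -, hθ⟩ := qfDefinable_sameTp.{u} (ar := ar) m (fun t => Upow.mk (w t))
  have h1 := (hθ (Upow A) fun t => Upow.mk (w t)).2 (SameTp.refl _ _)
  have h2 := Ultraproduct.boundedFormula_realize_cast (L := lang ar) (u := hyperfilter ℕ)
    (M := fun _ => A) θ (fun e : Empty => e.elim) w
  have h3 := h2.1 (by
    rw [Subsingleton.elim default _] at h1
    exact h1)
  refine h3.mono fun i hi => (hθ A _).1 ?_
  rwa [Subsingleton.elim default _]

theorem isEmb_diag [Nonempty A] : IsEmb ar (diag : A → Upow A) := by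
  refine ⟨fun a b h => by simpa using Upow.mk_eq.1 h, fun s v => ?_⟩
  obtain ⟨i, hi⟩ := (eventually_sameTp (ar := ar) (s.1 + 1) fun t => fun _ : ℕ => v t).exists
  exact hi.2 s (Nat.lt_succ_self s.1) id

/-- A finite tuple of the ultrapower has the type of a tuple of the structure in any finite
sublanguage. -/
theorem exists_sameTp_diag [Nonempty A] (m : ℕ) {p n : ℕ} (w : Fin p → Upow A) (ξ : Fin n → Fin p)
    {b : Fin n → A} (hb : w ∘ ξ = diag ∘ b) :
    ∃ c : Fin p → A, SameTp ar (firstSymb N m) w c ∧ c ∘ ξ = b := by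
  choose x hx using fun t => Upow.exists_rep (w t)
  obtain rfl : (fun t => Upow.mk (x t)) = w := funext hx
  have h1 : ∀ᶠ i in hyperfilter ℕ, ∀ t, x (ξ t) i = b t :=
    eventually_all.2 fun t => Upow.mk_eq.1 (congrFun hb t)
  obtain ⟨i, hi, hi'⟩ := ((eventually_sameTp (ar := ar) m x).and h1).exists
  exact ⟨fun t => x t i, hi, funext hi'⟩

variable {ζ : (lang ar).Theory} {μ : MuFun ar}

theorem models_upow [Nonempty A] {T : (lang ar).Theory} (h : A ⊨ T) : Upow A ⊨ T := by
  rw [Theory.model_iff] at h ⊢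
  exact fun φ hφ => (Ultraproduct.sentence_realize φ).2 (Eventually.of_forall fun _ => h φ hφ)

theorem ClosedModel.upow [Nonempty A] (hζ : ζ.IsUniversal) (hζj : PreservedByFreeJoins ζ)
    (hζf : FinitelyDetermined ζ) (hμ : IsMu μ) (h : ClosedModel ζ μ A) :
    ClosedModel ζ μ (Upow A) :=
  (models_closedTheory_iff hζ hζj hζf hμ).1 (models_upow h.models_closedTheory)

theorem rng_comp_subset {X : Type*} {p n : ℕ} (w : Fin p → X) (ξ : Fin n → Fin p) :
    rng (w ∘ ξ) ⊆ rng w := fun x hx => by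
  obtain ⟨t, rfl⟩ := mem_rng.1 hx
  exact mem_rng.2 ⟨_, rfl⟩

theorem rng_comp {X Y : Type*} {n : ℕ} (w : Y → X) (ξ : Fin n → Y) :
    rng (w ∘ ξ) = (rng ξ).image w := by ext; simp

theorem exists_comp_eq_of_rng_subset {X : Type*} {n p : ℕ} {b : Fin n → X} {w : Fin p → X}
    (h : rng b ⊆ rng w) : ∃ ξ, w ∘ ξ = b := by
  choose ξ hξ using fun t => mem_rng.1 (h (mem_rng.2 ⟨t, rfl⟩))
  exact ⟨ξ, funext hξ⟩

theorem Strong.dl_le_of_subset {E : Type*} [(lang ar).Structure E] (hf : FinOcc ar E)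
    {B C : Finset E} (hB : Strong ar B Set.univ) (K : Set (Symb N)) (hBC : B ⊆ C) :
    dl ar K B ≤ dl ar K C := by
  have h1 := (hB.strongIn hf).dl_le hf K (X := C) (Set.subset_univ _)
  rwa [show cap C (B : Set E) = B by
    ext x; have := @hBC x; simp only [mem_cap, Finset.mem_coe]; tauto] at h1

/-- A finite set in the ultrapower carries finitely many symbols, and in these it has the type of a
set of `A` that contains the given strong set. -/
theorem strong_diag [Nonempty A] (hf : FinOcc ar A) (hfU : FinOcc ar (Upow A)) {n : ℕ}
    {b : Fin n → A} (hb : Strong ar (rng b) Set.univ) :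
    Strong ar (rng (diag ∘ b)) (Set.univ : Set (Upow A)) := by
  rw [strong_iff hfU]
  refine ⟨Set.subset_univ _, fun W hW _ => ?_⟩
  obtain ⟨m, -, hm⟩ := exists_dl_firstSymb_eq hfU W
  obtain ⟨p, w, -, rfl⟩ := exists_enum W
  obtain ⟨ξ, hξ⟩ := exists_comp_eq_of_rng_subset hW
  obtain ⟨c, hc, hcb⟩ := exists_sameTp_diag (ar := ar) m w ξ hξ
  rw [← hm m le_rfl _ hW, ← hm m le_rfl _ subset_rfl, ← hξ, rng_comp, hc.dl_image subset_rfl,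
    hc.dl_image subset_rfl, ← rng_comp, hcb]
  exact hb.dl_le_of_subset hf _ (hcb ▸ rng_comp_subset c ξ)

theorem le_eventually (m : ℕ) : ∀ᶠ i in hyperfilter ℕ, m ≤ i :=
  Nat.hyperfilter_le_atTop (eventually_ge_atTop m)

/-- Every infinite set contains, in the ultrapower, a point that is free over a given finite
strong set. -/
theorem exists_free_upow [Nonempty A] (h : ClosedModel ζ μ A) (hfU : FinOcc ar (Upow A))
    {X : Finset (Upow A)} (hX : Strong ar X Set.univ) {P : Set A} (hP : P.Infinite) :
    ∃ z : ℕ → A, (∀ i, z i ∈ P) ∧ Upow.mk z ∉ X ∧ Strong ar (insert (Upow.mk z) X) Set.univ ∧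
      dl ar Set.univ (insert (Upow.mk z) X) = dl ar Set.univ X + 1 := by
  have hf := h.finOcc
  obtain ⟨n, x, -, rfl⟩ := exists_enum X
  choose y hy using fun t => Upow.exists_rep (x t)
  obtain rfl : (fun t => Upow.mk (y t)) = x := funext hy
  -- In coordinate `i` the point `z i` avoids the finite set of points that are algebraic with bound
  -- `i` over a strong set containing the `i`-th coordinates of `X`. The bounds exceed every `m`
  -- along the ultrafilter.
  choose B hB hBs using fun i => exists_strong_finset h.axiomTwo.2.1 (rng fun t => y t i)
  have hz : ∀ i, ∃ z ∈ P, z ∉ badSet ar i (B i) := fun i =>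
    (hP.sdiff (finite_badSet h.symm hf h.axiomTwo.2.2 i (hBs i))).nonempty.imp fun z hz => hz
  choose z hzP hzB using hz
  have key : ∀ W : Finset (Upow A), rng (fun t => Upow.mk (y t)) ⊆ W → Upow.mk z ∈ W →
      dl ar Set.univ (rng fun t => Upow.mk (y t)) + 1 ≤ dl ar Set.univ W := by
    intro W hXW hzW
    by_contra hlt
    have hle : dl ar Set.univ W ≤ dl ar Set.univ (rng fun t => Upow.mk (y t)) := by omega
    obtain ⟨m, hWm, hm⟩ := exists_dl_firstSymb_eq hfU W
    rw [← hm m le_rfl _ hXW, ← hm m le_rfl _ subset_rfl] at hle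
    obtain ⟨p, w, hw, rfl⟩ := exists_enum W
    choose v hv using fun t => Upow.exists_rep (w t)
    obtain rfl : (fun t => Upow.mk (v t)) = w := funext hv
    obtain ⟨ξ, hξ⟩ := exists_comp_eq_of_rng_subset hXW
    obtain ⟨t₀, ht₀⟩ := mem_rng.1 hzW
    have h1 : ∀ᶠ i in hyperfilter ℕ, ∀ t, v (ξ t) i = y t i :=
      eventually_all.2 fun t => Upow.mk_eq.1 (congrFun hξ t)
    obtain ⟨i, ⟨⟨h2, h3⟩, h4⟩, h5⟩ := (((eventually_sameTp (ar := ar) m v).and h1).and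
      (Upow.mk_eq.1 ht₀)).and (le_eventually m) |>.exists
    have hξi : (fun t => v t i) ∘ ξ = fun t => y t i := funext h3
    have hXB : (rng ξ).image (fun t => v t i) ⊆ B i := by
      rw [← rng_comp, hξi]
      exact hB i
    have hX' : rng (fun t => Upow.mk (y t)) = (rng ξ).image fun t => Upow.mk (v t) := by
      rw [← rng_comp, ← hξ]
    have hle' : dl ar (firstSymb N m) (rng fun t => v t i) ≤
        dl ar (firstSymb N m) ((rng ξ).image fun t => v t i) := by
      rw [← h2.dl_image subset_rfl, ← h2.dl_image subset_rfl, ← hX']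
      exact hle
    refine hzB i (badSet_mono hf h5 (B i) ⟨rng fun t => v t i, mem_rng.2 ⟨t₀, h4⟩, ?_, ?_⟩)
    · rw [← h2.card_image]
      exact hWm
    · have h6 := dl_submod hf (firstSymb N m) (B i) (rng fun t => v t i)
      have h7 : dl ar (firstSymb N m) ((rng ξ).image fun t => v t i) ≤
          dl ar (firstSymb N m) (B i ∩ rng fun t => v t i) := by
        obtain ⟨T, hT⟩ := exists_image_eq (i := fun t => v t i)
          (A := B i ∩ rng fun t => v t i) (fun x hx => by
            have := (Finset.mem_inter.1 hx).2
            obtain ⟨t, rfl⟩ := mem_rng.1 this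
            exact ⟨t, rfl⟩)
        have hξT : (rng ξ).image (fun t => v t i) ⊆ T.image fun t => v t i := by
          rw [hT]
          refine Finset.subset_inter hXB ?_
          rw [← rng_comp]
          exact rng_comp_subset (fun t => v t i) ξ
        have hξT' : (rng ξ ∪ T).image (fun t => v t i) = T.image fun t => v t i := by
          rw [Finset.image_union, Finset.union_eq_right.2 hξT]
        rw [← hT, ← hξT', ← h2.dl_image subset_rfl, ← h2.dl_image subset_rfl, ← hX']
        refine hX.dl_le_of_subset hfU _ ?_
        rw [hX', Finset.image_union]
        exact Finset.subset_union_left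
      omega
  have hn : Upow.mk z ∉ rng fun t => Upow.mk (y t) := fun hzX => by
    have := key _ subset_rfl hzX
    omega
  have hd : dl ar Set.univ (insert (Upow.mk z) (rng fun t => Upow.mk (y t))) =
      dl ar Set.univ (rng fun t => Upow.mk (y t)) + 1 := by
    refine le_antisymm ?_ (key _ (Finset.subset_insert _ _) (Finset.mem_insert_self _ _))
    have h1 := dl_insert_le hfU Set.univ (rng fun t => Upow.mk (y t)) {Upow.mk z}
    have h2 : (({Upow.mk z} : Finset (Upow A)) \ rng fun t => Upow.mk (y t)).card ≤ 1 :=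
      (Finset.card_le_card Finset.sdiff_subset).trans (by simp)
    rw [Finset.union_comm, ← Finset.insert_eq] at h1
    omega
  refine ⟨z, hzP, hn, (strong_iff hfU).2 ⟨Set.subset_univ _, fun W hW _ => ?_⟩, hd⟩
  rw [hd]
  exact key W ((Finset.subset_insert _ _).trans hW) (hW (Finset.mem_insert_self _ _))

/-- Models that are closed under algebraic and transcendental extensions. -/
structure Rich (ζ : (lang ar).Theory) (μ : MuFun ar) (M : Type u) [(lang ar).Structure M] :
    Prop extends ClosedModel ζ μ M where
  transClosed : TransClosed ar M

theorem ClosedModel.rich_upow [Infinite A] (hζ : ζ.IsUniversal) (hζj : PreservedByFreeJoins ζ)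
    (hζf : FinitelyDetermined ζ) (hμ : IsMu μ) (h : ClosedModel ζ μ A) : Rich ζ μ (Upow A) := by
  have h1 := h.upow hζ hζj hζf hμ
  refine ⟨h1, fun B hB => ?_⟩
  obtain ⟨z, -, hz⟩ := exists_free_upow h h1.finOcc hB (Set.infinite_univ (α := A))
  exact ⟨_, hz⟩

end Ultrapower

/-! ## Back and forth -/

section BackForth

open FirstOrder.Language

variable {ζ : (lang ar).Theory} {μ : MuFun ar}

/-- The forth step: `Z` and `b'` are enclosed in a finite strong set, which belongs to the class and
therefore embeds strongly in a rich model over `b`. -/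
theorem SameTp.exists_extension (hζ : ζ.IsUniversal) {M M' : Type u} [(lang ar).Structure M]
    [(lang ar).Structure M'] (hM : Rich ζ μ M) (hM' : IsSymm ar M') (h2 : AxiomTwo ζ μ M')
    {k : ℕ} {b' : Fin k → M'} {b : Fin k → M} (hb : SameTp ar Set.univ b' b)
    (hi : Function.Injective b') (hs' : Strong ar (rng b') Set.univ)
    (hs : Strong ar (rng b) Set.univ) (Z : Finset M') :
    ∃ (K : ℕ) (c' : Fin K → M') (c : Fin K → M) (ξ : Fin k → Fin K), SameTp ar Set.univ c' c ∧
      Function.Injective c' ∧ Strong ar (rng c') Set.univ ∧ Strong ar (rng c) Set.univ ∧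
      c' ∘ ξ = b' ∧ c ∘ ξ = b ∧ Z ⊆ rng c' := by
  obtain ⟨C, hC, hCs⟩ := exists_strong_finset h2.2.1 (rng b' ∪ Z)
  obtain ⟨K, c', hc', rfl⟩ := exists_enum C
  obtain ⟨ξ, rfl⟩ := exists_comp_eq_of_rng_subset (Finset.subset_union_left.trans hC)
  let := pull ar c'
  have he : IsEmb ar c' := isEmb_pull hc'
  have hCc : InClass ζ μ (Set.univ : Set (Fin K)) := by
    rw [← he.inClass_image hζ, Set.image_univ]
    have := inClass_of_axiomTwo hζ h2 hCs
    rwa [Finset.coe_image, Finset.coe_univ, Set.image_univ] at this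
  have hξs : Strong ar (rng ξ) (Set.univ : Set (Fin K)) := he.strong_img_of_strong hs'
  obtain ⟨f, hf, hfb, D, hD, hDs⟩ := exists_strong_emb hζ hM.axiomTwo.2.1 hM.algClosed
    hM.transClosed (he.isSymm hM') hCc K k ξ b (by simp)
    ((he.sameTp_comp ξ).trans hb) hi.of_comp hξs hs
  refine ⟨K, c', f, ξ, he.sameTp.symm.trans hf.sameTp, hc', hCs, ?_, rfl, hfb,
    Finset.subset_union_right.trans hC⟩
  have : D = rng f := by
    rw [← Finset.coe_inj, hD]
    simp
  exact this ▸ hDs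

theorem realize_term_var {β : Type*} (t : (lang ar).Term β) :
    ∃ i, ∀ (M : Type u) [(lang ar).Structure M] (v : β → M), t.realize v = v i := by
  cases t with
  | var i => exact ⟨i, fun _ _ _ => rfl⟩
  | func f _ => exact Empty.elim f

/-- Tuples with the same type that enumerate strong sets of rich models satisfy the same
formulas. -/
theorem Rich.realize_iff (hζ : ζ.IsUniversal) {M M' : Type u} [(lang ar).Structure M]
    [(lang ar).Structure M'] (hM : Rich ζ μ M) (hM' : Rich ζ μ M') {α : Type*} {n : ℕ}
    (φ : (lang ar).BoundedFormula α n) : ∀ {k : ℕ} {b : Fin k → M} {b' : Fin k → M'},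
      SameTp ar Set.univ b b' → Function.Injective b → Strong ar (rng b) Set.univ →
      Strong ar (rng b') Set.univ → ∀ (η : α → Fin k) (ξ : Fin n → Fin k),
      (φ.Realize (b ∘ η) (b ∘ ξ) ↔ φ.Realize (b' ∘ η) (b' ∘ ξ)) := by
  induction φ with
  | falsum => exact fun _ _ _ _ _ _ => Iff.rfl
  | equal t₁ t₂ =>
    intro k b b' h hi hs hs' η ξ
    obtain ⟨i, hti⟩ := realize_term_var.{u} t₁
    obtain ⟨j, htj⟩ := realize_term_var.{u} t₂
    simp only [BoundedFormula.Realize, hti M, htj M, hti M', htj M', ← Sum.comp_elim]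
    exact h.1 _ _
  | rel R ts =>
    intro k b b' h hi hs hs' η ξ
    choose i hti using fun t => realize_term_var.{u} (ts t)
    simp only [BoundedFormula.Realize, hti _ M, hti _ M', ← Sum.comp_elim]
    obtain ⟨s, rfl⟩ := R
    exact h.2 s trivial (fun t => Sum.elim η ξ (i t))
  | imp φ ψ ih₁ ih₂ =>
    intro k b b' h hi hs hs' η ξ
    exact imp_congr (ih₁ h hi hs hs' η ξ) (ih₂ h hi hs hs' η ξ)
  | all φ ih =>
    intro k b b' h hi hs hs' η ξ
    constructor
    · intro hφ y
      obtain ⟨K, c', c, ξ', hc, hci, hcs', hcs, rfl, rfl, hZ⟩ :=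
        h.symm.exists_extension hζ hM hM'.symm hM'.axiomTwo (h.injective hi) hs' hs {y}
      obtain ⟨t, rfl⟩ := mem_rng.1 (hZ (Finset.mem_singleton_self y))
      have := (ih hc.symm (hc.injective hci) hcs hcs' (ξ' ∘ η) (Fin.snoc (ξ' ∘ ξ) t)).1
      rw [Fin.comp_snoc, Fin.comp_snoc] at this
      exact this (hφ (c t))
    · intro hφ y
      obtain ⟨K, c', c, ξ', hc, hci, hcs', hcs, rfl, rfl, hZ⟩ :=
        h.exists_extension hζ hM' hM.symm hM.axiomTwo hi hs hs' {y}
      obtain ⟨t, rfl⟩ := mem_rng.1 (hZ (Finset.mem_singleton_self y))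
      have := (ih hc hci hcs' hcs (ξ' ∘ η) (Fin.snoc (ξ' ∘ ξ) t)).2
      rw [Fin.comp_snoc, Fin.comp_snoc] at this
      exact this (hφ (c t))

theorem Rich.realize_formula_iff (hζ : ζ.IsUniversal) {M M' : Type u} [(lang ar).Structure M]
    [(lang ar).Structure M'] (hM : Rich ζ μ M) (hM' : Rich ζ μ M') {α : Type*}
    (φ : (lang ar).Formula α) {k : ℕ} {b : Fin k → M} {b' : Fin k → M'}
    (h : SameTp ar Set.univ b b') (hi : Function.Injective b) (hs : Strong ar (rng b) Set.univ)
    (hs' : Strong ar (rng b') Set.univ) (η : α → Fin k) :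
    φ.Realize (b ∘ η) ↔ φ.Realize (b' ∘ η) := by
  have := hM.realize_iff hζ hM' φ h hi hs hs' η Fin.elim0
  unfold Formula.Realize
  rwa [Subsingleton.elim (b ∘ Fin.elim0) default, Subsingleton.elim (b' ∘ Fin.elim0) default] at this

theorem strong_empty {E : Type*} [(lang ar).Structure E] (h0 : ∀ A : Finset E, 0 ≤ delta ar A) :
    Strong ar (∅ : Finset E) Set.univ := by
  have hf := finOcc_of_nonneg h0
  rw [strong_iff hf]
  refine ⟨Set.subset_univ _, fun X _ _ => ?_⟩
  have h1 := (dl_nonneg_iff hf X).1 (h0 X)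
  have h2 := dl_empty_le (ar := ar) (E := E) Set.univ
  omega

theorem ElementarilyEquivalent.upow {A : Type u} [(lang ar).Structure A] [Nonempty A] :
    A ≅[lang ar] Upow A := by
  refine Set.ext fun φ => ?_
  change A ⊨ φ ↔ Upow A ⊨ φ
  rw [Ultraproduct.sentence_realize]
  simp

/-- Any two infinite closed models are elementarily equivalent. -/
theorem ClosedModel.elementarilyEquivalent (hζ : ζ.IsUniversal) (hζj : PreservedByFreeJoins ζ)
    (hζf : FinitelyDetermined ζ) (hμ : IsMu μ) {A A' : Type u} [(lang ar).Structure A]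
    [(lang ar).Structure A'] [Infinite A] [Infinite A'] (h : ClosedModel ζ μ A)
    (h' : ClosedModel ζ μ A') : A ≅[lang ar] A' := by
  have hU := h.rich_upow hζ hζj hζf hμ
  have hU' := h'.rich_upow hζ hζj hζf hμ
  refine ElementarilyEquivalent.upow.trans (Eq.trans ?_ ElementarilyEquivalent.upow.symm)
  refine Set.ext fun φ => ?_
  change Upow A ⊨ φ ↔ Upow A' ⊨ φ
  have he : ∀ {E : Type u} (f : Fin 0 → E), rng f = ∅ := fun f => by simp
  have := hU.realize_formula_iff hζ hU' φ (b := Fin.elim0) (b' := Fin.elim0)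
    (.of_isEmpty hU.axiomTwo.2.1 hU'.axiomTwo.2.1 _ _ _) (fun i => i.elim0)
    (by rw [he]; exact strong_empty hU.axiomTwo.2.1)
    (by rw [he]; exact strong_empty hU'.axiomTwo.2.1) (fun e => e.elim)
  unfold Sentence.Realize
  convert this

theorem rng_snoc {E : Type*} {n : ℕ} (b : Fin n → E) (z : E) :
    rng (Sum.elim b (fun _ : Fin 1 => z) ∘ finSumFinEquiv.symm) = insert z (rng b) := by
  rw [rng_elim_finSum, union_rng_const]

/-- Definable subsets of infinite closed models are finite or cofinite. -/
theorem ClosedModel.finite_or_cofinite (hζ : ζ.IsUniversal) (hζj : PreservedByFreeJoins ζ)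
    (hζf : FinitelyDetermined ζ) (hμ : IsMu μ) {A : Type u} [(lang ar).Structure A]
    [Infinite A] (h : ClosedModel ζ μ A) (D : Set A)
    (hD : (Set.univ : Set A).Definable₁ (lang ar) D) : D.Finite ∨ Dᶜ.Finite := by
  by_contra hc
  push Not at hc
  obtain ⟨hD1, hD2⟩ := hc
  obtain ⟨A₀, -, hA₀⟩ := Set.definable_iff_finitely_definable.1 hD
  obtain ⟨φ, hφ⟩ := Set.definable_iff_exists_formula_sum.1 hA₀
  have hU := h.rich_upow hζ hζj hζf hμ
  obtain ⟨X, hX, hXs⟩ := exists_strong_finset h.axiomTwo.2.1 A₀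
  obtain ⟨n, b, hb, rfl⟩ := exists_enum X
  have hbs := strong_diag h.finOcc hU.finOcc hXs
  -- If the set and its complement were both infinite, each would contribute a free point over the
  -- parameters. The two points have the same type, but by Łoś's theorem the formula separates them.
  obtain ⟨z, hz, hz1, hz2, hz3⟩ := exists_free_upow h hU.finOcc hbs hD1
  obtain ⟨z', hz', hz1', hz2', hz3'⟩ := exists_free_upow h hU.finOcc hbs hD2
  have htp := sameTp_insert hU.finOcc hU.finOcc (SameTp.refl Set.univ (diag ∘ b)) hz1 hz1' hz3 hz3'
  choose η hη using fun a : (A₀ : Set A) => mem_rng.1 (hX a.2)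
  have hφ' : ∀ x : A, x ∈ D ↔ φ.Realize (Sum.elim (fun a : (A₀ : Set A) => (a : A)) fun _ => x) :=
    fun x => Set.ext_iff.1 hφ fun _ => x
  have hins : Function.Injective (Sum.elim (diag ∘ b) fun _ : Fin 1 => Upow.mk z) := by
    refine Function.Injective.sumElim ((isEmb_diag (ar := ar)).1.comp hb)
      (Function.injective_of_subsingleton _) fun i _ h => hz1 (mem_rng.2 ⟨i, h⟩)
  have key := hU.realize_formula_iff hζ hU φ (htp.comp finSumFinEquiv.symm)
    (hins.comp finSumFinEquiv.symm.injective) (by rwa [rng_snoc]) (by rwa [rng_snoc])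
    (finSumFinEquiv ∘ Sum.map η id)
  have hcomp : ∀ z : ℕ → A,
      ((Sum.elim (diag ∘ b) fun _ : Fin 1 => Upow.mk z) ∘ finSumFinEquiv.symm) ∘
        (finSumFinEquiv ∘ Sum.map η id) = fun i => Upow.mk
          (Sum.elim (fun (a : (A₀ : Set A)) (_ : ℕ) => (a : A)) (fun _ => z) i) := by
    intro z
    funext i
    rcases i with a | i
    · simp [diag, hη]
    · simp
  rw [hcomp, hcomp] at key
  have hreal : ∀ z : ℕ → A, (φ.Realize fun i => Upow.mk
      (Sum.elim (fun (a : (A₀ : Set A)) (_ : ℕ) => (a : A)) (fun _ => z) i)) ↔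
        ∀ᶠ i in Filter.hyperfilter ℕ, z i ∈ D := by
    intro z
    refine (Ultraproduct.realize_formula_cast φ _).trans (Filter.eventually_congr ?_)
    refine Filter.Eventually.of_forall fun i => ?_
    rw [hφ']
    apply iff_of_eq
    congr 1
    funext j
    rcases j with a | j <;> rfl
  rw [hreal, hreal] at key
  obtain ⟨i, hi⟩ := (key.1 (Filter.Eventually.of_forall hz)).exists
  exact hz' i hi

end BackForth

/-! ## Model completeness -/

section ModelCompleteness

open FirstOrder.Language

variable {ζ : (lang ar).Theory} {μ : MuFun ar} {A A' : Type u} [(lang ar).Structure A]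
  [(lang ar).Structure A']

theorem SameTp.anti {ι E E' : Type*} [(lang ar).Structure E] [(lang ar).Structure E']
    {K : Set (Symb N)} {f : ι → E} {f' : ι → E'} (h : SameTp ar Set.univ f f') :
    SameTp ar K f f' := ⟨h.1, fun s _ => h.2 s trivial⟩

/-- An embedding of infinite closed models does not add elements to the bounded algebraic
closure of a set that is strong in both of them. -/
theorem mem_badSet_of_map (hζ : ζ.IsUniversal) (hζj : PreservedByFreeJoins ζ)
    (hζf : FinitelyDetermined ζ) (hμ : IsMu μ) [Infinite A] (h : ClosedModel ζ μ A)
    (h' : ClosedModel ζ μ A') {f : A → A'} (hf : IsEmb ar f) {B : Finset A}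
    (hB : Strong ar B Set.univ) (hB' : Strong ar (B.image f) Set.univ) {m : ℕ} {x : A}
    (hx : f x ∈ badSet ar m (B.image f)) : x ∈ badSet ar m B := by
  have hU := h.rich_upow hζ hζj hζf hμ
  have hQ := finite_badSet h.symm h.finOcc h.axiomTwo.2.2 m hB
  have hQ' := finite_badSet h'.symm h'.finOcc h'.axiomTwo.2.2 m hB'
  obtain ⟨n, b, hb, rfl⟩ := exists_enum B
  rw [← rng_comp] at hx hB' hQ'
  have hY : ∀ y : hQ'.toFinset, ∃ Y : Finset A', y.1 ∈ Y ∧ Y.card ≤ m ∧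
      dl ar (firstSymb N m) (rng (f ∘ b) ∪ Y) ≤ dl ar (firstSymb N m) (rng (f ∘ b)) :=
    fun y => hQ'.mem_toFinset.1 y.2
  choose Y hY1 hY2 hY3 using hY
  -- `c'` covers sets witnessing all bounded-algebraic points over `f(B)`. It is copied over `B`
  -- into the ultrapower, and from there, in the first `m` symbols, into `A`.
  obtain ⟨K, c', c, ξ, hc, -, -, -, hξ', hξ, hZ⟩ := SameTp.exists_extension hζ hU h'.symm h'.axiomTwo
    ((hf.sameTp_comp b).symm.trans (isEmb_diag.sameTp_comp b)) (hf.1.comp hb) hB'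
    (strong_diag h.finOcc hU.finOcc hB) (Finset.univ.biUnion Y)
  obtain ⟨c₀, hc₀, rfl⟩ := exists_sameTp_diag (ar := ar) m c ξ hξ
  have htp := hc.anti.trans hc₀
  have hYc : ∀ y, Y y ⊆ rng c' := fun y =>
    (Finset.subset_biUnion_of_mem Y (Finset.mem_univ y)).trans hZ
  choose s hs using fun y => mem_rng.1 (hYc y (hY1 y))
  have hmem : ∀ y, c₀ (s y) ∈ hQ.toFinset := by
    intro y
    obtain ⟨T, hT⟩ := exists_image_eq (i := c') (A := Y y) fun z hz => mem_rng.1 (hYc y hz)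
    have hsT : s y ∈ insert (s y) T := Finset.mem_insert_self _ _
    have hT' : (insert (s y) T).image c' = Y y := by
      rw [Finset.image_insert, hs, hT, Finset.insert_eq_of_mem (hY1 y)]
    refine hQ.mem_toFinset.2 ⟨(insert (s y) T).image c₀, Finset.mem_image_of_mem _ hsT, ?_, ?_⟩
    · rw [← htp.card_image, hT']
      exact hY2 y
    · rw [rng_comp, ← Finset.image_union, ← htp.dl_image subset_rfl, ← htp.dl_image subset_rfl,
        Finset.image_union, hT', ← rng_comp, hξ']
      exact hY3 y
  -- The copied points are algebraic over `B` with the same bound, and copying is injective. As `f`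
  -- maps the finite set over `B` into the one over `f(B)`, it maps onto it.
  have hcard : hQ'.toFinset.card ≤ hQ.toFinset.card := by
    rw [← Finset.card_attach]
    refine Finset.card_le_card_of_injOn (fun y => c₀ (s y)) (fun y _ => hmem y) ?_
    intro y _ y' _ hyy'
    have := (htp.1 _ _).2 hyy'
    rw [hs, hs] at this
    exact Subtype.ext this
  have hsub : hQ.toFinset.image f ⊆ hQ'.toFinset := by
    intro y hy
    obtain ⟨z, hz, rfl⟩ := Finset.mem_image.1 hy
    obtain ⟨Z, h1, h2, h3⟩ := hQ.mem_toFinset.1 hz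
    refine hQ'.mem_toFinset.2 ⟨Z.image f, Finset.mem_image_of_mem _ h1,
      Finset.card_image_le.trans h2, ?_⟩
    rw [rng_comp, ← Finset.image_union, hf.dl_image, hf.dl_image]
    exact h3
  have heq := Finset.eq_of_subset_of_card_le hsub
    (by rwa [Finset.card_image_of_injective _ hf.1])
  obtain ⟨z, hz, hzx⟩ := Finset.mem_image.1 (heq.symm ▸ hQ'.mem_toFinset.2 hx :
    f x ∈ hQ.toFinset.image f)
  exact hf.1 hzx ▸ hQ.mem_toFinset.1 hz

/-- Embeddings of infinite closed models preserve strong sets. -/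
theorem IsEmb.strong_image_of_closedModel (hζ : ζ.IsUniversal) (hζj : PreservedByFreeJoins ζ)
    (hζf : FinitelyDetermined ζ) (hμ : IsMu μ) [Infinite A] (h : ClosedModel ζ μ A)
    (h' : ClosedModel ζ μ A') {f : A → A'} (hf : IsEmb ar f) {ι : Type*} [Fintype ι] {c : ι → A}
    (hc : Function.Injective c) (hcs : Strong ar (img c) Set.univ) (B : Finset ι)
    (hB : Strong ar (B.image c) Set.univ) (hB' : Strong ar ((B.image c).image f) Set.univ) :
    Strong ar (img (f ∘ c)) Set.univ := by
  -- `B` is enlarged to everything by steps of `exists_step`. A simply algebraic step adds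
  -- predimension zero and so keeps strongness on both sides; only free points need an argument.
  induction hd : Bᶜ.card using Nat.strong_induction_on generalizing B with
  | _ d ih =>
  by_cases hne : ∃ x, x ∉ B
  · let := pull ar c
    have he : IsEmb ar c := isEmb_pull hc
    have hlt : ∀ B₁ : Finset ι, B ⊂ B₁ → B₁ᶜ.card < d := fun B₁ hB₁ =>
      hd ▸ Finset.card_lt_card (Finset.compl_ssubset_compl.2 hB₁)
    have hfn := he.finOcc h.finOcc
    have hBn : Strong ar B Set.univ := by
      rw [← he.strong_image]
      refine hB.mono ?_ (Set.subset_univ _)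
      rw [Finset.coe_image]
      exact Set.image_mono (Set.subset_univ _)
    rcases exists_step hfn hBn hne with ⟨T, hT, -⟩ | ⟨x, hxB, hxs, hxd⟩
    · obtain ⟨hT0, hBT, hTd, -⟩ := (simplyAlg_iff hfn).1 hT
      have hsub : B ⊆ B ∪ T := Finset.subset_union_left
      refine ih _ (hlt (B ∪ T) (hsub.ssubset_of_ne fun hBT' => ?_)) (B ∪ T) ?_ ?_ rfl
      · obtain ⟨t, ht⟩ := hT0
        exact Finset.disjoint_left.1 hBT (hBT' ▸ Finset.mem_union_right _ ht) ht
      · refine strong_of_dl_eq h.finOcc hB (Finset.image_subset_image hsub)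
          (Set.subset_univ _) ?_
        rw [he.dl_image, he.dl_image, hTd]
      · refine strong_of_dl_eq h'.finOcc hB' (Finset.image_subset_image
          (Finset.image_subset_image hsub)) (Set.subset_univ _) ?_
        rw [hf.dl_image, hf.dl_image, he.dl_image, he.dl_image, hTd]
    · have hxs' : Strong ar ((insert x B).image c) Set.univ := by
        refine Strong.trans h.finOcc ?_ hcs
        rw [← he.strong_image, Set.image_univ] at hxs
        simpa using hxs
      refine ih _ (hlt (insert x B) (Finset.ssubset_insert hxB)) (insert x B) hxs' ?_ rfl
      rw [strong_iff h'.finOcc]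
      refine ⟨Set.subset_univ _, fun W hW _ => ?_⟩
      rw [hf.dl_image, he.dl_image, hxd]
      -- A set `W` of too small predimension would make `f (c x)` bounded-algebraic over `f(B)`,
      -- hence `c x` bounded-algebraic over `B`, where it is free.
      by_contra hlt'
      have hBW : (B.image c).image f ⊆ W := (Finset.image_subset_image
        (Finset.image_subset_image (Finset.subset_insert x B))).trans hW
      have hxW : f (c x) ∈ W := hW (Finset.mem_image_of_mem _ (Finset.mem_image_of_mem _
        (Finset.mem_insert_self _ _)))
      obtain ⟨m, hWm, hm⟩ := exists_dl_firstSymb_eq h'.finOcc W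
      obtain ⟨Z, hxZ, -, hZ⟩ := mem_badSet_of_map hζ hζj hζf hμ h h' hf hB hB'
        (m := m) (x := c x) ⟨W, hxW, hWm, by
          rw [Finset.union_eq_right.2 hBW, hm m le_rfl _ subset_rfl, hm m le_rfl _ hBW,
            hf.dl_image, he.dl_image]
          omega⟩
      have h1 := (symb_mem_of_dl_le h.finOcc hB Finset.subset_union_left hZ).1
      have h2 := hxs'.dl_le_of_subset h.finOcc Set.univ (C := B.image c ∪ Z) (by
        rw [Finset.image_insert]
        exact Finset.insert_subset (Finset.mem_union_right _ hxZ) Finset.subset_union_left)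
      rw [he.dl_image] at h1 h2
      omega
  · have : B = Finset.univ := Finset.eq_univ_of_forall fun x => not_not.1 fun hx => hne ⟨x, hx⟩
    subst this
    rw [Finset.image_image] at hB'
    convert hB'

/-- Embeddings of infinite closed models are elementary. -/
theorem IsEmb.realize_iff (hζ : ζ.IsUniversal) (hζj : PreservedByFreeJoins ζ)
    (hζf : FinitelyDetermined ζ) (hμ : IsMu μ) [Infinite A] [Infinite A']
    (h : ClosedModel ζ μ A) (h' : ClosedModel ζ μ A') {f : A → A'} (hf : IsEmb ar f) {α : Type*}
    [Finite α] (φ : (lang ar).Formula α) (v : α → A) : φ.Realize (f ∘ v) ↔ φ.Realize v := by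
  have hU := h.rich_upow hζ hζj hζf hμ
  have hU' := h'.rich_upow hζ hζj hζf hμ
  have := Fintype.ofFinite α
  obtain ⟨X, hX, hXs⟩ := exists_strong_finset h.axiomTwo.2.1 (Finset.univ.image v)
  obtain ⟨n, b, hb, rfl⟩ := exists_enum X
  choose η hη using fun a => mem_rng.1 (hX (Finset.mem_image_of_mem v (Finset.mem_univ a)))
  obtain rfl : b ∘ η = v := funext hη
  -- The empty set is strong in both structures, so the enlargement can start there.
  have hXs' := hf.strong_image_of_closedModel hζ hζj hζf hμ h h' hb hXs ∅
    (by simpa using strong_empty h.axiomTwo.2.1) (by simpa using strong_empty h'.axiomTwo.2.1)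
  have key := hU'.realize_formula_iff hζ hU φ (b := diag ∘ f ∘ b) (b' := diag ∘ b)
    ((isEmb_diag.sameTp_comp (f ∘ b)).symm.trans
      ((hf.sameTp_comp b).symm.trans (isEmb_diag.sameTp_comp b)))
    ((isEmb_diag (ar := ar)).1.comp (hf.1.comp hb)) (strong_diag h'.finOcc hU'.finOcc hXs')
    (strong_diag h.finOcc hU.finOcc hXs) η
  have hd : ∀ {E : Type u} [(lang ar).Structure E] [Nonempty E] (w : α → E),
      φ.Realize (diag ∘ w) ↔ φ.Realize w := fun {E} _ _ w =>
    (Ultraproduct.realize_formula_cast φ fun a (_ : ℕ) => w a).trans Filter.eventually_const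
  exact (hd (f ∘ b ∘ η)).symm.trans (key.trans (hd (b ∘ η)))

end ModelCompleteness

/-! ### The theory of the generic -/

theorem IsGeneric.closedModel {ζ : (lang ar).Theory} {μ : MuFun ar} {M : Type u}
    [(lang ar).Structure M] (hζ : ζ.IsUniversal) (hM : IsGeneric ζ μ M) : ClosedModel ζ μ M :=
  ⟨hM.symm, hM.axiomTwo hζ, hM.algClosed hζ⟩

theorem IsGeneric.infinite {ζ : (lang ar).Theory} {μ : MuFun ar} {M : Type u}
    [(lang ar).Structure M] (hζ : ζ.IsUniversal) (hζj : PreservedByFreeJoins ζ)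
    (hp : Sat ar (discrete ar Unit) ζ) (hM : IsGeneric ζ μ M) : Infinite M := by
  by_contra hinf
  rw [not_infinite_iff_finite] at hinf
  have := Fintype.ofFinite M
  obtain ⟨X, hX, hXs⟩ := exists_strong_finset hM.delta_nonneg (Finset.univ : Finset M)
  obtain ⟨x, hx, -⟩ := hM.transClosed hζ hζj hp X hXs
  exact hx (hX (Finset.mem_univ x))

/-- Being infinite and being closed are first-order and hold in the generic. Conversely, infinite
closed models are elementarily equivalent to it. -/
theorem models_completeTheory_iff {ζ : (lang ar).Theory} {μ : MuFun ar} (hζ : ζ.IsUniversal)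
    (hζj : PreservedByFreeJoins ζ) (hζf : FinitelyDetermined ζ)
    (hp : Sat ar (discrete ar Unit) ζ) (hμ : IsMu μ) {M : Type u} [(lang ar).Structure M]
    (hM : IsGeneric ζ μ M) (A : Type u) [(lang ar).Structure A] :
    A ⊨ (lang ar).completeTheory M ↔ Infinite A ∧ ClosedModel ζ μ A := by
  have := hM.infinite hζ hζj hp
  have hMc := hM.closedModel hζ
  constructor
  · intro h
    refine ⟨?_, (models_closedTheory_iff hζ hζj hζf hμ).1 (h.mono ?_)⟩
    · rw [← FirstOrder.Language.model_infiniteTheory_iff (lang ar)]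
      exact h.mono (FirstOrder.Language.Theory.model_iff_subset_completeTheory.1
        (FirstOrder.Language.model_infiniteTheory _))
    · exact FirstOrder.Language.Theory.model_iff_subset_completeTheory.1
        hMc.models_closedTheory
  · rintro ⟨_, h⟩
    exact (hMc.elementarilyEquivalent hζ hζj hζf hμ h).theory_model

end

end HG


theorem mainTheorem2 {N : ℕ∞} (ar : HG.Symb N → ℕ) (ζ : (HG.lang ar).Theory)
    (hζ : ζ.IsUniversal) (hζjoin : HG.PreservedByFreeJoins ζ)
    (hζfin : HG.FinitelyDetermined ζ)
    (hζpoint : HG.Sat ar (HG.discrete ar Unit) ζ)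
    (μ : HG.MuFun ar) (hμ : HG.IsMu μ) :
    (∃ (M : Type u) (_ : (HG.lang ar).Structure M), HG.IsGeneric ζ μ M) ∧
    ∀ (M : Type u) [(HG.lang ar).Structure M], HG.IsGeneric ζ μ M →
      HG.StronglyMinimal.{u} ((HG.lang ar).completeTheory M) ∧
      (∀ (A : Type u) [(HG.lang ar).Structure A],
        A ⊨ (HG.lang ar).completeTheory M ↔
          Infinite A ∧ HG.IsSymm ar A ∧ HG.AxiomTwo ζ μ A ∧ HG.AxiomThree ζ μ A) ∧
      (∃ Ψ : (HG.lang ar).Theory, (∀ φ ∈ Ψ, HG.IsForallExists φ) ∧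
        ∀ (A : Type u) [(HG.lang ar).Structure A],
          A ⊨ Ψ ↔ HG.IsSymm ar A ∧ HG.AxiomTwo ζ μ A ∧ HG.AxiomThree ζ μ A) ∧
      HG.ModelComplete.{u} ((HG.lang ar).completeTheory M) := by
  refine ⟨HG.exists_isGeneric hζ hζjoin hζpoint hμ, fun M _ hM => ?_⟩
  have key := HG.models_completeTheory_iff hζ hζjoin hζfin hζpoint hμ hM
  refine ⟨fun A _ hA => ?_, fun A _ => ?_, ⟨HG.closedTheory.{u} ζ μ, fun φ hφ => hφ.1,
    fun A _ => ?_⟩, fun A A' _ _ hA hA' f n φ v => ?_⟩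
  · obtain ⟨_, h⟩ := (key A).1 hA
    exact ⟨inferInstance, h.finite_or_cofinite hζ hζjoin hζfin hμ⟩
  · rw [key, HG.closedModel_iff hζ hζjoin hμ]
  · rw [HG.models_closedTheory_iff hζ hζjoin hζfin hμ, HG.closedModel_iff hζ hζjoin hμ]
  · obtain ⟨_, h⟩ := (key A).1 hA
    obtain ⟨_, h'⟩ := (key A').1 hA'
    exact f.isEmb.realize_iff hζ hζjoin hζfin hμ h h' φ v
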